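/- \textbf{Setting.} For $m,n\ge 0$ let $\mathrm{Cob}^m_n$ be Bar-Natan's category. Its objects are $q^k a$, where $k\in\mathbb Z$ and $a$ is a properly embedded compact $1$-manifold in the unit square (closed components allowed) with $m$ boundary points on the top edge and $n$ on the bottom edge. Its morphisms from $q^k a$ to $q^l b$ are the $\mathbb Z[\alpha]$-linear combinations of isotopy classes of dotted cobordisms $a\to b$ embedded in the cube, with vertical side walls, that are homogeneous of degree $0$, modulo the local relations: spheres with $0,1,2,3$ dots equal $0,1,0,\alpha$ respectively; neck cutting (a neck equals the sum of the two ways of replacing it by two discs, one of which carries a dot); and a handle equals twice a dot. Here $\deg\alpha=4$, and a dotted cobordism $S$ from $q^ka$ to $q^lb$ has degree $l-k-\chi(S)+\tfrac{m+n}{2}+2\cdot\#\{\text{dots}\}$. Let $\mathrm{BN}^m_n$ be the category of formal finite direct sums of objects of $\mathrm{Cob}^m_n$ with matrices of morphisms, $\mathrm{BN}^{m,\oplus}_n$ the category of formal countable direct sums with matrices in which each object of the source has only finitely many nonzero components, and $\mathrm{BN}^{m,\Pi}_n$ the category of formal countable direct products with matrices in which each object of the target has only finitely many nonzero components. Write $\mathrm{BN}_n=\mathrm{BN}^n_n$,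 and similarly with $\oplus$ and $\Pi$. Stacking of diagrams, the first on top of the second, gives bifunctors $\mathrm{BN}^m_k\times\mathrm{BN}^k_n\to\mathrm{BN}^m_n$, and likewise with $\oplus$ and $\Pi$; the identity diagram of $n$ vertical strands is denoted $1_n$. $\mathrm{Ch}(\mathcal A)$ denotes possibly unbounded chain complexes over $\mathcal A$ with differentials of homological degree $+1$ (and $q$-degree $0$), and $\simeq$ denotes homotopy equivalence. For complexes $A,B$ over the $\oplus$-categories, $A\otimes B$ is the complex with $(A\otimes B)^k=\bigoplus_{i+j=k}A^i\otimes B^j$; for complexes over the $\Pi$-categories, $A\,\bar\otimes\,B$ is the complex with $(A\,\bar\otimes\,B)^k=\prod_{i+j=k}A^i\otimes B^j$; in both cases the differential is $d_A\otimes 1+(-1)^i\,1\otimes d_B$ on the term of bidegree $(i,j)$. The dual functor $(\ )^\vee\colon(\mathrm{BN}^m_n)^{\mathrm{op}}\to\mathrm{BN}^n_m$ reflects diagrams in a horizontal line, reverses the $q$-degree, applies $(x,y,z)\mapsto(x,1-y,1-z)$ to cobordisms, and transposes matrices. For a complex $A$ over $\mathrm{BN}^m_n$, $(A^\vee)^k=(A^{-k})^\vee$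 with differential $(-1)^{k+1}(d_A^{-k-1})^\vee$ from degree $k$ to degree $k+1$. A universal projector is a complex $P_n\in\mathrm{Ch}(\mathrm{BN}_n)$ such that (i) $P_n^k=0$ for $k>0$; (ii) $P_n^0\cong 1_n$, and no shift $q^l 1_n$ is a direct summand of $P_n^k$ for $k\neq 0$; (iii) $P_n$ kills turnbacks: $a\otimes P_n\simeq 0$ for every diagram $a\in\mathrm{Cob}^{n-2}_n$ that consists of one arc joining two neighbouring bottom points and of $n-2$ vertical strands, and $P_n\otimes b\simeq 0$ for every reflection $b\in\mathrm{Cob}^n_{n-2}$ of such a diagram. \textbf{Proposition (Commuting rule).} Let $n\ge 0$, and let $P_n$ be a universal projector on $n$ strands. Then for every $A\in\mathrm{Ch}(\mathrm{BN}_n^{\oplus})$ (no boundedness assumed) $$P_n^\vee\otimes A\;\simeq\;A\otimes P_n^\vee,$$ and for every $A\in\mathrm{Ch}(\mathrm{BN}_n^{\Pi})$ $$P_n\,\bar\otimes\,A\;\simeq\;A\,\bar\otimes\,P_n .$$ -/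

import Mathlib

open CategoryTheory CategoryTheory.Limits

noncomputable section

namespace BarNatan

/-! ### Planar diagrams -/

/-- Properly embedded 1-submanifolds of the square with `m` points on the top and `n` points on
the bottom, in Morse position and read from top to bottom: `one n` is `n` vertical strands,
`cup n i` is an arc joining the top points `i` and `i + 1` (counted from `0`) next to `n` vertical
strands, `cap n i` is its reflection, and `comp a b` is `a` stacked on top of `b`. -/
inductive Diag : ℕ → ℕ → Type
  | one (n : ℕ) : Diag n n
  | cup (n : ℕ) (i : Fin (n + 1)) : Diag (n + 2) n
  | cap (n : ℕ) (i : Fin (n + 1)) : Diag n (n + 2)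
  | comp {m k n : ℕ} (a : Diag m k) (b : Diag k n) : Diag m n

/-- The order preserving injection `Fin n → Fin (n + 2)` that misses `i` and `i + 1`. -/
def skip {n : ℕ} (i : Fin (n + 1)) (j : Fin n) : Fin (n + 2) :=
  if j.val < i.val then ⟨j.val, by omega⟩ else ⟨j.val + 2, by omega⟩

namespace Diag

/-- Segments of a diagram; the diagram is obtained from them by gluing along `Link`. -/
def Seg : {m n : ℕ} → Diag m n → Type
  | _, _, one n => Fin n
  | _, _, cup n _ => Fin (n + 2)
  | _, _, cap n _ => Fin (n + 2)
  | _, _, comp a b => Seg a ⊕ Seg b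

/-- The segment that contains the `j`-th top boundary point. -/
def top : {m n : ℕ} → (a : Diag m n) → Fin m → a.Seg
  | _, _, one _ => fun j => j
  | _, _, cup _ _ => fun j => j
  | _, _, cap _ i => fun j => skip i j
  | _, _, comp a _ => fun j => Sum.inl (top a j)

/-- The segment that contains the `j`-th bottom boundary point. -/
def bot : {m n : ℕ} → (a : Diag m n) → Fin n → a.Seg
  | _, _, one _ => fun j => j
  | _, _, cup _ i => fun j => skip i j
  | _, _, cap _ _ => fun j => j
  | _, _, comp _ b => fun j => Sum.inr (bot b j)

/-- Two segments that share an end point. -/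
def Link : {m n : ℕ} → (a : Diag m n) → a.Seg → a.Seg → Prop
  | _, _, one _ => fun _ _ => False
  | _, _, cup _ i => fun x y => x = i.castSucc ∧ y = i.succ
  | _, _, cap _ i => fun x y => x = i.castSucc ∧ y = i.succ
  | _, _, comp a b => fun x y =>
      match x, y with
      | Sum.inl x, Sum.inl y => Link a x y
      | Sum.inr x, Sum.inr y => Link b x y
      | Sum.inl x, Sum.inr y => ∃ j, x = a.bot j ∧ y = b.top j
      | Sum.inr _, Sum.inl _ => False

/-- The diagram with a single circle to the right of `i` vertical strands, and with `n` vertical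
strands altogether. -/
abbrev circ (n : ℕ) (i : Fin (n + 1)) : Diag n n := comp (cap n i) (cup n i)

/-- Reflection in a horizontal line. -/
def flip : {m n : ℕ} → Diag m n → Diag n m
  | _, _, one n => one n
  | _, _, cup n i => cap n i
  | _, _, cap n i => cup n i
  | _, _, comp a b => comp (flip b) (flip a)

/-- The segments of a diagram and of its reflection. -/
def flipSeg : {m n : ℕ} → (a : Diag m n) → a.Seg ≃ a.flip.Seg
  | _, _, one n => Equiv.refl (Fin n)
  | _, _, cup n _ => Equiv.refl (Fin (n + 2))
  | _, _, cap n _ => Equiv.refl (Fin (n + 2))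
  | _, _, comp a b => (Equiv.sumComm _ _).trans (Equiv.sumCongr (flipSeg b) (flipSeg a))

end Diag

open Diag

/-! ### Cobordisms -/

/-- The elementary planar isotopies, which together with their inverses generate all planar
isotopies between diagrams in Morse position. -/
inductive Isot : {m n : ℕ} → Diag m n → Diag m n → Type
  | assoc {m k l n : ℕ} (a : Diag m k) (b : Diag k l) (c : Diag l n) :
      Isot (comp (comp a b) c) (comp a (comp b c))
  | oneLeft {m n : ℕ} (a : Diag m n) : Isot (comp (one m) a) a
  | oneRight {m n : ℕ} (a : Diag m n) : Isot (comp a (one n)) a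
  | zigzag {n : ℕ} (i : Fin n) : Isot (comp (cap n i.castSucc) (cup n i.succ)) (one n)
  | zagzig {n : ℕ} (i : Fin n) : Isot (comp (cap n i.succ) (cup n i.castSucc)) (one n)
  | cupCup {n : ℕ} (i j : Fin (n + 1)) (h : i ≤ j) :
      Isot (comp (cup (n + 2) i.castSucc.castSucc) (cup n j))
        (comp (cup (n + 2) j.succ.succ) (cup n i))
  | capCap {n : ℕ} (i j : Fin (n + 1)) (h : i ≤ j) :
      Isot (comp (cap n j) (cap (n + 2) i.castSucc.castSucc))
        (comp (cap n i) (cap (n + 2) j.succ.succ))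
  | cupCapRight {n : ℕ} (i j : Fin (n + 1)) (h : i ≤ j) :
      Isot (comp (cup n i) (cap n j))
        (comp (cap (n + 2) j.succ.succ) (cup (n + 2) i.castSucc.castSucc))
  | cupCapLeft {n : ℕ} (i j : Fin (n + 1)) (h : j ≤ i) :
      Isot (comp (cup n i) (cap n j))
        (comp (cap (n + 2) j.castSucc.castSucc) (cup (n + 2) i.succ.succ))

/-- The components that a planar isotopy identifies, apart from those that meet the boundary. -/
def Isot.Ident : {m n : ℕ} → {a b : Diag m n} → Isot a b → a.Seg → b.Seg → Prop
  | _, _, _, _, assoc _ _ _ => fun x y => y = Equiv.sumAssoc _ _ _ x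
  | _, _, _, _, oneLeft _ => fun x y => x = Sum.inr y
  | _, _, _, _, oneRight _ => fun x y => x = Sum.inl y
  | _, _, _, _, _ => fun _ _ => False

/-- Elementary cobordisms in the cube from `a` (the source) to `b` (the target): the identity, a
dot on the identity of `a` on the segment `x`, traces of planar isotopies, birth and death of a
circle, and saddles. -/
inductive Elem : {m n : ℕ} → Diag m n → Diag m n → Type
  | id {m n : ℕ} (a : Diag m n) : Elem a a
  | dot {m n : ℕ} (a : Diag m n) (x : a.Seg) : Elem a a
  | isot {m n : ℕ} {a b : Diag m n} (h : Isot a b) : Elem a b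
  | isotInv {m n : ℕ} {a b : Diag m n} (h : Isot a b) : Elem b a
  | birth (n : ℕ) (i : Fin (n + 1)) : Elem (one n) (circ n i)
  | death (n : ℕ) (i : Fin (n + 1)) : Elem (circ n i) (one n)
  | saddle (n : ℕ) (i : Fin (n + 1)) : Elem (one (n + 2)) (comp (cup n i) (cap n i))
  | unsaddle (n : ℕ) (i : Fin (n + 1)) : Elem (comp (cup n i) (cap n i)) (one (n + 2))

/-- Movie presentations of the dotted cobordisms embedded in the cube, with vertical side walls:
`comp s t` is `s` followed by `t`, and `stack s t` puts `s` on top of `t` in the plane. -/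
inductive Cobordism : {m n : ℕ} → Diag m n → Diag m n → Type
  | elem {m n : ℕ} {a b : Diag m n} (e : Elem a b) : Cobordism a b
  | comp {m n : ℕ} {a b c : Diag m n} (s : Cobordism a b) (t : Cobordism b c) : Cobordism a c
  | stack {m k n : ℕ} {a a' : Diag m k} {b b' : Diag k n} (s : Cobordism a a')
      (t : Cobordism b b') : Cobordism (Diag.comp a b) (Diag.comp a' b')

namespace Elem

/-- The segments of source and target that an elementary cobordism connects, apart from those
connected along the side walls. -/
def Ident : {m n : ℕ} → {a b : Diag m n} → Elem a b → a.Seg → b.Seg → Prop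
  | _, _, _, _, id _ => fun x y => x = y
  | _, _, _, _, dot _ _ => fun x y => x = y
  | _, _, _, _, isot h => fun x y => h.Ident x y
  | _, _, _, _, isotInv h => fun x y => h.Ident y x
  | _, _, _, _, _ => fun _ _ => False

/-- The gluing of source and target segments whose components are those of the cobordism. -/
def Glue {m n : ℕ} {a b : Diag m n} (e : Elem a b) : a.Seg ⊕ b.Seg → a.Seg ⊕ b.Seg → Prop
  | Sum.inl x, Sum.inl y => a.Link x y
  | Sum.inr x, Sum.inr y => b.Link x y
  | Sum.inl x, Sum.inr y =>
      e.Ident x y ∨ (∃ j, x = a.top j ∧ y = b.top j) ∨ ∃ j, x = a.bot j ∧ y = b.bot j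
  | Sum.inr _, Sum.inl _ => False

/-- Critical points, counted by `1` if the index is even and by `-1` if it is odd. -/
def crit : {m n : ℕ} → {a b : Diag m n} → Elem a b → (a.Seg ⊕ b.Seg →₀ ℤ)
  | _, _, _, _, birth _ i => Finsupp.single (Sum.inr (Sum.inl i.castSucc)) 1
  | _, _, _, _, death _ i => Finsupp.single (Sum.inl (Sum.inl i.castSucc)) 1
  | _, _, _, _, saddle _ i => Finsupp.single (Sum.inl i.castSucc) (-1)
  | _, _, _, _, unsaddle _ i => Finsupp.single (Sum.inr i.castSucc) (-1)
  | _, _, _, _, _ => 0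

/-- The dots. -/
def dots : {m n : ℕ} → {a b : Diag m n} → Elem a b → (a.Seg ⊕ b.Seg →₀ ℕ)
  | _, _, _, _, dot _ x => Finsupp.single (Sum.inl x) 1
  | _, _, _, _, _ => 0

end Elem

namespace Cobordism

/-- Pieces of a cobordism; its components are obtained from them by gluing along `Glue`. -/
def Piece : {m n : ℕ} → {a b : Diag m n} → Cobordism a b → Type
  | _, _, a, b, elem _ => a.Seg ⊕ b.Seg
  | _, _, _, _, comp s t => Piece s ⊕ Piece t
  | _, _, _, _, stack s t => Piece s ⊕ Piece t

/-- The piece that contains a given segment of the source. -/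
def src : {m n : ℕ} → {a b : Diag m n} → (s : Cobordism a b) → a.Seg → s.Piece
  | _, _, _, _, elem _ => Sum.inl
  | _, _, _, _, comp s _ => fun x => Sum.inl (src s x)
  | _, _, _, _, stack s t => Sum.map (src s) (src t)

/-- The piece that contains a given segment of the target. -/
def tgt : {m n : ℕ} → {a b : Diag m n} → (s : Cobordism a b) → b.Seg → s.Piece
  | _, _, _, _, elem _ => Sum.inr
  | _, _, _, _, comp _ t => fun x => Sum.inr (tgt t x)
  | _, _, _, _, stack s t => Sum.map (tgt s) (tgt t)

/-- Adjacent pieces: `comp s t` is glued along the common target of `s` and source of `t`, and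
`stack s t` is glued along the common side wall. -/
def Glue : {m n : ℕ} → {a b : Diag m n} → (s : Cobordism a b) → s.Piece → s.Piece → Prop
  | _, _, _, _, elem e => e.Glue
  | _, _, _, _, comp s t => fun p q =>
      match p, q with
      | Sum.inl p, Sum.inl q => Glue s p q
      | Sum.inr p, Sum.inr q => Glue t p q
      | Sum.inl p, Sum.inr q => ∃ x, p = s.tgt x ∧ q = t.src x
      | Sum.inr _, Sum.inl _ => False
  | _, _, _, _, stack (a := a) (b := b) s t => fun p q =>
      match p, q with
      | Sum.inl p, Sum.inl q => Glue s p q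
      | Sum.inr p, Sum.inr q => Glue t p q
      | Sum.inl p, Sum.inr q => ∃ j, p = s.src (a.bot j) ∧ q = t.src (b.top j)
      | Sum.inr _, Sum.inl _ => False

/-- The critical points, with signs. -/
def crit : {m n : ℕ} → {a b : Diag m n} → (s : Cobordism a b) → (s.Piece →₀ ℤ)
  | _, _, _, _, elem e => e.crit
  | _, _, _, _, comp s t => (crit s).mapDomain Sum.inl + (crit t).mapDomain Sum.inr
  | _, _, _, _, stack s t => (crit s).mapDomain Sum.inl + (crit t).mapDomain Sum.inr

/-- The dots. -/
def dots : {m n : ℕ} → {a b : Diag m n} → (s : Cobordism a b) → (s.Piece →₀ ℕ)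
  | _, _, _, _, elem e => e.dots
  | _, _, _, _, comp s t => (dots s).mapDomain Sum.inl + (dots t).mapDomain Sum.inr
  | _, _, _, _, stack s t => (dots s).mapDomain Sum.inl + (dots t).mapDomain Sum.inr

/-- The quantum degree of a dotted cobordism `S` is `(m + n) / 2 - χ(S) + 2 · (number of dots)`;
since the source has Euler characteristic `(m + n) / 2`, this is twice the number of dots minus the
signed number of critical points. -/
def deg {m n : ℕ} {a b : Diag m n} (s : Cobordism a b) : ℤ :=
  2 * (s.dots.sum fun _ k => (k : ℤ)) - s.crit.sum fun _ k => k

/-- The set of connected components. -/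
def Component {m n : ℕ} {a b : Diag m n} (s : Cobordism a b) : Type := Quot s.Glue

/-- The component of a piece. -/
def toComp {m n : ℕ} {a b : Diag m n} (s : Cobordism a b) (p : s.Piece) : s.Component :=
  Quot.mk _ p

/-- The relative Euler characteristic `χ(S) - χ(S ∩ source)` of each component `S`. -/
def euler {m n : ℕ} {a b : Diag m n} (s : Cobordism a b) : s.Component →₀ ℤ :=
  s.crit.mapDomain s.toComp

/-- The number of dots on each component. -/
def dotCount {m n : ℕ} {a b : Diag m n} (s : Cobordism a b) : s.Component →₀ ℕ :=
  s.dots.mapDomain s.toComp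

/-- A bijection between the components of two cobordisms with the same source and target that is
compatible with the components of source and target (hence with the boundary). -/
structure Matching {m n : ℕ} {a b : Diag m n} (s t : Cobordism a b) where
  toEquiv : s.Component ≃ t.Component
  src_eq : ∀ x, toEquiv (s.toComp (s.src x)) = t.toComp (t.src x)
  tgt_eq : ∀ x, toEquiv (s.toComp (s.tgt x)) = t.toComp (t.tgt x)

section Finsupp

variable {A α β γ δ ε : Type*} [AddCommMonoid A]

lemma mapDomain_sum (F : α ⊕ β → γ) (f : α →₀ A) (g : β →₀ A) :
    (f.mapDomain Sum.inl + g.mapDomain Sum.inr).mapDomain F =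
      f.mapDomain (F ∘ Sum.inl) + g.mapDomain (F ∘ Sum.inr) := by
  rw [Finsupp.mapDomain_add, ← Finsupp.mapDomain_comp, ← Finsupp.mapDomain_comp]

lemma mapDomain_zero_sum (F : α ⊕ β → γ) (g : β →₀ A) :
    ((0 : α →₀ A).mapDomain Sum.inl + g.mapDomain Sum.inr).mapDomain F =
      g.mapDomain (F ∘ Sum.inr) := by
  rw [mapDomain_sum, Finsupp.mapDomain_zero, zero_add]

lemma mapDomain_sum_zero (F : α ⊕ β → γ) (f : α →₀ A) :
    (f.mapDomain Sum.inl + (0 : β →₀ A).mapDomain Sum.inr).mapDomain F =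
      f.mapDomain (F ∘ Sum.inl) := by
  rw [mapDomain_sum, Finsupp.mapDomain_zero, add_zero]

lemma mapDomain_sumAssoc (G : α ⊕ β ⊕ γ → δ) (f : α →₀ A) (g : β →₀ A) (h : γ →₀ A) :
    ((f.mapDomain Sum.inl + g.mapDomain Sum.inr).mapDomain Sum.inl +
      h.mapDomain Sum.inr).mapDomain (G ∘ Equiv.sumAssoc α β γ) =
    (f.mapDomain Sum.inl +
      (g.mapDomain Sum.inl + h.mapDomain Sum.inr).mapDomain Sum.inr).mapDomain G := by
  simp only [Finsupp.mapDomain_add, ← Finsupp.mapDomain_comp, add_assoc]; rfl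

lemma mapDomain_sumComm (G : β ⊕ α → δ) (f : α →₀ A) (g : β →₀ A) :
    (f.mapDomain Sum.inl + g.mapDomain Sum.inr).mapDomain (G ∘ Equiv.sumComm α β) =
    (g.mapDomain Sum.inl + f.mapDomain Sum.inr).mapDomain G := by
  simp only [mapDomain_sum]; rw [add_comm]; rfl

lemma mapDomain_sumSumSumComm (G : (α ⊕ γ) ⊕ β ⊕ ε → δ) (f : α →₀ A) (g : β →₀ A) (h : γ →₀ A)
    (k : ε →₀ A) :
    ((f.mapDomain Sum.inl + g.mapDomain Sum.inr).mapDomain Sum.inl +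
      (h.mapDomain Sum.inl + k.mapDomain Sum.inr).mapDomain Sum.inr).mapDomain
        (G ∘ Equiv.sumSumSumComm α β γ ε) =
    ((f.mapDomain Sum.inl + h.mapDomain Sum.inr).mapDomain Sum.inl +
      (g.mapDomain Sum.inl + k.mapDomain Sum.inr).mapDomain Sum.inr).mapDomain G := by
  simp only [Finsupp.mapDomain_add, ← Finsupp.mapDomain_comp]; rw [add_add_add_comm]; rfl

end Finsupp

variable {m k n l : ℕ}

lemma toComp_eq {a b : Diag m n} {s : Cobordism a b} {p q : s.Piece} (h : s.Glue p q) :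
    s.toComp p = s.toComp q := Quot.sound h

lemma toComp_surj {a b : Diag m n} {s : Cobordism a b} {P : s.Component → Prop}
    (h : ∀ p, P (s.toComp p)) (c) : P c := Quot.ind h c

/-- The matching of components that is given by mutually inverse maps of pieces. -/
def Matching.mk' {a b : Diag m n} (s t : Cobordism a b) (φ : s.Piece → t.Piece)
    (ψ : t.Piece → s.Piece)
    (hφ : ∀ p q, s.Glue p q → t.toComp (φ p) = t.toComp (φ q))
    (hψ : ∀ p q, t.Glue p q → s.toComp (ψ p) = s.toComp (ψ q))
    (h₁ : ∀ p, s.toComp (ψ (φ p)) = s.toComp p)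
    (h₂ : ∀ p, t.toComp (φ (ψ p)) = t.toComp p)
    (hs : ∀ x, t.toComp (φ (s.src x)) = t.toComp (t.src x))
    (ht : ∀ x, t.toComp (φ (s.tgt x)) = t.toComp (t.tgt x)) : Matching s t where
  toEquiv :=
    { toFun := Quot.lift (fun p => t.toComp (φ p)) hφ
      invFun := Quot.lift (fun p => s.toComp (ψ p)) hψ
      left_inv := by rintro ⟨p⟩; exact h₁ p
      right_inv := by rintro ⟨p⟩; exact h₂ p }
  src_eq := hs
  tgt_eq := ht

/-- Two dotted cobordisms that are homeomorphic relative to the boundary. -/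
def Same {a b : Diag m n} (s t : Cobordism a b) : Prop :=
  ∃ e : Matching s t, s.euler.mapDomain e.toEquiv = t.euler ∧
    s.dotCount.mapDomain e.toEquiv = t.dotCount

lemma Same.mk' {a b : Diag m n} (s t : Cobordism a b) (φ : s.Piece → t.Piece)
    (ψ : t.Piece → s.Piece)
    (hφ : ∀ p q, s.Glue p q → t.toComp (φ p) = t.toComp (φ q))
    (hψ : ∀ p q, t.Glue p q → s.toComp (ψ p) = s.toComp (ψ q))
    (h₁ : ∀ p, s.toComp (ψ (φ p)) = s.toComp p)
    (h₂ : ∀ p, t.toComp (φ (ψ p)) = t.toComp p)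
    (hs : ∀ x, t.toComp (φ (s.src x)) = t.toComp (t.src x))
    (ht : ∀ x, t.toComp (φ (s.tgt x)) = t.toComp (t.tgt x))
    (hc : s.crit.mapDomain (t.toComp ∘ φ) = t.crit.mapDomain t.toComp)
    (hd : s.dots.mapDomain (t.toComp ∘ φ) = t.dots.mapDomain t.toComp) : Same s t := by
  refine ⟨Matching.mk' s t φ ψ hφ hψ h₁ h₂ hs ht, ?_, ?_⟩
  · rw [euler, euler, ← hc, ← Finsupp.mapDomain_comp]; rfl
  · rw [dotCount, dotCount, ← hd, ← Finsupp.mapDomain_comp]; rfl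

lemma toComp_inl_comp {a b c : Diag m n} (s : Cobordism a b) (t : Cobordism b c) {p q : s.Piece}
    (h : s.toComp p = s.toComp q) :
    (comp s t).toComp (Sum.inl p) = (comp s t).toComp (Sum.inl q) :=
  congrArg (Quot.lift (fun p => (comp s t).toComp (Sum.inl p))
    (fun _ _ h => toComp_eq (s := comp s t) h)) h

lemma toComp_inr_comp {a b c : Diag m n} (s : Cobordism a b) (t : Cobordism b c) {p q : t.Piece}
    (h : t.toComp p = t.toComp q) :
    (comp s t).toComp (Sum.inr p) = (comp s t).toComp (Sum.inr q) :=
  congrArg (Quot.lift (fun p => (comp s t).toComp (Sum.inr p))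
    (fun _ _ h => toComp_eq (s := comp s t) h)) h

lemma toComp_inl_stack {a a' : Diag m k} {b b' : Diag k n} (s : Cobordism a a')
    (t : Cobordism b b') {p q : s.Piece} (h : s.toComp p = s.toComp q) :
    (stack s t).toComp (Sum.inl p) = (stack s t).toComp (Sum.inl q) :=
  congrArg (Quot.lift (fun p => (stack s t).toComp (Sum.inl p))
    (fun _ _ h => toComp_eq (s := stack s t) h)) h

lemma toComp_inr_stack {a a' : Diag m k} {b b' : Diag k n} (s : Cobordism a a')
    (t : Cobordism b b') {p q : t.Piece} (h : t.toComp p = t.toComp q) :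
    (stack s t).toComp (Sum.inr p) = (stack s t).toComp (Sum.inr q) :=
  congrArg (Quot.lift (fun p => (stack s t).toComp (Sum.inr p))
    (fun _ _ h => toComp_eq (s := stack s t) h)) h

lemma toComp_glue_comp {a b c : Diag m n} (s : Cobordism a b) (t : Cobordism b c) (x : b.Seg) :
    (comp s t).toComp (Sum.inl (s.tgt x)) = (comp s t).toComp (Sum.inr (t.src x)) :=
  toComp_eq (s := comp s t) ⟨x, rfl, rfl⟩

lemma toComp_glue_stack {a a' : Diag m k} {b b' : Diag k n} (s : Cobordism a a')
    (t : Cobordism b b') (j : Fin k) :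
    (stack s t).toComp (Sum.inl (s.src (a.bot j))) =
      (stack s t).toComp (Sum.inr (t.src (b.top j))) :=
  toComp_eq (s := stack s t) ⟨j, rfl, rfl⟩

/-- Linked segments of the source lie in the same component. -/
lemma toComp_src_link : {m n : ℕ} → {a b : Diag m n} → (s : Cobordism a b) → (x y : a.Seg) →
    a.Link x y → s.toComp (s.src x) = s.toComp (s.src y)
  | _, _, _, _, elem e, _, _, h => toComp_eq (s := elem e) h
  | _, _, _, _, comp s t, x, y, h => toComp_inl_comp s t (toComp_src_link s x y h)
  | _, _, _, _, stack s t, x, y, h => by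
      rcases x with x | x <;> rcases y with y | y
      · exact toComp_inl_stack s t (toComp_src_link s x y h)
      · obtain ⟨j, rfl, rfl⟩ := h
        exact toComp_glue_stack s t j
      · exact h.elim
      · exact toComp_inr_stack s t (toComp_src_link t x y h)

/-- The side walls are connected. -/
lemma toComp_wall : {m n : ℕ} → {a b : Diag m n} → (s : Cobordism a b) →
    (∀ j, s.toComp (s.src (a.top j)) = s.toComp (s.tgt (b.top j))) ∧
    (∀ j, s.toComp (s.src (a.bot j)) = s.toComp (s.tgt (b.bot j)))
  | _, _, a, b, elem e => ⟨fun j => toComp_eq (s := elem e)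
      (Or.inr (Or.inl ⟨j, rfl, rfl⟩) : e.Glue (Sum.inl (a.top j)) (Sum.inr (b.top j))),
      fun j => toComp_eq (s := elem e)
      (Or.inr (Or.inr ⟨j, rfl, rfl⟩) : e.Glue (Sum.inl (a.bot j)) (Sum.inr (b.bot j)))⟩
  | _, _, _, _, comp s t =>
      ⟨fun j => (toComp_inl_comp s t ((toComp_wall s).1 j)).trans ((toComp_glue_comp s t _).trans
        (toComp_inr_comp s t ((toComp_wall t).1 j))),
      fun j => (toComp_inl_comp s t ((toComp_wall s).2 j)).trans ((toComp_glue_comp s t _).trans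
        (toComp_inr_comp s t ((toComp_wall t).2 j)))⟩
  | _, _, _, _, stack s t =>
      ⟨fun j => toComp_inl_stack s t ((toComp_wall s).1 j),
      fun j => toComp_inr_stack s t ((toComp_wall t).2 j)⟩

/-- Linked segments of the target lie in the same component. -/
lemma toComp_tgt_link : {m n : ℕ} → {a b : Diag m n} → (s : Cobordism a b) → (x y : b.Seg) →
    b.Link x y → s.toComp (s.tgt x) = s.toComp (s.tgt y)
  | _, _, _, _, elem e, _, _, h => toComp_eq (s := elem e) h
  | _, _, _, _, comp s t, x, y, h => toComp_inr_comp s t (toComp_tgt_link t x y h)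
  | _, _, _, _, stack s t, x, y, h => by
      rcases x with x | x <;> rcases y with y | y
      · exact toComp_inl_stack s t (toComp_tgt_link s x y h)
      · obtain ⟨j, rfl, rfl⟩ := h
        exact (toComp_inl_stack s t ((toComp_wall s).2 j).symm).trans
          ((toComp_glue_stack s t j).trans (toComp_inr_stack s t ((toComp_wall t).1 j)))
      · exact h.elim
      · exact toComp_inr_stack s t (toComp_tgt_link t x y h)

/-- The identity cobordism. -/
abbrev id (a : Diag m n) : Cobordism a a := elem (Elem.id a)

lemma toComp_id (a : Diag m n) (x : a.Seg) :
    (id a).toComp (Sum.inl x) = (id a).toComp (Sum.inr x) :=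
  toComp_eq (s := id a) (Or.inl rfl : (Elem.id a).Glue (Sum.inl x) (Sum.inr x))

lemma id_glue {a : Diag m n} {M : Type*} (f : a.Seg → M)
    (hf : ∀ x y, a.Link x y → f x = f y) : ∀ p q : a.Seg ⊕ a.Seg, (Elem.id a).Glue p q →
      f (Sum.elim _root_.id _root_.id p) = f (Sum.elim _root_.id _root_.id q)
  | Sum.inl x, Sum.inl y, h => hf x y h
  | Sum.inr x, Sum.inr y, h => hf x y h
  | Sum.inl x, Sum.inr y, h => by
      rcases h with h | ⟨j, h, h'⟩ | ⟨j, h, h'⟩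
      · exact congrArg f h
      · exact congrArg f (h.trans h'.symm)
      · exact congrArg f (h.trans h'.symm)
  | Sum.inr _, Sum.inl _, h => h.elim

lemma id_comp_same {a b : Diag m n} (s : Cobordism a b) : Same (comp (id a) s) s := by
  refine Same.mk' _ _ (Sum.elim (fun p => s.src (Sum.elim _root_.id _root_.id p)) _root_.id)
    Sum.inr ?_ ?_ ?_ ?_ ?_ ?_ ?_ ?_
  · rintro (p | p) (q | q) h
    · exact id_glue (fun x => s.toComp (s.src x)) (toComp_src_link s) p q h
    · obtain ⟨x, rfl, rfl⟩ := h; rfl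
    · exact h.elim
    · exact toComp_eq h
  · intro p q h; exact toComp_eq (s := comp (id a) s) h
  · rintro ((p | p) | p)
    · exact (toComp_glue_comp (id a) s p).symm.trans
        (toComp_inl_comp (id a) s (toComp_id a p).symm)
    · exact (toComp_glue_comp (id a) s p).symm
    · rfl
  · intro p; rfl
  · intro x; rfl
  · intro x; rfl
  · exact mapDomain_zero_sum _ _
  · exact mapDomain_zero_sum _ _

lemma comp_id_same {a b : Diag m n} (s : Cobordism a b) : Same (comp s (id b)) s := by
  refine Same.mk' _ _ (Sum.elim _root_.id (fun p => s.tgt (Sum.elim _root_.id _root_.id p)))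
    Sum.inl ?_ ?_ ?_ ?_ ?_ ?_ ?_ ?_
  · rintro (p | p) (q | q) h
    · exact toComp_eq h
    · obtain ⟨x, rfl, rfl⟩ := h; rfl
    · exact h.elim
    · exact id_glue (fun x => s.toComp (s.tgt x)) (toComp_tgt_link s) p q h
  · intro p q h; exact toComp_eq (s := comp s (id b)) h
  · rintro (p | (p | p))
    · rfl
    · exact toComp_glue_comp s (id b) p
    · exact (toComp_glue_comp s (id b) p).trans (toComp_inr_comp s (id b) (toComp_id b p))
  · intro p; rfl
  · intro x; rfl
  · intro x; rfl
  · exact mapDomain_sum_zero _ _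
  · exact mapDomain_sum_zero _ _

lemma comp_assoc_same {a b c d : Diag m n} (s : Cobordism a b) (t : Cobordism b c)
    (u : Cobordism c d) : Same (comp (comp s t) u) (comp s (comp t u)) := by
  refine Same.mk' _ _ (Equiv.sumAssoc _ _ _) (Equiv.sumAssoc _ _ _).symm ?_ ?_ ?_ ?_ ?_ ?_ ?_ ?_
  · rintro ((p | p) | p) ((q | q) | q) h
    · exact toComp_eq (s := comp s (comp t u)) h
    · obtain ⟨x, rfl, rfl⟩ := h
      exact toComp_eq (s := comp s (comp t u)) ⟨x, rfl, rfl⟩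
    · obtain ⟨x, h, -⟩ := h; cases h
    · exact h.elim
    · exact toComp_eq (s := comp s (comp t u)) h
    · obtain ⟨x, h, rfl⟩ := h
      cases h
      exact toComp_inr_comp s (comp t u) (toComp_glue_comp t u x)
    · exact h.elim
    · exact h.elim
    · exact toComp_eq (s := comp s (comp t u)) h
  · rintro (p | (p | p)) (q | (q | q)) h
    · exact toComp_eq (s := comp (comp s t) u) h
    · obtain ⟨x, rfl, h⟩ := h
      cases h
      exact toComp_inl_comp (comp s t) u (toComp_glue_comp s t x)
    · obtain ⟨x, -, h⟩ := h; cases h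
    · exact h.elim
    · exact toComp_eq (s := comp (comp s t) u) h
    · obtain ⟨x, rfl, rfl⟩ := h
      exact toComp_eq (s := comp (comp s t) u) ⟨x, rfl, rfl⟩
    · exact h.elim
    · exact h.elim
    · exact toComp_eq (s := comp (comp s t) u) h
  · rintro ((p | p) | p) <;> rfl
  · rintro (p | (p | p)) <;> rfl
  · intro x; rfl
  · intro x; rfl
  · exact mapDomain_sumAssoc _ _ _ _
  · exact mapDomain_sumAssoc _ _ _ _

lemma stack_id_same (a : Diag m k) (b : Diag k n) :
    Same (stack (id a) (id b)) (id (Diag.comp a b)) := by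
  refine Same.mk' _ _ (Equiv.sumSumSumComm _ _ _ _) (Equiv.sumSumSumComm _ _ _ _)
    ?_ ?_ ?_ ?_ ?_ ?_ ?_ ?_
  · rintro ((p | p) | (p | p)) ((q | q) | (q | q)) h
    · exact toComp_eq (s := id (Diag.comp a b)) h
    · rcases h with h | ⟨j, h, h'⟩ | ⟨j, h, h'⟩
      · cases h; exact toComp_id (Diag.comp a b) (Sum.inl p)
      · subst h; subst h'; exact toComp_id (Diag.comp a b) (Sum.inl (a.top j))
      · subst h; subst h'; exact toComp_id (Diag.comp a b) (Sum.inl (a.bot j))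
    · obtain ⟨j, h, h'⟩ := h
      cases h; cases h'
      exact toComp_eq (s := id (Diag.comp a b)) ⟨j, rfl, rfl⟩
    · obtain ⟨j, h, h'⟩ := h; cases h'
    · exact h.elim
    · exact toComp_eq (s := id (Diag.comp a b)) h
    · obtain ⟨j, h, h'⟩ := h; cases h
    · obtain ⟨j, h, h'⟩ := h; cases h
    · exact h.elim
    · exact h.elim
    · exact toComp_eq (s := id (Diag.comp a b)) h
    · rcases h with h | ⟨j, h, h'⟩ | ⟨j, h, h'⟩
      · cases h; exact toComp_id (Diag.comp a b) (Sum.inr p)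
      · subst h; subst h'; exact toComp_id (Diag.comp a b) (Sum.inr (b.top j))
      · subst h; subst h'; exact toComp_id (Diag.comp a b) (Sum.inr (b.bot j))
    · exact h.elim
    · exact h.elim
    · exact h.elim
    · exact toComp_eq (s := id (Diag.comp a b)) h
  · have key : ∀ p : (Diag.comp a b).Seg, (stack (id a) (id b)).toComp
        (Equiv.sumSumSumComm _ _ _ _ (Sum.inl p)) = (stack (id a) (id b)).toComp
        (Equiv.sumSumSumComm _ _ _ _ (Sum.inr p)) := by
      rintro (p | p)
      · exact toComp_inl_stack (id a) (id b) (toComp_id a p)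
      · exact toComp_inr_stack (id a) (id b) (toComp_id b p)
    rintro (p | p) (q | q) h
    · have hp : ∀ p : (Diag.comp a b).Seg, Equiv.sumSumSumComm _ _ _ _ (Sum.inl p) =
          (stack (id a) (id b)).src p := by rintro (p | p) <;> rfl
      exact (congrArg _ (hp p)).trans ((toComp_src_link (stack (id a) (id b)) p q h).trans
        (congrArg _ (hp q)).symm)
    · rcases h with h | ⟨j, h, h'⟩ | ⟨j, h, h'⟩
      · cases h; exact key p
      · subst h; subst h'; exact key _
      · subst h; subst h'; exact key _
    · exact h.elim
    · have hp : ∀ p : (Diag.comp a b).Seg, Equiv.sumSumSumComm _ _ _ _ (Sum.inr p) =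
          (stack (id a) (id b)).tgt p := by rintro (p | p) <;> rfl
      exact (congrArg _ (hp p)).trans ((toComp_tgt_link (stack (id a) (id b)) p q h).trans
        (congrArg _ (hp q)).symm)
  · rintro ((p | p) | (p | p)) <;> rfl
  · rintro ((p | p) | (p | p)) <;> rfl
  · rintro (x | x) <;> rfl
  · rintro (x | x) <;> rfl
  · exact (mapDomain_zero_sum _ 0).trans Finsupp.mapDomain_zero
  · exact (mapDomain_zero_sum _ 0).trans Finsupp.mapDomain_zero

lemma stack_comp_same {a b c : Diag m k} {a' b' c' : Diag k n} (s : Cobordism a b)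
    (t : Cobordism b c) (s' : Cobordism a' b') (t' : Cobordism b' c') :
    Same (stack (comp s t) (comp s' t')) (comp (stack s s') (stack t t')) := by
  refine Same.mk' _ _ (Equiv.sumSumSumComm _ _ _ _) (Equiv.sumSumSumComm _ _ _ _)
    ?_ ?_ ?_ ?_ ?_ ?_ ?_ ?_
  · rintro ((p | p) | (p | p)) ((q | q) | (q | q)) h
    · exact toComp_eq (s := comp (stack s s') (stack t t')) h
    · obtain ⟨x, rfl, rfl⟩ := h
      exact toComp_glue_comp (stack s s') (stack t t') (Sum.inl x)
    · obtain ⟨j, h, h'⟩ := h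
      cases h; cases h'
      exact toComp_inl_comp (stack s s') (stack t t') (toComp_glue_stack s s' j)
    · obtain ⟨j, h, h'⟩ := h; cases h'
    · exact h.elim
    · exact toComp_eq (s := comp (stack s s') (stack t t')) h
    · obtain ⟨j, h, h'⟩ := h; cases h
    · obtain ⟨j, h, h'⟩ := h; cases h
    · exact h.elim
    · exact h.elim
    · exact toComp_eq (s := comp (stack s s') (stack t t')) h
    · obtain ⟨x, rfl, rfl⟩ := h
      exact toComp_glue_comp (stack s s') (stack t t') (Sum.inr x)
    · exact h.elim
    · exact h.elim
    · exact h.elim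
    · exact toComp_eq (s := comp (stack s s') (stack t t')) h
  · rintro ((p | p) | (p | p)) ((q | q) | (q | q)) h
    · exact toComp_eq (s := stack (comp s t) (comp s' t')) h
    · obtain ⟨j, rfl, rfl⟩ := h
      exact toComp_eq (s := stack (comp s t) (comp s' t')) ⟨j, rfl, rfl⟩
    · obtain ⟨x | x, h, h'⟩ := h <;> cases h <;> cases h'
      exact toComp_inl_stack (comp s t) (comp s' t') (toComp_glue_comp s t x)
    · obtain ⟨x | x, h, h'⟩ := h <;> cases h <;> cases h'
    · exact h.elim
    · exact toComp_eq (s := stack (comp s t) (comp s' t')) h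
    · obtain ⟨x | x, h, h'⟩ := h <;> cases h <;> cases h'
    · obtain ⟨x | x, h, h'⟩ := h <;> cases h <;> cases h'
      exact toComp_inr_stack (comp s t) (comp s' t') (toComp_glue_comp s' t' x)
    · exact h.elim
    · exact h.elim
    · exact toComp_eq (s := stack (comp s t) (comp s' t')) h
    · obtain ⟨j, rfl, rfl⟩ := h
      refine (toComp_inl_stack (comp s t) (comp s' t')
        ((toComp_glue_comp s t _).symm.trans
          (toComp_inl_comp s t ((toComp_wall s).2 j).symm))).trans
        ((toComp_glue_stack (comp s t) (comp s' t') j).trans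
          (toComp_inr_stack (comp s t) (comp s' t') ?_))
      exact (toComp_inl_comp s' t' ((toComp_wall s').1 j)).trans (toComp_glue_comp s' t' _)
    · exact h.elim
    · exact h.elim
    · exact h.elim
    · exact toComp_eq (s := stack (comp s t) (comp s' t')) h
  · rintro ((p | p) | (p | p)) <;> rfl
  · rintro ((p | p) | (p | p)) <;> rfl
  · rintro (x | x) <;> rfl
  · rintro (x | x) <;> rfl
  · exact mapDomain_sumSumSumComm _ _ _ _ _
  · exact mapDomain_sumSumSumComm _ _ _ _ _


end Cobordism

/-! ### Reflection of cobordisms -/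

/-- Reflection of a planar isotopy, as an elementary cobordism, in a horizontal line followed by
time reversal. -/
def Isot.flip : {m n : ℕ} → {a b : Diag m n} → Isot a b → Elem b.flip a.flip
  | _, _, _, _, assoc a b c => Elem.isot (assoc c.flip b.flip a.flip)
  | _, _, _, _, oneLeft a => Elem.isotInv (oneRight a.flip)
  | _, _, _, _, oneRight a => Elem.isotInv (oneLeft a.flip)
  | _, _, _, _, zigzag i => Elem.isotInv (zagzig i)
  | _, _, _, _, zagzig i => Elem.isotInv (zigzag i)
  | _, _, _, _, cupCup i j h => Elem.isotInv (capCap i j h)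
  | _, _, _, _, capCap i j h => Elem.isotInv (cupCup i j h)
  | _, _, _, _, cupCapRight i j h => Elem.isotInv (cupCapLeft j i h)
  | _, _, _, _, cupCapLeft i j h => Elem.isotInv (cupCapRight j i h)

/-- The inverse of `Isot.flip`. -/
def Isot.flipInv : {m n : ℕ} → {a b : Diag m n} → Isot a b → Elem a.flip b.flip
  | _, _, _, _, assoc a b c => Elem.isotInv (assoc c.flip b.flip a.flip)
  | _, _, _, _, oneLeft a => Elem.isot (oneRight a.flip)
  | _, _, _, _, oneRight a => Elem.isot (oneLeft a.flip)
  | _, _, _, _, zigzag i => Elem.isot (zagzig i)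
  | _, _, _, _, zagzig i => Elem.isot (zigzag i)
  | _, _, _, _, cupCup i j h => Elem.isot (capCap i j h)
  | _, _, _, _, capCap i j h => Elem.isot (cupCup i j h)
  | _, _, _, _, cupCapRight i j h => Elem.isot (cupCapLeft j i h)
  | _, _, _, _, cupCapLeft i j h => Elem.isot (cupCapRight j i h)

/-- The image of an elementary cobordism under `(x, y, z) ↦ (x, 1 - y, 1 - z)`. -/
def Elem.flip : {m n : ℕ} → {a b : Diag m n} → Elem a b → Elem b.flip a.flip
  | _, _, _, _, id a => id a.flip
  | _, _, _, _, dot a x => dot a.flip (a.flipSeg x)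
  | _, _, _, _, isot h => h.flip
  | _, _, _, _, isotInv h => h.flipInv
  | _, _, _, _, birth n i => death n i
  | _, _, _, _, death n i => birth n i
  | _, _, _, _, saddle n i => unsaddle n i
  | _, _, _, _, unsaddle n i => saddle n i

/-- The image of a cobordism under `(x, y, z) ↦ (x, 1 - y, 1 - z)`. -/
def Cobordism.flip : {m n : ℕ} → {a b : Diag m n} → Cobordism a b → Cobordism b.flip a.flip
  | _, _, _, _, elem e => elem e.flip
  | _, _, _, _, comp s t => comp (flip t) (flip s)
  | _, _, _, _, stack s t => stack (flip t) (flip s)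

lemma Diag.flipSeg_top : {m n : ℕ} → (a : Diag m n) → (j : Fin m) →
    a.flipSeg (a.top j) = a.flip.bot j
  | _, _, one _, _ => rfl
  | _, _, cup _ _, _ => rfl
  | _, _, cap _ _, _ => rfl
  | _, _, comp a _, j => congrArg Sum.inr (flipSeg_top a j)

lemma Diag.flipSeg_bot : {m n : ℕ} → (a : Diag m n) → (j : Fin n) →
    a.flipSeg (a.bot j) = a.flip.top j
  | _, _, one _, _ => rfl
  | _, _, cup _ _, _ => rfl
  | _, _, cap _ _, _ => rfl
  | _, _, comp _ b, j => congrArg Sum.inl (flipSeg_bot b j)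

/-- Linked segments, up to symmetry. -/
def Diag.Near {m n : ℕ} (a : Diag m n) (x y : a.Seg) : Prop := a.Link x y ∨ a.Link y x

lemma Diag.near_flip : {m n : ℕ} → (a : Diag m n) → (x y : a.Seg) →
    (a.flip.Near (a.flipSeg x) (a.flipSeg y) ↔ a.Near x y)
  | _, _, one _, _, _ => Iff.rfl
  | _, _, cup _ _, _, _ => Iff.rfl
  | _, _, cap _ _, _, _ => Iff.rfl
  | _, _, comp a b, x, y => by
      have key : ∀ (x : a.Seg) (y : b.Seg),
          (∃ j, b.flipSeg y = b.flip.bot j ∧ a.flipSeg x = a.flip.top j) ↔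
          ∃ j, x = a.bot j ∧ y = b.top j := fun x y => exists_congr fun j => by
        rw [← flipSeg_top, ← flipSeg_bot, b.flipSeg.apply_eq_iff_eq, a.flipSeg.apply_eq_iff_eq,
          and_comm]
      rcases x with x | x <;> rcases y with y | y
      · exact near_flip a x y
      · exact or_comm.trans (or_congr (key x y) Iff.rfl)
      · exact or_comm.trans (or_congr Iff.rfl (key y x))
      · exact near_flip b x y

lemma sumAssoc_flip {α β γ α' β' γ' : Type} (f : α ≃ α') (g : β ≃ β') (h : γ ≃ γ')
    (x : (α ⊕ β) ⊕ γ) (y : α ⊕ β ⊕ γ) :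
    ((Equiv.sumComm _ _).trans
        (Equiv.sumCongr h ((Equiv.sumComm _ _).trans (Equiv.sumCongr g f)))) x =
      Equiv.sumAssoc _ _ _ (((Equiv.sumComm _ _).trans
        (Equiv.sumCongr ((Equiv.sumComm _ _).trans (Equiv.sumCongr h g)) f)) y) ↔
    y = Equiv.sumAssoc _ _ _ x := by
  rcases x with (x | x) | x <;> rcases y with y | y | y <;> simp [eq_comm]

lemma sumComm_flip_inl {α β α' β' : Type} (f : α ≃ α') (g : β ≃ β') (x : α ⊕ β) (y : β) :
    ((Equiv.sumComm _ _).trans (Equiv.sumCongr g f)) x = Sum.inl (g y) ↔ x = Sum.inr y := by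
  rcases x with x | x <;> simp

lemma sumComm_flip_inr {α β α' β' : Type} (f : α ≃ α') (g : β ≃ β') (x : α ⊕ β) (y : α) :
    ((Equiv.sumComm _ _).trans (Equiv.sumCongr g f)) x = Sum.inr (f y) ↔ x = Sum.inl y := by
  rcases x with x | x <;> simp

lemma Isot.ident_flip {m n : ℕ} {a b : Diag m n} (h : Isot a b) (x : a.Seg) (y : b.Seg) :
    (h.flip.Ident (b.flipSeg y) (a.flipSeg x) ↔ h.Ident x y) ∧
    (h.flipInv.Ident (a.flipSeg x) (b.flipSeg y) ↔ h.Ident x y) := by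
  cases h with
  | assoc a b c =>
    have key := sumAssoc_flip a.flipSeg b.flipSeg c.flipSeg x y
    exact ⟨key, key⟩
  | @oneLeft m _ a =>
    have key := sumComm_flip_inl (Equiv.refl (Fin m)) b.flipSeg x y
    exact ⟨key, key⟩
  | @oneRight _ n a =>
    have key := sumComm_flip_inr b.flipSeg (Equiv.refl (Fin n)) x y
    exact ⟨key, key⟩
  | _ => exact ⟨Iff.rfl, Iff.rfl⟩

lemma Elem.ident_flip {m n : ℕ} {a b : Diag m n} (e : Elem a b) (x : a.Seg) (y : b.Seg) :
    e.flip.Ident (b.flipSeg y) (a.flipSeg x) ↔ e.Ident x y := by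
  cases e with
  | id a => exact (a.flipSeg.apply_eq_iff_eq).trans eq_comm
  | dot a x => exact (a.flipSeg.apply_eq_iff_eq).trans eq_comm
  | isot h => exact (h.ident_flip x y).1
  | isotInv h => exact (h.ident_flip y x).2
  | _ => exact Iff.rfl

namespace Cobordism

variable {m k n l : ℕ}

/-- The pieces of a cobordism and of its image under `flip`. -/
def flipPiece : {m n : ℕ} → {a b : Diag m n} → (s : Cobordism a b) → s.Piece ≃ s.flip.Piece
  | _, _, a, b, elem _ => (Equiv.sumComm _ _).trans (Equiv.sumCongr b.flipSeg a.flipSeg)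
  | _, _, _, _, comp s t =>
      (Equiv.sumComm _ _).trans (Equiv.sumCongr (flipPiece t) (flipPiece s))
  | _, _, _, _, stack s t =>
      (Equiv.sumComm _ _).trans (Equiv.sumCongr (flipPiece t) (flipPiece s))

lemma flipPiece_src : {m n : ℕ} → {a b : Diag m n} → (s : Cobordism a b) → (x : a.Seg) →
    s.flipPiece (s.src x) = s.flip.tgt (a.flipSeg x)
  | _, _, _, _, elem _, _ => rfl
  | _, _, _, _, comp s _, x => congrArg Sum.inr (flipPiece_src s x)
  | _, _, _, _, stack s t, x => by
      rcases x with x | x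
      · exact congrArg Sum.inr (flipPiece_src s x)
      · exact congrArg Sum.inl (flipPiece_src t x)

lemma flipPiece_tgt : {m n : ℕ} → {a b : Diag m n} → (s : Cobordism a b) → (x : b.Seg) →
    s.flipPiece (s.tgt x) = s.flip.src (b.flipSeg x)
  | _, _, _, _, elem _, _ => rfl
  | _, _, _, _, comp _ t, x => congrArg Sum.inl (flipPiece_tgt t x)
  | _, _, _, _, stack s t, x => by
      rcases x with x | x
      · exact congrArg Sum.inr (flipPiece_tgt s x)
      · exact congrArg Sum.inl (flipPiece_tgt t x)

/-- Near segments of source and target lie in the same component. -/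
lemma toComp_src_near {a b : Diag m n} (s : Cobordism a b) (x y : a.Seg) (h : a.Near x y) :
    s.toComp (s.src x) = s.toComp (s.src y) :=
  h.elim (toComp_src_link s x y) fun h => (toComp_src_link s y x h).symm

lemma toComp_tgt_near {a b : Diag m n} (s : Cobordism a b) (x y : b.Seg) (h : b.Near x y) :
    s.toComp (s.tgt x) = s.toComp (s.tgt y) :=
  h.elim (toComp_tgt_link s x y) fun h => (toComp_tgt_link s y x h).symm

lemma flip_glue : {m n : ℕ} → {a b : Diag m n} → (s : Cobordism a b) → (p q : s.Piece) →
    s.Glue p q → s.flip.toComp (s.flipPiece p) = s.flip.toComp (s.flipPiece q)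
  | _, _, a, b, elem e, p, q, h => by
      rcases p with x | x <;> rcases q with y | y
      · exact toComp_tgt_near (elem e.flip) _ _ ((a.near_flip x y).2 (Or.inl h))
      · refine (toComp_eq (s := elem e.flip) (p := Sum.inl (b.flipSeg y))
          (q := Sum.inr (a.flipSeg x)) ?_).symm
        rcases h with h | ⟨j, rfl, rfl⟩ | ⟨j, rfl, rfl⟩
        · exact Or.inl ((e.ident_flip x y).2 h)
        · exact Or.inr (Or.inr ⟨j, b.flipSeg_top j, a.flipSeg_top j⟩)
        · exact Or.inr (Or.inl ⟨j, b.flipSeg_bot j, a.flipSeg_bot j⟩)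
      · exact h.elim
      · exact toComp_src_near (elem e.flip) _ _ ((b.near_flip x y).2 (Or.inl h))
  | _, _, _, _, comp s t, p, q, h => by
      rcases p with p | p <;> rcases q with q | q
      · exact toComp_inr_comp t.flip s.flip (flip_glue s p q h)
      · obtain ⟨x, rfl, rfl⟩ := h
        have h := toComp_glue_comp t.flip s.flip (Diag.flipSeg _ x)
        rw [← flipPiece_src, ← flipPiece_tgt] at h
        exact h.symm
      · exact h.elim
      · exact toComp_inl_comp t.flip s.flip (flip_glue t p q h)
  | _, _, _, _, stack (a := a) (b := b) s t, p, q, h => by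
      rcases p with p | p <;> rcases q with q | q
      · exact toComp_inr_stack t.flip s.flip (flip_glue s p q h)
      · obtain ⟨j, rfl, rfl⟩ := h
        have h₁ := toComp_inl_stack t.flip s.flip ((toComp_wall t.flip).2 j)
        have h₂ := toComp_inr_stack t.flip s.flip ((toComp_wall s.flip).1 j)
        have h₃ := h₂.symm.trans ((toComp_glue_stack t.flip s.flip j).symm.trans h₁)
        rw [← Diag.flipSeg_top, ← Diag.flipSeg_bot, ← flipPiece_src, ← flipPiece_src] at h₃
        exact h₃
      · exact h.elim
      · exact toComp_inl_stack t.flip s.flip (flip_glue t p q h)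

lemma flip_glue_symm : {m n : ℕ} → {a b : Diag m n} → (s : Cobordism a b) →
    (p q : s.flip.Piece) → s.flip.Glue p q →
    s.toComp (s.flipPiece.symm p) = s.toComp (s.flipPiece.symm q)
  | _, _, a, b, elem e, p, q, h => by
      obtain ⟨p, rfl⟩ := (flipPiece (elem e)).surjective p
      obtain ⟨q, rfl⟩ := (flipPiece (elem e)).surjective q
      rw [Equiv.symm_apply_apply, Equiv.symm_apply_apply]
      rcases p with x | x <;> rcases q with y | y
      · exact toComp_src_near (elem e) _ _ ((a.near_flip x y).1 (Or.inl h))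
      · exact h.elim
      · refine (toComp_eq (s := elem e) (p := Sum.inl y) (q := Sum.inr x) ?_).symm
        rcases h with h | ⟨j, h, h'⟩ | ⟨j, h, h'⟩
        · exact Or.inl ((e.ident_flip y x).1 h)
        · exact Or.inr (Or.inr ⟨j, a.flipSeg.injective (h'.trans (a.flipSeg_bot j).symm),
            b.flipSeg.injective (h.trans (b.flipSeg_bot j).symm)⟩)
        · exact Or.inr (Or.inl ⟨j, a.flipSeg.injective (h'.trans (a.flipSeg_top j).symm),
            b.flipSeg.injective (h.trans (b.flipSeg_top j).symm)⟩)
      · exact toComp_tgt_near (elem e) _ _ ((b.near_flip x y).1 (Or.inl h))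
  | _, _, _, _, comp (b := b) s t, p, q, h => by
      rcases p with p | p <;> rcases q with q | q
      · exact toComp_inr_comp s t (flip_glue_symm t p q h)
      · obtain ⟨x, rfl, rfl⟩ := h
        obtain ⟨x, rfl⟩ := b.flipSeg.surjective x
        have h₁ : t.flipPiece.symm (t.flip.tgt (b.flipSeg x)) = t.src x := by
          rw [← flipPiece_src, Equiv.symm_apply_apply]
        have h₂ : s.flipPiece.symm (s.flip.src (b.flipSeg x)) = s.tgt x := by
          rw [← flipPiece_tgt, Equiv.symm_apply_apply]
        have h₃ := toComp_glue_comp s t x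
        rw [← h₁, ← h₂] at h₃
        exact h₃.symm
      · exact h.elim
      · exact toComp_inl_comp s t (flip_glue_symm s p q h)
  | _, _, _, _, stack (a := a) (a' := a') (b := b) (b' := b') s t, p, q, h => by
      rcases p with p | p <;> rcases q with q | q
      · exact toComp_inr_stack s t (flip_glue_symm t p q h)
      · obtain ⟨j, rfl, rfl⟩ := h
        have h₁ : t.flipPiece.symm (t.flip.src (b'.flip.bot j)) = t.tgt (b'.top j) := by
          rw [← Diag.flipSeg_top, ← flipPiece_tgt, Equiv.symm_apply_apply]
        have h₂ : s.flipPiece.symm (s.flip.src (a'.flip.top j)) = s.tgt (a'.bot j) := by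
          rw [← Diag.flipSeg_bot, ← flipPiece_tgt, Equiv.symm_apply_apply]
        have h₃ := (toComp_inl_stack s t ((toComp_wall s).2 j)).symm.trans
          ((toComp_glue_stack s t j).trans (toComp_inr_stack s t ((toComp_wall t).1 j)))
        rw [← h₁, ← h₂] at h₃
        exact h₃.symm
      · exact h.elim
      · exact toComp_inl_stack s t (flip_glue_symm s p q h)

/-- The components of a cobordism and of its image under `flip`. -/
def flipComp {a b : Diag m n} (s : Cobordism a b) : s.Component ≃ s.flip.Component where
  toFun := Quot.lift (fun p => s.flip.toComp (s.flipPiece p)) (flip_glue s)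
  invFun := Quot.lift (fun p => s.toComp (s.flipPiece.symm p)) (flip_glue_symm s)
  left_inv := by rintro ⟨p⟩; exact congrArg s.toComp (s.flipPiece.symm_apply_apply p)
  right_inv := by rintro ⟨p⟩; exact congrArg s.flip.toComp (s.flipPiece.apply_symm_apply p)

lemma flipComp_toComp {a b : Diag m n} (s : Cobordism a b) (p : s.Piece) :
    s.flipComp (s.toComp p) = s.flip.toComp (s.flipPiece p) := rfl

/-- The image of a matching under `flip`. -/
def Matching.flip {a b : Diag m n} {s t : Cobordism a b} (e : Matching s t) :
    Matching s.flip t.flip where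
  toEquiv := (s.flipComp.symm.trans e.toEquiv).trans t.flipComp
  src_eq x := by
    obtain ⟨x, rfl⟩ := b.flipSeg.surjective x
    rw [← flipPiece_tgt, ← flipPiece_tgt, ← flipComp_toComp, ← flipComp_toComp, ← e.tgt_eq]
    simp
  tgt_eq x := by
    obtain ⟨x, rfl⟩ := a.flipSeg.surjective x
    rw [← flipPiece_src, ← flipPiece_src, ← flipComp_toComp, ← flipComp_toComp, ← e.src_eq]
    simp

lemma mapDomain_single' {A α β : Type*} [AddCommMonoid A] (f : α → β) (x : α) (c : A) :
    (Finsupp.single x c).mapDomain f = Finsupp.single (f x) c := Finsupp.mapDomain_single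

lemma Elem.crit_flip {a b : Diag m n} (e : Elem a b) :
    e.crit.mapDomain ((elem e.flip).toComp ∘ (elem e).flipPiece) =
      e.flip.crit.mapDomain (elem e.flip).toComp := by
  cases e with
  | isot h => cases h <;> rfl
  | isotInv h => cases h <;> rfl
  | birth _ i =>
    refine (mapDomain_single' _ (Sum.inr (Sum.inl i.castSucc)) 1).trans
      (Eq.trans ?_ (mapDomain_single' _ (Sum.inl (Sum.inl i.castSucc)) 1).symm)
    refine congrArg (fun c => Finsupp.single c (1 : ℤ)) ?_
    exact toComp_src_near (elem (Elem.death _ i)) (Sum.inr i.castSucc) (Sum.inl i.castSucc)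
      (Or.inr ⟨i.castSucc, rfl, rfl⟩)
  | death _ i =>
    refine (mapDomain_single' _ (Sum.inl (Sum.inl i.castSucc)) 1).trans
      (Eq.trans ?_ (mapDomain_single' _ (Sum.inr (Sum.inl i.castSucc)) 1).symm)
    refine congrArg (fun c => Finsupp.single c (1 : ℤ)) ?_
    exact toComp_tgt_near (elem (Elem.birth _ i)) (Sum.inr i.castSucc) (Sum.inl i.castSucc)
      (Or.inr ⟨i.castSucc, rfl, rfl⟩)
  | saddle n i =>
    exact (mapDomain_single' _ (Sum.inl i.castSucc) (-1)).trans
      (mapDomain_single' _ (Sum.inr i.castSucc) (-1)).symm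
  | unsaddle n i =>
    exact (mapDomain_single' _ (Sum.inr i.castSucc) (-1)).trans
      (mapDomain_single' _ (Sum.inl i.castSucc) (-1)).symm
  | id a => rfl
  | dot a x => rfl

lemma Elem.dots_flip {a b : Diag m n} (e : Elem a b) :
    e.dots.mapDomain ((elem e.flip).toComp ∘ (elem e).flipPiece) =
      e.flip.dots.mapDomain (elem e.flip).toComp := by
  cases e with
  | isot h => cases h <;> rfl
  | isotInv h => cases h <;> rfl
  | dot a x =>
    refine (mapDomain_single' _ (Sum.inl x) 1).trans
      (Eq.trans ?_ (mapDomain_single' _ (Sum.inl (a.flipSeg x)) 1).symm)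
    refine congrArg (fun c => Finsupp.single c (1 : ℕ)) ?_
    exact (toComp_eq (s := elem (Elem.dot a.flip (a.flipSeg x)))
      (p := Sum.inl (a.flipSeg x)) (q := Sum.inr (a.flipSeg x))
      (Or.inl rfl : (Elem.dot a.flip (a.flipSeg x)).Glue (Sum.inl (a.flipSeg x))
        (Sum.inr (a.flipSeg x)))).symm
  | _ => rfl

/-- An additive count of pieces that is compatible with `flip` on the parts of a cobordism. -/
lemma count_flip {A α β α' β' C D E : Type*} [AddCommMonoid A] {f : α →₀ A} {g : β →₀ A}
    {f' : α' →₀ A} {g' : β' →₀ A} {p : α → α'} {q : β → β'} {u : α' → C} {v : β' → D}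
    (hf : f.mapDomain (u ∘ p) = f'.mapDomain u) (hg : g.mapDomain (v ∘ q) = g'.mapDomain v)
    (w : β' ⊕ α' → E) (U : C → E) (V : D → E) (hU : ∀ x, U (u x) = w (Sum.inr x))
    (hV : ∀ x, V (v x) = w (Sum.inl x)) :
    (f.mapDomain Sum.inl + g.mapDomain Sum.inr).mapDomain
        (w ∘ Sum.elim (Sum.inr ∘ p) (Sum.inl ∘ q)) =
      (g'.mapDomain Sum.inl + f'.mapDomain Sum.inr).mapDomain w := by
  have h₁ : w ∘ Sum.inr = U ∘ u := funext fun x => (hU x).symm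
  have h₂ : w ∘ Sum.inl = V ∘ v := funext fun x => (hV x).symm
  have hf' : f.mapDomain ((U ∘ u) ∘ p) = f'.mapDomain (U ∘ u) := by
    rw [Function.comp_assoc, Finsupp.mapDomain_comp, hf, ← Finsupp.mapDomain_comp]
  have hg' : g.mapDomain ((V ∘ v) ∘ q) = g'.mapDomain (V ∘ v) := by
    rw [Function.comp_assoc, Finsupp.mapDomain_comp, hg, ← Finsupp.mapDomain_comp]
  rw [← h₁] at hf'
  rw [← h₂] at hg'
  rw [mapDomain_sum, mapDomain_sum, add_comm (g'.mapDomain _), ← hf', ← hg']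
  rfl

lemma crit_flip : {m n : ℕ} → {a b : Diag m n} → (s : Cobordism a b) →
    s.crit.mapDomain (s.flip.toComp ∘ s.flipPiece) = s.flip.crit.mapDomain s.flip.toComp
  | _, _, _, _, elem e => Elem.crit_flip e
  | _, _, _, _, comp s t => by
      refine Eq.trans ?_ (count_flip (crit_flip s) (crit_flip t) (comp t.flip s.flip).toComp
        (Quot.lift (fun p => (comp t.flip s.flip).toComp (Sum.inr p))
          fun _ _ h => toComp_inr_comp t.flip s.flip (toComp_eq h))
        (Quot.lift (fun p => (comp t.flip s.flip).toComp (Sum.inl p))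
          fun _ _ h => toComp_inl_comp t.flip s.flip (toComp_eq h)) (fun _ => rfl) (fun _ => rfl))
      refine congrArg (fun F => Finsupp.mapDomain F _) (funext ?_)
      rintro (x | x) <;> rfl
  | _, _, _, _, stack s t => by
      refine Eq.trans ?_ (count_flip (crit_flip s) (crit_flip t) (stack t.flip s.flip).toComp
        (Quot.lift (fun p => (stack t.flip s.flip).toComp (Sum.inr p))
          fun _ _ h => toComp_inr_stack t.flip s.flip (toComp_eq h))
        (Quot.lift (fun p => (stack t.flip s.flip).toComp (Sum.inl p))
          fun _ _ h => toComp_inl_stack t.flip s.flip (toComp_eq h)) (fun _ => rfl) (fun _ => rfl))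
      refine congrArg (fun F => Finsupp.mapDomain F _) (funext ?_)
      rintro (x | x) <;> rfl

lemma dots_flip : {m n : ℕ} → {a b : Diag m n} → (s : Cobordism a b) →
    s.dots.mapDomain (s.flip.toComp ∘ s.flipPiece) = s.flip.dots.mapDomain s.flip.toComp
  | _, _, _, _, elem e => Elem.dots_flip e
  | _, _, _, _, comp s t => by
      refine Eq.trans ?_ (count_flip (dots_flip s) (dots_flip t) (comp t.flip s.flip).toComp
        (Quot.lift (fun p => (comp t.flip s.flip).toComp (Sum.inr p))
          fun _ _ h => toComp_inr_comp t.flip s.flip (toComp_eq h))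
        (Quot.lift (fun p => (comp t.flip s.flip).toComp (Sum.inl p))
          fun _ _ h => toComp_inl_comp t.flip s.flip (toComp_eq h)) (fun _ => rfl) (fun _ => rfl))
      refine congrArg (fun F => Finsupp.mapDomain F _) (funext ?_)
      rintro (x | x) <;> rfl
  | _, _, _, _, stack s t => by
      refine Eq.trans ?_ (count_flip (dots_flip s) (dots_flip t) (stack t.flip s.flip).toComp
        (Quot.lift (fun p => (stack t.flip s.flip).toComp (Sum.inr p))
          fun _ _ h => toComp_inr_stack t.flip s.flip (toComp_eq h))
        (Quot.lift (fun p => (stack t.flip s.flip).toComp (Sum.inl p))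
          fun _ _ h => toComp_inl_stack t.flip s.flip (toComp_eq h)) (fun _ => rfl) (fun _ => rfl))
      refine congrArg (fun F => Finsupp.mapDomain F _) (funext ?_)
      rintro (x | x) <;> rfl

lemma euler_flip {a b : Diag m n} (s : Cobordism a b) :
    s.flip.euler = s.euler.mapDomain s.flipComp := by
  rw [euler, euler, ← crit_flip, ← Finsupp.mapDomain_comp]; rfl

lemma dotCount_flip {a b : Diag m n} (s : Cobordism a b) :
    s.flip.dotCount = s.dotCount.mapDomain s.flipComp := by
  rw [dotCount, dotCount, ← dots_flip, ← Finsupp.mapDomain_comp]; rfl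

/-- How a count on components is transported by `Matching.flip`. -/
lemma Matching.flip_mapDomain {A : Type*} [AddCommMonoid A] {a b : Diag m n}
    {s t : Cobordism a b} (e : Matching s t) (f : s.Component →₀ A) :
    (f.mapDomain s.flipComp).mapDomain e.flip.toEquiv =
      (f.mapDomain e.toEquiv).mapDomain t.flipComp := by
  rw [← Finsupp.mapDomain_comp, ← Finsupp.mapDomain_comp]
  refine congrArg (fun F => Finsupp.mapDomain F f) (funext fun x => ?_)
  exact congrArg (fun c => t.flipComp (e.toEquiv c)) (s.flipComp.symm_apply_apply x)

end Cobordism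

/-! ### The modules of cobordisms modulo local relations -/

/-- The ground ring `ℤ[α]`. -/
abbrev Ground : Type := Polynomial ℤ

/-- The formal parameter `α`. -/
abbrev α : Ground := Polynomial.X

/-- A dot on the circle of `circ n i`. -/
abbrev circDot (n : ℕ) (i : Fin (n + 1)) : Cobordism (circ n i) (circ n i) :=
  Cobordism.elem (Elem.dot (circ n i) (Sum.inl i.castSucc))

/-- Birth of the circle of `circ n i`. -/
abbrev circBirth (n : ℕ) (i : Fin (n + 1)) : Cobordism (one n) (circ n i) :=
  Cobordism.elem (Elem.birth n i)

/-- Death of the circle of `circ n i`. -/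
abbrev circDeath (n : ℕ) (i : Fin (n + 1)) : Cobordism (circ n i) (one n) :=
  Cobordism.elem (Elem.death n i)

open Cobordism Finsupp in
/-- The relations between linear combinations of dotted cobordisms. `isotopy` identifies dotted
cobordisms that are homeomorphic relative to the boundary, that is, have the same components with
the same Euler characteristics and numbers of dots (for embedded surfaces this is the same as
isotopy, modulo the other relations, since neck cutting turns every surface into discs). The others
are: spheres with 0, 1, 2 or 3 dots are `0`, `1`, `0`, `α`; neck cutting; a handle is twice a dot
(`s` is `t` with the dot on the component `c` replaced by a handle). Relations may be applied
locally, that is, inside a larger cobordism. -/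
inductive IsRelation : {m n : ℕ} → {a b : Diag m n} → (Cobordism a b →₀ Ground) → Prop
  | isotopy {m n : ℕ} {a b : Diag m n} (s t : Cobordism a b) (e : Matching s t)
      (hχ : s.euler.mapDomain e.toEquiv = t.euler)
      (hd : s.dotCount.mapDomain e.toEquiv = t.dotCount) :
      IsRelation (single s 1 - single t 1)
  | sphere (n : ℕ) (i : Fin (n + 1)) :
      IsRelation (single (comp (circBirth n i) (circDeath n i)) 1)
  | sphereDot (n : ℕ) (i : Fin (n + 1)) :
      IsRelation (single (comp (circBirth n i) (comp (circDot n i) (circDeath n i))) 1 -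
        single (Cobordism.id (one n)) 1)
  | sphereDotDot (n : ℕ) (i : Fin (n + 1)) :
      IsRelation (single (comp (circBirth n i) (comp (circDot n i)
        (comp (circDot n i) (circDeath n i)))) 1)
  | sphereDotDotDot (n : ℕ) (i : Fin (n + 1)) :
      IsRelation (single (comp (circBirth n i) (comp (circDot n i) (comp (circDot n i)
        (comp (circDot n i) (circDeath n i))))) 1 - single (Cobordism.id (one n)) α)
  | neck (n : ℕ) (i : Fin (n + 1)) :
      IsRelation (single (Cobordism.id (circ n i)) 1 -
        single (comp (circDot n i) (comp (circDeath n i) (circBirth n i))) 1 -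
        single (comp (circDeath n i) (comp (circBirth n i) (circDot n i))) 1)
  | handle {m n : ℕ} {a b : Diag m n} (s t : Cobordism a b) (e : Matching s t) (c : t.Component)
      (hχ : s.euler.mapDomain e.toEquiv + single c 2 = t.euler)
      (hd : s.dotCount.mapDomain e.toEquiv + single c 1 = t.dotCount) :
      IsRelation (single s 1 - single t 2)
  | compLeft {m n : ℕ} {a b c : Diag m n} (s : Cobordism a b) (x : Cobordism b c →₀ Ground) :
      IsRelation x → IsRelation (x.mapDomain fun t => comp s t)
  | compRight {m n : ℕ} {a b c : Diag m n} (t : Cobordism b c) (x : Cobordism a b →₀ Ground) :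
      IsRelation x → IsRelation (x.mapDomain fun s => comp s t)
  | stackLeft {m k n : ℕ} {a a' : Diag m k} {b b' : Diag k n} (s : Cobordism a a')
      (x : Cobordism b b' →₀ Ground) : IsRelation x → IsRelation (x.mapDomain fun t => stack s t)
  | stackRight {m k n : ℕ} {a a' : Diag m k} {b b' : Diag k n} (t : Cobordism b b')
      (x : Cobordism a a' →₀ Ground) : IsRelation x → IsRelation (x.mapDomain fun s => stack s t)

/-- The submodule of relations. -/
def relations {m n : ℕ} (a b : Diag m n) : Submodule Ground (Cobordism a b →₀ Ground) :=
  Submodule.span Ground {x | IsRelation x}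

/-- `ℤ[α]`-linear combinations of dotted cobordisms modulo the local relations. -/
abbrev CobMod {m n : ℕ} (a b : Diag m n) : Type := (Cobordism a b →₀ Ground) ⧸ relations a b

section Quotients

variable {R S T U : Type*} [CommRing R] {p : Submodule R (S →₀ R)} {q : Submodule R (T →₀ R)}
  {r : Submodule R (U →₀ R)}

/-- The linear map between quotients of free modules that is induced by a map of bases. -/
def liftMap (f : S → T) (h : ∀ x ∈ p, x.mapDomain f ∈ q) :
    ((S →₀ R) ⧸ p) →ₗ[R] ((T →₀ R) ⧸ q) :=
  Submodule.mapQ p q (Finsupp.lmapDomain R R f) h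

lemma liftMap_mk (f : S → T) (h : ∀ x ∈ p, x.mapDomain f ∈ q) (x : S →₀ R) :
    liftMap f h (Submodule.Quotient.mk x) = Submodule.Quotient.mk (x.mapDomain f) := rfl

/-- The bilinear map between quotients of free modules that is induced by a binary operation on
bases. -/
def liftMap₂ (f : S → T → U) (h₁ : ∀ s, ∀ y ∈ q, y.mapDomain (f s) ∈ r)
    (h₂ : ∀ t, ∀ x ∈ p, (x.mapDomain fun s => f s t) ∈ r) :
    ((S →₀ R) ⧸ p) →ₗ[R] ((T →₀ R) ⧸ q) →ₗ[R] ((U →₀ R) ⧸ r) :=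
  p.liftQ (Finsupp.linearCombination R fun s => liftMap (f s) (h₁ s)) (by
    intro x hx
    rw [LinearMap.mem_ker]
    refine LinearMap.ext fun y => ?_
    obtain ⟨y, rfl⟩ := Submodule.Quotient.mk_surjective _ y
    induction y using Finsupp.induction_linear with
    | zero => rw [Submodule.Quotient.mk_zero, map_zero, map_zero]
    | add y z hy hz => rw [Submodule.Quotient.mk_add, map_add, map_add, hy, hz]
    | single t c =>
      have key : (Finsupp.linearCombination R fun s => liftMap (f s) (h₁ s)) x
          (Submodule.Quotient.mk (Finsupp.single t c)) =
          c • Submodule.Quotient.mk (p := r) (x.mapDomain fun s => f s t) := by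
        clear hx
        induction x using Finsupp.induction_linear with
        | zero => simp
        | add y z hy hz =>
          rw [map_add, LinearMap.add_apply, hy, hz, Finsupp.mapDomain_add,
            Submodule.Quotient.mk_add, smul_add]
        | single s d =>
          rw [Finsupp.linearCombination_single, LinearMap.smul_apply, liftMap_mk,
            Finsupp.mapDomain_single,
            Finsupp.mapDomain_single, ← Submodule.Quotient.mk_smul, ← Submodule.Quotient.mk_smul,
            Finsupp.smul_single, Finsupp.smul_single, smul_eq_mul, smul_eq_mul, mul_comm]
      rw [key, (Submodule.Quotient.mk_eq_zero r).2 (h₂ t x hx), smul_zero]; rfl)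

lemma liftMap₂_single (f : S → T → U) (h₁ : ∀ s, ∀ y ∈ q, y.mapDomain (f s) ∈ r)
    (h₂ : ∀ t, ∀ x ∈ p, (x.mapDomain fun s => f s t) ∈ r) (s : S) (t : T) :
    liftMap₂ f h₁ h₂ (Submodule.Quotient.mk (Finsupp.single s 1))
      (Submodule.Quotient.mk (Finsupp.single t 1)) =
      Submodule.Quotient.mk (Finsupp.single (f s t) 1) := by
  rw [liftMap₂, Submodule.liftQ_apply, Finsupp.linearCombination_single, one_smul, liftMap_mk,
    Finsupp.mapDomain_single]

lemma span_mapDomain {P : (S →₀ R) → Prop} {Q : (T →₀ R) → Prop} (f : S → T)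
    (h : ∀ x, P x → x.mapDomain f ∈ Submodule.span R {y | Q y}) :
    ∀ x ∈ Submodule.span R {x | P x}, x.mapDomain f ∈ Submodule.span R {y | Q y} := fun x hx =>
  (Submodule.span_le (p := (Submodule.span R {y | Q y}).comap (Finsupp.lmapDomain R R f))).2
    h hx

lemma quotient_induction {P : ((S →₀ R) ⧸ p) → Prop}
    (add : ∀ x y, P x → P y → P (x + y)) (zero : P 0)
    (single : ∀ (c : R) (s : S), P (c • Submodule.Quotient.mk (Finsupp.single s 1))) (x) : P x := by
  obtain ⟨x, rfl⟩ := Submodule.Quotient.mk_surjective _ x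
  induction x using Finsupp.induction_linear with
  | zero => exact zero
  | add y z hy hz => rw [Submodule.Quotient.mk_add]; exact add _ _ hy hz
  | single s c =>
    have := single c s
    rwa [← Submodule.Quotient.mk_smul, Finsupp.smul_single, smul_eq_mul, mul_one] at this

end Quotients

namespace CobMod

variable {m k n : ℕ}

/-- The class of a dotted cobordism. -/
def of {a b : Diag m n} (s : Cobordism a b) : CobMod a b :=
  Submodule.Quotient.mk (Finsupp.single s 1)

lemma induction {a b : Diag m n} {P : CobMod a b → Prop} (add : ∀ x y, P x → P y → P (x + y))
    (zero : P 0) (of : ∀ (c : Ground) (s : Cobordism a b), P (c • of s)) (x) : P x :=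
  quotient_induction add zero of x

lemma of_eq {a b : Diag m n} {s t : Cobordism a b} (h : Cobordism.Same s t) : of s = of t := by
  obtain ⟨e, h₁, h₂⟩ := h
  exact (Submodule.Quotient.eq _).2 (Submodule.subset_span (IsRelation.isotopy s t e h₁ h₂))

/-- Composition of cobordisms. -/
def comp {a b c : Diag m n} : CobMod a b →ₗ[Ground] CobMod b c →ₗ[Ground] CobMod a c :=
  liftMap₂ (fun s t => Cobordism.comp s t)
    (fun s => span_mapDomain _ fun x hx => Submodule.subset_span (IsRelation.compLeft s x hx))
    (fun t => span_mapDomain _ fun x hx => Submodule.subset_span (IsRelation.compRight t x hx))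

/-- Gluing of cobordisms in the plane, the first on top of the second. -/
def stack {a a' : Diag m k} {b b' : Diag k n} :
    CobMod a a' →ₗ[Ground] CobMod b b' →ₗ[Ground] CobMod (Diag.comp a b) (Diag.comp a' b') :=
  liftMap₂ (fun s t => Cobordism.stack s t)
    (fun s => span_mapDomain _ fun x hx => Submodule.subset_span (IsRelation.stackLeft s x hx))
    (fun t => span_mapDomain _ fun x hx => Submodule.subset_span (IsRelation.stackRight t x hx))

lemma comp_of {a b c : Diag m n} (s : Cobordism a b) (t : Cobordism b c) :
    comp (of s) (of t) = of (Cobordism.comp s t) := liftMap₂_single _ _ _ s t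

lemma stack_of {a a' : Diag m k} {b b' : Diag k n} (s : Cobordism a a') (t : Cobordism b b') :
    stack (of s) (of t) = of (Cobordism.stack s t) := liftMap₂_single _ _ _ s t

/-- The identity cobordism. -/
def id (a : Diag m n) : CobMod a a := of (Cobordism.id a)

lemma id_comp {a b : Diag m n} (x : CobMod a b) : comp (id a) x = x := by
  induction x using CobMod.induction with
  | add x y hx hy => rw [map_add, hx, hy]
  | zero => rw [map_zero]
  | of c s => rw [map_smul, id, comp_of, of_eq (Cobordism.id_comp_same s)]

lemma comp_id {a b : Diag m n} (x : CobMod a b) : comp x (id b) = x := by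
  induction x using CobMod.induction with
  | add x y hx hy => rw [map_add, LinearMap.add_apply, hx, hy]
  | zero => rw [map_zero, LinearMap.zero_apply]
  | of c s =>
    rw [map_smul, LinearMap.smul_apply, id, comp_of, of_eq (Cobordism.comp_id_same s)]

lemma comp_assoc {a b c d : Diag m n} (x : CobMod a b) (y : CobMod b c) (z : CobMod c d) :
    comp (comp x y) z = comp x (comp y z) := by
  induction x using CobMod.induction with
  | add x x' hx hx' => simp only [map_add, LinearMap.add_apply, hx, hx']
  | zero => simp only [map_zero, LinearMap.zero_apply]
  | of c s =>
    induction y using CobMod.induction with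
    | add y y' hy hy' => simp only [map_add, LinearMap.add_apply, hy, hy']
    | zero => simp only [map_zero, LinearMap.zero_apply]
    | of c' t =>
      induction z using CobMod.induction with
      | add z z' hz hz' => simp only [map_add, hz, hz']
      | zero => simp only [map_zero]
      | of c'' u =>
        simp only [map_smul, LinearMap.smul_apply, comp_of, of_eq (Cobordism.comp_assoc_same s t u)]

lemma stack_id (a : Diag m k) (b : Diag k n) : stack (id a) (id b) = id (Diag.comp a b) := by
  rw [id, id, stack_of, of_eq (Cobordism.stack_id_same a b), id]

lemma stack_comp {a b c : Diag m k} {a' b' c' : Diag k n} (x : CobMod a b) (y : CobMod b c)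
    (x' : CobMod a' b') (y' : CobMod b' c') :
    stack (comp x y) (comp x' y') = comp (stack x x') (stack y y') := by
  induction x using CobMod.induction with
  | add x z hx hz => simp only [map_add, LinearMap.add_apply, hx, hz]
  | zero => simp only [map_zero, LinearMap.zero_apply]
  | of c s =>
    induction y using CobMod.induction with
    | add y z hy hz => simp only [map_add, LinearMap.add_apply, hy, hz]
    | zero => simp only [map_zero, LinearMap.zero_apply]
    | of c t =>
      induction x' using CobMod.induction with
      | add x z hx hz => simp only [map_add, LinearMap.add_apply, hx, hz]
      | zero => simp only [map_zero, LinearMap.zero_apply]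
      | of c s' =>
        induction y' using CobMod.induction with
        | add y z hy hz => simp only [map_add, hy, hz]
        | zero => simp only [map_zero]
        | of c t' =>
          simp only [map_smul, LinearMap.smul_apply, comp_of, stack_of,
            of_eq (Cobordism.stack_comp_same s t s' t')]
          simp only [smul_smul, mul_comm, mul_left_comm]

/-- A dot may be moved along its component. -/
lemma of_dot_eq (a : Diag m n) (x y : a.Seg) (h : a.Link x y) :
    of (Cobordism.elem (Elem.dot a x)) = of (Cobordism.elem (Elem.dot a y)) := by
  refine of_eq (Cobordism.Same.mk' _ _ _root_.id _root_.id ?_ ?_ ?_ ?_ ?_ ?_ rfl ?_)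
  · intro p q h; exact Cobordism.toComp_eq (s := Cobordism.elem (Elem.dot a y)) h
  · intro p q h; exact Cobordism.toComp_eq (s := Cobordism.elem (Elem.dot a x)) h
  · intro p; rfl
  · intro p; rfl
  · intro p; rfl
  · intro p; rfl
  · refine (Cobordism.mapDomain_single' _ (Sum.inl x) 1).trans
      (Eq.trans ?_ (Cobordism.mapDomain_single' _ (Sum.inl y) 1).symm)
    exact congrArg (fun c => Finsupp.single c (1 : ℕ))
      (Cobordism.toComp_eq (s := Cobordism.elem (Elem.dot a y)) (p := Sum.inl x) (q := Sum.inl y) h)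

/-- The relations are preserved by `flip`. -/
lemma relations_flip {a b : Diag m n} (x : Cobordism a b →₀ Ground) (hx : IsRelation x) :
    x.mapDomain Cobordism.flip ∈ relations b.flip a.flip := by
  have hD : ∀ (n : ℕ) (i : Fin (n + 1)), of (Cobordism.flip (circDot n i)) =
      of (circDot n i) := fun n i =>
    (of_dot_eq (circ n i) (Sum.inl i.castSucc) (Sum.inr i.castSucc) ⟨i.castSucc, rfl, rfl⟩).symm
  rw [← Submodule.Quotient.mk_eq_zero]
  induction hx with
  | isotopy s t e hχ hd =>
    rw [Finsupp.mapDomain_sub, Finsupp.mapDomain_single, Finsupp.mapDomain_single,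
      Submodule.Quotient.mk_eq_zero]
    refine Submodule.subset_span (IsRelation.isotopy _ _ e.flip ?_ ?_)
    · rw [Cobordism.euler_flip, Cobordism.euler_flip, e.flip_mapDomain, hχ]
    · rw [Cobordism.dotCount_flip, Cobordism.dotCount_flip, e.flip_mapDomain, hd]
  | handle s t e c hχ hd =>
    rw [Finsupp.mapDomain_sub, Finsupp.mapDomain_single, Finsupp.mapDomain_single,
      Submodule.Quotient.mk_eq_zero]
    refine Submodule.subset_span (IsRelation.handle _ _ e.flip (t.flipComp c) ?_ ?_)
    · rw [Cobordism.euler_flip, Cobordism.euler_flip, e.flip_mapDomain, ← hχ,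
        Finsupp.mapDomain_add, Finsupp.mapDomain_single]
    · rw [Cobordism.dotCount_flip, Cobordism.dotCount_flip, e.flip_mapDomain, ← hd,
        Finsupp.mapDomain_add, Finsupp.mapDomain_single]
  | sphere n i =>
    rw [Finsupp.mapDomain_single, Submodule.Quotient.mk_eq_zero]
    exact Submodule.subset_span (IsRelation.sphere n i)
  | sphereDot n i =>
    have h := (Submodule.Quotient.mk_eq_zero (relations _ _)).2 (Submodule.subset_span (IsRelation.sphereDot n i))
    rw [Submodule.Quotient.mk_sub] at h
    rw [Finsupp.mapDomain_sub, Finsupp.mapDomain_single, Finsupp.mapDomain_single,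
      Submodule.Quotient.mk_sub]
    refine Eq.trans (congrArg (· - _) ?_) h
    have key : ∀ d : Cobordism (circ n i) (circ n i), of d = of (circDot n i) →
        of (Cobordism.comp (Cobordism.comp (circBirth n i) d)
      (circDeath n i)) = of (Cobordism.comp (circBirth n i) (Cobordism.comp (circDot n i)
      (circDeath n i))) :=
      fun d hd => by simp only [← comp_of, hd, comp_assoc]
    exact key _ (hD n i)
  | sphereDotDot n i =>
    have h := (Submodule.Quotient.mk_eq_zero (relations _ _)).2
      (Submodule.subset_span (IsRelation.sphereDotDot n i))
    rw [Finsupp.mapDomain_single]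
    refine Eq.trans ?_ h
    have key : ∀ d : Cobordism (circ n i) (circ n i), of d = of (circDot n i) →
        of (Cobordism.comp (Cobordism.comp (Cobordism.comp (circBirth n i) d)
      d) (circDeath n i)) = of (Cobordism.comp (circBirth n i)
      (Cobordism.comp (circDot n i) (Cobordism.comp (circDot n i) (circDeath n i)))) :=
      fun d hd => by simp only [← comp_of, hd, comp_assoc]
    exact key _ (hD n i)
  | sphereDotDotDot n i =>
    have h := (Submodule.Quotient.mk_eq_zero (relations _ _)).2
      (Submodule.subset_span (IsRelation.sphereDotDotDot n i))
    rw [Submodule.Quotient.mk_sub] at h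
    rw [Finsupp.mapDomain_sub, Finsupp.mapDomain_single, Finsupp.mapDomain_single,
      Submodule.Quotient.mk_sub]
    refine Eq.trans (congrArg (· - _) ?_) h
    have key : ∀ d : Cobordism (circ n i) (circ n i), of d = of (circDot n i) →
        of (Cobordism.comp (Cobordism.comp (Cobordism.comp (Cobordism.comp (circBirth n i)
      d) d) d) (circDeath n i)) =
      of (Cobordism.comp (circBirth n i) (Cobordism.comp (circDot n i) (Cobordism.comp
      (circDot n i) (Cobordism.comp (circDot n i) (circDeath n i))))) :=
      fun d hd => by simp only [← comp_of, hd, comp_assoc]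
    exact key _ (hD n i)
  | neck n i =>
    have h := (Submodule.Quotient.mk_eq_zero (relations _ _)).2 (Submodule.subset_span (IsRelation.neck n i))
    rw [Submodule.Quotient.mk_sub, Submodule.Quotient.mk_sub, sub_right_comm] at h
    rw [Finsupp.mapDomain_sub, Finsupp.mapDomain_sub, Finsupp.mapDomain_single,
      Finsupp.mapDomain_single, Finsupp.mapDomain_single, Submodule.Quotient.mk_sub,
      Submodule.Quotient.mk_sub]
    refine Eq.trans (congrArg₂ (fun x y => _ - x - y) ?_ ?_) h
    · have key : ∀ d : Cobordism (circ n i) (circ n i), of d = of (circDot n i) →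
          of (Cobordism.comp (Cobordism.comp (circDeath n i) (circBirth n i))
        d) = of (Cobordism.comp (circDeath n i) (Cobordism.comp (circBirth n i)
        (circDot n i))) :=
        fun d hd => by simp only [← comp_of, hd, comp_assoc]
      exact key _ (hD n i)
    · have key : ∀ d : Cobordism (circ n i) (circ n i), of d = of (circDot n i) →
          of (Cobordism.comp (Cobordism.comp d (circDeath n i))
        (circBirth n i)) = of (Cobordism.comp (circDot n i) (Cobordism.comp (circDeath n i)
        (circBirth n i))) :=
        fun d hd => by simp only [← comp_of, hd, comp_assoc]
      exact key _ (hD n i)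
  | compLeft s x _ ih =>
    rw [Submodule.Quotient.mk_eq_zero] at ih ⊢
    rw [← Finsupp.mapDomain_comp]
    refine (congrArg (· ∈ _) (Finsupp.mapDomain_comp (f := Cobordism.flip)
      (g := fun t => Cobordism.comp t s.flip) (v := x))).mpr ?_
    exact span_mapDomain _ (fun y hy => Submodule.subset_span (IsRelation.compRight s.flip y hy)) _ ih
  | compRight t x _ ih =>
    rw [Submodule.Quotient.mk_eq_zero] at ih ⊢
    rw [← Finsupp.mapDomain_comp]
    refine (congrArg (· ∈ _) (Finsupp.mapDomain_comp (f := Cobordism.flip)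
      (g := fun s => Cobordism.comp t.flip s) (v := x))).mpr ?_
    exact span_mapDomain _ (fun y hy => Submodule.subset_span (IsRelation.compLeft t.flip y hy)) _ ih
  | stackLeft s x _ ih =>
    rw [Submodule.Quotient.mk_eq_zero] at ih ⊢
    rw [← Finsupp.mapDomain_comp]
    refine (congrArg (· ∈ _) (Finsupp.mapDomain_comp (f := Cobordism.flip)
      (g := fun t => Cobordism.stack t s.flip) (v := x))).mpr ?_
    exact span_mapDomain _ (fun y hy => Submodule.subset_span (IsRelation.stackRight s.flip y hy)) _ ih
  | stackRight t x _ ih =>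
    rw [Submodule.Quotient.mk_eq_zero] at ih ⊢
    rw [← Finsupp.mapDomain_comp]
    refine (congrArg (· ∈ _) (Finsupp.mapDomain_comp (f := Cobordism.flip)
      (g := fun s => Cobordism.stack t.flip s) (v := x))).mpr ?_
    exact span_mapDomain _ (fun y hy => Submodule.subset_span (IsRelation.stackLeft t.flip y hy)) _ ih

lemma relations_mapDomain_flip {a b : Diag m n} :
    ∀ x ∈ relations a b, x.mapDomain Cobordism.flip ∈ relations b.flip a.flip :=
  span_mapDomain _ relations_flip

/-- The image of a combination of cobordisms under `flip`. -/
def dual {a b : Diag m n} : CobMod a b →ₗ[Ground] CobMod b.flip a.flip :=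
  liftMap Cobordism.flip relations_mapDomain_flip

lemma dual_of {a b : Diag m n} (s : Cobordism a b) : dual (of s) = of s.flip := by
  rw [dual, of, liftMap_mk, Finsupp.mapDomain_single, of]

lemma dual_id (a : Diag m n) : dual (id a) = id a.flip := dual_of _

lemma dual_comp {a b c : Diag m n} (x : CobMod a b) (y : CobMod b c) :
    dual (comp x y) = comp (dual y) (dual x) := by
  induction x using CobMod.induction with
  | add x x' hx hx' => simp only [map_add, LinearMap.add_apply, hx, hx']
  | zero => simp only [map_zero, LinearMap.zero_apply]
  | of c s =>
    induction y using CobMod.induction with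
    | add y y' hy hy' => simp only [map_add, LinearMap.add_apply, hy, hy']
    | zero => simp only [map_zero, LinearMap.zero_apply]
    | of c' t =>
      simp only [map_smul, LinearMap.smul_apply, comp_of, dual_of, Cobordism.flip]
      rw [smul_comm]

end CobMod

/-! ### The quantum grading -/

namespace Cobordism

variable {m k n : ℕ}

lemma sum_mapDomain_inl_add_inr {A B C : Type*} [AddCommMonoid C] {D : Type*} [AddCommMonoid D]
    (g : D →+ C) (f : A →₀ D) (h : B →₀ D) :
    (f.mapDomain Sum.inl + h.mapDomain Sum.inr : A ⊕ B →₀ D).sum (fun _ c => g c) =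
      f.sum (fun _ c => g c) + h.sum (fun _ c => g c) := by
  rw [Finsupp.sum_add_index' (fun _ => map_zero g) (fun _ => map_add g),
    Finsupp.sum_mapDomain_index (fun _ => map_zero g) (fun _ => map_add g),
    Finsupp.sum_mapDomain_index (fun _ => map_zero g) (fun _ => map_add g)]

lemma deg_comp {a b c : Diag m n} (s : Cobordism a b) (t : Cobordism b c) :
    (comp s t).deg = s.deg + t.deg := by
  have h₁ := sum_mapDomain_inl_add_inr (Nat.castAddMonoidHom ℤ) s.dots t.dots
  have h₂ := sum_mapDomain_inl_add_inr (AddMonoidHom.id ℤ) s.crit t.crit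
  simp only [Nat.coe_castAddMonoidHom, AddMonoidHom.id_apply] at h₁ h₂
  simp only [deg, dots, crit]
  erw [h₁, h₂]
  ring

lemma deg_stack {a a' : Diag m k} {b b' : Diag k n} (s : Cobordism a a') (t : Cobordism b b') :
    (stack s t).deg = s.deg + t.deg := by
  have h₁ := sum_mapDomain_inl_add_inr (Nat.castAddMonoidHom ℤ) s.dots t.dots
  have h₂ := sum_mapDomain_inl_add_inr (AddMonoidHom.id ℤ) s.crit t.crit
  simp only [Nat.coe_castAddMonoidHom, AddMonoidHom.id_apply] at h₁ h₂
  simp only [deg, dots, crit]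
  erw [h₁, h₂]
  ring

lemma deg_id (a : Diag m n) : (Cobordism.id a).deg = 0 := by
  change 2 * ((0 : a.Seg ⊕ a.Seg →₀ ℕ).sum fun _ k => (k : ℤ)) -
    (0 : a.Seg ⊕ a.Seg →₀ ℤ).sum (fun _ k => k) = 0
  simp

lemma sum_eq_of_mapDomain {A B C D E : Type*} [AddCommMonoid D] [AddCommMonoid E] (g : D →+ E)
    {f : A →₀ D} {h : B →₀ D} {p : A → C} {q : B → C} (e : f.mapDomain p = h.mapDomain q) :
    f.sum (fun _ c => g c) = h.sum (fun _ c => g c) := by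
  have := congrArg (fun f => f.sum fun _ c => g c) e
  rwa [Finsupp.sum_mapDomain_index (fun _ => map_zero g) (fun _ => map_add g),
    Finsupp.sum_mapDomain_index (fun _ => map_zero g) (fun _ => map_add g)] at this

lemma deg_flip {a b : Diag m n} (s : Cobordism a b) : s.flip.deg = s.deg := by
  have h₁ := sum_eq_of_mapDomain (Nat.castAddMonoidHom ℤ) s.dots_flip
  have h₂ := sum_eq_of_mapDomain (AddMonoidHom.id ℤ) s.crit_flip
  simp only [Nat.coe_castAddMonoidHom, AddMonoidHom.id_apply] at h₁ h₂
  rw [deg, deg, h₁, h₂]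

end Cobordism

namespace CobMod

variable {m k n : ℕ}

/-- The combinations of dotted cobordisms that are homogeneous of quantum degree `d`, where `α` has
degree `4`. -/
def homDeg (a b : Diag m n) (d : ℤ) : AddSubgroup (CobMod a b) :=
  AddSubgroup.closure
    {x | ∃ (j : ℕ) (s : Cobordism a b), 4 * (j : ℤ) + s.deg = d ∧ x = α ^ j • of s}

lemma id_mem (a : Diag m n) {d : ℤ} (h : d = 0) : id a ∈ homDeg a a d :=
  AddSubgroup.subset_closure ⟨0, Cobordism.id a, by rw [h, Cobordism.deg_id]; rfl, by
    rw [pow_zero, one_smul, id]⟩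

/-- Bilinear maps that are homogeneous on cobordisms are homogeneous. -/
lemma bilin_mem {m m' m'' n n' n'' : ℕ} {a b : Diag m n} {a' b' : Diag m' n'}
    {a'' b'' : Diag m'' n''}
    (F : CobMod a b →ₗ[Ground] CobMod a' b' →ₗ[Ground] CobMod a'' b'')
    (f : Cobordism a b → Cobordism a' b' → Cobordism a'' b'')
    (hF : ∀ s t, F (of s) (of t) = of (f s t)) (hf : ∀ s t, (f s t).deg = s.deg + t.deg)
    {x : CobMod a b} {y : CobMod a' b'} {d d' d'' : ℤ} (h : d + d' = d'')
    (hx : x ∈ homDeg a b d) (hy : y ∈ homDeg a' b' d') : F x y ∈ homDeg a'' b'' d'' := by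
  induction hx using AddSubgroup.closure_induction with
  | zero => rw [map_zero, LinearMap.zero_apply]; exact zero_mem _
  | add x x' _ _ hx hx' => rw [map_add, LinearMap.add_apply]; exact add_mem hx hx'
  | neg x _ hx => rw [map_neg, LinearMap.neg_apply]; exact neg_mem hx
  | mem x hx =>
    obtain ⟨j, s, hs, rfl⟩ := hx
    induction hy using AddSubgroup.closure_induction with
    | zero => rw [map_zero]; exact zero_mem _
    | add y y' _ _ hy hy' => rw [map_add]; exact add_mem hy hy'
    | neg y _ hy => rw [map_neg]; exact neg_mem hy
    | mem y hy =>
      obtain ⟨j', t, ht, rfl⟩ := hy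
      refine AddSubgroup.subset_closure ⟨j + j', f s t, ?_, ?_⟩
      · rw [hf]; push_cast; linarith
      · rw [map_smul, map_smul, LinearMap.smul_apply, hF, smul_smul, ← pow_add, add_comm j]

lemma comp_mem {a b c : Diag m n} {x : CobMod a b} {y : CobMod b c} {d d' d'' : ℤ}
    (h : d + d' = d'') (hx : x ∈ homDeg a b d) (hy : y ∈ homDeg b c d') :
    comp x y ∈ homDeg a c d'' :=
  bilin_mem comp Cobordism.comp comp_of Cobordism.deg_comp h hx hy

lemma stack_mem {a a' : Diag m k} {b b' : Diag k n} {x : CobMod a a'} {y : CobMod b b'}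
    {d d' d'' : ℤ} (h : d + d' = d'') (hx : x ∈ homDeg a a' d) (hy : y ∈ homDeg b b' d') :
    stack x y ∈ homDeg (Diag.comp a b) (Diag.comp a' b') d'' :=
  bilin_mem stack Cobordism.stack stack_of Cobordism.deg_stack h hx hy

lemma dual_mem {a b : Diag m n} {x : CobMod a b} {d d' : ℤ} (h : d = d')
    (hx : x ∈ homDeg a b d) : dual x ∈ homDeg b.flip a.flip d' := by
  subst h
  induction hx using AddSubgroup.closure_induction with
  | zero => rw [map_zero]; exact zero_mem _
  | add x x' _ _ hx hx' => rw [map_add]; exact add_mem hx hx'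
  | neg x _ hx => rw [map_neg]; exact neg_mem hx
  | mem x hx =>
    obtain ⟨j, s, hs, rfl⟩ := hx
    exact AddSubgroup.subset_closure ⟨j, s.flip, by rw [Cobordism.deg_flip, hs], by
      rw [map_smul, dual_of]⟩

end CobMod

/-! ### The category of graded diagrams and cobordisms of degree zero -/

/-- The object `q^k a`, for a diagram `a` with `m` top and `n` bottom points. -/
structure Cob (m n : ℕ) where
  shift : ℤ
  diag : Diag m n

namespace Cob

variable {m k n : ℕ}

/-- The morphisms `q^k a ⟶ q^l b` are the combinations of dotted cobordisms modulo relations of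
degree zero, the degree of a cobordism being shifted by `l - k`. -/
instance : Category (Cob m n) where
  Hom X Y := CobMod.homDeg X.diag Y.diag (X.shift - Y.shift)
  id X := ⟨CobMod.id X.diag, CobMod.id_mem _ (sub_self _)⟩
  comp f g := ⟨CobMod.comp f.1 g.1, CobMod.comp_mem (sub_add_sub_cancel _ _ _) f.2 g.2⟩
  id_comp f := Subtype.ext (CobMod.id_comp f.1)
  comp_id f := Subtype.ext (CobMod.comp_id f.1)
  assoc f g h := Subtype.ext (CobMod.comp_assoc f.1 g.1 h.1)

instance : Preadditive (Cob m n) where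
  homGroup X Y := inferInstanceAs
    (AddCommGroup (CobMod.homDeg X.diag Y.diag (X.shift - Y.shift)))
  add_comp _ _ _ f f' g := Subtype.ext (LinearMap.map_add₂ CobMod.comp f.1 f'.1 g.1)
  comp_add _ _ _ f g g' := Subtype.ext (map_add (CobMod.comp f.1) g.1 g'.1)

/-- Stacking `m`-`k` diagrams on top of `k`-`n` diagrams. -/
def tensor (m k n : ℕ) : Cob m k ⥤ Cob k n ⥤ Cob m n where
  obj X :=
    { obj Y := ⟨X.shift + Y.shift, Diag.comp X.diag Y.diag⟩
      map {Y Y'} g := ⟨CobMod.stack (CobMod.id X.diag) g.1,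
        CobMod.stack_mem (by dsimp only; abel) (CobMod.id_mem X.diag rfl) g.2⟩
      map_id Y := Subtype.ext (CobMod.stack_id _ _)
      map_comp g g' := Subtype.ext
        ((congrArg (fun x => CobMod.stack x _) (CobMod.id_comp _).symm).trans
          (CobMod.stack_comp _ _ g.1 g'.1)) }
  map {X X'} f :=
    { app Y := ⟨CobMod.stack f.1 (CobMod.id Y.diag),
        CobMod.stack_mem (by dsimp only; abel) f.2 (CobMod.id_mem Y.diag rfl)⟩
      naturality Y Y' g := Subtype.ext <| by
        change CobMod.comp (CobMod.stack _ _) (CobMod.stack _ _) =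
          CobMod.comp (CobMod.stack _ _) (CobMod.stack _ _)
        rw [← CobMod.stack_comp, ← CobMod.stack_comp, CobMod.id_comp, CobMod.comp_id,
          CobMod.id_comp, CobMod.comp_id] }
  map_id X := by
    ext Y
    exact Subtype.ext (CobMod.stack_id _ _)
  map_comp f f' := by
    ext Y
    exact Subtype.ext ((congrArg (fun x => CobMod.stack _ x) (CobMod.id_comp _).symm).trans
      (CobMod.stack_comp f.1 f'.1 _ _))

instance (m k n : ℕ) (X : Cob m k) : ((tensor m k n).obj X).Additive where
  map_add := Subtype.ext (map_add (CobMod.stack (CobMod.id X.diag)) _ _)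

instance (m k n : ℕ) (Y : Cob k n) : ((tensor m k n).flip.obj Y).Additive where
  map_add {_ _ f g} := Subtype.ext (LinearMap.map_add₂ CobMod.stack f.1 g.1 _)

/-- Duality: reflection of diagrams in a horizontal line, reversal of the quantum degree, and
reversal of cobordisms. -/
def dual (m n : ℕ) : (Cob m n)ᵒᵖ ⥤ Cob n m where
  obj X := ⟨-X.unop.shift, X.unop.diag.flip⟩
  map f := ⟨CobMod.dual f.unop.1, CobMod.dual_mem (by dsimp only; abel) f.unop.2⟩
  map_id X := Subtype.ext (CobMod.dual_id _)
  map_comp f g := Subtype.ext (CobMod.dual_comp g.unop.1 f.unop.1)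

instance (m n : ℕ) : (dual m n).Additive where
  map_add := Subtype.ext (map_add CobMod.dual _ _)

end Cob

/-! ### Countable sums and products -/

section Matrices

variable {C : Type*} [Category C] [Preadditive C]

/-- The entries of an identity matrix. -/
def delta {ι : Type*} (X : ι → C) (i j : ι) : X i ⟶ X j :=
  open Classical in if h : i = j then eqToHom (congrArg X h) else 0

lemma delta_self {ι : Type*} (X : ι → C) (i : ι) : delta X i i = 𝟙 (X i) := by simp [delta]

lemma delta_of_ne {ι : Type*} (X : ι → C) {i j : ι} (h : i ≠ j) : delta X i j = 0 := by
  simp [delta, h]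

lemma finsum_delta_comp {ι : Type*} (X : ι → C) {Y : C} (i : ι) (g : ∀ j, X j ⟶ Y) :
    ∑ᶠ j, delta X i j ≫ g j = g i := by
  rw [finsum_eq_single _ i fun j hj => by rw [delta_of_ne X hj.symm, zero_comp], delta_self,
    Category.id_comp]

lemma finsum_comp_delta {ι : Type*} (X : ι → C) {Y : C} (i : ι) (g : ∀ j, Y ⟶ X j) :
    ∑ᶠ j, g j ≫ delta X j i = g i := by
  rw [finsum_eq_single _ i fun j hj => by rw [delta_of_ne X hj, comp_zero], delta_self,
    Category.comp_id]

lemma finsum_comp_left {ι : Type*} {X : ι → C} {W Y : C} {f : ∀ j, W ⟶ X j} (g : ∀ j, X j ⟶ Y)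
    {s : Finset ι} (hs : ∀ j, f j ≠ 0 → j ∈ s) : ∑ᶠ j, f j ≫ g j = ∑ j ∈ s, f j ≫ g j :=
  finsum_eq_sum_of_support_subset _ fun j hj => hs j fun h => hj (by simp only [h, zero_comp])

lemma finsum_comp_right {ι : Type*} {X : ι → C} {W Y : C} (f : ∀ j, W ⟶ X j) {g : ∀ j, X j ⟶ Y}
    {s : Finset ι} (hs : ∀ j, g j ≠ 0 → j ∈ s) : ∑ᶠ j, f j ≫ g j = ∑ j ∈ s, f j ≫ g j :=
  finsum_eq_sum_of_support_subset _ fun j hj => hs j fun h => hj (by simp only [h, comp_zero])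

end Matrices

/-- Formal countable direct sums of objects of `C`. -/
structure SumClosure (C : Type*) where
  ι : Type
  [countable : Countable ι]
  X : ι → C

/-- Formal countable direct products of objects of `C`. -/
structure ProdClosure (C : Type*) where
  ι : Type
  [countable : Countable ι]
  X : ι → C

attribute [instance] SumClosure.countable ProdClosure.countable

namespace SumClosure

variable {C : Type*} [Category C] [Preadditive C]

/-- Matrices `f i j : M i ⟶ N j` such that for each `i` only finitely many `f i j` are nonzero. -/
def matrices (M N : SumClosure C) : AddSubgroup (∀ i j, M.X i ⟶ N.X j) where
  carrier := {f | ∀ i, {j | f i j ≠ 0}.Finite}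
  zero_mem' _ := by simp
  add_mem' {f g} hf hg i := ((hf i).union (hg i)).subset fun j hj => by
    by_contra h
    simp only [Set.mem_union, Set.mem_ofPred_eq, not_or, not_not] at h
    exact hj (by rw [Pi.add_apply, Pi.add_apply, h.1, h.2, add_zero])
  neg_mem' {f} hf i := (hf i).subset fun j hj h => hj (by simp [h])

lemma exists_support {M N : SumClosure C} (f : M.matrices N) (i : M.ι) :
    ∃ s : Finset N.ι, ∀ j, f.1 i j ≠ 0 → j ∈ s :=
  ⟨(f.2 i).toFinset, fun _ hj => (Set.Finite.mem_toFinset _).2 hj⟩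

/-- Multiplication of matrices. -/
def mul {M N K : SumClosure C} (f : M.matrices N) (g : N.matrices K) : M.matrices K :=
  ⟨fun i k => ∑ᶠ j, f.1 i j ≫ g.1 j k, fun i => by
    obtain ⟨s, hs⟩ := exists_support f i
    refine (Set.Finite.biUnion s.finite_toSet fun j _ => g.2 j).subset fun k hk => ?_
    by_contra h
    simp only [Set.mem_iUnion, Set.mem_ofPred_eq, not_exists, not_not] at h
    refine hk ((finsum_comp_left _ hs).trans ?_)
    exact Finset.sum_eq_zero fun j hj => by rw [h j hj, comp_zero]⟩

instance : Category (SumClosure C) where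
  Hom M N := M.matrices N
  id M := ⟨delta M.X, fun i => (Set.finite_singleton i).subset fun j hj => by
    by_contra h
    exact hj (delta_of_ne _ fun e => h e.symm)⟩
  comp f g := mul f g
  id_comp f := Subtype.ext (funext₂ fun i j => finsum_delta_comp _ i fun k => f.1 k j)
  comp_id f := Subtype.ext (funext₂ fun i j => finsum_comp_delta _ j fun k => f.1 i k)
  assoc {M N K L} f g h := Subtype.ext (funext₂ fun i l => by
    classical
    obtain ⟨s, hs⟩ := exists_support f i
    choose t ht using exists_support g
    change ∑ᶠ k, (∑ᶠ j, f.1 i j ≫ g.1 j k) ≫ h.1 k l =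
      ∑ᶠ j, f.1 i j ≫ ∑ᶠ k, g.1 j k ≫ h.1 k l
    have h₁ : ∀ k, ∑ᶠ j, f.1 i j ≫ g.1 j k = ∑ j ∈ s, f.1 i j ≫ g.1 j k :=
      fun k => finsum_comp_left _ hs
    have h₂ : ∀ j ∈ s, ∑ᶠ k, g.1 j k ≫ h.1 k l = ∑ k ∈ s.biUnion t, g.1 j k ≫ h.1 k l :=
      fun j hj => finsum_comp_left _ fun k hk => Finset.mem_biUnion.2 ⟨j, hj, ht j k hk⟩
    rw [finsum_comp_left (s := s.biUnion t) _ fun k hk => by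
      by_contra hk'
      refine hk ((h₁ k).trans (Finset.sum_eq_zero fun j hj => ?_))
      rw [show g.1 j k = 0 from by_contra fun e => hk' (Finset.mem_biUnion.2 ⟨j, hj, ht j k e⟩),
        comp_zero], finsum_comp_left _ hs]
    refine Eq.trans ?_ (Finset.sum_congr rfl fun j hj => congrArg (f.1 i j ≫ ·) (h₂ j hj).symm)
    simp only [h₁, Preadditive.sum_comp, Preadditive.comp_sum, Category.assoc]
    exact Finset.sum_comm)

lemma comp_apply {M N K : SumClosure C} (f : M ⟶ N) (g : N ⟶ K) (i : M.ι) (k : K.ι) :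
    (f ≫ g).1 i k = ∑ᶠ j, f.1 i j ≫ g.1 j k := rfl

instance : Preadditive (SumClosure C) where
  homGroup M N := inferInstanceAs (AddCommGroup (M.matrices N))
  add_comp M N K f f' g := Subtype.ext (funext₂ fun i k => by
    classical
    obtain ⟨s, hs⟩ := exists_support f i
    obtain ⟨s', hs'⟩ := exists_support f' i
    obtain ⟨s'', hs''⟩ := exists_support ((show M.matrices N from f) + (show M.matrices N from f') : M.matrices N) i
    change ∑ᶠ j, ((show M.matrices N from f) + (show M.matrices N from f') : M.matrices N).1 i j ≫ g.1 j k =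
      ∑ᶠ j, f.1 i j ≫ g.1 j k + ∑ᶠ j, f'.1 i j ≫ g.1 j k
    have h (j) : j ∈ s ∨ j ∈ s' ∨ j ∈ s'' → j ∈ s ∪ (s' ∪ s'') := by simp
    rw [finsum_comp_left _ fun j hj => h j (Or.inl (hs j hj)),
      finsum_comp_left _ fun j hj => h j (Or.inr (Or.inl (hs' j hj))),
      finsum_comp_left _ fun j hj => h j (Or.inr (Or.inr (hs'' j hj))), ← Finset.sum_add_distrib]
    exact Finset.sum_congr rfl fun j _ => Preadditive.add_comp _ _ _ _ _ _)
  comp_add M N K f g g' := Subtype.ext (funext₂ fun i k => by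
    obtain ⟨s, hs⟩ := exists_support f i
    change ∑ᶠ j, f.1 i j ≫ ((show N.matrices K from g) + (show N.matrices K from g') : N.matrices K).1 j k =
      ∑ᶠ j, f.1 i j ≫ g.1 j k + ∑ᶠ j, f.1 i j ≫ g'.1 j k
    rw [finsum_comp_left _ hs, finsum_comp_left _ hs, finsum_comp_left _ hs,
      ← Finset.sum_add_distrib]
    exact Finset.sum_congr rfl fun j _ => Preadditive.comp_add _ _ _ _ _ _)

/-- The coproduct of countably many objects. -/
def cofan {J : Type} [Countable J] (M : J → SumClosure C) : Cofan M :=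
  Cofan.mk ⟨Σ j, (M j).ι, fun p => (M p.1).X p.2⟩ fun j =>
    ⟨fun i p => delta (fun p : Σ j, (M j).ι => (M p.1).X p.2) ⟨j, i⟩ p,
      fun i => (Set.finite_singleton ⟨j, i⟩).subset fun p hp => by
        by_contra h
        exact hp (delta_of_ne _ fun e => h e.symm)⟩

/-- `cofan` is a colimit. -/
def cofanIsColimit {J : Type} [Countable J] (M : J → SumClosure C) : IsColimit (cofan M) :=
  Cofan.IsColimit.mk _
    (fun s => ⟨fun p k => (s.inj p.1).1 p.2 k, fun p => (s.inj p.1).2 p.2⟩)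
    (fun s j => Subtype.ext (funext₂ fun i k =>
      finsum_delta_comp (fun p : Σ j, (M j).ι => (M p.1).X p.2) ⟨j, i⟩
        fun p => (s.inj p.1).1 p.2 k))
    (fun s m hm => Subtype.ext (funext₂ fun p k => by
      rw [show (s.inj p.1).1 p.2 k = (s.inj p.1).1 p.2 k from rfl, ← hm p.1]
      exact (finsum_delta_comp (fun p : Σ j, (M j).ι => (M p.1).X p.2) p
        fun p => m.1 p k).symm))

instance : HasCountableCoproducts (SumClosure C) where
  out _ _ := ⟨fun F => 
    have : HasColimit (Discrete.functor (F.obj ∘ Discrete.mk)) := ⟨⟨_, cofanIsColimit _⟩⟩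
    hasColimit_of_iso (G := F) Discrete.natIsoFunctor⟩

/-- The inclusion of finite direct sums. -/
def incl (C : Type) [SmallCategory C] [Preadditive C] : Mat_ C ⥤ SumClosure C where
  obj M := ⟨M.ι, M.X⟩
  map f := ⟨f, fun _ => Set.toFinite _⟩
  map_id M := Subtype.ext (funext₂ fun i j => by
    by_cases h : i = j
    · subst h; exact (Mat_.id_apply_self M i).trans (delta_self _ i).symm
    · exact (Mat_.id_apply_of_ne M i j h).trans (delta_of_ne _ h).symm)
  map_comp f g := Subtype.ext (funext₂ fun i k =>
    (finsum_eq_sum_of_fintype fun j => f i j ≫ g j k).symm)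

instance (C : Type) [SmallCategory C] [Preadditive C] : (incl C).Additive where
  map_add := rfl

end SumClosure

namespace ProdClosure

variable {C : Type*} [Category C] [Preadditive C]

/-- Matrices `f i j : M i ⟶ N j` such that for each `j` only finitely many `f i j` are nonzero. -/
def matrices (M N : ProdClosure C) : AddSubgroup (∀ i j, M.X i ⟶ N.X j) where
  carrier := {f | ∀ j, {i | f i j ≠ 0}.Finite}
  zero_mem' _ := by simp
  add_mem' {f g} hf hg j := ((hf j).union (hg j)).subset fun i hi => by
    by_contra h
    simp only [Set.mem_union, Set.mem_ofPred_eq, not_or, not_not] at h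
    exact hi (by rw [Pi.add_apply, Pi.add_apply, h.1, h.2, add_zero])
  neg_mem' {f} hf j := (hf j).subset fun i hi h => hi (by simp [h])

lemma exists_support {M N : ProdClosure C} (f : M.matrices N) (j : N.ι) :
    ∃ s : Finset M.ι, ∀ i, f.1 i j ≠ 0 → i ∈ s :=
  ⟨(f.2 j).toFinset, fun _ hi => (Set.Finite.mem_toFinset _).2 hi⟩

/-- Multiplication of matrices. -/
def mul {M N K : ProdClosure C} (f : M.matrices N) (g : N.matrices K) : M.matrices K :=
  ⟨fun i k => ∑ᶠ j, f.1 i j ≫ g.1 j k, fun k => by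
    obtain ⟨s, hs⟩ := exists_support g k
    refine (Set.Finite.biUnion s.finite_toSet fun j _ => f.2 j).subset fun i hi => ?_
    by_contra h
    simp only [Set.mem_iUnion, Set.mem_ofPred_eq, not_exists, not_not] at h
    refine hi ((finsum_comp_right _ hs).trans ?_)
    exact Finset.sum_eq_zero fun j hj => by rw [h j hj, zero_comp]⟩

instance : Category (ProdClosure C) where
  Hom M N := M.matrices N
  id M := ⟨delta M.X, fun j => (Set.finite_singleton j).subset fun i hi => by
    by_contra h
    exact hi (delta_of_ne _ h)⟩
  comp f g := mul f g
  id_comp f := Subtype.ext (funext₂ fun i j => finsum_delta_comp _ i fun k => f.1 k j)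
  comp_id f := Subtype.ext (funext₂ fun i j => finsum_comp_delta _ j fun k => f.1 i k)
  assoc {M N K L} f g h := Subtype.ext (funext₂ fun i l => by
    classical
    obtain ⟨s, hs⟩ := exists_support h l
    choose t ht using exists_support g
    change ∑ᶠ k, (∑ᶠ j, f.1 i j ≫ g.1 j k) ≫ h.1 k l =
      ∑ᶠ j, f.1 i j ≫ ∑ᶠ k, g.1 j k ≫ h.1 k l
    have h₁ : ∀ j, ∑ᶠ k, g.1 j k ≫ h.1 k l = ∑ k ∈ s, g.1 j k ≫ h.1 k l :=
      fun j => finsum_comp_right _ hs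
    have h₂ : ∀ k ∈ s, ∑ᶠ j, f.1 i j ≫ g.1 j k = ∑ j ∈ s.biUnion t, f.1 i j ≫ g.1 j k :=
      fun k hk => finsum_comp_right _ fun j hj => Finset.mem_biUnion.2 ⟨k, hk, ht k j hj⟩
    rw [finsum_comp_right _ hs, finsum_comp_right (s := s.biUnion t) _ fun j hj => by
      by_contra hj'
      refine hj ((h₁ j).trans (Finset.sum_eq_zero fun k hk => ?_))
      rw [show g.1 j k = 0 from by_contra fun e => hj' (Finset.mem_biUnion.2 ⟨k, hk, ht k j e⟩),
        zero_comp]]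
    refine (Finset.sum_congr rfl fun k hk => congrArg (· ≫ h.1 k l) (h₂ k hk)).trans ?_
    simp only [h₁, Preadditive.sum_comp, Preadditive.comp_sum, Category.assoc]
    exact Finset.sum_comm)

lemma comp_apply {M N K : ProdClosure C} (f : M ⟶ N) (g : N ⟶ K) (i : M.ι) (k : K.ι) :
    (f ≫ g).1 i k = ∑ᶠ j, f.1 i j ≫ g.1 j k := rfl

instance : Preadditive (ProdClosure C) where
  homGroup M N := inferInstanceAs (AddCommGroup (M.matrices N))
  add_comp M N K f f' g := Subtype.ext (funext₂ fun i k => by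
    obtain ⟨s, hs⟩ := exists_support g k
    change ∑ᶠ j, ((show M.matrices N from f) + (show M.matrices N from f') :
      M.matrices N).1 i j ≫ g.1 j k = ∑ᶠ j, f.1 i j ≫ g.1 j k + ∑ᶠ j, f'.1 i j ≫ g.1 j k
    rw [finsum_comp_right _ hs, finsum_comp_right _ hs, finsum_comp_right _ hs,
      ← Finset.sum_add_distrib]
    exact Finset.sum_congr rfl fun j _ => Preadditive.add_comp _ _ _ _ _ _)
  comp_add M N K f g g' := Subtype.ext (funext₂ fun i k => by
    classical
    obtain ⟨s, hs⟩ := exists_support g k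
    obtain ⟨s', hs'⟩ := exists_support g' k
    obtain ⟨s'', hs''⟩ := exists_support ((show N.matrices K from g) +
      (show N.matrices K from g') : N.matrices K) k
    change ∑ᶠ j, f.1 i j ≫ ((show N.matrices K from g) + (show N.matrices K from g') :
      N.matrices K).1 j k = ∑ᶠ j, f.1 i j ≫ g.1 j k + ∑ᶠ j, f.1 i j ≫ g'.1 j k
    have h (j) : j ∈ s ∨ j ∈ s' ∨ j ∈ s'' → j ∈ s ∪ (s' ∪ s'') := by simp
    rw [finsum_comp_right _ fun j hj => h j (Or.inl (hs j hj)),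
      finsum_comp_right _ fun j hj => h j (Or.inr (Or.inl (hs' j hj))),
      finsum_comp_right _ fun j hj => h j (Or.inr (Or.inr (hs'' j hj))), ← Finset.sum_add_distrib]
    exact Finset.sum_congr rfl fun j _ => Preadditive.comp_add _ _ _ _ _ _)

/-- The product of countably many objects. -/
def fan {J : Type} [Countable J] (M : J → ProdClosure C) : Fan M :=
  Fan.mk ⟨Σ j, (M j).ι, fun p => (M p.1).X p.2⟩ fun j =>
    ⟨fun p i => delta (fun p : Σ j, (M j).ι => (M p.1).X p.2) p ⟨j, i⟩,
      fun i => (Set.finite_singleton ⟨j, i⟩).subset fun p hp => by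
        by_contra h
        exact hp (delta_of_ne _ h)⟩

/-- `fan` is a limit. -/
def fanIsLimit {J : Type} [Countable J] (M : J → ProdClosure C) : IsLimit (fan M) :=
  Fan.IsLimit.mk _
    (fun s => ⟨fun k p => (s.proj p.1).1 k p.2, fun p => (s.proj p.1).2 p.2⟩)
    (fun s j => Subtype.ext (funext₂ fun k i =>
      finsum_comp_delta (fun p : Σ j, (M j).ι => (M p.1).X p.2) ⟨j, i⟩
        fun p => (s.proj p.1).1 k p.2))
    (fun s m hm => Subtype.ext (funext₂ fun k p => by
      rw [show (s.proj p.1).1 k p.2 = (s.proj p.1).1 k p.2 from rfl, ← hm p.1]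
      exact (finsum_comp_delta (fun p : Σ j, (M j).ι => (M p.1).X p.2) p
        fun p => m.1 k p).symm))

instance : HasCountableProducts (ProdClosure C) where
  out _ _ := ⟨fun F =>
    have : HasLimit (Discrete.functor (F.obj ∘ Discrete.mk)) := ⟨⟨_, fanIsLimit _⟩⟩
    hasLimit_of_iso (F := Discrete.functor (F.obj ∘ Discrete.mk)) Discrete.natIsoFunctor.symm⟩

/-- The inclusion of finite direct sums. -/
def incl (C : Type) [SmallCategory C] [Preadditive C] : Mat_ C ⥤ ProdClosure C where
  obj M := ⟨M.ι, M.X⟩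
  map f := ⟨f, fun _ => Set.toFinite _⟩
  map_id M := Subtype.ext (funext₂ fun i j => by
    by_cases h : i = j
    · subst h; exact (Mat_.id_apply_self M i).trans (delta_self _ i).symm
    · exact (Mat_.id_apply_of_ne M i j h).trans (delta_of_ne _ h).symm)
  map_comp f g := Subtype.ext (funext₂ fun i k =>
    (finsum_eq_sum_of_fintype fun j => f i j ≫ g j k).symm)

instance (C : Type) [SmallCategory C] [Preadditive C] : (incl C).Additive where
  map_add := rfl

end ProdClosure

/-! ### Extension of bifunctors to countable sums and products -/

section Bifunctors

variable {C D E : Type*} [Category C] [Category D] [Category E] (F : C ⥤ D ⥤ E)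

/-- The effect of a bifunctor on a pair of morphisms. -/
def biMap {X X' : C} {Y Y' : D} (f : X ⟶ X') (g : Y ⟶ Y') :
    (F.obj X).obj Y ⟶ (F.obj X').obj Y' := (F.map f).app Y ≫ (F.obj X').map g

lemma biMap_id (X : C) (Y : D) : biMap F (𝟙 X) (𝟙 Y) = 𝟙 _ := by simp [biMap]

lemma biMap_comp {X X' X'' : C} {Y Y' Y'' : D} (f : X ⟶ X') (f' : X' ⟶ X'') (g : Y ⟶ Y')
    (g' : Y' ⟶ Y'') : biMap F (f ≫ f') (g ≫ g') = biMap F f g ≫ biMap F f' g' := by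
  simp [biMap]

variable [Preadditive C] [Preadditive E] [∀ Y, (F.flip.obj Y).Additive]

lemma app_map_add {X X' : C} (Y : D) (f f' : X ⟶ X') :
    (F.map (f + f')).app Y = (F.map f).app Y + (F.map f').app Y :=
  (F.flip.obj Y).map_add

variable [Preadditive D] [∀ X, (F.obj X).Additive]

/-- `biMap` is biadditive. -/
def biMapHom (X X' : C) (Y Y' : D) :
    (X ⟶ X') →+ (Y ⟶ Y') →+ ((F.obj X).obj Y ⟶ (F.obj X').obj Y') :=
  AddMonoidHom.mk' (fun f => AddMonoidHom.mk' (biMap F f) fun g g' => by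
      rw [biMap, Functor.map_add, Preadditive.comp_add, biMap, biMap]) fun f f' => by
    ext g
    change biMap F (f + f') g = biMap F f g + biMap F f' g
    rw [biMap, app_map_add, Preadditive.add_comp, biMap, biMap]

lemma biMap_zero_left {X X' : C} {Y Y' : D} (g : Y ⟶ Y') : biMap F (0 : X ⟶ X') g = 0 :=
  DFunLike.congr_fun (map_zero (biMapHom F X X' Y Y')) g

lemma biMap_zero_right {X X' : C} {Y Y' : D} (f : X ⟶ X') : biMap F f (0 : Y ⟶ Y') = 0 :=
  map_zero (biMapHom F X X' Y Y' f)

lemma biMap_sum {ι κ : Type*} (s : Finset ι) (t : Finset κ) {X X' : C} {Y Y' : D}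
    (f : ι → (X ⟶ X')) (g : κ → (Y ⟶ Y')) :
    biMap F (∑ i ∈ s, f i) (∑ j ∈ t, g j) = ∑ p ∈ s ×ˢ t, biMap F (f p.1) (g p.2) := by
  rw [Finset.sum_product]
  change biMapHom F X X' Y Y' (∑ i ∈ s, f i) (∑ j ∈ t, g j) = _
  rw [map_sum (biMapHom F X X' Y Y'), AddMonoidHom.finsetSum_apply]
  exact Finset.sum_congr rfl fun i _ => map_sum (biMapHom F X X' Y Y' (f i)) _ _

lemma biMap_delta {ι κ : Type*} (X : ι → C) (Y : κ → D) (p q : ι × κ) :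
    biMap F (delta X p.1 q.1) (delta Y p.2 q.2) =
      delta (fun p : ι × κ => (F.obj (X p.1)).obj (Y p.2)) p q := by
  by_cases h : p = q
  · subst h
    rw [delta_self, delta_self, delta_self, biMap_id]
  · rw [delta_of_ne _ h]
    by_cases h₁ : p.1 = q.1
    · rw [delta_of_ne _ fun h₂ => h (Prod.ext h₁ h₂), biMap_zero_right]
    · rw [delta_of_ne _ h₁, biMap_zero_left]

namespace SumClosure

/-- The extension of a biadditive bifunctor to countable sums. -/
def extend : SumClosure C ⥤ SumClosure D ⥤ SumClosure E := Functor.curry.obj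
  { obj M := ⟨M.1.ι × M.2.ι, fun p => (F.obj (M.1.X p.1)).obj (M.2.X p.2)⟩
    map f := ⟨fun p q => biMap F (f.1.1 p.1 q.1) (f.2.1 p.2 q.2), fun p =>
      ((f.1.2 p.1).prod (f.2.2 p.2)).subset fun q hq =>
        ⟨fun h => hq ((congrArg (biMap F · _) h).trans (biMap_zero_left F _)),
          fun h => hq ((congrArg (biMap F _) h).trans (biMap_zero_right F _))⟩⟩
    map_id M := Subtype.ext (funext₂ fun p q => biMap_delta F M.1.X M.2.X p q)
    map_comp {_ N _} f g := Subtype.ext (funext₂ fun p q => by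
      obtain ⟨s, hs⟩ := exists_support f.1 p.1
      obtain ⟨t, ht⟩ := exists_support f.2 p.2
      change biMap F (∑ᶠ j, f.1.1 p.1 j ≫ g.1.1 j q.1) (∑ᶠ j, f.2.1 p.2 j ≫ g.2.1 j q.2) =
        ∑ᶠ j : N.1.ι × N.2.ι, biMap F (f.1.1 p.1 j.1) (f.2.1 p.2 j.2) ≫ biMap F (g.1.1 j.1 q.1) (g.2.1 j.2 q.2)
      rw [finsum_comp_left _ hs, finsum_comp_left _ ht, biMap_sum,
        finsum_comp_left (s := s ×ˢ t) _ fun j hj => Finset.mem_product.2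
          ⟨hs _ fun h => hj (by rw [h, biMap_zero_left]),
            ht _ fun h => hj (by rw [h, biMap_zero_right])⟩]
      exact Finset.sum_congr rfl fun j _ => biMap_comp F _ _ _ _) }

instance : (extend F).PreservesZeroMorphisms where
  map_zero _ _ := by
    ext N
    exact Subtype.ext (funext₂ fun _ _ => biMap_zero_left F _)

instance (M : SumClosure C) : ((extend F).obj M).PreservesZeroMorphisms where
  map_zero _ _ := Subtype.ext (funext₂ fun _ _ => biMap_zero_right F _)

end SumClosure

namespace ProdClosure

/-- The extension of a biadditive bifunctor to countable products. -/
def extend : ProdClosure C ⥤ ProdClosure D ⥤ ProdClosure E := Functor.curry.obj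
  { obj M := ⟨M.1.ι × M.2.ι, fun p => (F.obj (M.1.X p.1)).obj (M.2.X p.2)⟩
    map f := ⟨fun p q => biMap F (f.1.1 p.1 q.1) (f.2.1 p.2 q.2), fun q =>
      ((f.1.2 q.1).prod (f.2.2 q.2)).subset fun p hp =>
        ⟨fun h => hp ((congrArg (biMap F · _) h).trans (biMap_zero_left F _)),
          fun h => hp ((congrArg (biMap F _) h).trans (biMap_zero_right F _))⟩⟩
    map_id M := Subtype.ext (funext₂ fun p q => biMap_delta F M.1.X M.2.X p q)
    map_comp {_ N _} f g := Subtype.ext (funext₂ fun p q => by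
      obtain ⟨s, hs⟩ := exists_support g.1 q.1
      obtain ⟨t, ht⟩ := exists_support g.2 q.2
      change biMap F (∑ᶠ j, f.1.1 p.1 j ≫ g.1.1 j q.1) (∑ᶠ j, f.2.1 p.2 j ≫ g.2.1 j q.2) =
        ∑ᶠ j : N.1.ι × N.2.ι, biMap F (f.1.1 p.1 j.1) (f.2.1 p.2 j.2) ≫ biMap F (g.1.1 j.1 q.1) (g.2.1 j.2 q.2)
      rw [finsum_comp_right _ hs, finsum_comp_right _ ht, biMap_sum,
        finsum_comp_right (s := s ×ˢ t) _ fun j hj => Finset.mem_product.2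
          ⟨hs _ fun h => hj (by rw [h, biMap_zero_left]),
            ht _ fun h => hj (by rw [h, biMap_zero_right])⟩]
      exact Finset.sum_congr rfl fun j _ => biMap_comp F _ _ _ _) }

instance : (extend F).PreservesZeroMorphisms where
  map_zero _ _ := by
    ext N
    exact Subtype.ext (funext₂ fun _ _ => biMap_zero_left F _)

instance (M : ProdClosure C) : ((extend F).obj M).PreservesZeroMorphisms where
  map_zero _ _ := Subtype.ext (funext₂ fun _ _ => biMap_zero_right F _)

end ProdClosure

end Bifunctors

/-! ### Total complexes and duals -/

section Total

variable {C D E : Type*} [Category C] [Category D] [Category E]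
  [HasZeroMorphisms C] [HasZeroMorphisms D] [Preadditive E] [HasCountableProducts E]
  (F : C ⥤ D ⥤ E) (K : CochainComplex C ℤ) (L : CochainComplex D ℤ)

/-- The bidegrees of total degree `k`. -/
abbrev Bideg (k : ℤ) : Type := {s : ℤ × ℤ // s.1 + s.2 = k}

/-- The chain objects of the product total complex. -/
abbrev totProdX (k : ℤ) : E := ∏ᶜ fun s : Bideg k => (F.obj (K.X s.1.1)).obj (L.X s.1.2)

/-- The projections from the product total complex. -/
abbrev totProdπ (p q k : ℤ) (h : p + q = k) :
    totProdX F K L k ⟶ (F.obj (K.X p)).obj (L.X q) :=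
  Pi.π (fun s : Bideg k => (F.obj (K.X s.1.1)).obj (L.X s.1.2)) ⟨(p, q), h⟩

/-- The differential of the product total complex; it is `d ⊗ 1 + (-1)^p (1 ⊗ d)` on the factor of
bidegree `(p, q)`. -/
def totProdD (k l : ℤ) : totProdX F K L k ⟶ totProdX F K L l :=
  if h : k + 1 = l then
    Pi.lift fun s =>
      totProdπ F K L (s.1.1 - 1) s.1.2 k (by have := s.2; omega) ≫
          (F.map (K.d (s.1.1 - 1) s.1.1)).app (L.X s.1.2) +
        s.1.1.negOnePow • totProdπ F K L s.1.1 (s.1.2 - 1) k (by have := s.2; omega) ≫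
          (F.obj (K.X s.1.1)).map (L.d (s.1.2 - 1) s.1.2)
  else 0

lemma totProdD_π (k l p q : ℤ) (h : k + 1 = l) (hs : p + q = l) :
    totProdD F K L k l ≫ totProdπ F K L p q l hs =
      totProdπ F K L (p - 1) q k (by omega) ≫ (F.map (K.d (p - 1) p)).app (L.X q) +
        p.negOnePow • totProdπ F K L p (q - 1) k (by omega) ≫
          (F.obj (K.X p)).map (L.d (q - 1) q) := by
  rw [totProdD, dif_pos h]
  exact Pi.lift_π _ _

variable [F.PreservesZeroMorphisms] [∀ X, (F.obj X).PreservesZeroMorphisms]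

/-- The product total complex of `F(K, L)`. -/
def totProd : CochainComplex E ℤ where
  X := totProdX F K L
  d := totProdD F K L
  shape k l h := dif_neg h
  d_comp_d' := by
    rintro i j k rfl rfl
    refine Pi.hom_ext _ _ ?_
    rintro ⟨⟨p, q⟩, h⟩
    have h₁ : (F.map (K.d (p - 1 - 1) (p - 1))).app (L.X q) ≫
        (F.map (K.d (p - 1) p)).app (L.X q) = 0 := by
      rw [← NatTrans.comp_app, ← F.map_comp, K.d_comp_d, F.map_zero, zero_app]
    have h₂ : (F.obj (K.X p)).map (L.d (q - 1 - 1) (q - 1)) ≫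
        (F.obj (K.X p)).map (L.d (q - 1) q) = 0 := by
      rw [← Functor.map_comp, L.d_comp_d, Functor.map_zero]
    have h₃ := (F.map (K.d (p - 1) p)).naturality (L.d (q - 1) q)
    rw [zero_comp, Category.assoc, totProdD_π F K L _ _ p q rfl h, Preadditive.comp_add,
      Linear.comp_units_smul, ← Category.assoc, ← Category.assoc,
      totProdD_π F K L _ _ (p - 1) q rfl, totProdD_π F K L _ _ p (q - 1) rfl]
    simp only [Preadditive.add_comp, Category.assoc, h₁, h₂, comp_zero, zero_add, smul_zero,
      add_zero, Linear.units_smul_comp, h₃]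
    rw [Int.negOnePow_sub, Int.negOnePow_one]
    simp

/-- The sum total complex of `F(K, L)`, with differential `d ⊗ 1 + (-1)^p (1 ⊗ d)` on the summand
of bidegree `(p, q)`. -/
abbrev totSum {E' : Type*} [Category E'] [Preadditive E'] [HasCountableCoproducts E']
    (F : C ⥤ D ⥤ E') [F.PreservesZeroMorphisms] [∀ X, (F.obj X).PreservesZeroMorphisms] :
    CochainComplex E' ℤ :=
  HomologicalComplex.mapBifunctor K L F (ComplexShape.up ℤ)

/-- The image of a complex under a contravariant functor `F`, with the differential
`(-1)^(k+1) F(d^(-k-1))` in degree `k`. -/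
def dualComplex {C E : Type*} [Category C] [Preadditive C] [Category E] [Preadditive E]
    (F : Cᵒᵖ ⥤ E) [F.Additive] (K : CochainComplex C ℤ) : CochainComplex E ℤ where
  X k := F.obj (.op (K.X (-k)))
  d k l := (k + 1).negOnePow • F.map (K.d (-l) (-k)).op
  shape k l h := by
    rw [K.shape _ _ fun h' => h (by simp only [ComplexShape.up_Rel] at h' ⊢; omega), op_zero,
      F.map_zero, smul_zero]
  d_comp_d' i j k _ _ := by
    rw [Linear.comp_units_smul, Linear.units_smul_comp, ← F.map_comp, ← op_comp, K.d_comp_d,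
      op_zero, F.map_zero, smul_zero, smul_zero]

end Total

/-! ### Bar-Natan's categories and universal projectors -/

/-- The category of finite direct sums of graded diagrams. -/
abbrev BN (m n : ℕ) : Type 1 := Mat_ (Cob m n)

/-- The category of countable direct sums of graded diagrams. -/
abbrev BNSum (m n : ℕ) : Type 1 := SumClosure (Cob m n)

/-- The category of countable direct products of graded diagrams. -/
abbrev BNProd (m n : ℕ) : Type 1 := ProdClosure (Cob m n)

instance {C D : Type} [SmallCategory C] [Preadditive C] [SmallCategory D] [Preadditive D]
    (F : C ⥤ D) [F.Additive] : F.mapMat_.Additive where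
  map_add := by intros; ext; exact F.map_add

namespace BN

/-- The object `q^l 1_n`. -/
def unit (n : ℕ) (l : ℤ) : BN n n := (Mat_.embedding _).obj ⟨l, Diag.one n⟩

/-- The dual of a finite direct sum, and of a matrix. -/
def dual (m n : ℕ) : (BN m n)ᵒᵖ ⥤ BN n m where
  obj M := ⟨M.unop.ι, fun i => (Cob.dual m n).obj (.op (M.unop.X i))⟩
  map f i j := (Cob.dual m n).map (f.unop j i).op
  map_id M := by
    ext i j
    by_cases h : i = j
    · subst h
      exact ((congrArg (fun x => (Cob.dual m n).map (Quiver.Hom.op x))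
        (Mat_.id_apply_self M.unop i)).trans ((Cob.dual m n).map_id _)).trans
          (Mat_.id_apply_self _ i).symm
    · exact ((congrArg (fun x => (Cob.dual m n).map (Quiver.Hom.op x))
        (Mat_.id_apply_of_ne M.unop j i fun e => h e.symm)).trans (Functor.map_zero _ _ _)).trans
          (Mat_.id_apply_of_ne _ i j h).symm
  map_comp {M N K} f g := by
    ext i k
    change (Cob.dual m n).map (Quiver.Hom.op (∑ j, g.unop k j ≫ f.unop j i)) =
      ∑ j, (Cob.dual m n).map (f.unop j i).op ≫ (Cob.dual m n).map (g.unop k j).op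
    rw [op_sum, Functor.map_sum]
    exact Finset.sum_congr rfl fun j _ => (Cob.dual m n).map_comp _ _

instance (m n : ℕ) : (dual m n).Additive where
  map_add := by intros; ext; exact (Cob.dual _ _).map_add

/-- `a ⊗ P`, for a diagram `a` and a complex `P`. -/
def stackLeft {m k n : ℕ} (a : Diag m k) (P : CochainComplex (BN k n) ℤ) :
    CochainComplex (BN m n) ℤ :=
  (((Cob.tensor m k n).obj ⟨0, a⟩).mapMat_.mapHomologicalComplex _).obj P

/-- `P ⊗ b`, for a diagram `b` and a complex `P`. -/
def stackRight {m k n : ℕ} (P : CochainComplex (BN m k) ℤ) (b : Diag k n) :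
    CochainComplex (BN m n) ℤ :=
  (((Cob.tensor m k n).flip.obj ⟨0, b⟩).mapMat_.mapHomologicalComplex _).obj P

/-- The complex `P` is homotopy equivalent to `0`. -/
def Contractible {m n : ℕ} (P : CochainComplex (BN m n) ℤ) : Prop :=
  Nonempty (Homotopy (𝟙 P) 0)

/-- `P` is a universal projector on `n` strands. -/
structure IsUniversalProjector {n : ℕ} (P : CochainComplex (BN n n) ℤ) : Prop where
  nonpos : ∀ k > 0, IsZero (P.X k)
  zero : Nonempty (P.X 0 ≅ unit n 0)
  /-- No shift of `1_n` is a direct summand of another chain object. -/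
  no_summand : ∀ k ≠ 0, ∀ l, IsEmpty (Retract (unit n l) (P.X k))
  kills_left : ∀ (k : ℕ) (h : n = k + 2) (i : Fin (k + 1)),
    Contractible (stackLeft (h ▸ Diag.cap k i : Diag k n) P)
  kills_right : ∀ (k : ℕ) (h : n = k + 2) (i : Fin (k + 1)),
    Contractible (stackRight P (h ▸ Diag.cup k i : Diag n k))

/-- The dual `P^∨` of a complex. -/
def dualCh {m n : ℕ} (P : CochainComplex (BN m n) ℤ) : CochainComplex (BN n m) ℤ :=
  dualComplex (dual m n) P

/-- A complex over finite direct sums as a complex over countable direct sums. -/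
def toSum {m n : ℕ} (P : CochainComplex (BN m n) ℤ) : CochainComplex (BNSum m n) ℤ :=
  ((SumClosure.incl _).mapHomologicalComplex _).obj P

/-- A complex over finite direct sums as a complex over countable direct products. -/
def toProd {m n : ℕ} (P : CochainComplex (BN m n) ℤ) : CochainComplex (BNProd m n) ℤ :=
  ((ProdClosure.incl _).mapHomologicalComplex _).obj P

end BN

/-- The tensor product of complexes over countable direct sums. -/
def tensorSum {m k n : ℕ} (A : CochainComplex (BNSum m k) ℤ) (B : CochainComplex (BNSum k n) ℤ) :
    CochainComplex (BNSum m n) ℤ :=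
  totSum A B (SumClosure.extend (Cob.tensor m k n))

/-- The completed tensor product of complexes over countable direct products. -/
def tensorProd {m k n : ℕ} (A : CochainComplex (BNProd m k) ℤ)
    (B : CochainComplex (BNProd k n) ℤ) : CochainComplex (BNProd m n) ℤ :=
  totProd (ProdClosure.extend (Cob.tensor m k n)) A B

end BarNatan
end

/-! The projector absorbs itself across any complex: both `A ⊗ P` and `P ⊗ A` are deformation
retracts of `P ⊗ A ⊗ P`, hence homotopy equivalent to each other. Here `P` stands for the projector
with the completed tensor product, or for its dual with the ordinary one; a Boolean `b` (`true` for
sums, `false` for products) treats both cases at once.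

Consider the part `A ⊗ P` of `(P ⊗ A) ⊗ P` that comes from `P⁰ = 1_n`. Circles can be removed by
neck cutting, zigzags straightened and distant arcs exchanged, so every diagram is a sum of shifts
of normal forms, that is, cups followed by caps (`Cob.splits_normal`). A normal form on `n` strands
other than the identity passes through fewer than `n` points (`Cob.retract_one_or_splits_isLow`).
For `i ≠ 0` the object `Pⁱ` has no summand `q^l 1_n`, so it splits into such diagrams. Stacked on
any object, their lower parts split into diagrams that end in a cap, and `P` kills turnbacks; thus
`(Pⁱ ⊗ Y) ⊗ P` is contractible for every object `Y`.

These contractions form a homotopy `H` that ignores the differential of `P ⊗ A`. If `Z` is the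
projection to the part with `i = 0`, then `Z + dH + Hd = 1 - N`, where `N` collects the terms with
the differential of `P ⊗ A` and lowers the degree of the last factor by one. That factor is bounded
on one side, so each entry of the geometric series for the inverse of `1 - N` is a finite sum. The
series is a legitimate matrix because nonpositive degrees are paired with products (finite columns)
and nonnegative degrees with sums (finite rows): see `MatClosure.npow_eq_zero`,
`MatClosure.geom_mem` and `DG.Absorbing.exists_homotopy`. Nothing is asked of `A`. A perturbation
argument (`DG.DefRetract.ofInclusion`, `DG.DefRetract.ofProjection`) turns this into the deformation
retraction `DG.Absorbing.absorb`. The same statement for the bifunctor with interchanged arguments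
gives the other side, and `DG.Absorbing.commute` joins the two.

To handle infinite sums, a complex is collected into one graded object with a square-zero matrix
(`DG`); its total complexes live on products of index sets. `DG.totSumIso` and `DG.totProdIso`
compare them with the tensor products of the theorem. Associativity and unitality of stacking are
needed up to natural isomorphism. Since cobordisms are compared through their components, these
reduce to bijections of components (`Isot.Model`). -/

noncomputable section

namespace BarNatan
open Diag

/-! ### Planar isotopies are invertible -/

variable {m k l n : ℕ}

/-- The component of a segment. -/
abbrev Diag.toComp (a : Diag m n) (x : a.Seg) : Quot a.Link := Quot.mk _ x

lemma Diag.congr_toComp {a : Diag m n} {β : Type*} {F : a.Seg → β}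
    (hF : ∀ x y, a.Link x y → F x = F y) {x y : a.Seg} (h : a.toComp x = a.toComp y) :
    F x = F y := congrArg (Quot.lift F hF) h

/-- A bijection between the components of the source and the target of a planar isotopy, given by
maps of segments. -/
structure Isot.Model {a b : Diag m n} (h : Isot a b) where
  f : a.Seg → b.Seg
  g : b.Seg → a.Seg
  hf : ∀ x y, a.Link x y → b.toComp (f x) = b.toComp (f y)
  hg : ∀ x y, b.Link x y → a.toComp (g x) = a.toComp (g y)
  hgf : ∀ x, a.toComp (g (f x)) = a.toComp x
  hfg : ∀ y, b.toComp (f (g y)) = b.toComp y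
  htop : ∀ j, b.toComp (f (a.top j)) = b.toComp (b.top j)
  hbot : ∀ j, b.toComp (f (a.bot j)) = b.toComp (b.bot j)
  hid : ∀ x y, h.Ident x y → b.toComp (f x) = b.toComp y
  touch : ∀ x, (∃ j, a.toComp x = a.toComp (a.top j)) ∨ (∃ j, a.toComp x = a.toComp (a.bot j)) ∨
    ∃ x' y', a.toComp x = a.toComp x' ∧ h.Ident x' y'

namespace Isot.Model

variable {a b : Diag m n} {h : Isot a b} (M : h.Model)

open Cobordism

lemma f_congr {x y : a.Seg} (e : a.toComp x = a.toComp y) : b.toComp (M.f x) = b.toComp (M.f y) :=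
  Diag.congr_toComp M.hf e

lemma g_congr {x y : b.Seg} (e : b.toComp x = b.toComp y) : a.toComp (M.g x) = a.toComp (M.g y) :=
  Diag.congr_toComp M.hg e

lemma gtop (j : Fin m) : a.toComp (M.g (b.top j)) = a.toComp (a.top j) :=
  (M.g_congr (M.htop j)).symm.trans (M.hgf _)

lemma gbot (j : Fin n) : a.toComp (M.g (b.bot j)) = a.toComp (a.bot j) :=
  (M.g_congr (M.hbot j)).symm.trans (M.hgf _)

lemma gid (x : a.Seg) (y : b.Seg) (e : h.Ident x y) : a.toComp (M.g y) = a.toComp x :=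
  (M.g_congr (M.hid x y e)).symm.trans (M.hgf _)

lemma src_congr (s : Cobordism a b) {x y : a.Seg} (e : a.toComp x = a.toComp y) :
    s.toComp (s.src x) = s.toComp (s.src y) := Diag.congr_toComp (toComp_src_link s) e

lemma tgt_congr (s : Cobordism a b) {x y : b.Seg} (e : b.toComp x = b.toComp y) :
    s.toComp (s.tgt x) = s.toComp (s.tgt y) := Diag.congr_toComp (toComp_tgt_link s) e

/-- The trace of an isotopy glues source to target only along the side walls and along `Ident`. This
is why a model has the field `touch`: every component meets the top, the bottom or an identified
pair, and through any of these it continues to its image under `f`. -/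
lemma isot_conn (x : a.Seg) : (elem (Elem.isot h)).toComp (Sum.inl x) =
    (elem (Elem.isot h)).toComp (Sum.inr (M.f x)) := by
  obtain ⟨j, e⟩ | ⟨j, e⟩ | ⟨x', y', e, e'⟩ := M.touch x
  · exact (src_congr (elem (Elem.isot h)) e).trans (((toComp_wall _).1 j).trans
      (tgt_congr (elem (Elem.isot h)) ((M.f_congr e).trans (M.htop j))).symm)
  · exact (src_congr (elem (Elem.isot h)) e).trans (((toComp_wall _).2 j).trans
      (tgt_congr (elem (Elem.isot h)) ((M.f_congr e).trans (M.hbot j))).symm)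
  · exact (src_congr (elem (Elem.isot h)) e).trans
      ((toComp_eq (s := elem (Elem.isot h)) (p := Sum.inl x') (q := Sum.inr y') (Or.inl e')).trans
      (tgt_congr (elem (Elem.isot h)) ((M.f_congr e).trans (M.hid _ _ e'))).symm)

lemma isotInv_conn (x : a.Seg) : (elem (Elem.isotInv h)).toComp (Sum.inr x) =
    (elem (Elem.isotInv h)).toComp (Sum.inl (M.f x)) := by
  obtain ⟨j, e⟩ | ⟨j, e⟩ | ⟨x', y', e, e'⟩ := M.touch x
  · exact (tgt_congr (elem (Elem.isotInv h)) e).trans (((toComp_wall _).1 j).symm.trans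
      (src_congr (elem (Elem.isotInv h)) ((M.f_congr e).trans (M.htop j))).symm)
  · exact (tgt_congr (elem (Elem.isotInv h)) e).trans (((toComp_wall _).2 j).symm.trans
      (src_congr (elem (Elem.isotInv h)) ((M.f_congr e).trans (M.hbot j))).symm)
  · exact (tgt_congr (elem (Elem.isotInv h)) e).trans
      ((toComp_eq (s := elem (Elem.isotInv h)) (p := Sum.inl y') (q := Sum.inr x')
        (Or.inl e')).symm.trans
      (src_congr (elem (Elem.isotInv h)) ((M.f_congr e).trans (M.hid _ _ e'))).symm)

end Isot.Model

namespace Cobordism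

variable {a b : Diag m n}

/-- A map of components that is compatible with an elementary cobordism is compatible with its
pieces. -/
lemma elem_glue {M : Type*} (e : Elem a b) (F : a.Seg → M) (G : b.Seg → M)
    (hF : ∀ x y, a.Link x y → F x = F y) (hG : ∀ x y, b.Link x y → G x = G y)
    (hid : ∀ x y, e.Ident x y → F x = G y) (htop : ∀ j, F (a.top j) = G (b.top j))
    (hbot : ∀ j, F (a.bot j) = G (b.bot j)) :
    ∀ p q : a.Seg ⊕ b.Seg, e.Glue p q → Sum.elim F G p = Sum.elim F G q
  | Sum.inl x, Sum.inl y, h => hF x y h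
  | Sum.inr x, Sum.inr y, h => hG x y h
  | Sum.inl x, Sum.inr y, h => by
      rcases h with h | ⟨j, rfl, rfl⟩ | ⟨j, rfl, rfl⟩
      · exact hid x y h
      · exact htop j
      · exact hbot j
  | Sum.inr _, Sum.inl _, h => h.elim

/-- Without critical points and dots only the components matter. Each component of the composite
runs from a segment of `a` through `b` back to the same component of `a`. Stated for two elementary
cobordisms so that it serves for both orders of an isotopy and its inverse. -/
lemma comp_same_id (e : Elem a b) (e' : Elem b a) (f : a.Seg → b.Seg) (g : b.Seg → a.Seg)
    (hcrit : e.crit = 0) (hcrit' : e'.crit = 0) (hdots : e.dots = 0) (hdots' : e'.dots = 0)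
    (hg : ∀ x y, b.Link x y → a.toComp (g x) = a.toComp (g y))
    (gtop : ∀ j, a.toComp (g (b.top j)) = a.toComp (a.top j))
    (gbot : ∀ j, a.toComp (g (b.bot j)) = a.toComp (a.bot j))
    (hid : ∀ x y, e.Ident x y → a.toComp (g y) = a.toComp x)
    (hid' : ∀ x y, e'.Ident y x → a.toComp (g y) = a.toComp x)
    (hx : ∀ x, (elem e).toComp (Sum.inl x) = (elem e).toComp (Sum.inr (f x)))
    (hx' : ∀ x, (elem e').toComp (Sum.inr x) = (elem e').toComp (Sum.inl (f x)))
    (hy : ∀ y, (elem e).toComp (Sum.inr y) = (elem e).toComp (Sum.inl (g y))) :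
    Same (comp (elem e) (elem e')) (id a) := by
  have key (x : a.Seg) : (comp (elem e) (elem e')).toComp (Sum.inl (Sum.inl x)) =
      (comp (elem e) (elem e')).toComp (Sum.inr (Sum.inr x)) :=
    (toComp_inl_comp _ _ (hx x)).trans ((toComp_glue_comp (elem e) (elem e') (f x)).trans
      (toComp_inr_comp _ _ (hx' x)).symm)
  have src {x y : a.Seg} (h : a.toComp x = a.toComp y) :
      (id a).toComp (Sum.inl x) = (id a).toComp (Sum.inl y) :=
    Diag.congr_toComp (F := fun x => (id a).toComp (Sum.inl x)) (toComp_src_link (id a)) h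
  have G₁ := elem_glue e (fun x => (id a).toComp (Sum.inl x))
    (fun y => (id a).toComp (Sum.inl (g y))) (toComp_src_link (id a)) (fun x y h => src (hg x y h))
    (fun x y h => src (hid x y h).symm) (fun j => src (gtop j).symm) (fun j => src (gbot j).symm)
  have G₂ := elem_glue e' (fun y => (id a).toComp (Sum.inl (g y)))
    (fun x => (id a).toComp (Sum.inl x)) (fun x y h => src (hg x y h)) (toComp_src_link (id a))
    (fun x y h => src (hid' y x h)) (fun j => src (gtop j)) (fun j => src (gbot j))
  -- Both layers of `b` are pulled back by `g` to the source of the identity. Only the last layer of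
  -- `a` is sent to its target, so that compatibility with the target holds by definition.
  refine Same.mk' _ _
    (Sum.elim (Sum.elim Sum.inl (Sum.inl ∘ g)) (Sum.elim (Sum.inl ∘ g) Sum.inr))
    (Sum.elim (Sum.inl ∘ Sum.inl) (Sum.inr ∘ Sum.inr)) ?_ ?_ ?_ ?_ ?_ ?_ ?_ ?_
  · rintro (p | p) (q | q) h
    · have := G₁ p q h
      rcases p with p | p <;> rcases q with q | q <;> exact this
    · obtain ⟨x, rfl, rfl⟩ := h; rfl
    · exact h.elim
    · have := G₂ p q h
      rcases p with p | p <;> rcases q with q | q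
      · exact this
      · exact this.trans (toComp_id a q)
      · exact h.elim
      · exact (toComp_id a p).symm.trans (this.trans (toComp_id a q))
  · rintro (x | x) (y | y) h
    · exact toComp_inl_comp _ _ (toComp_src_link (elem e) x y h)
    · have : x = y := by
        rcases h with h | ⟨j, h, h'⟩ | ⟨j, h, h'⟩
        · exact h
        · exact h.trans h'.symm
        · exact h.trans h'.symm
      subst this
      exact key x
    · exact h.elim
    · exact toComp_inr_comp _ _ (toComp_tgt_link (elem e') x y h)
  · rintro ((x | y) | (y | x))
    · rfl
    · exact toComp_inl_comp _ _ (hy y).symm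
    · exact (toComp_inl_comp _ _ (hy y).symm).trans (toComp_glue_comp (elem e) (elem e') y)
    · rfl
  · rintro (x | x) <;> rfl
  · intro x; rfl
  · intro x; rfl
  · refine (mapDomain_sum _ _ _).trans ?_
    change Finsupp.mapDomain _ e.crit + Finsupp.mapDomain _ e'.crit = Finsupp.mapDomain _ 0
    rw [hcrit, hcrit']
    exact (congrArg₂ (· + ·) Finsupp.mapDomain_zero Finsupp.mapDomain_zero).trans
      ((add_zero _).trans Finsupp.mapDomain_zero.symm)
  · refine (mapDomain_sum _ _ _).trans ?_
    change Finsupp.mapDomain _ e.dots + Finsupp.mapDomain _ e'.dots = Finsupp.mapDomain _ 0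
    rw [hdots, hdots']
    exact (congrArg₂ (· + ·) Finsupp.mapDomain_zero Finsupp.mapDomain_zero).trans
      ((add_zero _).trans Finsupp.mapDomain_zero.symm)

end Cobordism

namespace Isot.Model

open Cobordism

variable {a b : Diag m n} {h : Isot a b} (M : h.Model)

include M

lemma comp_inv_same : Same (comp (elem (Elem.isot h)) (elem (Elem.isotInv h))) (id a) :=
  comp_same_id _ _ M.f M.g rfl rfl rfl rfl M.hg M.gtop M.gbot M.gid M.gid M.isot_conn
    M.isotInv_conn fun y =>
      (tgt_congr (elem (Elem.isot h)) (M.hfg y)).symm.trans (M.isot_conn _).symm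

lemma inv_comp_same : Same (comp (elem (Elem.isotInv h)) (elem (Elem.isot h))) (id b) :=
  have src {y : b.Seg} := (src_congr (elem (Elem.isotInv h)) (M.hfg y))
  have tgt {y : b.Seg} := (tgt_congr (elem (Elem.isot h)) (M.hfg y))
  comp_same_id _ _ M.g M.f rfl rfl rfl rfl M.hf M.htop M.hbot (fun y x => M.hid x y)
    (fun y x => M.hid x y) (fun _ => src.symm.trans (M.isotInv_conn _).symm)
    (fun _ => tgt.symm.trans (M.isot_conn _).symm) M.isotInv_conn

end Isot.Model
end BarNatan

/-! ### Models of the elementary planar isotopies -/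

namespace BarNatan
open Diag

variable {m k l n : ℕ}

lemma skip_val {n : ℕ} (i : Fin (n + 1)) (j : Fin n) :
    (skip i j).val = if j.val < i.val then j.val else j.val + 2 := by
  unfold skip; split_ifs <;> rfl

lemma Diag.sound {a : Diag m n} {x y : a.Seg} (h : a.Link x y) : a.toComp x = a.toComp y :=
  Quot.sound h

lemma Diag.comp_inl {a : Diag m k} {b : Diag k n} {x y : a.Seg} (h : a.toComp x = a.toComp y) :
    (Diag.comp a b).toComp (Sum.inl x) = (Diag.comp a b).toComp (Sum.inl y) :=
  Diag.congr_toComp (F := fun x => (Diag.comp a b).toComp (Sum.inl x))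
    (fun _ _ h => sound (a := Diag.comp a b) h) h

lemma Diag.comp_inr {a : Diag m k} {b : Diag k n} {x y : b.Seg} (h : b.toComp x = b.toComp y) :
    (Diag.comp a b).toComp (Sum.inr x) = (Diag.comp a b).toComp (Sum.inr y) :=
  Diag.congr_toComp (F := fun x => (Diag.comp a b).toComp (Sum.inr x))
    (fun _ _ h => sound (a := Diag.comp a b) h) h

lemma Diag.inl_eq {a : Diag m k} {b : Diag k n} {x y : a.Seg} (h : x = y) :
    (Diag.comp a b).toComp (Sum.inl x) = (Diag.comp a b).toComp (Sum.inl y) := by rw [h]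

lemma Diag.inr_eq {a : Diag m k} {b : Diag k n} {x y : b.Seg} (h : x = y) :
    (Diag.comp a b).toComp (Sum.inr x) = (Diag.comp a b).toComp (Sum.inr y) := by rw [h]

lemma Diag.comp_glue (a : Diag m k) (b : Diag k n) (j : Fin k) :
    (Diag.comp a b).toComp (Sum.inl (a.bot j)) = (Diag.comp a b).toComp (Sum.inr (b.top j)) :=
  sound (a := Diag.comp a b) ⟨j, rfl, rfl⟩

namespace Isot

/-- Closed components never meet the boundary, but reassociation identifies every segment with one
of the target, so `touch` is settled by `Ident` alone. -/
def assocModel (a : Diag m k) (b : Diag k l) (c : Diag l n) : (assoc a b c).Model where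
  f := Equiv.sumAssoc _ _ _
  g := (Equiv.sumAssoc _ _ _).symm
  hf := by
    rintro ((x | x) | x) ((y | y) | y) h
    · exact sound (a := Diag.comp a (Diag.comp b c)) h
    · exact sound (a := Diag.comp a (Diag.comp b c)) (by obtain ⟨j, rfl, rfl⟩ := h; exact ⟨j, rfl, rfl⟩)
    · obtain ⟨j, h, -⟩ := h; cases h
    · exact h.elim
    · exact sound (a := Diag.comp a (Diag.comp b c)) h
    · obtain ⟨j, h, rfl⟩ := h
      cases h
      exact Diag.comp_inr (Diag.comp_glue b c j)
    · exact h.elim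
    · exact h.elim
    · exact sound (a := Diag.comp a (Diag.comp b c)) h
  hg := by
    rintro (x | (x | x)) (y | (y | y)) h
    · exact sound (a := Diag.comp (Diag.comp a b) c) h
    · obtain ⟨j, rfl, h⟩ := h
      cases h
      exact Diag.comp_inl (Diag.comp_glue a b j)
    · obtain ⟨j, -, h⟩ := h; cases h
    · exact h.elim
    · exact sound (a := Diag.comp (Diag.comp a b) c) h
    · exact sound (a := Diag.comp (Diag.comp a b) c) (by obtain ⟨j, rfl, rfl⟩ := h; exact ⟨j, rfl, rfl⟩)
    · exact h.elim
    · exact h.elim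
    · exact sound (a := Diag.comp (Diag.comp a b) c) h
  hgf := by rintro ((x | x) | x) <;> rfl
  hfg := by rintro (x | (x | x)) <;> rfl
  htop _ := rfl
  hbot _ := rfl
  hid x y h := by cases h; rfl
  touch x := Or.inr (Or.inr ⟨x, _, rfl, rfl⟩)

/-- A vertical strand is absorbed into the segment of `a` at whose top point it ends. Segments of
`a`, including those of closed components, are matched by `Ident`; the added strands reach the top.
-/
def oneLeftModel (a : Diag m n) : (oneLeft a).Model where
  f := Sum.elim a.top _root_.id
  g := Sum.inr
  hf := by
    rintro (x | x) (y | y) h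
    · exact h.elim
    · obtain ⟨j, rfl, rfl⟩ := h; rfl
    · exact h.elim
    · exact sound h
  hg x y h := sound (a := Diag.comp (one m) a) h
  hgf := by
    rintro (x | x)
    · exact (sound (a := Diag.comp (one m) a) (x := Sum.inl x) (y := Sum.inr (a.top x))
        ⟨x, rfl, rfl⟩).symm
    · rfl
  hfg _ := rfl
  htop _ := rfl
  hbot _ := rfl
  hid x y h := by cases h; rfl
  touch := by
    rintro (x | x)
    · exact Or.inl ⟨x, rfl⟩
    · exact Or.inr (Or.inr ⟨_, x, rfl, rfl⟩)

def oneRightModel (a : Diag m n) : (oneRight a).Model where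
  f := Sum.elim _root_.id a.bot
  g := Sum.inl
  hf := by
    rintro (x | x) (y | y) h
    · exact sound h
    · obtain ⟨j, rfl, rfl⟩ := h; rfl
    · exact h.elim
    · exact h.elim
  hg x y h := sound (a := Diag.comp a (one n)) h
  hgf := by
    rintro (x | x)
    · rfl
    · exact sound (a := Diag.comp a (one n)) (x := Sum.inl (a.bot x)) (y := Sum.inr x)
        ⟨x, rfl, rfl⟩
  hfg _ := rfl
  htop _ := rfl
  hbot _ := rfl
  hid x y h := by cases h; rfl
  touch := by
    rintro (x | x)
    · exact Or.inr (Or.inr ⟨_, x, rfl, rfl⟩)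
    · exact Or.inr (Or.inl ⟨x, rfl⟩)

/-- The map that contracts `i`, `i + 1` and `i + 2` to `i`. -/
def contract (i : Fin n) (x : Fin (n + 2)) : Fin n :=
  if h : x.val < i.val then ⟨x, by omega⟩ else if h : x.val ≤ i.val + 2 then i else
    ⟨x.val - 2, by omega⟩

lemma contract_val (i : Fin n) (x : Fin (n + 2)) : (contract i x).val =
    if x.val < i.val then x.val else if x.val ≤ i.val + 2 then i.val else x.val - 2 := by
  unfold contract; split_ifs <;> rfl

lemma toComp_mid (i j : Fin (n + 1)) (x : Fin (n + 2)) :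
    (Diag.comp (cap n i) (cup n j)).toComp (Sum.inl x) =
      (Diag.comp (cap n i) (cup n j)).toComp (Sum.inr x) :=
  sound (a := Diag.comp (cap n i) (cup n j)) ⟨x, rfl, rfl⟩

/-- A segment of the upper half and the segment of the lower half with the same number are glued in
the middle, so an arc of the lower cup also links the corresponding segments of the upper half. -/
lemma toComp_arc (i j : Fin (n + 1)) (x y : Fin (n + 2))
    (h : (x.val = i.val ∧ y.val = i.val + 1) ∨ (x.val = j.val ∧ y.val = j.val + 1)) :
    (Diag.comp (cap n i) (cup n j)).toComp (Sum.inl x) =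
      (Diag.comp (cap n i) (cup n j)).toComp (Sum.inl y) := by
  rcases h with h | h
  · exact sound (a := Diag.comp (cap n i) (cup n j)) ⟨Fin.ext h.1, Fin.ext h.2⟩
  · exact (toComp_mid i j x).trans (((sound (a := Diag.comp (cap n i) (cup n j)) (x := Sum.inr x)
      (y := Sum.inr y) ⟨Fin.ext h.1, Fin.ext h.2⟩)).trans (toComp_mid i j y).symm)

lemma contract_skip (i : Fin n) (p : Fin (n + 1)) (hp : i.val = p.val ∨ i.val + 1 = p.val)
    (j : Fin n) : contract i (skip p j) = j := by
  apply Fin.ext; rw [contract_val, skip_val]; split_ifs <;> omega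

/-- The two arcs of a zigzag join `i` to `i + 1` and `i + 1` to `i + 2`. So contraction stays in the
component, and `skip p` chooses the one of the three strands that reaches the top. -/
lemma toComp_skip_contract (i : Fin n) (p q : Fin (n + 1))
    (h : (i.val = p.val ∧ i.val + 1 = q.val) ∨ (i.val = q.val ∧ i.val + 1 = p.val))
    (x : Fin (n + 2)) : (Diag.comp (cap n p) (cup n q)).toComp (Sum.inl (skip p (contract i x))) =
      (Diag.comp (cap n p) (cup n q)).toComp (Sum.inl x) := by
  -- One of these links comes from the cap and the other from the cup; the hypothesis `h` says which
  -- one.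
  have h₁ := toComp_arc p q ⟨i.val, by omega⟩ ⟨i.val + 1, by omega⟩ (by simp only; omega)
  have h₂ := toComp_arc p q ⟨i.val + 1, by omega⟩ ⟨i.val + 2, by omega⟩ (by simp only; omega)
  have hs := skip_val p (contract i x)
  rw [contract_val] at hs
  by_cases hx : x.val < i.val ∨ i.val + 2 < x.val
  · exact congrArg (fun x => (Diag.comp (cap n p) (cup n q)).toComp (Sum.inl x))
      (Fin.ext (by split_ifs at hs <;> omega))
  · have key (y : Fin (n + 2)) (hy : i.val ≤ y.val ∧ y.val ≤ i.val + 2) :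
        (Diag.comp (cap n p) (cup n q)).toComp (Sum.inl y) =
        (Diag.comp (cap n p) (cup n q)).toComp (Sum.inl ⟨i.val, by omega⟩) := by
      obtain h | h | h : y = ⟨i.val, by omega⟩ ∨ y = ⟨i.val + 1, by omega⟩ ∨
          y = ⟨i.val + 2, by omega⟩ := by simp only [Fin.ext_iff]; omega
      · rw [h]
      · rw [h, h₁]
      · rw [h, h₁, h₂]
    exact (key _ (by split_ifs at hs <;> omega)).trans (key x (by omega)).symm

/-- Both arcs lie inside the block `i`, `i + 1`, `i + 2` that is contracted to a point, and gluing
in the middle preserves the number of the segment. -/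
lemma contract_congr (i : Fin n) (p q : Fin (n + 1))
    (h : (i.val = p.val ∧ i.val + 1 = q.val) ∨ (i.val = q.val ∧ i.val + 1 = p.val)) :
    ∀ x y, (Diag.comp (cap n p) (cup n q)).Link x y →
      Sum.elim (contract i) (contract i) x = Sum.elim (contract i) (contract i) y := by
  rintro (x | x) (y | y) e
  · obtain ⟨rfl, rfl⟩ := e
    apply Fin.ext
    change (contract i p.castSucc).val = (contract i p.succ).val
    rw [contract_val, contract_val, Fin.val_castSucc, Fin.val_succ]
    split_ifs <;> omega
  · obtain ⟨j, rfl, rfl⟩ := e; rfl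
  · exact e.elim
  · obtain ⟨rfl, rfl⟩ := e
    apply Fin.ext
    change (contract i q.castSucc).val = (contract i q.succ).val
    rw [contract_val, contract_val, Fin.val_castSucc, Fin.val_succ]
    split_ifs <;> omega

lemma contract_touch (i : Fin n) (p q : Fin (n + 1))
    (h : (i.val = p.val ∧ i.val + 1 = q.val) ∨ (i.val = q.val ∧ i.val + 1 = p.val))
    (x : (Diag.comp (cap n p) (cup n q)).Seg) :
    (Diag.comp (cap n p) (cup n q)).toComp (Sum.inl (skip p
      (Sum.elim (contract i) (contract i) x))) = (Diag.comp (cap n p) (cup n q)).toComp x := by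
  rcases x with x | x
  · exact toComp_skip_contract i p q h x
  · exact (toComp_skip_contract i p q h x).trans (toComp_mid p q x)

/-- A zigzag has no closed components: every segment lies on the strand through the top point given
by its contraction. This verifies `touch` although `Ident` is empty here. -/
def zigzagModel (i : Fin n) : (zigzag i).Model where
  f := Sum.elim (contract i) (contract i)
  g j := Sum.inl (skip i.castSucc j)
  hf x y h := congrArg _ (contract_congr i _ _ (Or.inl ⟨rfl, rfl⟩) x y h)
  hg _ _ h := h.elim
  hgf x := contract_touch i _ _ (Or.inl ⟨rfl, rfl⟩) x
  hfg y := congrArg _ (contract_skip i _ (Or.inl rfl) y)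
  htop y := congrArg _ (contract_skip i _ (Or.inl rfl) y)
  hbot y := congrArg _ (contract_skip i _ (Or.inr rfl) y)
  hid _ _ h := h.elim
  touch x := Or.inl ⟨_, (contract_touch i _ _ (Or.inl ⟨rfl, rfl⟩) x).symm⟩

def zagzigModel (i : Fin n) : (zagzig i).Model where
  f := Sum.elim (contract i) (contract i)
  g j := Sum.inl (skip i.succ j)
  hf x y h := congrArg _ (contract_congr i _ _ (Or.inr ⟨rfl, rfl⟩) x y h)
  hg _ _ h := h.elim
  hgf x := contract_touch i _ _ (Or.inr ⟨rfl, rfl⟩) x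
  hfg y := congrArg _ (contract_skip i _ (Or.inr rfl) y)
  htop y := congrArg _ (contract_skip i _ (Or.inr rfl) y)
  hbot y := congrArg _ (contract_skip i _ (Or.inl rfl) y)
  hid _ _ h := h.elim
  touch x := Or.inl ⟨_, (contract_touch i _ _ (Or.inr ⟨rfl, rfl⟩) x).symm⟩

/-- The map that moves the middle strands to the left of `p + 2` to the top, those between to the
bottom. -/
def far (p : Fin (n + 1)) (t : Fin (n + 2 + 2)) : Fin (n + 2) ⊕ Fin (n + 2) :=
  if h : t.val < p.val + 2 then Sum.inl ⟨t, by omega⟩ else if h : t.val ≤ p.val + 3 then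
    Sum.inr ⟨t - 2, by omega⟩ else Sum.inl ⟨t - 2, by omega⟩

lemma far_eq (p : Fin (n + 1)) (t : Fin (n + 2 + 2)) :
    (∃ x : Fin (n + 2), far p t = Sum.inl x ∧ ((t.val < p.val + 2 ∧ x.val = t.val) ∨
      (p.val + 3 < t.val ∧ x.val + 2 = t.val))) ∨
    (∃ x : Fin (n + 2), far p t = Sum.inr x ∧ p.val + 2 ≤ t.val ∧ t.val ≤ p.val + 3 ∧
      x.val + 2 = t.val) := by
  unfold far
  split_ifs with h h'
  · exact Or.inl ⟨_, rfl, Or.inl ⟨h, rfl⟩⟩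
  · exact Or.inr ⟨_, rfl, by omega, h', by simp only; omega⟩
  · exact Or.inl ⟨_, rfl, Or.inr ⟨by omega, by simp only; omega⟩⟩

section

variable (i j : Fin (n + 1))

/-- The four cases say on which side of the upper arc and on which side of the lower arc a vertical
strand passes; crossing from one side to the other shifts its number by two. -/
lemma cupCap_mid {x y : Fin (n + 2)} (h : (x.val < i.val ∧ x.val < j.val ∧ y.val = x.val) ∨
    (x.val < i.val ∧ j.val ≤ x.val ∧ y.val = x.val + 2) ∨
    (i.val + 2 ≤ x.val ∧ x.val < j.val + 2 ∧ y.val + 2 = x.val) ∨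
    (i.val + 2 ≤ x.val ∧ j.val + 2 ≤ x.val ∧ y.val = x.val)) :
    (Diag.comp (cup n i) (cap n j)).toComp (Sum.inl x) =
      (Diag.comp (cup n i) (cap n j)).toComp (Sum.inr y) := by
  have key (k : Fin n) (h₁ : skip i k = x) (h₂ : skip j k = y) :
      (Diag.comp (cup n i) (cap n j)).toComp (Sum.inl x) =
      (Diag.comp (cup n i) (cap n j)).toComp (Sum.inr y) := by
    subst h₁; subst h₂; exact Diag.comp_glue (cup n i) (cap n j) k
  by_cases hx : x.val < i.val
  · refine key ⟨x.val, by omega⟩ (Fin.ext ?_) (Fin.ext ?_) <;> rw [skip_val] <;> split_ifs <;>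
      simp only at * <;> omega
  · refine key ⟨x.val - 2, by omega⟩ (Fin.ext ?_) (Fin.ext ?_) <;> rw [skip_val] <;> split_ifs <;>
      simp only at * <;> omega

lemma cupCap_top {x y : Fin (n + 2)} (h : x.val = i.val) (h' : y.val = i.val + 1) :
    (Diag.comp (cup n i) (cap n j)).toComp (Sum.inl x) =
      (Diag.comp (cup n i) (cap n j)).toComp (Sum.inl y) :=
  Diag.comp_inl (sound (a := cup n i) ⟨Fin.ext h, Fin.ext h'⟩)

lemma cupCap_bot {x y : Fin (n + 2)} (h : x.val = j.val) (h' : y.val = j.val + 1) :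
    (Diag.comp (cup n i) (cap n j)).toComp (Sum.inr x) =
      (Diag.comp (cup n i) (cap n j)).toComp (Sum.inr y) :=
  Diag.comp_inr (sound (a := cap n j) ⟨Fin.ext h, Fin.ext h'⟩)

end

/-- After the exchange the middle level has `n + 4` points. Those numbered `j + 2` and `j + 3` are
the ends of the lower arc pulled up, and correspond to bottom segments; the others lie on components
that reach the top. The map `far` records this choice, and the rest is arithmetic of the shifts made
by `skip`. -/
def cupCapRightModel (i j : Fin (n + 1)) (h : i ≤ j) : (cupCapRight i j h).Model where
  f := Sum.elim (fun x => Sum.inl (skip j.succ.succ x)) (fun x => Sum.inr (skip i.castSucc.castSucc x))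
  g := Sum.elim (far j) (far j)
  hf := by
    rintro (x | x) (y | y) e
    · obtain ⟨rfl, rfl⟩ := e
      refine toComp_arc _ _ _ _ (Or.inr ⟨?_, ?_⟩) <;> rw [skip_val] <;>
        simp only [Fin.val_castSucc, Fin.val_succ, Fin.le_def] at * <;> split_ifs <;> omega
    · obtain ⟨k, rfl, rfl⟩ := e
      refine (Diag.inl_eq (a := cap (n + 2) _) (b := cup (n + 2) _) (Fin.ext ?_)).trans
        (toComp_mid _ _ _)
      change (skip _ (skip _ _)).val = (skip _ (skip _ _)).val
      simp only [skip_val, Fin.val_castSucc, Fin.val_succ, Fin.le_def] at *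
      split_ifs <;> omega
    · exact e.elim
    · obtain ⟨rfl, rfl⟩ := e
      refine (toComp_mid _ _ _).symm.trans ((toComp_arc _ _ _ _ (Or.inl ⟨?_, ?_⟩)).trans
        (toComp_mid _ _ _)) <;> rw [skip_val] <;>
        simp only [Fin.val_castSucc, Fin.val_succ, Fin.le_def] at * <;> split_ifs <;> omega
  hg := by
    rintro (x | x) (y | y) e
    · obtain ⟨rfl, rfl⟩ := e
      obtain ⟨x, hx, hx'⟩ | ⟨x, hx, hx'⟩ := far_eq j j.succ.succ.castSucc <;>
      obtain ⟨y, hy, hy'⟩ | ⟨y, hy, hy'⟩ := far_eq j j.succ.succ.succ <;>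
      simp only [Fin.val_castSucc, Fin.val_succ, Fin.le_def] at * <;> try omega
      exact (congrArg _ hx).trans ((cupCap_bot i j (by omega) (by omega)).trans (congrArg _ hy).symm)
    · obtain ⟨k, rfl, rfl⟩ := e; rfl
    · exact e.elim
    · obtain ⟨rfl, rfl⟩ := e
      obtain ⟨x, hx, hx'⟩ | ⟨x, hx, hx'⟩ := far_eq j i.castSucc.castSucc.castSucc <;>
      obtain ⟨y, hy, hy'⟩ | ⟨y, hy, hy'⟩ := far_eq j i.castSucc.castSucc.succ <;>
      simp only [Fin.val_castSucc, Fin.val_succ, Fin.le_def] at * <;> try omega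
      exact (congrArg _ hx).trans ((cupCap_top i j (by omega) (by omega)).trans (congrArg _ hy).symm)
  hgf := by
    rintro (x | x)
    · have hs := skip_val j.succ.succ x
      obtain ⟨y, hy, hy'⟩ | ⟨y, hy, hy'⟩ := far_eq j (skip j.succ.succ x) <;>
      simp only [Fin.val_succ] at hs
      · exact (congrArg _ hy).trans (Diag.inl_eq (a := cup n i) (b := cap n j)
          (Fin.ext (by split_ifs at hs <;> omega)))
      · split_ifs at hs <;> omega
    · have hs := skip_val i.castSucc.castSucc x
      obtain ⟨y, hy, hy'⟩ | ⟨y, hy, hy'⟩ := far_eq j (skip i.castSucc.castSucc x) <;>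
      simp only [Fin.val_castSucc, Fin.le_def] at hs h <;>
      refine (congrArg _ hy).trans ?_
      · exact cupCap_mid i j (by split_ifs at hs <;> omega)
      · exact Diag.inr_eq (a := cup n i) (b := cap n j) (Fin.ext (by split_ifs at hs <;> omega))
  hfg := by
    have key (t : Fin (n + 2 + 2)) : (Diag.comp (cap (n + 2) j.succ.succ)
        (cup (n + 2) i.castSucc.castSucc)).toComp (Sum.elim (fun x => Sum.inl (skip j.succ.succ x))
          (fun x => Sum.inr (skip i.castSucc.castSucc x)) (far j t)) =
        (Diag.comp (cap (n + 2) j.succ.succ) (cup (n + 2) i.castSucc.castSucc)).toComp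
          (Sum.inl t) := by
      obtain ⟨y, hy, hy'⟩ | ⟨y, hy, hy'⟩ := far_eq j t <;> rw [hy]
      · refine Diag.inl_eq (a := cap (n + 2) _) (b := cup (n + 2) _) (Fin.ext ?_)
        rw [skip_val]; simp only [Fin.val_succ]; split_ifs <;> omega
      · refine (Diag.inr_eq (a := cap (n + 2) _) (b := cup (n + 2) _) (Fin.ext ?_)).trans
            (toComp_mid _ _ t).symm
        simp only [Fin.le_def] at h
        rw [skip_val]; simp only [Fin.val_castSucc]; split_ifs <;> omega
    rintro (t | t)
    · exact key t
    · exact (key t).trans (toComp_mid _ _ t)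
  htop _ := rfl
  hbot _ := rfl
  hid _ _ h := h.elim
  touch := by
    rintro (x | x)
    · exact Or.inl ⟨x, rfl⟩
    · exact Or.inr (Or.inl ⟨x, rfl⟩)

/-- The map that moves the middle strands `p` and `p + 1` to the bottom and the others to the
top. -/
def far' (p : Fin (n + 1)) (t : Fin (n + 2 + 2)) : Fin (n + 2) ⊕ Fin (n + 2) :=
  if h : t.val < p.val then Sum.inl ⟨t, by omega⟩ else if h : t.val ≤ p.val + 1 then
    Sum.inr ⟨t, by omega⟩ else Sum.inl ⟨t - 2, by omega⟩

lemma far'_eq (p : Fin (n + 1)) (t : Fin (n + 2 + 2)) :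
    (∃ x : Fin (n + 2), far' p t = Sum.inl x ∧ ((t.val < p.val ∧ x.val = t.val) ∨
      (p.val + 1 < t.val ∧ x.val + 2 = t.val))) ∨
    (∃ x : Fin (n + 2), far' p t = Sum.inr x ∧ p.val ≤ t.val ∧ t.val ≤ p.val + 1 ∧
      x.val = t.val) := by
  unfold far'
  split_ifs with h h'
  · exact Or.inl ⟨_, rfl, Or.inl ⟨h, rfl⟩⟩
  · exact Or.inr ⟨_, rfl, by omega, h', rfl⟩
  · exact Or.inl ⟨_, rfl, Or.inr ⟨by omega, by simp only; omega⟩⟩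

/-- The mirror case: the pulled up arc now lies to the left of the other, so its ends are the middle
points `j` and `j + 1` and the remaining points to the right are shifted. -/
def cupCapLeftModel (i j : Fin (n + 1)) (h : j ≤ i) : (cupCapLeft i j h).Model where
  f := Sum.elim (fun x => Sum.inl (skip j.castSucc.castSucc x)) (fun x => Sum.inr (skip i.succ.succ x))
  g := Sum.elim (far' j) (far' j)
  hf := by
    rintro (x | x) (y | y) e
    · obtain ⟨rfl, rfl⟩ := e
      refine toComp_arc _ _ _ _ (Or.inr ⟨?_, ?_⟩) <;> rw [skip_val] <;>
        simp only [Fin.val_castSucc, Fin.val_succ, Fin.le_def] at * <;> split_ifs <;> omega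
    · obtain ⟨k, rfl, rfl⟩ := e
      refine (Diag.inl_eq (a := cap (n + 2) _) (b := cup (n + 2) _) (Fin.ext ?_)).trans
        (toComp_mid _ _ _)
      change (skip _ (skip _ _)).val = (skip _ (skip _ _)).val
      simp only [skip_val, Fin.val_castSucc, Fin.val_succ, Fin.le_def] at *
      split_ifs <;> omega
    · exact e.elim
    · obtain ⟨rfl, rfl⟩ := e
      refine (toComp_mid _ _ _).symm.trans ((toComp_arc _ _ _ _ (Or.inl ⟨?_, ?_⟩)).trans
        (toComp_mid _ _ _)) <;> rw [skip_val] <;>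
        simp only [Fin.val_castSucc, Fin.val_succ, Fin.le_def] at * <;> split_ifs <;> omega
  hg := by
    rintro (x | x) (y | y) e
    · obtain ⟨rfl, rfl⟩ := e
      obtain ⟨x, hx, hx'⟩ | ⟨x, hx, hx'⟩ := far'_eq j j.castSucc.castSucc.castSucc <;>
      obtain ⟨y, hy, hy'⟩ | ⟨y, hy, hy'⟩ := far'_eq j j.castSucc.castSucc.succ <;>
      simp only [Fin.val_castSucc, Fin.val_succ, Fin.le_def] at * <;> try omega
      exact (congrArg _ hx).trans ((cupCap_bot i j (by omega) (by omega)).trans (congrArg _ hy).symm)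
    · obtain ⟨k, rfl, rfl⟩ := e; rfl
    · exact e.elim
    · obtain ⟨rfl, rfl⟩ := e
      obtain ⟨x, hx, hx'⟩ | ⟨x, hx, hx'⟩ := far'_eq j i.succ.succ.castSucc <;>
      obtain ⟨y, hy, hy'⟩ | ⟨y, hy, hy'⟩ := far'_eq j i.succ.succ.succ <;>
      simp only [Fin.val_castSucc, Fin.val_succ, Fin.le_def] at * <;> try omega
      exact (congrArg _ hx).trans ((cupCap_top i j (by omega) (by omega)).trans (congrArg _ hy).symm)
  hgf := by
    rintro (x | x)
    · have hs := skip_val j.castSucc.castSucc x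
      obtain ⟨y, hy, hy'⟩ | ⟨y, hy, hy'⟩ := far'_eq j (skip j.castSucc.castSucc x) <;>
      simp only [Fin.val_castSucc] at hs
      · exact (congrArg _ hy).trans (Diag.inl_eq (a := cup n i) (b := cap n j)
          (Fin.ext (by split_ifs at hs <;> omega)))
      · split_ifs at hs <;> omega
    · have hs := skip_val i.succ.succ x
      obtain ⟨y, hy, hy'⟩ | ⟨y, hy, hy'⟩ := far'_eq j (skip i.succ.succ x) <;>
      simp only [Fin.val_succ, Fin.le_def] at hs h <;>
      refine (congrArg _ hy).trans ?_
      · exact cupCap_mid i j (by split_ifs at hs <;> omega)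
      · exact Diag.inr_eq (a := cup n i) (b := cap n j) (Fin.ext (by split_ifs at hs <;> omega))
  hfg := by
    have key (t : Fin (n + 2 + 2)) : (Diag.comp (cap (n + 2) j.castSucc.castSucc)
        (cup (n + 2) i.succ.succ)).toComp (Sum.elim
          (fun x => Sum.inl (skip j.castSucc.castSucc x))
          (fun x => Sum.inr (skip i.succ.succ x)) (far' j t)) =
        (Diag.comp (cap (n + 2) j.castSucc.castSucc) (cup (n + 2) i.succ.succ)).toComp
          (Sum.inl t) := by
      obtain ⟨y, hy, hy'⟩ | ⟨y, hy, hy'⟩ := far'_eq j t <;> rw [hy]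
      · refine Diag.inl_eq (a := cap (n + 2) _) (b := cup (n + 2) _) (Fin.ext ?_)
        rw [skip_val]; simp only [Fin.val_castSucc]; split_ifs <;> omega
      · refine (Diag.inr_eq (a := cap (n + 2) _) (b := cup (n + 2) _) (Fin.ext ?_)).trans
            (toComp_mid _ _ t).symm
        simp only [Fin.le_def] at h
        rw [skip_val]; simp only [Fin.val_succ]; split_ifs <;> omega
    rintro (t | t)
    · exact key t
    · exact (key t).trans (toComp_mid _ _ t)
  htop _ := rfl
  hbot _ := rfl
  hid _ _ h := h.elim
  touch := by
    rintro (x | x)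
    · exact Or.inl ⟨x, rfl⟩
    · exact Or.inr (Or.inl ⟨x, rfl⟩)

end Isot
end BarNatan

/-! ### Naturality of the associativity and unit isotopies -/

namespace BarNatan
open Diag

variable {m k l n : ℕ}

namespace Cobordism

lemma congr_toComp {a b : Diag m n} {s : Cobordism a b} {β : Type*} {F : s.Piece → β}
    (hF : ∀ p q, s.Glue p q → F p = F q) {p q : s.Piece} (h : s.toComp p = s.toComp q) :
    F p = F q := congrArg (Quot.lift F hF) h

/-- Counts of critical points and dots that agree on components still agree after the components are
merged further inside a larger cobordism. -/
lemma mapDomain_through {A α β γ δ : Type*} [AddCommMonoid A] {f : α →₀ A} {g : β →₀ A}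
    {u : α → γ} {v : β → γ} (L : γ → δ) (h : f.mapDomain u = g.mapDomain v) :
    f.mapDomain (L ∘ u) = g.mapDomain (L ∘ v) := by
  rw [Finsupp.mapDomain_comp, h, Finsupp.mapDomain_comp]

open Isot.Model in
/-- Naturality of planar isotopies with respect to cobordisms. -/
lemma natural_same {a b a' b' : Diag m n} {h : Isot a b} {h' : Isot a' b'} (M : h.Model)
    (M' : h'.Model) (S : Cobordism a a') (T : Cobordism b b') (φ : S.Piece → T.Piece)
    (ψ : T.Piece → S.Piece)
    (hφ : ∀ p q, S.Glue p q → T.toComp (φ p) = T.toComp (φ q))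
    (hψ : ∀ p q, T.Glue p q → S.toComp (ψ p) = S.toComp (ψ q))
    (h₁ : ∀ p, S.toComp (ψ (φ p)) = S.toComp p) (h₂ : ∀ p, T.toComp (φ (ψ p)) = T.toComp p)
    (hs : ∀ x, T.toComp (φ (S.src x)) = T.toComp (T.src (M.f x)))
    (ht : ∀ x, T.toComp (φ (S.tgt x)) = T.toComp (T.tgt (M'.f x)))
    (hc : S.crit.mapDomain (T.toComp ∘ φ) = T.crit.mapDomain T.toComp)
    (hd : S.dots.mapDomain (T.toComp ∘ φ) = T.dots.mapDomain T.toComp) :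
    Same (comp S (elem (Elem.isot h'))) (comp (elem (Elem.isot h)) T) := by
  have hsrc (x) : (comp (elem (Elem.isot h)) T).toComp (Sum.inr (φ (S.src x))) =
      (comp (elem (Elem.isot h)) T).toComp (Sum.inl (Sum.inl x)) :=
    (toComp_inr_comp _ _ (hs x)).trans
      ((toComp_glue_comp (elem (Elem.isot h)) T (M.f x)).symm.trans
        (toComp_inl_comp _ _ (M.isot_conn x).symm))
  have hψ' {p q} (e : T.toComp p = T.toComp q) : S.toComp (ψ p) = S.toComp (ψ q) :=
    congr_toComp (F := fun p => S.toComp (ψ p)) hψ e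
  have hψs (y) : S.toComp (ψ (T.src y)) = S.toComp (S.src (M.g y)) :=
    (hψ' ((src_congr T (M.hfg y)).symm.trans (hs _).symm)).trans (h₁ _)
  have hψt (y) : S.toComp (ψ (T.tgt y)) = S.toComp (S.tgt (M'.g y)) :=
    (hψ' ((tgt_congr T (M'.hfg y)).symm.trans (ht _).symm)).trans (h₁ _)
  -- The trace of an isotopy has no critical points and no dots, and its components are those of its
  -- ends. Its pieces can thus be pushed into the target of `T`, or the source of `S`, by the maps
  -- of the models.
  refine Same.mk' _ _
    (Sum.elim (Sum.inr ∘ φ) (Sum.elim (fun x => Sum.inr (T.tgt (M'.f x)))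
      (fun y => Sum.inr (T.tgt y))))
    (Sum.elim (Sum.elim (fun x => Sum.inl (S.src x)) (fun y => Sum.inl (S.src (M.g y))))
      (Sum.inl ∘ ψ)) ?_ ?_ ?_ ?_ ?_ ?_ ?_ ?_
  · rintro (p | p) (q | q) e
    · exact toComp_inr_comp _ _ (hφ p q e)
    · obtain ⟨x, rfl, rfl⟩ := e
      exact toComp_inr_comp _ _ (ht x)
    · exact e.elim
    · have := elem_glue (Elem.isot h') (fun x => T.toComp (T.tgt (M'.f x)))
        (fun y => T.toComp (T.tgt y)) (fun x y e => tgt_congr T (M'.hf x y e))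
        (toComp_tgt_link T) (fun x y e => tgt_congr T (M'.hid x y e))
        (fun j => tgt_congr T (M'.htop j)) (fun j => tgt_congr T (M'.hbot j)) p q e
      rcases p with p | p <;> rcases q with q | q <;> exact toComp_inr_comp _ _ this
  · rintro (p | p) (q | q) e
    · have := elem_glue (Elem.isot h) (fun x => S.toComp (S.src x))
        (fun y => S.toComp (S.src (M.g y))) (toComp_src_link S)
        (fun x y e => src_congr S (M.hg x y e)) (fun x y e => src_congr S (M.gid x y e).symm)
        (fun j => src_congr S (M.gtop j).symm) (fun j => src_congr S (M.gbot j).symm) p q e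
      rcases p with p | p <;> rcases q with q | q <;> exact toComp_inl_comp _ _ this
    · obtain ⟨y, rfl, rfl⟩ := e
      exact toComp_inl_comp _ _ (hψs y).symm
    · exact e.elim
    · exact toComp_inl_comp _ _ (hψ p q e)
  · rintro (p | (x | y))
    · exact toComp_inl_comp _ _ (h₁ p)
    · exact (toComp_inl_comp _ _ ((hψ' (ht x).symm).trans (h₁ _))).trans
        (toComp_glue_comp S (elem (Elem.isot h')) x)
    · exact (toComp_inl_comp _ _ (hψt y)).trans
        ((toComp_glue_comp S (elem (Elem.isot h')) (M'.g y)).trans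
          (toComp_inr_comp S _ ((M'.isot_conn _).trans
            (tgt_congr (elem (Elem.isot h')) (M'.hfg y)))))
  · rintro ((x | y) | p)
    · exact hsrc x
    · exact (toComp_inr_comp _ _ ((hs _).trans (src_congr T (M.hfg y)))).trans
        (toComp_glue_comp (elem (Elem.isot h)) T y).symm
    · exact toComp_inr_comp _ _ (h₂ p)
  · exact hsrc
  · intro y; rfl
  · refine (mapDomain_sum_zero _ _).trans (Eq.trans ?_ (mapDomain_zero_sum _ _).symm)
    exact mapDomain_through (Quot.lift (fun p => (comp (elem (Elem.isot h)) T).toComp (Sum.inr p))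
      fun _ _ e => toComp_inr_comp (elem (Elem.isot h)) T (toComp_eq e)) hc
  · refine (mapDomain_sum_zero _ _).trans (Eq.trans ?_ (mapDomain_zero_sum _ _).symm)
    exact mapDomain_through (Quot.lift (fun p => (comp (elem (Elem.isot h)) T).toComp (Sum.inr p))
      fun _ _ e => toComp_inr_comp (elem (Elem.isot h)) T (toComp_eq e)) hd

lemma assoc_same {a a' : Diag m k} {b b' : Diag k l} {c c' : Diag l n} (s : Cobordism a a')
    (t : Cobordism b b') (u : Cobordism c c') :
    Same (comp (stack (stack s t) u) (elem (Elem.isot (Isot.assoc a' b' c'))))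
      (comp (elem (Elem.isot (Isot.assoc a b c))) (stack s (stack t u))) := by
  refine natural_same (Isot.assocModel a b c) (Isot.assocModel a' b' c') _ _
    (Equiv.sumAssoc _ _ _) (Equiv.sumAssoc _ _ _).symm ?_ ?_ ?_ ?_ ?_ ?_ ?_ ?_
  · rintro ((p | p) | p) ((q | q) | q) e
    · exact toComp_inl_stack _ _ (toComp_eq e)
    · obtain ⟨j, rfl, rfl⟩ := e
      exact toComp_glue_stack s (stack t u) j
    · obtain ⟨j, e, -⟩ := e; cases e
    · exact e.elim
    · exact toComp_inr_stack s _ (toComp_inl_stack t u (toComp_eq e))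
    · obtain ⟨j, e, rfl⟩ := e
      cases e
      exact toComp_inr_stack s _ (toComp_glue_stack t u j)
    · exact e.elim
    · exact e.elim
    · exact toComp_inr_stack s _ (toComp_inr_stack t u (toComp_eq e))
  · rintro (p | (p | p)) (q | (q | q)) e
    · exact toComp_inl_stack _ u (toComp_inl_stack s t (toComp_eq e))
    · obtain ⟨j, rfl, e⟩ := e
      cases e
      exact toComp_inl_stack _ u (toComp_glue_stack s t j)
    · obtain ⟨j, -, e⟩ := e; cases e
    · exact e.elim
    · exact toComp_inl_stack _ u (toComp_inr_stack s t (toComp_eq e))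
    · obtain ⟨j, rfl, rfl⟩ := e
      exact toComp_glue_stack (stack s t) u j
    · exact e.elim
    · exact e.elim
    · exact toComp_inr_stack _ _ (toComp_eq e)
  · rintro ((p | p) | p) <;> rfl
  · rintro (p | (p | p)) <;> rfl
  · rintro ((p | p) | p) <;> rfl
  · rintro ((p | p) | p) <;> rfl
  · exact mapDomain_sumAssoc _ _ _ _
  · exact mapDomain_sumAssoc _ _ _ _

lemma oneLeft_same {a a' : Diag m n} (s : Cobordism a a') :
    Same (comp (stack (id (one m)) s) (elem (Elem.isot (Isot.oneLeft a'))))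
      (comp (elem (Elem.isot (Isot.oneLeft a))) s) := by
  refine natural_same (Isot.oneLeftModel a) (Isot.oneLeftModel a') _ _
    -- The sheet over a strand of the unit diagram is merged with the component of `s` that contains
    -- the side wall at the same top point.
    (Sum.elim (fun x => s.src (a.top (Sum.elim _root_.id _root_.id x))) _root_.id) Sum.inr
    ?_ ?_ ?_ ?_ ?_ ?_ ?_ ?_
  · rintro (p | p) (q | q) e
    · exact id_glue (a := one m) (fun x => s.toComp (s.src (a.top x))) (fun x y e => e.elim) p q e
    · obtain ⟨j, rfl, rfl⟩ := e; rfl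
    · exact e.elim
    · exact toComp_eq e
  · intro p q e; exact toComp_inr_stack _ _ (toComp_eq e)
  · rintro (p | p)
    · refine (toComp_glue_stack (id (one m)) s (Sum.elim _root_.id _root_.id p)).symm.trans
        (toComp_inl_stack _ _ ?_)
      rcases p with p | p
      · rfl
      · exact toComp_id (one m) p
    · rfl
  · intro p; rfl
  · rintro (p | p) <;> rfl
  · rintro (p | p)
    · exact (toComp_wall s).1 p
    · rfl
  · exact mapDomain_zero_sum _ _
  · exact mapDomain_zero_sum _ _

lemma oneRight_same {a a' : Diag m n} (s : Cobordism a a') :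
    Same (comp (stack s (id (one n))) (elem (Elem.isot (Isot.oneRight a'))))
      (comp (elem (Elem.isot (Isot.oneRight a))) s) := by
  refine natural_same (Isot.oneRightModel a) (Isot.oneRightModel a') _ _
    (Sum.elim _root_.id (fun x => s.src (a.bot (Sum.elim _root_.id _root_.id x)))) Sum.inl
    ?_ ?_ ?_ ?_ ?_ ?_ ?_ ?_
  · rintro (p | p) (q | q) e
    · exact toComp_eq e
    · obtain ⟨j, rfl, rfl⟩ := e; rfl
    · exact e.elim
    · exact id_glue (a := one n) (fun x => s.toComp (s.src (a.bot x))) (fun x y e => e.elim) p q e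
  · intro p q e; exact toComp_inl_stack _ _ (toComp_eq e)
  · rintro (p | p)
    · rfl
    · refine (toComp_glue_stack s (id (one n)) (Sum.elim _root_.id _root_.id p)).trans
        (toComp_inr_stack _ _ ?_)
      rcases p with p | p
      · rfl
      · exact toComp_id (one n) p
  · intro p; rfl
  · rintro (p | p) <;> rfl
  · rintro (p | p)
    · rfl
    · exact (toComp_wall s).2 p
  · exact mapDomain_sum_zero _ _
  · exact mapDomain_sum_zero _ _

end Cobordism

namespace CobMod

lemma assoc_natural {a a' : Diag m k} {b b' : Diag k l} {c c' : Diag l n} (x : CobMod a a')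
    (y : CobMod b b') (z : CobMod c c') :
    comp (stack (stack x y) z) (of (Cobordism.elem (Elem.isot (Isot.assoc a' b' c')))) =
      comp (of (Cobordism.elem (Elem.isot (Isot.assoc a b c)))) (stack x (stack y z)) := by
  induction x using CobMod.induction with
  | add x x' hx hx' => simp only [map_add, LinearMap.add_apply, hx, hx']
  | zero => simp only [map_zero, LinearMap.zero_apply]
  | of r s =>
    induction y using CobMod.induction with
    | add y y' hy hy' => simp only [map_add, LinearMap.add_apply] at *; simp only [hy, hy']
    | zero => simp only [map_zero, LinearMap.zero_apply]
    | of r' t =>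
      induction z using CobMod.induction with
      | add z z' hz hz' => simp only [map_add, LinearMap.add_apply, hz, hz']
      | zero => simp only [map_zero, LinearMap.zero_apply]
      | of r'' u =>
        simp only [map_smul, LinearMap.smul_apply, stack_of, comp_of,
          of_eq (Cobordism.assoc_same s t u)]

lemma oneLeft_natural {a a' : Diag m n} (x : CobMod a a') :
    comp (stack (id (one m)) x) (of (Cobordism.elem (Elem.isot (Isot.oneLeft a')))) =
      comp (of (Cobordism.elem (Elem.isot (Isot.oneLeft a)))) x := by
  induction x using CobMod.induction with
  | add x x' hx hx' => simp only [map_add, LinearMap.add_apply, hx, hx']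
  | zero => simp only [map_zero, LinearMap.zero_apply]
  | of r s =>
    simp only [map_smul, LinearMap.smul_apply, id, stack_of, comp_of,
      of_eq (Cobordism.oneLeft_same s)]

lemma oneRight_natural {a a' : Diag m n} (x : CobMod a a') :
    comp (stack x (id (one n))) (of (Cobordism.elem (Elem.isot (Isot.oneRight a')))) =
      comp (of (Cobordism.elem (Elem.isot (Isot.oneRight a)))) x := by
  induction x using CobMod.induction with
  | add x x' hx hx' => simp only [map_add, LinearMap.add_apply, hx, hx']
  | zero => simp only [map_zero, LinearMap.zero_apply]
  | of r s =>
    simp only [map_smul, LinearMap.smul_apply, id, stack_of, comp_of,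
      of_eq (Cobordism.oneRight_same s)]

lemma of_mem {a b : Diag m n} (s : Cobordism a b) {d : ℤ} (h : s.deg = d) :
    of s ∈ homDeg a b d :=
  AddSubgroup.subset_closure ⟨0, s, by simpa using h, by rw [pow_zero, one_smul]⟩

end CobMod

lemma Cobordism.deg_elem_zero {a b : Diag m n} (e : Elem a b) (hc : e.crit = 0) (hd : e.dots = 0) :
    (Cobordism.elem e).deg = 0 := by
  change 2 * (e.dots.sum fun _ k => (k : ℤ)) - e.crit.sum (fun _ k => k) = 0
  rw [hc, hd]
  simp

/-! ### Coherence isomorphisms for stacking -/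

namespace Cob

/-- The isomorphism given by a planar isotopy. -/
def isotIso {a b : Diag m n} {h : Isot a b} (M : h.Model) {r s : ℤ} (e : r = s) :
    (⟨r, a⟩ : Cob m n) ≅ ⟨s, b⟩ where
  hom := ⟨CobMod.of (Cobordism.elem (Elem.isot h)), CobMod.of_mem _ (by
    rw [Cobordism.deg_elem_zero _ rfl rfl]; simp [e])⟩
  inv := ⟨CobMod.of (Cobordism.elem (Elem.isotInv h)), CobMod.of_mem _ (by
    rw [Cobordism.deg_elem_zero _ rfl rfl]; simp [e])⟩
  hom_inv_id := Subtype.ext ((CobMod.comp_of _ _).trans (CobMod.of_eq M.comp_inv_same))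
  inv_hom_id := Subtype.ext ((CobMod.comp_of _ _).trans (CobMod.of_eq M.inv_comp_same))

/-- Associativity of stacking. -/
def assocIso (X : Cob m k) (Y : Cob k l) (Z : Cob l n) :
    ((tensor m l n).obj (((tensor m k l).obj X).obj Y)).obj Z ≅
      ((tensor m k n).obj X).obj (((tensor k l n).obj Y).obj Z) :=
  isotIso (Isot.assocModel X.diag Y.diag Z.diag) (add_assoc _ _ _)

/-- The left unit of stacking. -/
def oneLeftIso (X : Cob m n) : ((tensor m m n).obj ⟨0, one m⟩).obj X ≅ X :=
  isotIso (Isot.oneLeftModel X.diag) (zero_add _)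

/-- The right unit of stacking. -/
def oneRightIso (X : Cob m n) : ((tensor m n n).obj X).obj ⟨0, one n⟩ ≅ X :=
  isotIso (Isot.oneRightModel X.diag) (add_zero _)

lemma comp_val {X Y Z : Cob m n} (f : X ⟶ Y) (g : Y ⟶ Z) : (f ≫ g).1 = CobMod.comp f.1 g.1 := rfl

/-- The interchange law turns the two-step definition of `biMap` into a single stacking, the form in
which naturality was proved for cobordisms. -/
lemma biMap_val {X X' : Cob m k} {Y Y' : Cob k n} (f : X ⟶ X') (g : Y ⟶ Y') :
    (biMap (tensor m k n) f g).1 = CobMod.stack f.1 g.1 := by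
  change CobMod.comp (CobMod.stack f.1 (CobMod.id _)) (CobMod.stack (CobMod.id _) g.1) = _
  rw [← CobMod.stack_comp, CobMod.comp_id, CobMod.id_comp]

lemma assocIso_natural {X X' : Cob m k} {Y Y' : Cob k l} {Z Z' : Cob l n} (f : X ⟶ X')
    (g : Y ⟶ Y') (h : Z ⟶ Z') :
    biMap (tensor m l n) (biMap (tensor m k l) f g) h ≫ (assocIso X' Y' Z').hom =
      (assocIso X Y Z).hom ≫ biMap (tensor m k n) f (biMap (tensor k l n) g h) := by
  apply Subtype.ext
  rw [comp_val, comp_val, biMap_val, biMap_val, biMap_val, biMap_val]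
  exact CobMod.assoc_natural f.1 g.1 h.1

lemma oneLeftIso_natural {X X' : Cob m n} (f : X ⟶ X') :
    biMap (tensor m m n) (𝟙 ⟨0, one m⟩) f ≫ (oneLeftIso X').hom = (oneLeftIso X).hom ≫ f := by
  apply Subtype.ext
  rw [comp_val, comp_val, biMap_val]
  exact CobMod.oneLeft_natural f.1

lemma oneRightIso_natural {X X' : Cob m n} (f : X ⟶ X') :
    biMap (tensor m n n) f (𝟙 ⟨0, one n⟩) ≫ (oneRightIso X').hom = (oneRightIso X).hom ≫ f := by
  apply Subtype.ext
  rw [comp_val, comp_val, biMap_val]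
  exact CobMod.oneRight_natural f.1

end Cob
end BarNatan

namespace BarNatan
open Diag

variable {m k l n : ℕ}

/-! ### Decompositions of objects -/

/-- The objects that are iterated finite direct sums of objects with the property `S` (the
orthogonality of the projections is not required). -/
inductive Splits {C : Type} [SmallCategory C] [Preadditive C] (S : C → Prop) : C → Prop
  | of {X : C} (h : S X) : Splits S X
  | sum {X : C} (ι : Type) [Fintype ι] (Y : ι → C) (f : ∀ i, X ⟶ Y i) (g : ∀ i, Y i ⟶ X)
      (gf : ∀ i, g i ≫ f i = 𝟙 (Y i)) (fg : ∑ i, f i ≫ g i = 𝟙 X)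
      (h : ∀ i, Splits S (Y i)) : Splits S X

namespace Splits

variable {C D : Type} [SmallCategory C] [Preadditive C] [SmallCategory D] [Preadditive D]
  {S : C → Prop}

lemma of_iso {X Y : C} (e : X ≅ Y) (h : Splits S Y) : Splits S X :=
  sum Unit (fun _ => Y) (fun _ => e.hom) (fun _ => e.inv) (fun _ => e.inv_hom_id)
    (by simp) fun _ => h

lemma bind {T : C → Prop} {X : C} (h : Splits S X) (hS : ∀ Y, S Y → Splits T Y) : Splits T X := by
  induction h with
  | of h => exact hS _ h
  | sum ι Y f g gf fg _ ih => exact sum ι Y f g gf fg ih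

lemma map {T : D → Prop} (F : C ⥤ D) [F.Additive] {X : C} (h : Splits S X)
    (hS : ∀ Y, S Y → Splits T (F.obj Y)) : Splits T (F.obj X) := by
  induction h with
  | of h => exact hS _ h
  | sum ι Y f g gf fg _ ih =>
    exact sum ι (fun i => F.obj (Y i)) (fun i => F.map (f i)) (fun i => F.map (g i))
      (fun i => by rw [← F.map_comp, gf, F.map_id])
      (by simp_rw [← F.map_comp]; rw [← F.map_sum, fg, F.map_id]) ih

/-- Duality preserves decompositions because a decomposition is symmetric in its inclusions and
projections. -/
lemma map_op {T : D → Prop} (F : Cᵒᵖ ⥤ D) [F.Additive] {X : C} (h : Splits S X)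
    (hS : ∀ Y, S Y → Splits T (F.obj (.op Y))) : Splits T (F.obj (.op X)) := by
  induction h with
  | of h => exact hS _ h
  | sum ι Y f g gf fg _ ih =>
    exact sum ι (fun i => F.obj (.op (Y i))) (fun i => F.map (g i).op) (fun i => F.map (f i).op)
      (fun i => by rw [← F.map_comp, ← op_comp, gf, op_id, F.map_id])
      (by simp_rw [← F.map_comp, ← op_comp]; rw [← F.map_sum, ← op_sum, fg, op_id, F.map_id]) ih

/-- A property that passes to finite direct sums holds for `X` if it holds for its summands. -/
lemma retract_or {T : C → Prop} {X : C} {S' : C → Prop} (h : Splits S X)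
    (hS : ∀ Y, S Y → S' Y ∨ T Y) : (∃ Y, S' Y ∧ Nonempty (Retract Y X)) ∨ Splits T X := by
  induction h with
  | @of X h => exact (hS _ h).imp (fun h => ⟨X, h, ⟨Retract.refl X⟩⟩) of
  | sum ι Y f g gf fg _ ih =>
    by_cases H : ∀ i, Splits T (Y i)
    · exact Or.inr (sum ι Y f g gf fg H)
    · push Not at H
      obtain ⟨i, hi⟩ := H
      obtain ⟨Z, hZ, ⟨r⟩⟩ := (ih i).resolve_right hi
      exact Or.inl ⟨Z, hZ, ⟨r.trans ⟨g i, f i, gf i⟩⟩⟩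

end Splits

/-! ### Removal of circles -/

namespace CobMod

lemma mk_eq_zero_of_rel {a b : Diag m n} {x : Cobordism a b →₀ Ground} (h : IsRelation x) :
    (Submodule.Quotient.mk x : CobMod a b) = 0 :=
  (Submodule.Quotient.mk_eq_zero _).2 (Submodule.subset_span h)

lemma birth_dot_death (n : ℕ) (i : Fin (n + 1)) :
    comp (of (circBirth n i)) (comp (of (circDot n i)) (of (circDeath n i))) = id (one n) := by
  have h := mk_eq_zero_of_rel (IsRelation.sphereDot n i)
  rw [Submodule.Quotient.mk_sub, sub_eq_zero] at h
  rw [comp_of, comp_of]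
  exact h

lemma neck_cutting (n : ℕ) (i : Fin (n + 1)) :
    comp (comp (of (circDot n i)) (of (circDeath n i))) (of (circBirth n i)) +
      comp (of (circDeath n i)) (comp (of (circBirth n i)) (of (circDot n i))) =
        id (circ n i) := by
  have h := mk_eq_zero_of_rel (IsRelation.neck n i)
  rw [Submodule.Quotient.mk_sub, Submodule.Quotient.mk_sub, sub_sub, sub_eq_zero] at h
  rw [comp_assoc]
  simp only [comp_of]
  exact h.symm

end CobMod

lemma Cobordism.deg_elem {a b : Diag m n} (e : Elem a b) : (Cobordism.elem e).deg =
    2 * (e.dots.sum fun _ k => (k : ℤ)) - e.crit.sum (fun _ k => k) := rfl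

lemma Cobordism.deg_circDot (n : ℕ) (i : Fin (n + 1)) : (circDot n i).deg = 2 := by
  rw [Cobordism.deg_elem]
  change 2 * ((Finsupp.single _ 1 : _ →₀ ℕ).sum fun _ k => (k : ℤ)) -
    (0 : _ →₀ ℤ).sum (fun _ k => k) = 2
  rw [Finsupp.sum_single_index (by simp)]; simp

lemma Cobordism.deg_circBirth (n : ℕ) (i : Fin (n + 1)) : (circBirth n i).deg = -1 := by
  rw [Cobordism.deg_elem]
  change 2 * ((0 : _ →₀ ℕ).sum fun _ k => (k : ℤ)) -
    (Finsupp.single _ 1 : _ →₀ ℤ).sum (fun _ k => k) = -1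
  rw [Finsupp.sum_single_index (by simp)]; simp

lemma Cobordism.deg_circDeath (n : ℕ) (i : Fin (n + 1)) : (circDeath n i).deg = -1 := by
  rw [Cobordism.deg_elem]
  change 2 * ((0 : _ →₀ ℕ).sum fun _ k => (k : ℤ)) -
    (Finsupp.single _ 1 : _ →₀ ℤ).sum (fun _ k => k) = -1
  rw [Finsupp.sum_single_index (by simp)]; simp

/-- A circle next to vertical strands is the sum of two shifts of the vertical strands. -/
lemma Cob.splits_circ {S : Cob n n → Prop} (i : Fin (n + 1)) (s : ℤ)
    (hS : ∀ r, Splits S ⟨r, one n⟩) : Splits S ⟨s, circ n i⟩ := by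
  -- The shifts compensate the degrees of the maps: death has degree `-1` and dotted death has
  -- degree `1`.
  let Y : Bool → Cob n n := fun b => ⟨if b then s + 1 else s - 1, one n⟩
  let f : ∀ b, (⟨s, circ n i⟩ : Cob n n) ⟶ Y b
    | true => ⟨CobMod.of (circDeath n i), CobMod.of_mem _ (by
        rw [Cobordism.deg_circDeath]; simp [Y])⟩
    | false => ⟨CobMod.comp (CobMod.of (circDot n i)) (CobMod.of (circDeath n i)), by
        rw [CobMod.comp_of]
        refine CobMod.of_mem _ ?_
        rw [Cobordism.deg_comp, Cobordism.deg_circDeath, Cobordism.deg_circDot]; simp [Y]⟩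
  let g : ∀ b, Y b ⟶ (⟨s, circ n i⟩ : Cob n n)
    | true => ⟨CobMod.comp (CobMod.of (circBirth n i)) (CobMod.of (circDot n i)), by
        rw [CobMod.comp_of]
        refine CobMod.of_mem _ ?_
        rw [Cobordism.deg_comp, Cobordism.deg_circBirth, Cobordism.deg_circDot]; simp [Y]⟩
    | false => ⟨CobMod.of (circBirth n i), CobMod.of_mem _ (by
        rw [Cobordism.deg_circBirth]; simp [Y])⟩
  -- The diagonal composites are spheres with one dot, and the sum over both summands is neck
  -- cutting. Spheres with zero or two dots would give orthogonality, which `Splits` does not ask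
  -- for.
  refine Splits.sum Bool Y f g ?_ ?_ fun b => hS _
  · rintro (_ | _)
    · exact Subtype.ext (CobMod.birth_dot_death n i)
    · exact Subtype.ext ((CobMod.comp_assoc _ _ _).trans (CobMod.birth_dot_death n i))
  · rw [Fintype.sum_bool, add_comm]
    exact Subtype.ext (CobMod.neck_cutting n i)

/-! ### Normal forms of diagrams -/

/-- Compositions of cups. -/
inductive IsCups : {m n : ℕ} → Diag m n → Prop
  | one (n : ℕ) : IsCups (one n)
  | snoc {m n : ℕ} (a : Diag m (n + 2)) (i : Fin (n + 1)) (h : IsCups a) :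
      IsCups (comp a (cup n i))

/-- Compositions of caps. -/
inductive IsCaps : {m n : ℕ} → Diag m n → Prop
  | one (n : ℕ) : IsCaps (one n)
  | snoc {m n : ℕ} (a : Diag m n) (i : Fin (n + 1)) (h : IsCaps a) : IsCaps (comp a (cap n i))

lemma IsCups.le {a : Diag m n} (h : IsCups a) : n ≤ m := by
  induction h with
  | one => exact le_rfl
  | snoc a i _ ih => omega

lemma IsCaps.le {a : Diag m n} (h : IsCaps a) : m ≤ n := by
  induction h with
  | one => exact le_rfl
  | snoc a i _ ih => omega

/-- Compositions of cups followed by compositions of caps. -/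
def IsNormal (X : Cob m n) : Prop :=
  ∃ (t : ℕ) (u : Diag m t) (v : Diag t n), IsCups u ∧ IsCaps v ∧ X.diag = comp u v

namespace Cob

lemma isNormal {t : ℕ} {u : Diag m t} {v : Diag t n} (hu : IsCups u) (hv : IsCaps v) (s : ℤ) :
    IsNormal (⟨s, Diag.comp u v⟩ : Cob m n) := ⟨t, u, v, hu, hv, rfl⟩

/-- Transport of decompositions along an isotopy of the upper part of a diagram. -/
lemma splits_stack_left {S : Cob m k → Prop} {T : Cob m n → Prop} {s : ℤ} {a : Diag m k}
    (h : Splits S ⟨s, a⟩) (b : Diag k n) (hS : ∀ r c, S ⟨r, c⟩ → Splits T ⟨r, comp c b⟩) :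
    Splits T ⟨s, comp a b⟩ := by
  have := h.map ((tensor m k n).flip.obj ⟨0, b⟩) (T := T) fun Y hY => by
    have := hS Y.shift Y.diag hY
    change Splits T ⟨Y.shift + 0, comp Y.diag b⟩
    rwa [add_zero]
  change Splits T ⟨s + 0, comp a b⟩ at this
  rwa [add_zero] at this

lemma splits_stack_right {S : Cob k n → Prop} {T : Cob m n → Prop} {s : ℤ} {b : Diag k n}
    (h : Splits S ⟨s, b⟩) (a : Diag m k) (hS : ∀ r c, S ⟨r, c⟩ → Splits T ⟨r, comp a c⟩) :
    Splits T ⟨s, comp a b⟩ := by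
  have := h.map ((tensor m k n).obj ⟨0, a⟩) (T := T) fun Y hY => by
    have := hS Y.shift Y.diag hY
    change Splits T ⟨0 + Y.shift, comp a Y.diag⟩
    rwa [zero_add]
  change Splits T ⟨0 + s, comp a b⟩ at this
  rwa [zero_add] at this

/-- The objects with a given diagram. -/
def Is (a : Diag m n) (X : Cob m n) : Prop := X.diag = a

lemma splits_is {a b : Diag m n} {h : Isot a b} (M : h.Model) (s : ℤ) : Splits (Is b) ⟨s, a⟩ :=
  (Splits.of rfl : Splits (Is b) ⟨s, b⟩).of_iso (isotIso M rfl)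

lemma splits_is' {a b : Diag m n} {h : Isot a b} (M : h.Model) (s : ℤ) : Splits (Is a) ⟨s, b⟩ :=
  (Splits.of rfl : Splits (Is a) ⟨s, a⟩).of_iso (isotIso M rfl).symm

lemma splits_assoc {T : Cob m n → Prop} {s : ℤ} {a : Diag m k} {b : Diag k l} {c : Diag l n}
    (h : Splits T ⟨s, comp a (comp b c)⟩) : Splits T ⟨s, comp (comp a b) c⟩ :=
  h.of_iso (isotIso (Isot.assocModel a b c) rfl)

lemma splits_assoc' {T : Cob m n → Prop} {s : ℤ} {a : Diag m k} {b : Diag k l} {c : Diag l n}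
    (h : Splits T ⟨s, comp (comp a b) c⟩) : Splits T ⟨s, comp a (comp b c)⟩ :=
  h.of_iso (isotIso (Isot.assocModel a b c) rfl).symm

lemma splits_oneRight {T : Cob m n → Prop} {s : ℤ} {a : Diag m n} (h : Splits T ⟨s, a⟩) :
    Splits T ⟨s, comp a (one n)⟩ := h.of_iso (isotIso (Isot.oneRightModel a) rfl)

/-- Replaces a lower part by an isotopic one. The shift is quantified because the decomposition
lemmas control only the diagram of a summand. -/
lemma splits_mid {T : Cob m n → Prop} {s : ℤ} {x : Diag m k} {a b : Diag k n} {h : Isot a b}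
    (M : h.Model) (H : ∀ r, Splits T ⟨r, comp x b⟩) : Splits T ⟨s, comp x a⟩ :=
  splits_stack_right (splits_is M s) x fun r c e => by
    obtain rfl : c = b := e; exact H r

/-- A cap composed with a cup. -/
lemma splits_cap_cup {t : ℕ} (w : Diag m t) (hw : ∀ s, Splits IsNormal (⟨s, w⟩ : Cob m t))
    (i j : Fin (t + 1)) (ih : ∀ (p : ℕ) (e : t = p + 2) (i : Fin (p + 1)) (s : ℤ),
      Splits IsNormal (⟨s, comp w (e ▸ cup p i)⟩ : Cob m p)) (s : ℤ) :
    Splits IsNormal (⟨s, comp w (comp (cap t j) (cup t i))⟩ : Cob m t) := by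
  -- After an exchange the cup meets `w` first, where it has been dealt with by induction, and the
  -- cap is appended to the resulting normal forms, which keeps them normal.
  have far : ∀ (p : ℕ) (w : Diag m (p + 2)) (i : Fin (p + 1)) (j : Fin (p + 1)) (r : ℤ),
      (∀ r, Splits IsNormal (⟨r, comp w (cup p i)⟩ : Cob m p)) →
      Splits IsNormal (⟨r, comp w (comp (cup p i) (cap p j))⟩ : Cob m (p + 2)) := by
    intro p w i j r H
    refine splits_assoc' (splits_stack_left (H r) _ ?_)
    rintro r _ ⟨t, u, v, hu, hv, rfl⟩
    exact splits_assoc (.of (isNormal hu (hv.snoc v j) r))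
  rcases Nat.lt_trichotomy i.val j.val with h | h | h
  · by_cases h' : j.val = i.val + 1
    · obtain ⟨q, rfl, rfl⟩ : ∃ q : Fin t, i = q.castSucc ∧ j = q.succ :=
        ⟨⟨i.val, by omega⟩, Fin.ext rfl, Fin.ext h'⟩
      exact splits_mid (Isot.zagzigModel q) fun r => splits_oneRight (hw r)
    -- Arcs at distance at least two can exist only if `t ≥ 2`, so the exchange has room for the
    -- remaining `p` strands.
    · obtain ⟨p, rfl⟩ : ∃ p, t = p + 2 := ⟨t - 2, by omega⟩
      obtain ⟨i', j', rfl, rfl, hij⟩ : ∃ i' j' : Fin (p + 1), i = i'.castSucc.castSucc ∧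
          j = j'.succ.succ ∧ i' ≤ j' :=
        ⟨⟨i.val, by omega⟩, ⟨j.val - 2, by omega⟩, Fin.ext rfl,
          Fin.ext (by simp only [Fin.val_succ]; omega), by simp only [Fin.le_def]; omega⟩
      refine splits_stack_right (splits_is' (Isot.cupCapRightModel i' j' hij) s) w fun r c e => ?_
      obtain rfl : c = _ := e
      exact far p w i' j' r fun r => ih p rfl i' r
  -- Cap and cup at the same place close up to a circle, which neck cutting replaces by two shifts
  -- of the identity.
  · obtain rfl : i = j := Fin.ext h
    refine splits_stack_right (splits_circ (S := Is (one t)) i s fun r => .of rfl) w fun r c e => ?_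
    obtain rfl : c = _ := e
    exact splits_oneRight (hw r)
  · by_cases h' : i.val = j.val + 1
    · obtain ⟨q, rfl, rfl⟩ : ∃ q : Fin t, j = q.castSucc ∧ i = q.succ :=
        ⟨⟨j.val, by omega⟩, Fin.ext rfl, Fin.ext h'⟩
      exact splits_mid (Isot.zigzagModel q) fun r => splits_oneRight (hw r)
    · obtain ⟨p, rfl⟩ : ∃ p, t = p + 2 := ⟨t - 2, by omega⟩
      obtain ⟨i', j', rfl, rfl, hij⟩ : ∃ i' j' : Fin (p + 1), i = i'.succ.succ ∧
          j = j'.castSucc.castSucc ∧ j' ≤ i' :=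
        ⟨⟨i.val - 2, by omega⟩, ⟨j.val, by omega⟩,
          Fin.ext (by simp only [Fin.val_succ]; omega), Fin.ext rfl, by
            simp only [Fin.le_def]; omega⟩
      refine splits_stack_right (splits_is' (Isot.cupCapLeftModel i' j' hij) s) w fun r c e => ?_
      obtain rfl : c = _ := e
      exact far p w i' j' r fun r => ih p rfl i' r

/-- A normal form composed with a cup. -/
lemma splits_snoc_cup {t p : ℕ} {v : Diag t p} (hv : IsCaps v) : ∀ (k : ℕ) (e : p = k + 2)
    {u : Diag m t} (_ : IsCups u) (i : Fin (k + 1)) (s : ℤ),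
    Splits IsNormal (⟨s, comp (comp u v) (e ▸ cup k i)⟩ : Cob m k) := by
  induction hv with
  | one =>
    rintro k rfl u hu i s
    refine splits_stack_left (splits_is (Isot.oneRightModel u) s) _ fun r c e => ?_
    obtain rfl : c = _ := e
    exact (Splits.of (isNormal (hu.snoc _ i) (.one _) r)).of_iso
      (isotIso (Isot.oneRightModel _) rfl).symm
  | @snoc p v j hv ih =>
    intro k e u hu i s
    obtain rfl : p = k := by omega
    have key : Splits IsNormal (⟨s, comp (comp u (comp v (cap p j))) (cup p i)⟩ : Cob m p) := by
      refine splits_stack_left (splits_is' (Isot.assocModel u v (cap p j)) s) _ fun r c e => ?_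
      obtain rfl : c = _ := e
      -- The new cup meets the last cap. It either cancels against it, up to a circle, or slides
      -- above it and meets the shorter composition `v`, where the induction hypothesis applies.
      -- Cups need never be reordered among themselves, nor caps.
      exact splits_assoc (splits_cap_cup _ (fun s => .of (isNormal hu hv s)) i j
        (fun q e i s => ih q e hu i s) r)
    exact key

/-- A normal form composed with a diagram. -/
lemma splits_comp_normal : {k n : ℕ} → (d : Diag k n) → {m : ℕ} → (w : Diag m k) →
    (∀ s, IsNormal (⟨s, w⟩ : Cob m k)) → ∀ s, Splits IsNormal (⟨s, comp w d⟩ : Cob m n)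
  | _, _, one n, _, w, hw, s => splits_oneRight (.of (hw s))
  | _, _, cup n i, _, w, hw, s => by
      obtain ⟨t, u, v, hu, hv, e⟩ := hw s
      obtain rfl : w = _ := e
      exact splits_snoc_cup hv n rfl hu i s
  | _, _, cap n i, _, w, hw, s => by
      obtain ⟨t, u, v, hu, hv, e⟩ := hw s
      obtain rfl : w = _ := e
      exact splits_assoc (.of (isNormal hu (hv.snoc v i) s))
  | _, _, comp a b, _, w, hw, s => by
      refine splits_assoc' (splits_stack_left (splits_comp_normal a w hw s) b ?_)
      rintro r c ⟨t, u, v, hu, hv, e⟩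
      exact splits_comp_normal b c (fun s => ⟨t, u, v, hu, hv, e⟩) r

/-- Every diagram is a direct sum of shifts of normal forms. -/
lemma splits_normal (X : Cob m n) : Splits IsNormal X :=
  (splits_stack_left (splits_is' (Isot.oneLeftModel (one m)) X.shift) X.diag fun r c e => by
    obtain rfl : c = _ := e
    exact splits_comp_normal X.diag _ (fun s => isNormal (.one m) (.one m) s) r).of_iso
    (isotIso (Isot.oneLeftModel X.diag) rfl).symm

/-- Diagrams that end in a cap. -/
def EndsInCap (X : Cob m n) : Prop :=
  ∃ (k : ℕ) (e : n = k + 2) (x : Diag m k) (i : Fin (k + 1)), X.diag = comp x (e ▸ cap k i)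

/-- Diagrams that factor through fewer than `n` points. -/
def IsLow (X : Cob n n) : Prop :=
  ∃ (k : ℕ) (_ : k < n) (x : Diag n k) (y : Diag k n), X.diag = comp x y

/-- Cups do not increase the number of points. A normal form with fewer top points than bottom
points therefore has a cap, and its last factor is one. -/
lemma splits_endsInCap (h : m < n) (X : Cob m n) : Splits EndsInCap X := by
  refine (splits_normal X).bind ?_
  rintro ⟨s, d⟩ ⟨t, u, v, hu, hv, e⟩
  obtain rfl : d = _ := e
  cases hv with
  | one => exact absurd hu.le (by omega)
  | snoc v i hv => exact splits_assoc' (.of ⟨_, rfl, _, i, rfl⟩)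

/-- A normal form on `n` strands without caps has no cups either, by counting points, and is then
the identity; otherwise its middle level has fewer than `n` points. Either some summand of `X` is of
the first kind or all are of the second. -/
lemma retract_one_or_splits_isLow (X : Cob n n) :
    (∃ r, Nonempty (Retract (⟨r, one n⟩ : Cob n n) X)) ∨ Splits IsLow X := by
  have key : ∀ Y : Cob n n, IsNormal Y → Y.diag = comp (one n) (one n) ∨ IsLow Y := by
    rintro ⟨s, d⟩ ⟨t, u, v, hu, hv, rfl⟩
    cases hv with
    | one =>
      cases hu with
      | one => exact Or.inl rfl
      | snoc u i hu => exact absurd hu.le (by omega)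
    | @snoc k v i hv => exact Or.inr ⟨t, by have := hv.le; omega, _, _, rfl⟩
  refine ((splits_normal X).retract_or key).imp ?_ fun h => h
  rintro ⟨⟨s, d⟩, rfl, ⟨r⟩⟩
  exact ⟨s, ⟨(Retract.ofIso (isotIso (Isot.oneLeftModel (one n)) rfl).symm).trans r⟩⟩

end Cob
/-! ### Locally finite matrices -/

/-- Formal countable direct sums (`b = true`) or products (`b = false`) of objects of `C`. -/
structure MatClosure (b : Bool) (C : Type) where
  ι : Type
  [countable : Countable ι]
  X : ι → C

attribute [instance] MatClosure.countable

namespace MatClosure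

variable {C D E : Type} [SmallCategory C] [SmallCategory D] [SmallCategory E] [Preadditive C]
  [Preadditive D] [Preadditive E] {b : Bool}

/-- The underlying direct sum. -/
abbrev sum (M : MatClosure b C) : SumClosure C := ⟨M.ι, M.X⟩

/-- The underlying direct product. -/
abbrev prod (M : MatClosure b C) : ProdClosure C := ⟨M.ι, M.X⟩

/-- Matrices with finite rows or with finite columns. -/
def matrices (M N : MatClosure b C) : AddSubgroup (∀ i j, M.X i ⟶ N.X j) :=
  match b with
  | true => SumClosure.matrices M.sum N.sum
  | false => ProdClosure.matrices M.prod N.prod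

instance : Category (MatClosure b C) where
  Hom M N := M.matrices N
  id M := ⟨delta M.X, by
    cases b
    · exact (𝟙 M.prod : M.prod ⟶ M.prod).2
    · exact (𝟙 M.sum : M.sum ⟶ M.sum).2⟩
  comp {M N K} f g := ⟨fun i k => ∑ᶠ j, f.1 i j ≫ g.1 j k, by
    cases b
    · exact (ProdClosure.mul (M := M.prod) (N := N.prod) (K := K.prod) f g).2
    · exact (SumClosure.mul (M := M.sum) (N := N.sum) (K := K.sum) f g).2⟩
  id_comp f := Subtype.ext (funext₂ fun i j => finsum_delta_comp _ i fun k => f.1 k j)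
  comp_id f := Subtype.ext (funext₂ fun i j => finsum_comp_delta _ j fun k => f.1 i k)
  assoc {M N K L} f g h := by
    cases b
    · exact Category.assoc (obj := ProdClosure C) (W := M.prod) (X := N.prod) (Y := K.prod)
        (Z := L.prod) f g h
    · exact Category.assoc (obj := SumClosure C) (W := M.sum) (X := N.sum) (Y := K.sum)
        (Z := L.sum) f g h

instance : Preadditive (MatClosure b C) where
  homGroup M N := inferInstanceAs (AddCommGroup (M.matrices N))
  add_comp M N K f f' g := by
    cases b
    · exact Preadditive.add_comp (C := ProdClosure C) M.prod N.prod K.prod f f' g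
    · exact Preadditive.add_comp (C := SumClosure C) M.sum N.sum K.sum f f' g
  comp_add M N K f g g' := by
    cases b
    · exact Preadditive.comp_add (C := ProdClosure C) M.prod N.prod K.prod f g g'
    · exact Preadditive.comp_add (C := SumClosure C) M.sum N.sum K.sum f g g'

variable {M N K L : MatClosure b C}

@[ext]
lemma hom_ext {f g : M ⟶ N} (h : ∀ i j, f.1 i j = g.1 i j) : f = g := Subtype.ext (funext₂ h)

/-- The entries of a matrix. -/
def entry (M N : MatClosure b C) (i : M.ι) (j : N.ι) : (M ⟶ N) →+ (M.X i ⟶ N.X j) where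
  toFun f := f.1 i j
  map_zero' := rfl
  map_add' _ _ := rfl

lemma add_val (f g : M ⟶ N) (i : M.ι) (j : N.ι) : (f + g).1 i j = f.1 i j + g.1 i j := rfl

lemma neg_val (f : M ⟶ N) (i : M.ι) (j : N.ι) : (-f).1 i j = -f.1 i j := rfl

lemma sub_val (f g : M ⟶ N) (i : M.ι) (j : N.ι) : (f - g).1 i j = f.1 i j - g.1 i j :=
  map_sub (entry M N i j) f g

lemma sum_val {κ : Type*} (s : Finset κ) (f : κ → (M ⟶ N)) (i : M.ι) (j : N.ι) :
    (∑ k ∈ s, f k).1 i j = ∑ k ∈ s, (f k).1 i j := map_sum (entry M N i j) f s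

lemma id_val (i j : M.ι) : (𝟙 M : M ⟶ M).1 i j = delta M.X i j := rfl

lemma comp_val (f : M ⟶ N) (g : N ⟶ K) (i : M.ι) (k : K.ι) :
    (f ≫ g).1 i k = ∑ᶠ j, f.1 i j ≫ g.1 j k := rfl

/-- Matrices whose rows and columns are finite. -/
lemma mem_matrices {f : ∀ i j, M.X i ⟶ N.X j} (h : ∀ i, {j | f i j ≠ 0}.Finite)
    (h' : ∀ j, {i | f i j ≠ 0}.Finite) : f ∈ M.matrices N := by
  cases b
  · exact h'
  · exact h

/-- The finiteness comes from the row of `f` for sums and from the column of `g` for products.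
Bounding the support of the composites, not of a factor, gives both cases a common form. -/
lemma support_comp (f : M ⟶ N) (g : N ⟶ K) (i : M.ι) (k : K.ι) :
    ∃ s : Finset N.ι, ∀ j, f.1 i j ≫ g.1 j k ≠ 0 → j ∈ s := by
  cases b
  · obtain ⟨s, hs⟩ := ProdClosure.exists_support (M := N.prod) (N := K.prod) g k
    exact ⟨s, fun j hj => hs j fun h => hj (by rw [h, comp_zero])⟩
  · obtain ⟨s, hs⟩ := SumClosure.exists_support (M := M.sum) (N := N.sum) f i
    exact ⟨s, fun j hj => hs j fun h => hj (by rw [h, zero_comp])⟩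

lemma comp_val_sum (f : M ⟶ N) (g : N ⟶ K) (i : M.ι) (k : K.ι) {s : Finset N.ι}
    (hs : ∀ j, f.1 i j ≫ g.1 j k ≠ 0 → j ∈ s) : (f ≫ g).1 i k = ∑ j ∈ s, f.1 i j ≫ g.1 j k :=
  finsum_eq_sum_of_support_subset _ fun j hj => hs j hj

lemma exists_comp_ne_zero {f : M ⟶ N} {g : N ⟶ K} {i : M.ι} {k : K.ι} (h : (f ≫ g).1 i k ≠ 0) :
    ∃ j, f.1 i j ≠ 0 ∧ g.1 j k ≠ 0 := by
  by_contra! H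
  refine h (finsum_eq_zero_of_forall_eq_zero fun j => ?_)
  by_cases hj : f.1 i j = 0
  · rw [hj, zero_comp]
  · rw [H j hj, comp_zero]

/-- The matrix given by an equivalence of index sets and morphisms between the objects. -/
def diagMap (e : M.ι ≃ N.ι) (u : ∀ i, M.X i ⟶ N.X (e i)) : M ⟶ N :=
  ⟨fun i j => u i ≫ delta N.X (e i) j, mem_matrices
    (fun i => (Set.finite_singleton (e i)).subset fun j hj => by
      by_contra h
      exact hj (by rw [delta_of_ne _ fun e => h e.symm, comp_zero]))
    (fun j => (Set.finite_singleton (e.symm j)).subset fun i hi => by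
      by_contra h
      exact hi (by rw [delta_of_ne _ fun e' => h (by rw [← e']; simp), comp_zero]))⟩

lemma diagMap_val (e : M.ι ≃ N.ι) (u : ∀ i, M.X i ⟶ N.X (e i)) (i : M.ι) :
    (diagMap e u).1 i (e i) = u i := by
  change u i ≫ delta N.X (e i) (e i) = _
  rw [delta_self, Category.comp_id]

lemma diagMap_val_of_ne (e : M.ι ≃ N.ι) (u : ∀ i, M.X i ⟶ N.X (e i)) {i : M.ι} {j : N.ι}
    (h : e i ≠ j) : (diagMap e u).1 i j = 0 := by
  change u i ≫ delta N.X (e i) j = 0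
  rw [delta_of_ne _ h, comp_zero]

lemma diagMap_comp_val (e : M.ι ≃ N.ι) (u : ∀ i, M.X i ⟶ N.X (e i)) (g : N ⟶ K) (i : M.ι)
    (k : K.ι) : (diagMap e u ≫ g).1 i k = u i ≫ g.1 (e i) k := by
  rw [comp_val, finsum_eq_single _ (e i) fun j hj => by
    rw [diagMap_val_of_ne e u hj.symm, zero_comp], diagMap_val]

lemma comp_diagMap_val (e : M.ι ≃ N.ι) (u : ∀ i, M.X i ⟶ N.X (e i)) (f : K ⟶ M) (k : K.ι)
    (i : M.ι) : (f ≫ diagMap e u).1 k (e i) = f.1 k i ≫ u i := by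
  rw [comp_val, finsum_eq_single _ i fun j hj => by
    rw [diagMap_val_of_ne e u fun h => hj (e.injective h), comp_zero], diagMap_val]

/-- A diagonal matrix of isomorphisms is an isomorphism. -/
def diagIso (e : M.ι ≃ N.ι) (u : ∀ i, M.X i ≅ N.X (e i)) : M ≅ N where
  hom := diagMap e fun i => (u i).hom
  inv := diagMap e.symm fun j => eqToHom (by rw [e.apply_symm_apply]) ≫ (u (e.symm j)).inv
  hom_inv_id := by
    ext i j
    rw [diagMap_comp_val, id_val]
    by_cases h : i = j
    · subst h
      have := diagMap_val (M := N) (N := M) e.symm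
        (fun j => eqToHom (by rw [e.apply_symm_apply]) ≫ (u (e.symm j)).inv) (e i)
      -- The index `e.symm (e i)` equals `i` only propositionally, so the entry is computed at a
      -- variable index `k`, where the equality can be substituted.
      have key : ∀ k (hk : k = i), (diagMap (M := N) (N := M) e.symm
        (fun j => eqToHom (by rw [e.apply_symm_apply]) ≫ (u (e.symm j)).inv)).1 (e i) k =
          eqToHom (by rw [hk]) ≫ (u k).inv := by
        intro k hk
        obtain rfl : k = e.symm (e i) := by rw [hk, e.symm_apply_apply]
        rw [this]
      rw [key i rfl, delta_self]
      simp
    · rw [diagMap_val_of_ne _ _ fun h' => h (by rw [← h', e.symm_apply_apply]), comp_zero,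
        delta_of_ne _ h]
  inv_hom_id := by
    ext j i
    obtain ⟨i, rfl⟩ := e.surjective i
    rw [comp_diagMap_val, id_val]
    by_cases h : j = e i
    · subst h
      have := diagMap_val (M := N) (N := M) e.symm
        (fun j => eqToHom (by rw [e.apply_symm_apply]) ≫ (u (e.symm j)).inv) (e i)
      have key : ∀ k (hk : k = i), (diagMap (M := N) (N := M) e.symm
        (fun j => eqToHom (by rw [e.apply_symm_apply]) ≫ (u (e.symm j)).inv)).1 (e i) k =
          eqToHom (by rw [hk]) ≫ (u k).inv := by
        intro k hk
        obtain rfl : k = e.symm (e i) := by rw [hk, e.symm_apply_apply]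
        rw [this]
      rw [key i rfl, delta_self]
      simp
    · rw [diagMap_val_of_ne _ _ fun h' => h (by rw [← h', e.apply_symm_apply]), zero_comp,
        delta_of_ne _ h]

/-! ### Homogeneous matrices -/

/-- Matrices of degree `r`, for given degrees of the rows and columns. -/
def Homog (δ : M.ι → ℤ) (ε : N.ι → ℤ) (r : ℤ) (f : M ⟶ N) : Prop :=
  ∀ i j, f.1 i j ≠ 0 → ε j = δ i + r

namespace Homog

variable {δ : M.ι → ℤ} {ε : N.ι → ℤ} {ζ : K.ι → ℤ} {r s : ℤ}

lemma id : Homog δ δ 0 (𝟙 M) := fun i j h => by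
  by_cases e : i = j
  · rw [e, add_zero]
  · exact absurd (delta_of_ne _ e) h

lemma zero : Homog δ ε r (0 : M ⟶ N) := fun _ _ h => absurd rfl h

lemma comp {f : M ⟶ N} {g : N ⟶ K} (hf : Homog δ ε r f) (hg : Homog ε ζ s g) :
    Homog δ ζ (r + s) (f ≫ g) := fun i k h => by
  obtain ⟨j, h₁, h₂⟩ := exists_comp_ne_zero h
  rw [hg j k h₂, hf i j h₁, add_assoc]

lemma comp' {f : M ⟶ N} {g : N ⟶ K} {t : ℤ} (hf : Homog δ ε r f) (hg : Homog ε ζ s g)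
    (h : r + s = t) : Homog δ ζ t (f ≫ g) := h ▸ hf.comp hg

lemma add {f g : M ⟶ N} (hf : Homog δ ε r f) (hg : Homog δ ε r g) : Homog δ ε r (f + g) :=
  fun i j h => by
    by_cases h' : f.1 i j = 0
    · exact hg i j fun h'' => h (by rw [add_val, h', h'', add_zero])
    · exact hf i j h'

lemma neg {f : M ⟶ N} (hf : Homog δ ε r f) : Homog δ ε r (-f) :=
  fun i j h => hf i j fun h' => h (by rw [neg_val, h', neg_zero])

lemma sum {κ : Type*} (t : Finset κ) {f : κ → (M ⟶ N)} (h : ∀ k ∈ t, Homog δ ε r (f k)) :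
    Homog δ ε r (∑ k ∈ t, f k) := by
  classical
  induction t using Finset.induction_on with
  | empty => simpa using zero
  | insert k t hk ih =>
    rw [Finset.sum_insert hk]
    exact (h k (by simp)).add (ih fun k hk => h k (by simp [hk]))

lemma diagMap {e : M.ι ≃ N.ι} {u : ∀ i, M.X i ⟶ N.X (e i)} (h : ∀ i, ε (e i) = δ i + r) :
    Homog δ ε r (diagMap e u) := fun i j hij => by
  by_cases e' : e i = j
  · rw [← e', h]
  · exact absurd (diagMap_val_of_ne e u e') hij

end Homog

/-- The diagonal matrix with entries `(-1)^(δ i)`. -/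
def sign (δ : M.ι → ℤ) : M ⟶ M := diagMap (Equiv.refl _) fun i => (δ i).negOnePow • 𝟙 (M.X i)

lemma sign_comp_val (δ : M.ι → ℤ) (f : M ⟶ N) (i : M.ι) (j : N.ι) :
    (sign δ ≫ f).1 i j = (δ i).negOnePow • f.1 i j := by
  refine (diagMap_comp_val (Equiv.refl _) _ f i j).trans ?_
  change ((δ i).negOnePow • 𝟙 (M.X i)) ≫ f.1 i j = _
  rw [Linear.units_smul_comp, Category.id_comp]

lemma comp_sign_val (δ : N.ι → ℤ) (f : M ⟶ N) (i : M.ι) (j : N.ι) :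
    (f ≫ sign δ).1 i j = (δ j).negOnePow • f.1 i j := by
  refine (comp_diagMap_val (Equiv.refl _) _ f i j).trans ?_
  change f.1 i j ≫ ((δ j).negOnePow • 𝟙 (N.X j)) = _
  rw [Linear.comp_units_smul, Category.comp_id]

lemma Homog.sign {δ : M.ι → ℤ} : Homog δ δ 0 (sign δ) := .diagMap fun i => by simp

variable {δ : M.ι → ℤ} {ε : N.ι → ℤ} {f : M ⟶ N}

lemma Homog.comp_sign_even {r : ℤ} (hr : Even r) (h : Homog δ ε r f) :
    f ≫ MatClosure.sign ε = MatClosure.sign δ ≫ f := by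
  ext i j
  rw [comp_sign_val, sign_comp_val]
  by_cases hf : f.1 i j = 0
  · rw [hf, smul_zero, smul_zero]
  · rw [h i j hf, Int.negOnePow_add, Int.negOnePow_even _ hr, mul_one]

/-- The Koszul sign rule: `sign` multiplies by the parity of the degree, which a matrix of odd
degree changes. This is what makes the differential of a total complex square to zero. -/
lemma Homog.comp_sign_odd {r : ℤ} (hr : Odd r) (h : Homog δ ε r f) :
    f ≫ MatClosure.sign ε = -(MatClosure.sign δ ≫ f) := by
  ext i j
  rw [neg_val, comp_sign_val, sign_comp_val]
  by_cases hf : f.1 i j = 0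
  · rw [hf, smul_zero, smul_zero, neg_zero]
  · rw [h i j hf, Int.negOnePow_add, Int.negOnePow_odd _ hr, mul_neg, mul_one, Units.neg_smul]

end MatClosure

/-! ### Tensor products -/

namespace MatClosure

section Tensor

variable {C D E : Type} [SmallCategory C] [SmallCategory D] [SmallCategory E] [Preadditive C]
  [Preadditive D] [Preadditive E] {b : Bool} (F : C ⥤ D ⥤ E) [∀ Y, (F.flip.obj Y).Additive] [∀ X, (F.obj X).Additive]
  {N N' N'' : MatClosure b D} {M M' M'' : MatClosure b C}

/-- The extension of a bifunctor to formal sums or products. -/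
abbrev tobj (M : MatClosure b C) (N : MatClosure b D) : MatClosure b E :=
  ⟨M.ι × N.ι, fun p => (F.obj (M.X p.1)).obj (N.X p.2)⟩

lemma tmap_mem (f : M ⟶ M') (g : N ⟶ N') : (fun (p : (tobj F M N).ι) (q : (tobj F M' N').ι) =>
    (biMap F (f.1 p.1 q.1) (g.1 p.2 q.2) : (tobj F M N).X p ⟶ (tobj F M' N').X q)) ∈
      (tobj F M N).matrices (tobj F M' N') := by
    cases b
    · exact fun q => ((f.2 q.1).prod (g.2 q.2)).subset fun p hp =>
        ⟨fun h => hp ((congrArg (biMap F · _) h).trans (biMap_zero_left F _)),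
          fun h => hp ((congrArg (biMap F _) h).trans (biMap_zero_right F _))⟩
    · exact fun p => ((f.2 p.1).prod (g.2 p.2)).subset fun q hq =>
        ⟨fun h => hq ((congrArg (biMap F · _) h).trans (biMap_zero_left F _)),
          fun h => hq ((congrArg (biMap F _) h).trans (biMap_zero_right F _))⟩

/-- The extension of a bifunctor to matrices. -/
def tmap (f : M ⟶ M') (g : N ⟶ N') : tobj F M N ⟶ tobj F M' N' := ⟨_, tmap_mem F f g⟩

lemma tmap_val (f : M ⟶ M') (g : N ⟶ N') (p : (tobj F M N).ι) (q : (tobj F M' N').ι) :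
    (tmap F f g).1 p q = biMap F (f.1 p.1 q.1) (g.1 p.2 q.2) := rfl

lemma tmap_id : tmap F (𝟙 M) (𝟙 N) = 𝟙 _ := by
  ext p q
  exact biMap_delta F M.X N.X p q

lemma tmap_comp (f : M ⟶ M') (f' : M' ⟶ M'') (g : N ⟶ N') (g' : N' ⟶ N'') :
    tmap F (f ≫ f') (g ≫ g') = tmap F f g ≫ tmap F f' g' := by
  ext p q
  obtain ⟨s, hs⟩ := support_comp f f' p.1 q.1
  obtain ⟨t, ht⟩ := support_comp g g' p.2 q.2
  rw [tmap_val, comp_val_sum _ _ _ _ hs, comp_val_sum _ _ _ _ ht, biMap_sum,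
    comp_val_sum (s := s ×ˢ t) _ _ _ _ fun j hj => Finset.mem_product.2 ⟨hs _ fun h => hj (by
      rw [tmap_val, tmap_val, ← biMap_comp, h, biMap_zero_left]), ht _ fun h => hj (by
      rw [tmap_val, tmap_val, ← biMap_comp, h, biMap_zero_right])⟩]
  exact Finset.sum_congr rfl fun j _ => biMap_comp F _ _ _ _

lemma tmap_add_left (f f' : M ⟶ M') (g : N ⟶ N') :
    tmap F (f + f') g = tmap F f g + tmap F f' g := by
  ext p q
  exact DFunLike.congr_fun (map_add (biMapHom F _ _ _ _) _ _) _

lemma tmap_add_right (f : M ⟶ M') (g g' : N ⟶ N') :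
    tmap F f (g + g') = tmap F f g + tmap F f g' := by
  ext p q
  exact map_add (biMapHom F _ _ _ _ _) _ _

lemma tmap_zero_left (g : N ⟶ N') : tmap F (0 : M ⟶ M') g = 0 := by
  ext p q
  exact biMap_zero_left F _

lemma tmap_zero_right (f : M ⟶ M') : tmap F f (0 : N ⟶ N') = 0 := by
  ext p q
  exact biMap_zero_right F _

lemma tmap_neg_left (f : M ⟶ M') (g : N ⟶ N') : tmap F (-f) g = -tmap F f g := by
  rw [eq_neg_iff_add_eq_zero, ← tmap_add_left, neg_add_cancel, tmap_zero_left]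

variable {F}

lemma tmap_ne_zero {f : M ⟶ M'} {g : N ⟶ N'} {p : (tobj F M N).ι} {q : (tobj F M' N').ι}
    (h : (tmap F f g).1 p q ≠ 0) : f.1 p.1 q.1 ≠ 0 ∧ g.1 p.2 q.2 ≠ 0 :=
  ⟨fun h' => h (by rw [tmap_val, h', biMap_zero_left]),
    fun h' => h (by rw [tmap_val, h', biMap_zero_right])⟩

lemma Homog.tmap {δ : M.ι → ℤ} {δ' : M'.ι → ℤ} {ε : N.ι → ℤ} {ε' : N'.ι → ℤ} {f : M ⟶ M'}
    {g : N ⟶ N'} {r s t : ℤ} (hf : Homog δ δ' r f) (hg : Homog ε ε' s g) (h : r + s = t) :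
    Homog (M := tobj F M N) (N := tobj F M' N') (fun p => δ p.1 + ε p.2)
      (fun p => δ' p.1 + ε' p.2) t (MatClosure.tmap F f g) := fun p q hpq => by
  obtain ⟨h₁, h₂⟩ := tmap_ne_zero hpq
  have := hf _ _ h₁
  have := hg _ _ h₂
  simp only
  omega

/-- Parities of degrees add up in a tensor product. This is the sign compatibility behind the
associativity of total complexes. -/
lemma tmap_sign (δ : M.ι → ℤ) (ε : N.ι → ℤ) : tmap F (sign δ) (sign ε) =
    sign (M := tobj F M N) fun p => δ p.1 + ε p.2 := by
  have h₁ : tmap F (sign δ) (𝟙 N) = sign (M := tobj F M N) fun p => δ p.1 := by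
    ext p q
    rw [tmap_val, ← Category.comp_id (sign δ), sign_comp_val,
      ← Category.comp_id (sign (M := tobj F M N) _), sign_comp_val, id_val, id_val, id_val,
      ← biMap_delta]
    exact DFunLike.congr_fun (map_zsmul (biMapHom F _ _ _ _) ((δ p.1).negOnePow : ℤ) _) _
  have h₂ : tmap F (𝟙 M) (sign ε) = sign (M := tobj F M N) fun p => ε p.2 := by
    ext p q
    rw [tmap_val, ← Category.comp_id (sign ε), sign_comp_val,
      ← Category.comp_id (sign (M := tobj F M N) _), sign_comp_val, id_val, id_val, id_val,
      ← biMap_delta]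
    exact map_zsmul (biMapHom F _ _ _ _ _) ((ε p.2).negOnePow : ℤ) _
  have h₃ : tmap F (sign δ) (sign ε) = tmap F (sign δ) (𝟙 N) ≫ tmap F (𝟙 M) (sign ε) := by
    rw [← tmap_comp, Category.comp_id, Category.id_comp]
  rw [h₃, h₁, h₂]
  ext p q
  rw [sign_comp_val, ← Category.comp_id (sign (M := tobj F M N) fun p => ε p.2), sign_comp_val,
    smul_smul, ← Category.comp_id (sign (M := tobj F M N) _), sign_comp_val, Int.negOnePow_add]

end Tensor

end MatClosure
end BarNatan

namespace BarNatan
namespace MatClosure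

variable {C : Type} [SmallCategory C] [Preadditive C] {b : Bool}

/-! ### Geometric series -/

/-- The powers of an endomorphism. -/
def npow {M : MatClosure b C} (N : M ⟶ M) : ℕ → (M ⟶ M)
  | 0 => 𝟙 M
  | m + 1 => npow N m ≫ N

/-- The grading `δ` is nonnegative (for sums) or nonpositive (for products). -/
def Bounded : {b : Bool} → (M : MatClosure b C) → (M.ι → ℤ) → Prop
  | true, M, δ => ∀ i, δ i < 0 → IsZero (M.X i)
  | false, M, δ => ∀ i, 0 < δ i → IsZero (M.X i)

/-- The powers of a matrix of degree `-1` that may have a nonzero entry at `(i, j)` have a smaller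
exponent. -/
def ordBound : {b : Bool} → {M : MatClosure b C} → (M.ι → ℤ) → M.ι → M.ι → ℕ
  | true, _, δ, i, _ => (δ i).toNat + 1
  | false, _, δ, _, j => (-δ j).toNat + 1

section Geom

variable {M : MatClosure b C} {δ ε : M.ι → ℤ} {N : M ⟶ M}

lemma npow_succ' (N : M ⟶ M) (m : ℕ) : npow N (m + 1) = N ≫ npow N m := by
  induction m with
  | zero => simp [npow]
  | succ m ih => exact (congrArg (· ≫ N) ih).trans (Category.assoc _ _ _)

lemma Homog.cast {K L : MatClosure b C} {δ : K.ι → ℤ} {ε : L.ι → ℤ} {f : K ⟶ L} {r s : ℤ}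
    (h : Homog δ ε r f) (hrs : r = s) : Homog δ ε s f := hrs ▸ h

lemma Homog.npow {r : ℤ} (h : Homog δ δ r N) (m : ℕ) : Homog δ δ (m * r) (npow N m) := by
  induction m with
  | zero => exact Homog.id.cast (by simp)
  | succ m ih => exact ih.comp' h (by push_cast; ring)

/-- Partial sums of the geometric series. -/
def geomPart (N : M ⟶ M) (B : ℕ) : M ⟶ M := ∑ m ∈ Finset.range B, npow N m

lemma geomPart_comp (N : M ⟶ M) (B : ℕ) : geomPart N B ≫ (𝟙 M - N) = 𝟙 M - npow N B := by
  induction B with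
  | zero => simp [geomPart, npow]
  | succ B ih =>
    rw [geomPart, Finset.sum_range_succ, Preadditive.add_comp]
    change geomPart N B ≫ _ + _ = _
    rw [ih, Preadditive.comp_sub, Category.comp_id, npow]; abel

lemma comp_geomPart (N : M ⟶ M) (B : ℕ) : (𝟙 M - N) ≫ geomPart N B = 𝟙 M - npow N B := by
  induction B with
  | zero => simp [geomPart, npow]
  | succ B ih =>
    rw [geomPart, Finset.sum_range_succ, Preadditive.comp_add]
    change _ ≫ geomPart N B + _ = _
    rw [ih, Preadditive.sub_comp, Category.id_comp, ← npow_succ']; abel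

/-- A nonzero entry of the `m`-th power has `δ j = δ i - m`. For sums `δ j ≥ 0` gives `m ≤ δ i`; for
products `δ i ≤ 0` gives `m ≤ -δ j`. The bound thus depends only on the index whose row, or column,
must be finite. -/
lemma npow_eq_zero (hδ : Bounded M δ) (h : Homog δ δ (-1) N) {i j : M.ι} {m : ℕ}
    (hm : ordBound δ i j ≤ m) : (npow N m).1 i j = 0 := by
  by_contra H
  have h₁ := h.npow m i j H
  cases b
  · have : ¬ 0 < δ i := fun h => H ((hδ i h).eq_of_src _ _)
    simp only [ordBound] at hm
    omega
  · have : ¬ δ j < 0 := fun h => H ((hδ j h).eq_of_tgt _ _)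
    simp only [ordBound] at hm
    omega

lemma geomPart_eq (hδ : Bounded M δ) (h : Homog δ δ (-1) N) {i j : M.ι} {B : ℕ}
    (hB : ordBound δ i j ≤ B) :
    (geomPart N B).1 i j = (geomPart N (ordBound δ i j)).1 i j := by
  rw [geomPart, geomPart, sum_val, sum_val]
  refine (Finset.sum_subset (Finset.range_subset_range.2 hB) fun m _ hm => ?_).symm
  exact npow_eq_zero hδ h (by simpa using hm)

/-- Since `ordBound` is constant along a row for sums, and along a column for products, that row or
column agrees with the one of a single partial sum, which is finite. -/
lemma geom_mem (δ : M.ι → ℤ) (N : M ⟶ M) :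
    (fun i j => (geomPart N (ordBound δ i j)).1 i j) ∈ M.matrices M := by
  cases b
  · exact fun j => (geomPart N ((-δ j).toNat + 1)).2 j
  · exact fun i => (geomPart N ((δ i).toNat + 1)).2 i

/-- The sum of the geometric series. -/
def geom (δ : M.ι → ℤ) (N : M ⟶ M) : M ⟶ M := ⟨_, geom_mem δ N⟩

lemma geom_val (hδ : Bounded M δ) (h : Homog δ δ (-1) N) {i j : M.ι} {B : ℕ}
    (hB : ordBound δ i j ≤ B) : (geom δ N).1 i j = (geomPart N B).1 i j :=
  (geomPart_eq hδ h hB).symm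

/-- An entry of the product involves only finitely many bounds, so the series may be replaced by one
partial sum, for which the product telescopes up to a power that vanishes at this entry. -/
lemma geom_comp (hδ : Bounded M δ) (h : Homog δ δ (-1) N) : geom δ N ≫ (𝟙 M - N) = 𝟙 M := by
  ext i k
  -- For products the bound varies with the intermediate index `j`, but the column of `1 - N` at `k`
  -- is finite; for sums the bound depends on `i` alone.
  have key : ∃ B, ordBound δ i k ≤ B ∧
      ∀ j, (𝟙 M - N : M ⟶ M).1 j k ≠ 0 → ordBound δ i j ≤ B := by
    cases b
    · obtain ⟨s, hs⟩ := ProdClosure.exists_support (M := M.prod) (N := M.prod) (𝟙 M - N) k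
      refine ⟨s.sup (ordBound δ i) ⊔ ordBound δ i k, le_sup_right, fun j hj => ?_⟩
      exact le_sup_of_le_left (Finset.le_sup (f := ordBound δ i) (hs j hj))
    · exact ⟨_, le_rfl, fun j _ => le_rfl⟩
  obtain ⟨B, hk, hB⟩ := key
  have : (geom δ N ≫ (𝟙 M - N)).1 i k = (geomPart N B ≫ (𝟙 M - N)).1 i k := by
    rw [comp_val, comp_val]
    refine finsum_congr fun j => ?_
    by_cases hj : (𝟙 M - N : M ⟶ M).1 j k = 0
    · rw [hj, comp_zero, comp_zero]
    · rw [geom_val hδ h (hB j hj)]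
  rw [this, geomPart_comp, sub_val, npow_eq_zero hδ h hk, sub_zero]

lemma comp_geom (hδ : Bounded M δ) (h : Homog δ δ (-1) N) : (𝟙 M - N) ≫ geom δ N = 𝟙 M := by
  ext i k
  have key : ∃ B, ordBound δ i k ≤ B ∧
      ∀ j, (𝟙 M - N : M ⟶ M).1 i j ≠ 0 → ordBound δ j k ≤ B := by
    cases b
    · exact ⟨_, le_rfl, fun j _ => le_rfl⟩
    · obtain ⟨s, hs⟩ := SumClosure.exists_support (M := M.sum) (N := M.sum) (𝟙 M - N) i
      refine ⟨s.sup (ordBound δ · k) ⊔ ordBound δ i k, le_sup_right, fun j hj => ?_⟩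
      exact le_sup_of_le_left (Finset.le_sup (f := (ordBound δ · k)) (hs j hj))
  obtain ⟨B, hk, hB⟩ := key
  have : ((𝟙 M - N) ≫ geom δ N).1 i k = ((𝟙 M - N) ≫ geomPart N B).1 i k := by
    rw [comp_val, comp_val]
    refine finsum_congr fun j => ?_
    by_cases hj : (𝟙 M - N : M ⟶ M).1 i j = 0
    · rw [hj, zero_comp, zero_comp]
    · rw [geom_val hδ h (hB j hj)]
  rw [this, comp_geomPart, sub_val, npow_eq_zero hδ h hk, sub_zero]

/-- Two gradings are in play: convergence uses `δ`, for which `N` has degree `-1`, while `ε` is a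
grading that `N` preserves, such as the total homological degree. -/
lemma Homog.geom (h : Homog ε ε 0 N) : Homog ε ε 0 (geom δ N) := fun i j hij => by
  refine Homog.sum (δ := ε) (ε := ε) (r := 0) _ (fun m _ => ?_) i j hij
  simpa using h.npow m

end Geom

end MatClosure

open MatClosure

/-! ### Complexes of locally finite matrices -/

/-- Chain complexes over a category of formal sums or products, all of whose objects are
collected into a single graded object. -/
structure DG (b : Bool) (C : Type) [SmallCategory C] [Preadditive C] where
  obj : MatClosure b C
  deg : obj.ι → ℤ
  d : obj ⟶ obj
  homog : Homog deg deg 1 d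
  d_d : d ≫ d = 0

namespace DG

variable {C : Type} [SmallCategory C] [Preadditive C] {b : Bool}

/-- Chain maps. -/
@[ext]
structure Hom (K L : DG b C) where
  f : K.obj ⟶ L.obj
  homog : Homog K.deg L.deg 0 f
  comm : f ≫ L.d = K.d ≫ f

instance : Category (DG b C) where
  Hom := Hom
  id K := ⟨𝟙 _, .id, by simp⟩
  comp f g := ⟨f.f ≫ g.f, f.homog.comp' g.homog (by simp), by
    rw [Category.assoc, g.comm, ← Category.assoc, f.comm, Category.assoc]⟩
  id_comp f := Hom.ext (Category.id_comp f.f)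
  comp_id f := Hom.ext (Category.comp_id f.f)
  assoc f g h := Hom.ext (Category.assoc f.f g.f h.f)

variable {K L : DG b C}

@[ext]
lemma hom_ext {f g : K ⟶ L} (h : f.f = g.f) : f = g := Hom.ext h

/-- An isomorphism of graded objects that commutes with the differentials. -/
def isoMk (e : K.obj ≅ L.obj) (h : Homog K.deg L.deg 0 e.hom) (h' : Homog L.deg K.deg 0 e.inv)
    (comm : e.hom ≫ L.d = K.d ≫ e.hom) : K ≅ L where
  hom := ⟨e.hom, h, comm⟩
  inv := ⟨e.inv, h', by
    rw [← cancel_epi e.hom, ← Category.assoc, e.hom_inv_id, Category.id_comp, ← Category.assoc,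
      comm, Category.assoc, e.hom_inv_id, Category.comp_id]⟩
  hom_inv_id := Hom.ext e.hom_inv_id
  inv_hom_id := Hom.ext e.inv_hom_id

variable (K L) in
/-- Strong deformation retracts: `K` is a deformation retract of `L`. -/
structure DefRetract where
  i : K ⟶ L
  p : L ⟶ K
  H : L.obj ⟶ L.obj
  homog : Homog L.deg L.deg (-1) H
  i_p : i ≫ p = 𝟙 K
  eq : L.d ≫ H + H ≫ L.d = 𝟙 _ - p.f ≫ i.f

/-- A retract up to a perturbation of the identity, whose inclusion is a chain map. -/
def DefRetract.ofInclusion (φ : K ⟶ L) (ρ : L.obj ⟶ K.obj) (h V : L.obj ⟶ L.obj)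
    (hρ : Homog L.deg K.deg 0 ρ) (hh : Homog L.deg L.deg (-1) h) (hV : Homog L.deg L.deg 0 V)
    (φρ : φ.f ≫ ρ = 𝟙 _) (φh : φ.f ≫ h = 0)
    (UV : (ρ ≫ φ.f + L.d ≫ h + h ≫ L.d) ≫ V = 𝟙 _)
    (VU : V ≫ (ρ ≫ φ.f + L.d ≫ h + h ≫ L.d) = 𝟙 _) : DefRetract K L := by
  -- As `φ` is a chain map with `φρ = 1` and `φh = 0`, it satisfies `φU = φ`, hence also `φV = φ`.
  have φV : φ.f ≫ V = φ.f := by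
    have : φ.f ≫ (ρ ≫ φ.f + L.d ≫ h + h ≫ L.d) = φ.f := by
      rw [Preadditive.comp_add, Preadditive.comp_add, ← Category.assoc, φρ, Category.id_comp,
        ← Category.assoc, φ.comm, Category.assoc, φh, comp_zero, ← Category.assoc, φh, zero_comp,
        add_zero, add_zero]
    conv_lhs => rw [← this]
    rw [Category.assoc, UV, Category.comp_id]
  set U := ρ ≫ φ.f + L.d ≫ h + h ≫ L.d with hU
  have dU : L.d ≫ U = U ≫ L.d + (L.d ≫ ρ - ρ ≫ K.d) ≫ φ.f := by
    simp only [hU, Preadditive.comp_add, Preadditive.add_comp, Preadditive.sub_comp,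
      Category.assoc, φ.comm, L.d_d, comp_zero]
    rw [← Category.assoc L.d L.d, L.d_d, zero_comp]
    abel
  -- The map `ρ` need not be a chain map, so `V` need not commute with `d`. The defect factors
  -- through `φ`: it makes `V ≫ ρ` a chain map and disappears against `h`.
  have Vd : V ≫ L.d = L.d ≫ V + V ≫ (L.d ≫ ρ - ρ ≫ K.d) ≫ φ.f := by
    have : V ≫ (L.d ≫ U) ≫ V = V ≫ (U ≫ L.d + (L.d ≫ ρ - ρ ≫ K.d) ≫ φ.f) ≫ V := by rw [dU]
    rw [Category.assoc, UV, Category.comp_id, Preadditive.add_comp, Preadditive.comp_add,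
      Category.assoc, ← Category.assoc V U, VU, Category.id_comp, Category.assoc _ φ.f, φV] at this
    exact this
  refine ⟨φ, ⟨V ≫ ρ, hV.comp' hρ (by simp), ?_⟩, V ≫ h, hV.comp' hh (by simp), ?_, ?_⟩
  · have : L.d ≫ V = V ≫ L.d - V ≫ (L.d ≫ ρ - ρ ≫ K.d) ≫ φ.f := by rw [Vd]; abel
    rw [← Category.assoc L.d, this, Preadditive.sub_comp]
    simp only [Category.assoc, φρ, Category.comp_id, Preadditive.comp_sub]
    abel
  · refine hom_ext ?_
    change φ.f ≫ V ≫ ρ = _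
    rw [← Category.assoc, φV, φρ]; rfl
  · have : L.d ≫ V = V ≫ L.d - V ≫ (L.d ≫ ρ - ρ ≫ K.d) ≫ φ.f := by rw [Vd]; abel
    change L.d ≫ V ≫ h + (V ≫ h) ≫ L.d = 𝟙 _ - (V ≫ ρ) ≫ φ.f
    rw [← Category.assoc L.d, this, ← VU, hU]
    simp only [Preadditive.sub_comp, Preadditive.comp_add, Category.assoc, φh, comp_zero,
      sub_zero]
    abel

/-- A retract up to a perturbation of the identity, whose projection is a chain map. -/
def DefRetract.ofProjection (φ : K.obj ⟶ L.obj) (ρ : L ⟶ K) (h V : L.obj ⟶ L.obj)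
    (hφ : Homog K.deg L.deg 0 φ) (hh : Homog L.deg L.deg (-1) h) (hV : Homog L.deg L.deg 0 V)
    (φρ : φ ≫ ρ.f = 𝟙 _) (hρ : h ≫ ρ.f = 0)
    (UV : (ρ.f ≫ φ + L.d ≫ h + h ≫ L.d) ≫ V = 𝟙 _)
    (VU : V ≫ (ρ.f ≫ φ + L.d ≫ h + h ≫ L.d) = 𝟙 _) : DefRetract K L := by
  -- Here the projection is kept and the inclusion is corrected. The defect of `V` now starts with
  -- `ρ`, so it disappears after `h`, because `hρ = 0`.
  have Vρ : V ≫ ρ.f = ρ.f := by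
    have : (ρ.f ≫ φ + L.d ≫ h + h ≫ L.d) ≫ ρ.f = ρ.f := by
      rw [Preadditive.add_comp, Preadditive.add_comp, Category.assoc, φρ, Category.comp_id,
        Category.assoc, hρ, comp_zero, Category.assoc, ← ρ.comm, ← Category.assoc, hρ, zero_comp,
        add_zero, add_zero]
    conv_lhs => rw [← this]
    rw [← Category.assoc, VU, Category.id_comp]
  set U := ρ.f ≫ φ + L.d ≫ h + h ≫ L.d with hU
  have dU : U ≫ L.d = L.d ≫ U + ρ.f ≫ (φ ≫ L.d - K.d ≫ φ) := by
    simp only [hU, Preadditive.comp_add, Preadditive.add_comp, Preadditive.comp_sub,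
      Category.assoc, L.d_d, comp_zero]
    rw [← Category.assoc L.d L.d, L.d_d, zero_comp, ← Category.assoc L.d ρ.f, ← ρ.comm,
      Category.assoc]
    abel
  have dV : L.d ≫ V = V ≫ L.d + ρ.f ≫ (φ ≫ L.d - K.d ≫ φ) ≫ V := by
    have : V ≫ (U ≫ L.d) ≫ V = V ≫ (L.d ≫ U + ρ.f ≫ (φ ≫ L.d - K.d ≫ φ)) ≫ V := by rw [dU]
    rw [Category.assoc U, ← Category.assoc V U, VU, Category.id_comp, Preadditive.add_comp,
      Preadditive.comp_add, Category.assoc L.d U V, UV, Category.comp_id, Category.assoc ρ.f,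
      ← Category.assoc V ρ.f, Vρ] at this
    exact this
  refine ⟨⟨φ ≫ V, hφ.comp' hV (by simp), ?_⟩, ρ, h ≫ V, hh.comp' hV (by simp), ?_, ?_⟩
  · have : V ≫ L.d = L.d ≫ V - ρ.f ≫ (φ ≫ L.d - K.d ≫ φ) ≫ V := by rw [dV]; abel
    rw [Category.assoc, this, Preadditive.comp_sub, ← Category.assoc φ ρ.f, φρ, Category.id_comp]
    simp only [Category.assoc, Preadditive.sub_comp]
    abel
  · refine hom_ext ?_
    change (φ ≫ V) ≫ ρ.f = _
    rw [Category.assoc, Vρ, φρ]; rfl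
  · have : V ≫ L.d = L.d ≫ V - ρ.f ≫ (φ ≫ L.d - K.d ≫ φ) ≫ V := by rw [dV]; abel
    change L.d ≫ h ≫ V + (h ≫ V) ≫ L.d = 𝟙 _ - ρ.f ≫ φ ≫ V
    rw [Category.assoc h, this, ← UV, hU]
    simp only [Preadditive.comp_sub, Preadditive.add_comp, Category.assoc]
    rw [← Category.assoc h ρ.f, hρ, zero_comp]
    abel

end DG
namespace MatClosure

variable {C D E : Type} [SmallCategory C] [SmallCategory D] [SmallCategory E] [Preadditive C]
  [Preadditive D] [Preadditive E] {b : Bool}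

/-! ### Functors applied to entries -/

section Functor

variable (G G' : C ⥤ D) [G.Additive] [G'.Additive] {M N K : MatClosure b C}

/-- A functor applied to the objects of a formal sum or product. -/
abbrev fobj (M : MatClosure b C) : MatClosure b D := ⟨M.ι, fun i => G.obj (M.X i)⟩

lemma fmap_mem (f : M ⟶ N) : (fun (i : (fobj G M).ι) (j : (fobj G N).ι) =>
    (G.map (f.1 i j) : (fobj G M).X i ⟶ (fobj G N).X j)) ∈ (fobj G M).matrices (fobj G N) := by
  cases b
  · exact fun j => (f.2 j).subset fun i hi h => hi ((congrArg G.map h).trans (G.map_zero _ _))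
  · exact fun i => (f.2 i).subset fun j hj h => hj ((congrArg G.map h).trans (G.map_zero _ _))

/-- A functor applied to the entries of a matrix. -/
def fmap (f : M ⟶ N) : fobj G M ⟶ fobj G N := ⟨_, fmap_mem G f⟩

lemma fmap_val (f : M ⟶ N) (i : M.ι) (j : N.ι) : (fmap G f).1 i j = G.map (f.1 i j) := rfl

lemma fmap_id : fmap G (𝟙 M) = 𝟙 (fobj G M) := by
  ext i j
  rw [fmap_val, id_val, id_val]
  by_cases h : i = j
  · subst h
    rw [delta_self, delta_self, G.map_id]
  · rw [delta_of_ne _ h, delta_of_ne _ h, G.map_zero]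

lemma fmap_comp (f : M ⟶ N) (g : N ⟶ K) : fmap G (f ≫ g) = fmap G f ≫ fmap G g := by
  ext i k
  obtain ⟨s, hs⟩ := support_comp f g i k
  refine (congrArg G.map (comp_val_sum f g i k hs)).trans (((G.map_sum _ _).trans
    (Finset.sum_congr rfl fun j _ => G.map_comp _ _)).trans
      (comp_val_sum (fmap G f) (fmap G g) i k fun j hj => hs j fun h => hj ?_).symm)
  rw [fmap_val, fmap_val, ← G.map_comp, h, G.map_zero]

lemma fmap_add (f g : M ⟶ N) : fmap G (f + g) = fmap G f + fmap G g := by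
  ext i j
  exact G.map_add

variable {G}

lemma Homog.fmap {δ : M.ι → ℤ} {ε : N.ι → ℤ} {r : ℤ} {f : M ⟶ N} (h : Homog δ ε r f) :
    Homog (M := fobj G M) (N := fobj G N) δ ε r (MatClosure.fmap G f) := fun i j hij =>
  h i j fun h' => hij (by rw [fmap_val, h', G.map_zero])

variable {G'}

/-- The diagonal matrix given by a natural transformation. -/
def natMap (t : G ⟶ G') (M : MatClosure b C) : fobj G M ⟶ fobj G' M :=
  diagMap (Equiv.refl _) fun i => t.app (M.X i)

lemma natMap_comp_val (t : G ⟶ G') {L : MatClosure b D} (f : fobj G' M ⟶ L) (i : M.ι) (j : L.ι) :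
    (natMap t M ≫ f).1 i j = t.app (M.X i) ≫ f.1 i j :=
  diagMap_comp_val (M := fobj G M) (N := fobj G' M) (Equiv.refl _) _ f i j

lemma comp_natMap_val (t : G ⟶ G') {L : MatClosure b D} (f : L ⟶ fobj G M) (i : L.ι) (j : M.ι) :
    (f ≫ natMap t M).1 i j = f.1 i j ≫ t.app (M.X j) :=
  comp_diagMap_val (M := fobj G M) (N := fobj G' M) (Equiv.refl _) _ f i j

lemma natMap_naturality (t : G ⟶ G') (f : M ⟶ N) :
    fmap G f ≫ natMap t N = natMap t M ≫ fmap G' f := by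
  ext i j
  rw [comp_natMap_val, natMap_comp_val]
  exact t.naturality _

lemma Homog.natMap (t : G ⟶ G') {δ : M.ι → ℤ} :
    Homog (M := fobj G M) (N := fobj G' M) δ δ 0 (natMap t M) := .diagMap fun i => by simp

end Functor

/-! ### Block diagonal matrices -/

section Block

variable {κ : Type} [Countable κ] (G : κ → C ⥤ D) (M : MatClosure b C)

/-- The sum of a family of functors, applied to the objects of a formal sum or product. -/
abbrev bobj : MatClosure b D := ⟨κ × M.ι, fun p => (G p.1).obj (M.X p.2)⟩

variable {G M}

lemma blockDiag_mem (f : ∀ k, fobj (G k) M ⟶ fobj (G k) M) :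
    (fun p q : κ × M.ι => (f p.1).1 p.2 q.2 ≫ delta (bobj G M).X (p.1, q.2) q) ∈
      (bobj G M).matrices (bobj G M) := by
  cases b
  · refine fun q => (((f q.1).2 q.2).image (Prod.mk q.1)).subset fun p hp => ?_
    by_cases h : p.1 = q.1
    · obtain ⟨k, i⟩ := p
      obtain ⟨k', j⟩ := q
      obtain rfl : k = k' := h
      exact ⟨i, fun h' => hp ((congrArg (· ≫ _) h').trans zero_comp), rfl⟩
    · exact absurd ((congrArg ((f p.1).1 p.2 q.2 ≫ ·)
        (delta_of_ne (i := (p.1, q.2)) (j := q) (bobj (b := false) G M).X fun e => h (Prod.ext_iff.1 e).1)).trans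
          comp_zero) hp
  · refine fun p => (((f p.1).2 p.2).image (Prod.mk p.1)).subset fun q hq => ?_
    by_cases h : p.1 = q.1
    · obtain ⟨k, i⟩ := p
      obtain ⟨k', j⟩ := q
      obtain rfl : k = k' := h
      exact ⟨j, fun h' => hq ((congrArg (· ≫ _) h').trans zero_comp), rfl⟩
    · exact absurd ((congrArg ((f p.1).1 p.2 q.2 ≫ ·)
        (delta_of_ne (i := (p.1, q.2)) (j := q) (bobj (b := true) G M).X fun e => h (Prod.ext_iff.1 e).1)).trans
          comp_zero) hq

/-- The block diagonal matrix with given blocks. -/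
def blockDiag (f : ∀ k, fobj (G k) M ⟶ fobj (G k) M) : bobj G M ⟶ bobj G M :=
  ⟨_, blockDiag_mem f⟩

lemma blockDiag_val (f : ∀ k, fobj (G k) M ⟶ fobj (G k) M) (k : κ) (i j : M.ι) :
    (blockDiag f).1 (k, i) (k, j) = (f k).1 i j := by
  change (f k).1 i j ≫ delta (bobj G M).X (k, j) (k, j) = _
  rw [delta_self, Category.comp_id]

lemma blockDiag_val_of_ne (f : ∀ k, fobj (G k) M ⟶ fobj (G k) M) {p q : κ × M.ι}
    (h : p.1 ≠ q.1) : (blockDiag f).1 p q = 0 := by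
  change (f p.1).1 p.2 q.2 ≫ delta (bobj G M).X (p.1, q.2) q = 0
  rw [delta_of_ne (i := (p.1, q.2)) (j := q) _ fun e => h (Prod.ext_iff.1 e).1, comp_zero]

lemma blockDiag_ext {f : bobj G M ⟶ bobj G M} {g : ∀ k, fobj (G k) M ⟶ fobj (G k) M}
    (h : ∀ k i j, f.1 (k, i) (k, j) = (g k).1 i j)
    (h' : ∀ k k' i j, k ≠ k' → f.1 (k, i) (k', j) = 0) : f = blockDiag g := by
  ext ⟨k, i⟩ ⟨k', j⟩
  by_cases e : k = k'
  · subst e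
    rw [h, blockDiag_val]
  · rw [h' _ _ _ _ e, blockDiag_val_of_ne _ e]

lemma blockDiag_comp (f g : ∀ k, fobj (G k) M ⟶ fobj (G k) M) :
    blockDiag f ≫ blockDiag g = blockDiag fun k => f k ≫ g k := by
  classical
  refine blockDiag_ext (fun k i j => ?_) fun k k' i j h => ?_
  · obtain ⟨s, hs⟩ := support_comp (f k) (g k) i j
    rw [comp_val_sum (f k) (g k) i j hs, comp_val_sum (s := s.image (Prod.mk k)) _ _ _ _
      fun p hp => Finset.mem_image.2 ?_, Finset.sum_image fun _ _ _ _ e => congrArg Prod.snd e]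
    · exact Finset.sum_congr rfl fun l _ => by rw [blockDiag_val, blockDiag_val]
    · obtain ⟨l, x⟩ := p
      by_cases e : k = l
      · subst e
        exact ⟨x, hs x fun h => hp (by rw [blockDiag_val, blockDiag_val, h]), rfl⟩
      · exact absurd (by rw [blockDiag_val_of_ne f e, zero_comp]) hp
  · by_contra H
    obtain ⟨⟨l, x⟩, h₁, h₂⟩ := exists_comp_ne_zero H
    by_cases e : k = l
    · subst e
      exact h₂ (blockDiag_val_of_ne _ h)
    · exact h₁ (blockDiag_val_of_ne _ e)

lemma blockDiag_add (f g : ∀ k, fobj (G k) M ⟶ fobj (G k) M) :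
    blockDiag f + blockDiag g = blockDiag fun k => f k + g k :=
  blockDiag_ext (fun k i j => by rw [add_val, add_val, blockDiag_val, blockDiag_val])
    fun k k' i j h => by
      rw [add_val, blockDiag_val_of_ne _ h, blockDiag_val_of_ne _ h, add_zero]

lemma blockDiag_zero : blockDiag (fun k => (0 : fobj (G k) M ⟶ fobj (G k) M)) = 0 :=
  (blockDiag_ext (fun _ _ _ => rfl) fun _ _ _ _ _ => rfl).symm

lemma blockDiag_id : blockDiag (fun k => 𝟙 (fobj (G k) M)) = 𝟙 (bobj G M) := by
  refine (blockDiag_ext (fun k i j => ?_) fun k k' i j h => delta_of_ne _ fun e =>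
    h (congrArg Prod.fst e)).symm
  rw [id_val, id_val]
  by_cases h : i = j
  · subst h
    rw [delta_self, delta_self]
  · rw [delta_of_ne _ h, delta_of_ne _ fun e => h (congrArg Prod.snd e)]

lemma Homog.blockDiag {f : ∀ k, fobj (G k) M ⟶ fobj (G k) M} {δ : κ × M.ι → ℤ} {r : ℤ}
    (h : ∀ k, Homog (M := fobj (G k) M) (N := fobj (G k) M) (fun i => δ (k, i))
      (fun i => δ (k, i)) r (f k)) :
    Homog (M := bobj G M) (N := bobj G M) δ δ r (blockDiag f) := by
  rintro ⟨k, i⟩ ⟨k', j⟩ hp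
  by_cases e : k = k'
  · subst e
    exact h k i j fun h => hp (by rw [blockDiag_val, h])
  · exact absurd (blockDiag_val_of_ne _ e) hp

end Block

/-- The diagonal matrix with given integer entries. -/
def scal {M : MatClosure b C} (c : M.ι → ℤ) : M ⟶ M :=
  diagMap (Equiv.refl _) fun i => c i • 𝟙 (M.X i)

lemma scal_val {M : MatClosure b C} (c : M.ι → ℤ) (i j : M.ι) :
    (scal c).1 i j = c i • delta M.X i j :=
  (Preadditive.zsmul_comp _ _ _).trans (congrArg _ (Category.id_comp _))

section Tensor

variable (F : C ⥤ D ⥤ E)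

lemma biMap_id_left {X : C} {Y Y' : D} (g : Y ⟶ Y') : biMap F (𝟙 X) g = (F.obj X).map g := by
  simp [biMap]

lemma biMap_flip {X X' : C} {Y Y' : D} (f : X ⟶ X') (g : Y ⟶ Y') :
    biMap F.flip g f = biMap F f g := ((F.map f).naturality g)

variable [∀ Y, (F.flip.obj Y).Additive] [∀ X, (F.obj X).Additive] {M : MatClosure b C}
  {N : MatClosure b D}

lemma biMap_zsmul_left {X X' : C} {Y Y' : D} (r : ℤ) (f : X ⟶ X') (g : Y ⟶ Y') :
    biMap F (r • f) g = r • biMap F f g :=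
  DFunLike.congr_fun (map_zsmul (biMapHom F _ _ _ _) r f) g

/-- A diagonal matrix on the first factor leaves the second factor acting within each block, where
the object of the first factor is fixed. This allows contractions of `F(X, P)` to be chosen block by
block. -/
lemma tmap_scal (c : M.ι → ℤ) (g : N ⟶ N) : tmap F (scal c) g =
    blockDiag (G := fun k : M.ι => F.obj (M.X k)) fun k : M.ι => c k • fmap (F.obj (M.X k)) g := by
  refine blockDiag_ext (G := fun k : M.ι => F.obj (M.X k)) (fun k i j => ?_) fun k k' i j h => ?_
  · rw [tmap_val, scal_val, delta_self, biMap_zsmul_left, biMap_id_left]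
    exact (map_zsmul (entry (fobj (F.obj (M.X k)) N) (fobj (F.obj (M.X k)) N) i j) (c k)
      (fmap (F.obj (M.X k)) g)).symm
  · rw [tmap_val, scal_val, delta_of_ne _ h, smul_zero, biMap_zero_left]

lemma tmap_scal_id (c : M.ι → ℤ) :
    tmap F (scal c) (𝟙 N) = scal (M := tobj F M N) fun p => c p.1 := by
  ext p q
  rw [tmap_val, scal_val, scal_val, biMap_zsmul_left, id_val, ← biMap_delta]

end Tensor

end MatClosure

open MatClosure

namespace DG

variable {C : Type} [SmallCategory C] [Preadditive C] {b : Bool}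

/-! ### Tensor products of complexes -/

section Tensor

variable {D E : Type} [SmallCategory D] [SmallCategory E] [Preadditive D] [Preadditive E]
  (F : C ⥤ D ⥤ E) [∀ Y, (F.flip.obj Y).Additive] [∀ X, (F.obj X).Additive]

/-- The total complex of `F(K, L)`. -/
def tensor (K : DG b C) (L : DG b D) : DG b E where
  obj := tobj F K.obj L.obj
  deg p := K.deg p.1 + L.deg p.2
  d := tmap F K.d (𝟙 _) + tmap F (sign K.deg) L.d
  homog := (K.homog.tmap Homog.id (by simp)).add (Homog.sign.tmap L.homog (by simp))
  d_d := by
    -- The mixed terms cancel because `d` anticommutes with the parity of the degree.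
    have h := K.homog.comp_sign_odd odd_one
    simp only [Preadditive.comp_add, Preadditive.add_comp, ← tmap_comp, K.d_d, L.d_d, h,
      Category.comp_id, Category.id_comp, tmap_zero_left, tmap_zero_right, tmap_neg_left]
    simp

variable {F} {K K' : DG b C} {L L' : DG b D}

/-- The functoriality of the total complex. -/
def tensorMap (f : K ⟶ K') (g : L ⟶ L') : tensor F K L ⟶ tensor F K' L' where
  f := tmap F f.f g.f
  homog := f.homog.tmap g.homog (by simp)
  comm := by
    change tmap F f.f g.f ≫ (tmap F K'.d (𝟙 L'.obj) + tmap F (sign K'.deg) L'.d) =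
      (tmap F K.d (𝟙 L.obj) + tmap F (sign K.deg) L.d) ≫ tmap F f.f g.f
    simp only [Preadditive.comp_add, Preadditive.add_comp, ← tmap_comp, f.comm, g.comm,
      f.homog.comp_sign_even Even.zero, Category.comp_id, Category.id_comp]

/-- The functoriality of the total complex. -/
def tensorIso (f : K ≅ K') (g : L ≅ L') : tensor F K L ≅ tensor F K' L' where
  hom := tensorMap f.hom g.hom
  inv := tensorMap f.inv g.inv
  hom_inv_id := hom_ext ((tmap_comp F _ _ _ _).symm.trans
    ((congrArg₂ (tmap F) (congrArg Hom.f f.hom_inv_id) (congrArg Hom.f g.hom_inv_id)).trans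
      (tmap_id F)))
  inv_hom_id := hom_ext ((tmap_comp F _ _ _ _).symm.trans
    ((congrArg₂ (tmap F) (congrArg Hom.f f.inv_hom_id) (congrArg Hom.f g.inv_hom_id)).trans
      (tmap_id F)))

/-- Multiplication by a sign. -/
def signIso (u : ℤˣ) (X : E) : X ≅ X where
  hom := u • 𝟙 X
  inv := u • 𝟙 X
  hom_inv_id := by rw [Linear.units_smul_comp, Category.id_comp, smul_smul, Int.units_mul_self, one_smul]
  inv_hom_id := by rw [Linear.units_smul_comp, Category.id_comp, smul_smul, Int.units_mul_self, one_smul]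

lemma sign_val {M : MatClosure b E} (δ : M.ι → ℤ) (i j : M.ι) :
    (sign δ).1 i j = (δ i).negOnePow • delta M.X i j := by
  rw [← Category.comp_id (sign δ), sign_comp_val, id_val]

lemma biMap_units_smul_left {X X' : C} {Y Y' : D} (r : ℤˣ) (f : X ⟶ X') (g : Y ⟶ Y') :
    biMap F (r • f) g = r • biMap F f g := biMap_zsmul_left F _ _ _

variable (F K L) in
/-- The total complexes of `F(K, L)` and of the bifunctor with interchanged arguments. -/
def tensorFlip [∀ Y, (F.flip.flip.obj Y).Additive] : tensor F K L ≅ tensor F.flip L K :=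
  isoMk (diagIso (M := tobj F K.obj L.obj) (N := tobj F.flip L.obj K.obj) (Equiv.prodComm _ _)
      fun p => signIso (K.deg p.1 * L.deg p.2).negOnePow _)
    (.diagMap fun p => by change L.deg p.2 + K.deg p.1 = K.deg p.1 + L.deg p.2 + 0; ring)
    (.diagMap fun p => by change K.deg p.2 + L.deg p.1 = L.deg p.1 + K.deg p.2 + 0; ring) (by
      refine MatClosure.hom_ext ?_
      rintro ⟨k, l⟩ p
      obtain ⟨⟨k', l'⟩, rfl⟩ := (Equiv.prodComm K.obj.ι L.obj.ι).surjective p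
      refine (diagMap_comp_val (M := tobj F K.obj L.obj) (N := tobj F.flip L.obj K.obj)
        (Equiv.prodComm _ _) _ (tensor F.flip L K).d (k, l) (l', k')).trans
        (Eq.trans ?_ (comp_diagMap_val (M := tobj F K.obj L.obj) (N := tobj F.flip L.obj K.obj)
          (Equiv.prodComm _ _) _ (tensor F K L).d (k, l) (k', l')).symm)
      change ((K.deg k * L.deg l).negOnePow • 𝟙 _) ≫ (biMap F.flip (L.d.1 l l') (delta K.obj.X k k')
          + biMap F.flip ((sign L.deg).1 l l') (K.d.1 k k')) =
        (biMap F (K.d.1 k k') (delta L.obj.X l l') + biMap F ((sign K.deg).1 k k') (L.d.1 l l')) ≫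
          ((K.deg k' * L.deg l').negOnePow • 𝟙 _)
      rw [Linear.units_smul_comp, Category.id_comp, Linear.comp_units_smul, Category.comp_id,
        sign_val, sign_val, biMap_units_smul_left, biMap_units_smul_left, biMap_flip, biMap_flip,
        smul_add, smul_add, smul_smul, smul_smul, add_comm]
      -- A nonzero entry raises the degree of one factor by one. The interchange sign `(-1)^(deg k ·
      -- deg l)` then changes by the parity of the other factor, which is the sign in one of the two
      -- differentials.
      congr 1
      · by_cases h : K.d.1 k k' = 0
        · rw [h, biMap_zero_left, smul_zero, smul_zero]
        · by_cases h' : l = l'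
          · subst h'
            rw [K.homog k k' h, add_mul, one_mul, Int.negOnePow_add]
          · rw [delta_of_ne _ h', biMap_zero_right, smul_zero, smul_zero]
      · by_cases h : L.d.1 l l' = 0
        · rw [h, biMap_zero_right, smul_zero, smul_zero]
        · by_cases h' : k = k'
          · subst h'
            rw [L.homog l l' h, mul_add, mul_one, Int.negOnePow_add, mul_assoc, Int.units_mul_self,
              mul_one]
          · rw [delta_of_ne _ h', biMap_zero_left, smul_zero, smul_zero])

end Tensor

variable (F : C ⥤ C ⥤ C) [∀ Y, (F.flip.obj Y).Additive] [∀ X, (F.obj X).Additive]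
  (K L M : DG b C)

/-- Both differentials are the sum of the same three terms, with `d` in one factor and parity signs
on the factors before it; `A` carries each term to its counterpart. -/
lemma tensorAssoc_comm (A : tobj F (tobj F K.obj L.obj) M.obj ⟶ tobj F K.obj (tobj F L.obj M.obj))
    (hA : ∀ f g h, A ≫ tmap F f (tmap F g h) = tmap F (tmap F f g) h ≫ A) :
    A ≫ (tensor F K (tensor F L M)).d = (tensor F (tensor F K L) M).d ≫ A := by
  have h₁ : (tensor F K (tensor F L M)).d = tmap F K.d (tmap F (𝟙 _) (𝟙 _)) +
      (tmap F (sign K.deg) (tmap F L.d (𝟙 _)) + tmap F (sign K.deg) (tmap F (sign L.deg) M.d)) :=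
    congrArg₂ (· + ·) (congrArg (tmap F K.d) (tmap_id F).symm) (tmap_add_right F _ _ _)
  have h₂ : (tensor F (tensor F K L) M).d = tmap F (tmap F K.d (𝟙 _)) (𝟙 _) +
      tmap F (tmap F (sign K.deg) L.d) (𝟙 _) + tmap F (tmap F (sign K.deg) (sign L.deg)) M.d :=
    congrArg₂ (· + ·) (tmap_add_left F _ _ _)
      (congrArg (fun s => tmap F s M.d) (tmap_sign K.deg L.deg).symm)
  have main : A ≫ (tmap F K.d (tmap F (𝟙 L.obj) (𝟙 M.obj)) +
      (tmap F (sign K.deg) (tmap F L.d (𝟙 M.obj)) + tmap F (sign K.deg) (tmap F (sign L.deg) M.d)))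
      = (tmap F (tmap F K.d (𝟙 L.obj)) (𝟙 M.obj) + tmap F (tmap F (sign K.deg) L.d) (𝟙 M.obj) +
        tmap F (tmap F (sign K.deg) (sign L.deg)) M.d) ≫ A := by
    simp only [Preadditive.comp_add, Preadditive.add_comp, hA, add_assoc]
  exact (congrArg (A ≫ ·) h₁).trans (main.trans (congrArg (· ≫ A) h₂.symm))

/-- The associativity of the total complex. -/
def tensorAssoc (α : ∀ X Y Z, (F.obj ((F.obj X).obj Y)).obj Z ≅ (F.obj X).obj ((F.obj Y).obj Z))
    (nat : ∀ {X X' Y Y' Z Z'} (f : X ⟶ X') (g : Y ⟶ Y') (h : Z ⟶ Z'),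
      biMap F (biMap F f g) h ≫ (α X' Y' Z').hom = (α X Y Z).hom ≫ biMap F f (biMap F g h)) :
    tensor F (tensor F K L) M ≅ tensor F K (tensor F L M) :=
  isoMk (diagIso (M := tobj F (tobj F K.obj L.obj) M.obj) (N := tobj F K.obj (tobj F L.obj M.obj))
      (Equiv.prodAssoc _ _ _) fun p => α _ _ _)
    (.diagMap fun p => by
      change K.deg p.1.1 + (L.deg p.1.2 + M.deg p.2) = K.deg p.1.1 + L.deg p.1.2 + M.deg p.2 + 0
      ring)
    (.diagMap fun p => by
      change K.deg p.1 + L.deg p.2.1 + M.deg p.2.2 = K.deg p.1 + (L.deg p.2.1 + M.deg p.2.2) + 0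
      ring)
    (tensorAssoc_comm F K L M _ fun f g h => by
      refine MatClosure.hom_ext fun p q => ?_
      obtain ⟨q, rfl⟩ := (Equiv.prodAssoc K.obj.ι L.obj.ι M.obj.ι).surjective q
      refine (diagMap_comp_val (M := tobj F (tobj F K.obj L.obj) M.obj)
        (N := tobj F K.obj (tobj F L.obj M.obj)) (Equiv.prodAssoc _ _ _) _ _ p _).trans
        (Eq.trans ?_ (comp_diagMap_val (M := tobj F (tobj F K.obj L.obj) M.obj)
          (N := tobj F K.obj (tobj F L.obj M.obj)) (Equiv.prodAssoc _ _ _) _ _ p q).symm)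
      exact (nat _ _ _).symm)

/-- An object, as a complex in degree `0`. -/
def single (X : C) : DG b C where
  obj := ⟨Unit, fun _ => X⟩
  deg _ := 0
  d := 0
  homog := .zero
  d_d := comp_zero

/-- The unitality of the total complex. -/
def tensorUnit {X : C} (lam : F.obj X ≅ 𝟭 C) : tensor F (single X) K ≅ K :=
  isoMk (diagIso (M := tobj F (single (b := b) X).obj K.obj) (Equiv.punitProd _)
      fun p => lam.app (K.obj.X p.2))
    (.diagMap fun p => by change K.deg p.2 = 0 + K.deg p.2 + 0; ring)
    (.diagMap fun p => by change 0 + K.deg p = K.deg p + 0; ring) (by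
      refine MatClosure.hom_ext ?_
      rintro ⟨u, p⟩ q
      have hs : (sign (M := (single (b := b) X).obj) fun _ => 0).1 () () = 𝟙 X :=
        (sign_val (M := (single (b := b) X).obj) (fun _ => 0) () ()).trans
          ((congrArg (· • _) Int.negOnePow_zero).trans ((one_smul _ _).trans
            (delta_self (single (b := b) X).obj.X ())))
      have h : biMap F (X := X) (X' := X) 0 (delta K.obj.X p q) + biMap F (X := X) (X' := X)
          ((sign (M := (single (b := b) X).obj) fun _ => 0).1 () ()) (K.d.1 p q) =
            (F.obj X).map (K.d.1 p q) := by
        rw [biMap_zero_left, zero_add, ← biMap_id_left]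
        exact congrArg (biMap F · _) hs
      refine (diagMap_comp_val (M := tobj F (single (b := b) X).obj K.obj) (N := K.obj)
        (Equiv.punitProd _) _ _ (u, p) q).trans (Eq.trans ?_ (comp_diagMap_val (N := K.obj)
          (M := tobj F (single (b := b) X).obj K.obj) (Equiv.punitProd _) _
            (tensor F (single X) K).d (u, p) ((), q)).symm)
      exact (lam.hom.naturality _).symm.trans (congrArg (· ≫ lam.hom.app _) h.symm))

end DG
end BarNatan

namespace BarNatan
open MatClosure

namespace DG

variable {C D E : Type} [SmallCategory C] [SmallCategory D] [SmallCategory E] [Preadditive C]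
  [Preadditive D] [Preadditive E] {b : Bool}

/-! ### Contractions -/

/-- The image of `P` under the functor `G` has a contracting homotopy. -/
def Contr (P : DG b C) (G : C ⥤ D) [G.Additive] : Prop :=
  ∃ h : fobj G P.obj ⟶ fobj G P.obj,
    Homog (M := fobj G P.obj) (N := fobj G P.obj) P.deg P.deg (-1) h ∧
      fmap G P.d ≫ h + h ≫ fmap G P.d = 𝟙 _

namespace Contr

variable {P : DG b C}

lemma comp {G : C ⥤ D} [G.Additive] (h : Contr P G) (T : D ⥤ E) [T.Additive] :
    Contr P (G ⋙ T) := by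
  obtain ⟨h, h₁, h₂⟩ := h
  refine ⟨fmap T h, h₁.fmap, ?_⟩
  have := congrArg (fmap T) h₂
  rw [fmap_add, fmap_comp, fmap_comp, fmap_id] at this
  exact this

/-- The contraction is the sum of `f k ≫ h k ≫ g k`. Naturality moves the differential past `f` and
`g`, leaving the sum of the `f k ≫ g k`; orthogonality plays no role. -/
lemma of_sum {G : C ⥤ D} [G.Additive] {κ : Type} [Fintype κ] (G' : κ → C ⥤ D)
    [∀ k, (G' k).Additive] (f : ∀ k, G ⟶ G' k) (g : ∀ k, G' k ⟶ G)
    (fg : ∀ X, ∑ k, (f k).app X ≫ (g k).app X = 𝟙 (G.obj X)) (h : ∀ k, Contr P (G' k)) :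
    Contr P G := by
  choose h h₁ h₂ using h
  refine ⟨∑ k, natMap (f k) P.obj ≫ h k ≫ natMap (g k) P.obj, Homog.sum _ fun k _ =>
    (Homog.natMap (f k)).comp' ((h₁ k).comp' (Homog.natMap (g k)) (add_zero _)) (zero_add _), ?_⟩
  have key : ∑ k, natMap (f k) P.obj ≫ natMap (g k) P.obj = 𝟙 (fobj G P.obj) := by
    ext i j
    rw [sum_val, id_val]
    by_cases hij : i = j
    · subst hij
      rw [delta_self, ← fg]
      refine Finset.sum_congr rfl fun k _ => ?_
      rw [natMap_comp_val]
      exact congrArg _ (diagMap_val (M := fobj (G' k) P.obj) (N := fobj G P.obj)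
        (Equiv.refl _) _ i)
    · rw [delta_of_ne _ hij]
      refine Finset.sum_eq_zero fun k _ => ?_
      rw [natMap_comp_val]
      exact (congrArg _ (diagMap_val_of_ne (M := fobj (G' k) P.obj) (N := fobj G P.obj)
        (Equiv.refl _) _ hij)).trans comp_zero
  rw [Preadditive.comp_sum, Preadditive.sum_comp, ← Finset.sum_add_distrib, ← key]
  refine Finset.sum_congr rfl fun k _ => ?_
  rw [← Category.assoc, natMap_naturality, Category.assoc, Category.assoc, Category.assoc,
    ← natMap_naturality, ← Preadditive.comp_add, ← Category.assoc, ← Category.assoc,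
    ← Preadditive.add_comp, h₂, Category.id_comp]

lemma of_iso {G G' : C ⥤ D} [G.Additive] [G'.Additive] (e : G ≅ G') (h : Contr P G') :
    Contr P G :=
  of_sum (κ := Unit) (fun _ => G') (fun _ => e.hom) (fun _ => e.inv) (by simp) fun _ => h

/-- Contractibility of stacking an object with `P` passes to sums of objects, so it need only be
checked on the diagrams of a decomposition. -/
lemma of_splits {S : D → Prop} {T : D ⥤ C ⥤ E} [∀ X, (T.obj X).Additive]
    [∀ Y, (T.flip.obj Y).Additive] {X : D} (h : Splits S X)
    (hS : ∀ Y, S Y → Contr P (T.obj Y)) : Contr P (T.obj X) := by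
  induction h with
  | of h => exact hS _ h
  | sum ι Y f g gf fg _ ih =>
    refine of_sum (fun i => T.obj (Y i)) (fun i => T.map (f i)) (fun i => T.map (g i))
      (fun Z => ?_) ih
    simp_rw [← NatTrans.comp_app, ← T.map_comp]
    exact ((T.flip.obj Z).map_sum _ _).symm.trans
      ((congrArg (T.flip.obj Z).map fg).trans ((T.flip.obj Z).map_id _))

end Contr

/-! ### Absorption -/

/-- The properties of a projector that are used for the absorption of objects on the left of it:
`X` is the part of degree `0` of `P`, and `P` is contracted by the rest of `P`. -/
structure Absorbing (F : C ⥤ C ⥤ C) [∀ X, (F.obj X).Additive] (X : C) (P : DG b C) : Prop where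
  bounded : Bounded P.obj P.deg
  retract : ∃ (i : (single (b := b) X).obj ⟶ P.obj) (p : P.obj ⟶ (single (b := b) X).obj),
    Homog (single (b := b) X).deg P.deg 0 i ∧ Homog P.deg (single (b := b) X).deg 0 p ∧
      i ≫ p = 𝟙 _ ∧ p ≫ i = scal fun x => if P.deg x = 0 then 1 else 0
  contr : ∀ x, P.deg x ≠ 0 → ∀ Y, Contr P (F.obj ((F.obj (P.obj.X x)).obj Y))

namespace Absorbing

variable {F : C ⥤ C ⥤ C} [∀ X, (F.obj X).Additive] [∀ Y, (F.flip.obj Y).Additive] {X : C}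
  {P : DG b C}

variable (F P) in
/-- The projection to the part where the first factor has degree `0`. -/
def zeroPart (A : DG b C) : (tensor F (tensor F P A) P).obj ⟶ (tensor F (tensor F P A) P).obj :=
  tmap F (tmap F (scal fun x => if P.deg x = 0 then 1 else 0) (𝟙 _)) (𝟙 _)

/-- On each block where the first factor has nonzero degree a contraction of the last factor is
chosen, without compatibility with the differential of `P ⊗ A`. The resulting error lowers the
degree of the last factor, so one plus or minus it is invertible by a geometric series, also for
unbounded `A`. -/
lemma exists_homotopy (hP : Absorbing F X P) (A : DG b C) :
    ∃ h V : (tensor F (tensor F P A) P).obj ⟶ (tensor F (tensor F P A) P).obj,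
      Homog (tensor F (tensor F P A) P).deg (tensor F (tensor F P A) P).deg (-1) h ∧
      Homog (tensor F (tensor F P A) P).deg (tensor F (tensor F P A) P).deg 0 V ∧
      zeroPart F P A ≫ h = 0 ∧ h ≫ zeroPart F P A = 0 ∧
      (zeroPart F P A + (tensor F (tensor F P A) P).d ≫ h + h ≫ (tensor F (tensor F P A) P).d) ≫ V
        = 𝟙 _ ∧
      V ≫ (zeroPart F P A + (tensor F (tensor F P A) P).d ≫ h + h ≫ (tensor F (tensor F P A) P).d)
        = 𝟙 _ := by
  set T := tobj F P.obj A.obj with hT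
  let G : T.ι → C ⥤ C := fun k => F.obj (T.X k)
  let e : T.ι → ℤ := fun k => if P.deg k.1 = 0 then 1 else 0
  have hG : ∀ k, ∃ h : fobj (G k) P.obj ⟶ fobj (G k) P.obj,
      Homog (M := fobj (G k) P.obj) (N := fobj (G k) P.obj) P.deg P.deg (-1) h ∧
        e k • h = 0 ∧ fmap (G k) P.d ≫ h + h ≫ fmap (G k) P.d = (1 - e k) • 𝟙 _ := by
    intro k
    by_cases hk : P.deg k.1 = 0
    · exact ⟨0, .zero, smul_zero _, by simp [e, hk]⟩
    · obtain ⟨h, h₁, h₂⟩ := hP.contr k.1 hk (A.obj.X k.2)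
      exact ⟨h, h₁, by simp [e, hk], by simpa [e, hk] using h₂⟩
  choose h h₁ h₂ h₃ using hG
  -- The differential of the last factor carries the parity of the block. The homotopy gets the same
  -- sign, and the signs cancel in the products.
  let ε : T.ι → ℤ := fun k => ((P.deg k.1 + A.deg k.2).negOnePow : ℤ)
  have hε : ∀ k, ε k * ε k = 1 := fun k => by
    simp only [ε]
    rw [← Units.val_mul, Int.units_mul_self, Units.val_one]
  let H : tobj F T P.obj ⟶ tobj F T P.obj := blockDiag (G := G) fun k => ε k • h k
  let D₁ : tobj F T P.obj ⟶ tobj F T P.obj := tmap F (tensor F P A).d (𝟙 P.obj)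
  let D₂ : tobj F T P.obj ⟶ tobj F T P.obj := tmap F (sign (tensor F P A).deg) P.d
  have hD₂ : D₂ = blockDiag (G := G) fun k => ε k • fmap (G k) P.d :=
    tmap_scal F (M := T) ε P.d
  let Z : tobj F T P.obj ⟶ tobj F T P.obj := zeroPart F P A
  have hZ : Z = blockDiag (G := G) fun k => e k • 𝟙 _ := by
    refine (congrArg (tmap F · (𝟙 P.obj)) (tmap_scal_id F _)).trans
      ((tmap_scal F (M := T) e (𝟙 P.obj)).trans ?_)
    exact congrArg blockDiag (funext fun k => congrArg (e k • ·) (fmap_id (G k)))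
  -- For the differential of the last factor alone the homotopy identity is exact, since it can be
  -- checked on the blocks.
  have hDH : Z + (D₂ ≫ H + H ≫ D₂) = 𝟙 (tobj F T P.obj) := by
    rw [hD₂, hZ, blockDiag_comp, blockDiag_comp, blockDiag_add, blockDiag_add]
    refine Eq.trans (congrArg blockDiag (funext fun k => ?_)) blockDiag_id
    rw [Preadditive.zsmul_comp, Preadditive.zsmul_comp, Preadditive.comp_zsmul,
      Preadditive.comp_zsmul, smul_smul, smul_smul, hε, one_smul, one_smul, h₃, ← add_smul]
    simp
  -- Only the degree of the last factor counts here: `D₁` preserves it and `H` lowers it by one, so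
  -- `N` has degree `-1` for this grading and degree `0` for the total one.
  let δ : (tobj F T P.obj).ι → ℤ := fun q => P.deg q.2
  let N : tobj F T P.obj ⟶ tobj F T P.obj := -(D₁ ≫ H + H ≫ D₁)
  have hHδ : Homog δ δ (-1) H := .blockDiag fun k i j hij => h₁ k i j fun h' => hij (by
    refine (map_zsmul (entry (fobj (G k) P.obj) (fobj (G k) P.obj) i j) (ε k) (h k)).trans ?_
    exact (congrArg _ h').trans (smul_zero _))
  have hH : Homog (tensor F (tensor F P A) P).deg (tensor F (tensor F P A) P).deg (-1) H :=
    .blockDiag fun k i j hij => by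
      have := h₁ k i j fun h' => hij (by
        refine (map_zsmul (entry (fobj (G k) P.obj) (fobj (G k) P.obj) i j) (ε k) (h k)).trans ?_
        exact (congrArg _ h').trans (smul_zero _))
      change (tensor F P A).deg k + P.deg j = (tensor F P A).deg k + P.deg i + -1
      omega
  have hD₁δ : Homog δ δ 0 D₁ := fun p q hpq =>
    (Homog.id (M := P.obj) (δ := P.deg)) p.2 q.2 (tmap_ne_zero hpq).2
  have hD₁ : Homog (tensor F (tensor F P A) P).deg (tensor F (tensor F P A) P).deg 1 D₁ :=
    (tensor F P A).homog.tmap Homog.id (by simp)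
  have hNδ : Homog δ δ (-1) N := ((hD₁δ.comp' hHδ (by simp)).add (hHδ.comp' hD₁δ (by simp))).neg
  have hN : Homog (tensor F (tensor F P A) P).deg (tensor F (tensor F P A) P).deg 0 N :=
    ((hD₁.comp' hH (by simp)).add (hH.comp' hD₁ (by simp))).neg
  have hδ : Bounded (tobj F T P.obj) δ := by
    have := hP.bounded
    cases b
    · exact fun p hp => (F.obj _).map_isZero (this p.2 hp)
    · exact fun p hp => (F.obj _).map_isZero (this p.2 hp)
  have hU : Z + (D₁ + D₂) ≫ H + H ≫ (D₁ + D₂) = 𝟙 (tobj F T P.obj) - N := by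
    rw [← hDH, Preadditive.add_comp, Preadditive.comp_add]
    simp only [N]
    abel
  refine ⟨H, geom δ N, hH, hN.geom, ?_, ?_, ?_, ?_⟩
  · refine (congrArg (· ≫ H) hZ).trans ((blockDiag_comp _ _).trans (Eq.trans (congrArg blockDiag (funext fun k => ?_))
      blockDiag_zero))
    rw [Preadditive.zsmul_comp, Category.id_comp, smul_comm, h₂, smul_zero]
  · refine (congrArg (H ≫ ·) hZ).trans ((blockDiag_comp _ _).trans (Eq.trans (congrArg blockDiag (funext fun k => ?_))
      blockDiag_zero))
    rw [Preadditive.comp_zsmul, Category.comp_id, smul_comm, h₂, smul_zero]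
  · exact (congrArg (· ≫ geom δ N) hU).trans (comp_geom hδ hNδ)
  · exact (congrArg (geom δ N ≫ ·) hU).trans (geom_comp hδ hNδ)

/-- Tensoring on the left with an absorbing complex does not change complexes of the form
`A ⊗ P`, up to homotopy equivalence. -/
lemma absorb (hP : Absorbing F X P) (lam : F.obj X ≅ 𝟭 C) (A : DG b C) :
    Nonempty (DefRetract (tensor F A P) (tensor F (tensor F P A) P)) := by
  obtain ⟨i, p, hi, hp, ip, pi⟩ := hP.retract
  obtain ⟨h, V, hh, hV, zh, hz, UV, VU⟩ := hP.exists_homotopy A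
  let u := tensorUnit F A lam
  let v : A.obj ⟶ tobj F (single X).obj A.obj := u.inv.f
  let w : tobj F (single X).obj A.obj ⟶ A.obj := u.hom.f
  have huv : v ≫ w = 𝟙 _ := congrArg Hom.f u.inv_hom_id
  have hvu : w ≫ v = 𝟙 _ := congrArg Hom.f u.hom_inv_id
  let φ₀ : A.obj ⟶ tobj F P.obj A.obj := v ≫ tmap F i (𝟙 A.obj)
  let ρ₀ : tobj F P.obj A.obj ⟶ A.obj := tmap F p (𝟙 A.obj) ≫ w
  have hφ₀ : Homog A.deg (tensor F P A).deg 0 φ₀ :=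
    u.inv.homog.comp' (hi.tmap (F := F) (Homog.id (δ := A.deg)) (t := 0) (by simp)) (by simp)
  have hρ₀ : Homog (tensor F P A).deg A.deg 0 ρ₀ :=
    (hp.tmap (F := F) (Homog.id (δ := A.deg)) (t := 0) (by simp)).comp' u.hom.homog (by simp)
  have h₁ : φ₀ ≫ ρ₀ = 𝟙 A.obj := by
    have : tmap F i (𝟙 A.obj) ≫ tmap F p (𝟙 A.obj) = 𝟙 _ := by
      rw [← tmap_comp, ip, Category.comp_id, tmap_id]
    rw [Category.assoc, ← Category.assoc (tmap F i _), this, Category.id_comp, huv]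
  have h₂ : ρ₀ ≫ φ₀ = tmap F (scal fun x => if P.deg x = 0 then 1 else 0) (𝟙 A.obj) := by
    rw [Category.assoc, ← Category.assoc w, hvu, Category.id_comp, ← tmap_comp, pi,
      Category.comp_id]
  let φ : (tensor F A P).obj ⟶ (tensor F (tensor F P A) P).obj := tmap F φ₀ (𝟙 P.obj)
  let ρ : (tensor F (tensor F P A) P).obj ⟶ (tensor F A P).obj := tmap F ρ₀ (𝟙 P.obj)
  have hφρ : φ ≫ ρ = 𝟙 _ :=
     (tmap_comp F φ₀ ρ₀ (𝟙 P.obj) (𝟙 P.obj)).symm.trans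
      ((congrArg₂ (tmap F) h₁ (Category.comp_id _)).trans (tmap_id F))
  have hρφ : ρ ≫ φ = zeroPart F P A :=
     (tmap_comp F ρ₀ φ₀ (𝟙 P.obj) (𝟙 P.obj)).symm.trans
      (congrArg₂ (tmap F) h₂ (Category.comp_id _))
  have hφ : Homog (tensor F A P).deg (tensor F (tensor F P A) P).deg 0 φ :=
    hφ₀.tmap Homog.id (by simp)
  have hρ : Homog (tensor F (tensor F P A) P).deg (tensor F A P).deg 0 ρ :=
    hρ₀.tmap Homog.id (by simp)
  rw [← hρφ] at UV VU
  cases b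
  -- For products the degrees are nonpositive, so degree `0` is the last one and its part is a
  -- subcomplex: the inclusion is a chain map, the projection need not be.
  · have hid : i ≫ P.d = 0 := by
      ext x y
      by_contra H
      have := (hi.comp P.homog) x y H
      exact H ((hP.bounded y (by
        change P.deg y = 0 + (0 + 1) at this
        omega)).eq_of_tgt _ _)
    let i' : single X ⟶ P := ⟨i, hi, by rw [hid]; exact zero_comp.symm⟩
    let φ' : tensor F A P ⟶ tensor F (tensor F P A) P :=
      tensorMap (u.inv ≫ tensorMap i' (𝟙 A)) (𝟙 P)
    refine ⟨DefRetract.ofInclusion φ' ρ h V hρ hh hV hφρ ?_ UV VU⟩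
    have : φ ≫ zeroPart F P A = φ := by
      rw [← hρφ, ← Category.assoc, hφρ, Category.id_comp]
    change φ ≫ h = 0
    rw [← this, Category.assoc, zh, comp_zero]
  -- For sums the degrees are nonnegative, so degree `0` is the first one and its part is a quotient
  -- complex: now the projection is a chain map.
  · have hpd : P.d ≫ p = 0 := by
      ext x y
      by_contra H
      have := (P.homog.comp hp) x y H
      exact H ((hP.bounded x (by
        change 0 = P.deg x + (1 + 0) at this
        omega)).eq_of_src _ _)
    let p' : P ⟶ single X := ⟨p, hp, by rw [hpd]; exact comp_zero⟩
    let ρ' : tensor F (tensor F P A) P ⟶ tensor F A P :=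
      tensorMap (tensorMap p' (𝟙 A) ≫ u.hom) (𝟙 P)
    refine ⟨DefRetract.ofProjection φ ρ' h V hφ hh hV hφρ ?_ UV VU⟩
    have : zeroPart F P A ≫ ρ = ρ := by
      rw [← hρφ, Category.assoc, hφρ, Category.comp_id]
    change h ≫ ρ = 0
    rw [← this, ← Category.assoc, hz, zero_comp]

end Absorbing

end DG
end BarNatan

namespace BarNatan
namespace MatClosure

variable {C : Type} [SmallCategory C] [Preadditive C] {b : Bool} {M N K : MatClosure b C}

/-! ### Parts of formal sums and products -/

/-- The projection to a part of a formal sum or product. -/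
def pick (e : N.ι → M.ι) (he : e.Injective) (u : ∀ j, M.X (e j) ⟶ N.X j) : M ⟶ N :=
  ⟨fun i j => delta M.X i (e j) ≫ u j, mem_matrices
    (fun i => ((Set.finite_singleton i).preimage he.injOn).subset fun j hj => by
      by_contra h
      exact hj (by rw [delta_of_ne _ fun e => h e.symm, zero_comp]))
    (fun j => (Set.finite_singleton (e j)).subset fun i hi => by
      by_contra h
      exact hi (by rw [delta_of_ne _ h, zero_comp]))⟩

/-- The inclusion of a part of a formal sum or product. -/
def put (e : N.ι → M.ι) (he : e.Injective) (u : ∀ j, N.X j ⟶ M.X (e j)) : N ⟶ M :=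
  ⟨fun j i => u j ≫ delta M.X (e j) i, mem_matrices
    (fun j => (Set.finite_singleton (e j)).subset fun i hi => by
      by_contra h
      exact hi (by rw [delta_of_ne _ fun e => h e.symm, comp_zero]))
    (fun i => ((Set.finite_singleton i).preimage he.injOn).subset fun j hj => by
      by_contra h
      exact hj (by rw [delta_of_ne _ h, comp_zero]))⟩

variable {e : N.ι → M.ι} {he : e.Injective}

lemma comp_pick_val {u : ∀ j, M.X (e j) ⟶ N.X j} (f : K ⟶ M) (i : K.ι) (j : N.ι) :
    (f ≫ pick e he u).1 i j = f.1 i (e j) ≫ u j := by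
  rw [comp_val, finsum_eq_single _ (e j)]
  · change f.1 i (e j) ≫ delta M.X (e j) (e j) ≫ u j = _
    rw [delta_self, Category.id_comp]
  · intro k hk
    change f.1 i k ≫ delta M.X k (e j) ≫ u j = 0
    rw [delta_of_ne _ hk, zero_comp, comp_zero]

lemma put_comp_val {u : ∀ j, N.X j ⟶ M.X (e j)} (g : M ⟶ K) (j : N.ι) (k : K.ι) :
    (put e he u ≫ g).1 j k = u j ≫ g.1 (e j) k := by
  rw [comp_val, finsum_eq_single _ (e j)]
  · change (u j ≫ delta M.X (e j) (e j)) ≫ g.1 (e j) k = _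
    rw [delta_self, Category.comp_id]
  · intro i hi
    change (u j ≫ delta M.X (e j) i) ≫ g.1 i k = 0
    rw [delta_of_ne _ hi.symm, comp_zero, zero_comp]

/-- The part of degree `k`. -/
abbrev degPart (M : MatClosure b C) (δ : M.ι → ℤ) (k : ℤ) : MatClosure b C :=
  ⟨{i : M.ι // δ i = k}, fun i => M.X i.1⟩

/-- The restriction of a matrix to parts of given degrees. -/
def part (f : M ⟶ N) (δ : M.ι → ℤ) (ε : N.ι → ℤ) (k l : ℤ) : degPart M δ k ⟶ degPart N ε l :=
  put (M := M) (N := degPart M δ k) Subtype.val Subtype.val_injective (fun _ => 𝟙 _) ≫ f ≫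
    pick (M := N) (N := degPart N ε l) Subtype.val Subtype.val_injective (fun _ => 𝟙 _)

variable {δ : M.ι → ℤ} {ε : N.ι → ℤ} {ζ : K.ι → ℤ}

lemma part_val (f : M ⟶ N) (k l : ℤ) (i : {i // δ i = k}) (j : {j // ε j = l}) :
    (part f δ ε k l).1 i j = f.1 i.1 j.1 := by
  refine (put_comp_val (M := M) (N := degPart M δ k) (u := fun _ => 𝟙 _)
    (f ≫ pick (M := N) (N := degPart N ε l) Subtype.val Subtype.val_injective fun _ => 𝟙 _)
      i j).trans ((Category.id_comp _).trans ?_)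
  exact (comp_pick_val (M := N) (N := degPart N ε l) (u := fun _ => 𝟙 _) f i.1 j).trans (Category.comp_id _)

/-- By homogeneity of `f` the intermediate indices of other degrees contribute nothing to the
composite, so restricting the middle object to degree `l` loses no terms. -/
lemma part_comp_left {f : M ⟶ N} (g : N ⟶ K) {r k l : ℤ} (m : ℤ) (hf : Homog δ ε r f)
    (h : k + r = l) : part f δ ε k l ≫ part g ε ζ l m = part (f ≫ g) δ ζ k m := by
  refine MatClosure.hom_ext fun i j => ?_
  refine Eq.trans ?_ (part_val _ _ _ i j).symm
  rw [comp_val, comp_val]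
  simp only [part_val]
  refine (finsum_subtype_eq_finsum_cond (f := fun x => f.1 i.1 x ≫ g.1 x j.1)
    fun x => ε x = l).trans (finsum_congr fun x => ?_)
  by_cases hx : ε x = l
  · classical exact finsum_eq_if.trans (if_pos hx)
  · have : f.1 i.1 x = 0 := by
      by_contra H
      exact hx ((hf _ _ H).trans (by rw [i.2, h]))
    rw [this, zero_comp]
    exact finsum_zero

lemma part_id (k : ℤ) : part (𝟙 M) δ δ k k = 𝟙 (degPart M δ k) := by
  refine MatClosure.hom_ext fun i j => ?_
  rw [part_val, id_val, id_val]
  by_cases h : i = j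
  · subst h
    rw [delta_self, delta_self]
  · rw [delta_of_ne _ h, delta_of_ne _ fun h' => h (Subtype.ext h')]

lemma part_add (f g : M ⟶ N) (k l : ℤ) :
    part (f + g) δ ε k l = part f δ ε k l + part g δ ε k l := by
  rw [part, Preadditive.add_comp, Preadditive.comp_add]; rfl

lemma part_zero (k l : ℤ) : part (0 : M ⟶ N) δ ε k l = 0 := by
  rw [part, zero_comp, comp_zero]

lemma part_eq_zero {f : M ⟶ N} {r k l : ℤ} (hf : Homog δ ε r f) (h : k + r ≠ l) :
    part f δ ε k l = 0 := by
  refine MatClosure.hom_ext fun i j => ?_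
  rw [part_val]
  by_contra H
  have := hf _ _ H
  have := i.2
  have := j.2
  exact h (by omega)

end MatClosure

open MatClosure

/-! ### Realization as chain complexes and the commuting rule -/

namespace DG

variable {C : Type} [SmallCategory C] [Preadditive C] {b : Bool}

/-- The chain complex of the parts of all degrees. -/
def real : DG b C ⥤ CochainComplex (MatClosure b C) ℤ where
  obj K :=
    { X k := degPart K.obj K.deg k
      d k l := part K.d K.deg K.deg k l
      shape k l h := part_eq_zero K.homog h
      d_comp_d' i j k hij hjk := by rw [part_comp_left K.d k K.homog hij, K.d_d, part_zero] }
  map {K L} f :=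
    { f k := part f.f K.deg L.deg k k
      comm' i j hij := by
        rw [part_comp_left L.d _ f.homog (add_zero _), part_comp_left f.f _ K.homog hij, f.comm] }
  map_id K := by ext k : 1; exact part_id k
  map_comp f g := by
    ext k : 1
    exact (part_comp_left g.f k f.homog (add_zero _)).symm

/-- Deformation retracts are homotopy equivalences. -/
def DefRetract.homotopyEquiv {K L : DG b C} (r : DefRetract K L) :
    HomotopyEquiv (real.obj K) (real.obj L) where
  hom := real.map r.i
  inv := real.map r.p
  homotopyHomInvId := Homotopy.ofEq (by rw [← real.map_comp, r.i_p, real.map_id])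
  homotopyInvHomId := Homotopy.symm
    { hom k l := part r.H L.deg L.deg k l
      zero k l h := part_eq_zero r.homog fun h' => h (by simp only [ComplexShape.up_Rel]; omega)
      comm k := by
        let h (k l : ℤ) : (real.obj L).X k ⟶ (real.obj L).X l := part r.H L.deg L.deg k l
        have h₀ : dNext k h + prevD k h = (real.obj L).d k (k + 1) ≫ h (k + 1) k +
            h k (k - 1) ≫ (real.obj L).d (k - 1) k := by
          rw [dNext_eq _ (show (ComplexShape.up ℤ).Rel k (k + 1) from rfl),
            prevD_eq _ (show (ComplexShape.up ℤ).Rel (k - 1) k by simp)]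
        have h₁ : (real.obj L).d k (k + 1) ≫ part r.H L.deg L.deg (k + 1) k =
            part (L.d ≫ r.H) L.deg L.deg k k := part_comp_left r.H k L.homog rfl
        have h₂ : part r.H L.deg L.deg k (k - 1) ≫ (real.obj L).d (k - 1) k =
            part (r.H ≫ L.d) L.deg L.deg k k := part_comp_left L.d k r.homog (by ring)
        have h₃ : (real.map r.p ≫ real.map r.i).f k = part (r.p.f ≫ r.i.f) L.deg L.deg k k :=
          part_comp_left r.i.f k r.p.homog (add_zero _)
        have h₄ : (𝟙 (real.obj L) : real.obj L ⟶ real.obj L).f k = part (𝟙 _) L.deg L.deg k k :=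
          (part_id k).symm
        refine h₄.trans (Eq.trans ?_ (congrArg₂ (· + ·) (h₀.trans (congrArg₂ (· + ·) h₁ h₂))
          h₃).symm)
        have h₅ : 𝟙 L.obj = L.d ≫ r.H + r.H ≫ L.d + r.p.f ≫ r.i.f := by
          rw [r.eq, sub_add_cancel]
        exact (congrArg (part · L.deg L.deg k k) h₅).trans ((part_add _ _ k k).trans
          (congrArg (· + _) (part_add _ _ k k))) }

/-- Isomorphic complexes are homotopy equivalent. -/
def homotopyEquivOfIso {K L : DG b C} (e : K ≅ L) : HomotopyEquiv (real.obj K) (real.obj L) :=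
  .ofIso (real.mapIso e)

/-- The commuting rule. -/
theorem Absorbing.commute {F : C ⥤ C ⥤ C} [∀ X, (F.obj X).Additive]
    [∀ Y, (F.flip.obj Y).Additive] [∀ X, (F.flip.flip.obj X).Additive] {X : C} {P : DG b C}
    (h : Absorbing F X P) (h' : Absorbing F.flip X P) (lam : F.obj X ≅ 𝟭 C)
    (lam' : F.flip.obj X ≅ 𝟭 C)
    (α : ∀ X Y Z, (F.obj ((F.obj X).obj Y)).obj Z ≅ (F.obj X).obj ((F.obj Y).obj Z))
    (nat : ∀ {X X' Y Y' Z Z'} (f : X ⟶ X') (g : Y ⟶ Y') (h : Z ⟶ Z'),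
      biMap F (biMap F f g) h ≫ (α X' Y' Z').hom = (α X Y Z).hom ≫ biMap F f (biMap F g h))
    (A : DG b C) :
    Nonempty (HomotopyEquiv (real.obj (tensor F P A)) (real.obj (tensor F A P))) := by
  obtain ⟨r⟩ := h.absorb lam A
  obtain ⟨r'⟩ := h'.absorb lam' A
  -- Interchanging the arguments turns `r'` into a retraction of `P ⊗ (A ⊗ P)` onto `P ⊗ A`. After
  -- reassociation its large complex is that of `r`, which retracts onto `A ⊗ P`.
  refine ⟨(homotopyEquivOfIso (tensorFlip F P A)).trans (r'.homotopyEquiv.trans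
    ((homotopyEquivOfIso ?_).trans r.homotopyEquiv.symm))⟩
  exact tensorIso (tensorFlip F A P).symm (Iso.refl P) ≪≫ (tensorFlip F P (tensor F A P)).symm ≪≫
    (tensorAssoc F P A P α nat).symm

end DG
end BarNatan

/-! ### Collecting a complex into one graded object, and bidegrees of total complexes -/

namespace BarNatan
namespace MatClosure

variable {C D E : Type} [SmallCategory C] [SmallCategory D] [SmallCategory E] [Preadditive C]
  [Preadditive D] [Preadditive E] {b : Bool}

section

variable {M N K : MatClosure b C}

/-- Used for composites in a collected complex, where the intermediate index must lie in one chain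
object, embedded by `e`. -/
lemma comp_val_range {f : M ⟶ N} {g : N ⟶ K} {i : M.ι} {k : K.ι} {κ : Type*} {e : κ → N.ι}
    (he : e.Injective) (h : ∀ j, f.1 i j ≠ 0 → g.1 j k ≠ 0 → j ∈ Set.range e) :
    (f ≫ g).1 i k = ∑ᶠ x, f.1 i (e x) ≫ g.1 (e x) k := by
  classical
  rw [comp_val, ← finsum_mem_range (f := fun j => f.1 i j ≫ g.1 j k) he]
  refine finsum_congr fun j => ?_
  by_cases hj : j ∈ Set.range e
  · exact (finsum_eq_if.trans (if_pos hj)).symm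
  · refine Eq.trans ?_ (finsum_eq_if.trans (if_neg hj)).symm
    by_cases hf : f.1 i j = 0
    · rw [hf, zero_comp]
    · rw [not_not.1 fun hg => hj (h j hf hg), comp_zero]

variable {e : N.ι → M.ι} {he : e.Injective}

lemma comp_put_val {u : ∀ j, N.X j ⟶ M.X (e j)} (f : K ⟶ N) (i : K.ι) (j : N.ι) :
    (f ≫ put e he u).1 i (e j) = f.1 i j ≫ u j := by
  rw [comp_val, finsum_eq_single _ j]
  · change f.1 i j ≫ u j ≫ delta M.X (e j) (e j) = _
    rw [delta_self, Category.comp_id]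
  · intro k hk
    change f.1 i k ≫ u k ≫ delta M.X (e k) (e j) = 0
    rw [delta_of_ne _ fun h => hk (he h), comp_zero, comp_zero]

lemma comp_put_val_of {u : ∀ j, N.X j ⟶ M.X (e j)} (f : K ⟶ N) (i : K.ι) {j : M.ι}
    (h : j ∉ Set.range e) : (f ≫ put e he u).1 i j = 0 := by
  refine finsum_eq_zero_of_forall_eq_zero fun k => ?_
  change f.1 i k ≫ u k ≫ delta M.X (e k) j = 0
  rw [delta_of_ne _ fun h' => h ⟨k, h'⟩, comp_zero, comp_zero]

lemma pick_comp_val {u : ∀ j, M.X (e j) ⟶ N.X j} (g : N ⟶ K) (j : N.ι) (k : K.ι) :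
    (pick e he u ≫ g).1 (e j) k = u j ≫ g.1 j k := by
  rw [comp_val, finsum_eq_single _ j]
  · change (delta M.X (e j) (e j) ≫ u j) ≫ g.1 j k = _
    rw [delta_self, Category.id_comp]
  · intro i hi
    change (delta M.X (e j) (e i) ≫ u i) ≫ g.1 i k = 0
    rw [delta_of_ne _ fun h => hi (he h.symm), zero_comp, zero_comp]

lemma pick_comp_val_of {u : ∀ j, M.X (e j) ⟶ N.X j} (g : N ⟶ K) {i : M.ι} (k : K.ι)
    (h : i ∉ Set.range e) : (pick e he u ≫ g).1 i k = 0 := by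
  refine finsum_eq_zero_of_forall_eq_zero fun j => ?_
  change (delta M.X i (e j) ≫ u j) ≫ g.1 j k = 0
  rw [delta_of_ne _ fun h' => h ⟨j, h'.symm⟩, zero_comp, zero_comp]

end

end MatClosure

open MatClosure

namespace DG

variable {C D E : Type} [SmallCategory C] [SmallCategory D] [SmallCategory E] [Preadditive C]
  [Preadditive D] [Preadditive E] {b : Bool}

section Flat

variable (K : CochainComplex (MatClosure b C) ℤ)

/-- The differential connects only consecutive degrees. Each row or column of the collected matrix
thus comes from a single differential, however many degrees the complex has. -/
lemma flat_mem : (fun (p q : Σ k, (K.X k).ι) => (K.d p.1 q.1).1 p.2 q.2) ∈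
    matrices (b := b) ⟨Σ k, (K.X k).ι, fun p => (K.X p.1).X p.2⟩
      ⟨Σ k, (K.X k).ι, fun p => (K.X p.1).X p.2⟩ := by
  have hd : ∀ k l x y, (K.d k l).1 x y ≠ 0 → k + 1 = l := fun k l x y h => by
    by_contra h'
    exact h (by rw [K.shape k l h']; rfl)
  cases b
  · rintro ⟨l, y⟩
    refine (((K.d (l - 1) l).2 y).image (Sigma.mk (l - 1))).subset ?_
    rintro ⟨k, x⟩ h
    obtain rfl : k = l - 1 := by have := hd _ _ _ _ h; simp only at this; omega
    exact ⟨x, h, rfl⟩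
  · rintro ⟨k, x⟩
    refine (((K.d k (k + 1)).2 x).image (Sigma.mk (k + 1))).subset ?_
    rintro ⟨l, y⟩ h
    obtain rfl : k + 1 = l := hd _ _ _ _ h
    exact ⟨y, h, rfl⟩

/-- The collection of all chain objects of a complex. -/
def flat : DG b C where
  obj := ⟨Σ k, (K.X k).ι, fun p => (K.X p.1).X p.2⟩
  deg p := p.1
  d := ⟨_, flat_mem K⟩
  homog p q h := by
    by_contra h'
    refine h (?_ : (K.d p.1 q.1).1 p.2 q.2 = 0)
    rw [K.shape _ _ fun e => h' e.symm]; rfl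
  d_d := by
    refine MatClosure.hom_ext fun p r => ?_
    have := congrArg (fun f => f.1 p.2 r.2) (K.d_comp_d p.1 (p.1 + 1) r.1)
    refine Eq.trans (comp_val_range (e := Sigma.mk (p.1 + 1)) sigma_mk_injective
      fun q h _ => ?_) this
    obtain ⟨k, x⟩ := q
    by_cases e : p.1 + 1 = k
    · subst e
      exact ⟨x, rfl⟩
    · refine absurd (?_ : (K.d p.1 k).1 p.2 x = 0) h
      rw [K.shape _ _ e]; rfl

end Flat

section Bridge

variable (F : C ⥤ D ⥤ E) [∀ Y, (F.flip.obj Y).Additive] [∀ X, (F.obj X).Additive]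
  (K : CochainComplex (MatClosure b C) ℤ) (L : CochainComplex (MatClosure b D) ℤ)

/-- The total complex of `F(K, L)`. -/
abbrev tot : CochainComplex (MatClosure b E) ℤ := real.obj (tensor F (flat K) (flat L))

/-- The summands of bidegree `(p, q)`. -/
def bideg (p q k : ℤ) (h : p + q = k) (x : (tobj F (K.X p) (L.X q)).ι) : ((tot F K L).X k).ι :=
  ⟨(⟨p, x.1⟩, ⟨q, x.2⟩), h⟩

variable {p q k : ℤ} (h : p + q = k)

lemma bideg_injective : (bideg F K L p q k h).Injective := by
  rintro ⟨x, y⟩ ⟨x', y'⟩ e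
  have h₁ := congrArg (fun r : {r : (Σ k, (K.X k).ι) × (Σ k, (L.X k).ι) //
    r.1.1 + r.2.1 = k} => r.1.1) e
  have h₂ := congrArg (fun r : {r : (Σ k, (K.X k).ι) × (Σ k, (L.X k).ι) //
    r.1.1 + r.2.1 = k} => r.1.2) e
  exact Prod.ext (sigma_mk_injective (β := fun k => (K.X k).ι) h₁)
    (sigma_mk_injective (β := fun k => (L.X k).ι) h₂)

/-- The projection to the part of bidegree `(p, q)`. -/
def toBideg : (tot F K L).X k ⟶ tobj F (K.X p) (L.X q) :=
  pick (bideg F K L p q k h) (bideg_injective F K L h) fun _ => 𝟙 _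

/-- The inclusion of the part of bidegree `(p, q)`. -/
def ofBideg : tobj F (K.X p) (L.X q) ⟶ (tot F K L).X k :=
  put (bideg F K L p q k h) (bideg_injective F K L h) fun _ => 𝟙 _

variable {F K L}

lemma comp_toBideg_val {Z : MatClosure b E} (f : Z ⟶ (tot F K L).X k) (z : Z.ι)
    (x : (tobj F (K.X p) (L.X q)).ι) :
    (f ≫ toBideg F K L h).1 z x = f.1 z (bideg F K L p q k h x) :=
  (comp_pick_val (M := (tot F K L).X k) f z x).trans (Category.comp_id _)

lemma ofBideg_comp_val {Z : MatClosure b E} (f : (tot F K L).X k ⟶ Z) (z : Z.ι)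
    (x : (tobj F (K.X p) (L.X q)).ι) :
    (ofBideg F K L h ≫ f).1 x z = f.1 (bideg F K L p q k h x) z :=
  (put_comp_val (M := (tot F K L).X k) f x z).trans (Category.id_comp _)

/-- Every index of the total complex has a definite bidegree, so the entries of a matrix into it are
seen by the projections. This holds for sums as well as products, although only products have the
matching universal property. -/
lemma tot_hom_ext {Z : MatClosure b E} {f g : Z ⟶ (tot F K L).X k}
    (H : ∀ p q h, f ≫ toBideg F K L (p := p) (q := q) h = g ≫ toBideg F K L h) : f = g := by
  refine MatClosure.hom_ext fun z r => ?_
  obtain ⟨⟨⟨p, x⟩, ⟨q, y⟩⟩, h⟩ := r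
  have := congrArg (fun f => f.1 z (x, y)) (H p q h)
  exact (comp_toBideg_val h f z (x, y)).symm.trans (this.trans (comp_toBideg_val h g z (x, y)))

lemma tot_hom_ext' {Z : MatClosure b E} {f g : (tot F K L).X k ⟶ Z}
    (H : ∀ p q h, ofBideg F K L (p := p) (q := q) h ≫ f = ofBideg F K L h ≫ g) : f = g := by
  refine MatClosure.hom_ext fun r z => ?_
  obtain ⟨⟨⟨p, x⟩, ⟨q, y⟩⟩, h⟩ := r
  have := congrArg (fun f => f.1 (x, y) z) (H p q h)
  exact (ofBideg_comp_val h f z (x, y)).symm.trans (this.trans (ofBideg_comp_val h g z (x, y)))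

lemma delta_sigma {κ : Type} {ι : κ → Type} (X : (Σ k, ι k) → C) (k : κ) (x y : ι k) :
    delta X ⟨k, x⟩ ⟨k, y⟩ = delta (fun x => X ⟨k, x⟩) x y := by
  by_cases h : x = y
  · subst h
    rw [delta_self, delta_self]
  · rw [delta_of_ne _ h, delta_of_ne]
    intro e
    exact h (by simpa using e)

lemma toBideg_comp_val {Z : MatClosure b E} (g : tobj F (K.X p) (L.X q) ⟶ Z) (z : Z.ι)
    (x : (K.X p).ι) (y : (L.X q).ι) :
    (toBideg F K L h ≫ g).1 ⟨(⟨p, x⟩, ⟨q, y⟩), h⟩ z = g.1 (x, y) z :=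
  (pick_comp_val (M := (tot F K L).X k) (e := bideg F K L p q k h) (u := fun _ => 𝟙 _)
    (he := bideg_injective F K L h) g (x, y) z).trans (Category.id_comp _)

lemma comp_ofBideg_val {Z : MatClosure b E} (g : Z ⟶ tobj F (K.X p) (L.X q)) (z : Z.ι)
    (x : (K.X p).ι) (y : (L.X q).ι) :
    (g ≫ ofBideg F K L h).1 z ⟨(⟨p, x⟩, ⟨q, y⟩), h⟩ = g.1 z (x, y) :=
  (comp_put_val (M := (tot F K L).X k) (e := bideg F K L p q k h) (u := fun _ => 𝟙 _)
    (he := bideg_injective F K L h) g z (x, y)).trans (Category.comp_id _)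

lemma toBideg_comp_val_of_ne {Z : MatClosure b E} (g : tobj F (K.X p) (L.X q) ⟶ Z) (z : Z.ι)
    {r : ((tot F K L).X k).ι} (hr : r.1.1.1 ≠ p ∨ r.1.2.1 ≠ q) :
    (toBideg F K L h ≫ g).1 r z = 0 :=
  pick_comp_val_of (M := (tot F K L).X k) (e := bideg F K L p q k h) g z (by
    rintro ⟨x, rfl⟩
    exact hr.elim (· rfl) (· rfl))

lemma comp_ofBideg_val_of_ne {Z : MatClosure b E} (g : Z ⟶ tobj F (K.X p) (L.X q)) (z : Z.ι)
    {r : ((tot F K L).X k).ι} (hr : r.1.1.1 ≠ p ∨ r.1.2.1 ≠ q) :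
    (g ≫ ofBideg F K L h).1 z r = 0 :=
  comp_put_val_of (M := (tot F K L).X k) (e := bideg F K L p q k h) g z (by
    rintro ⟨x, rfl⟩
    exact hr.elim (· rfl) (· rfl))

end Bridge

section Differential

variable {F : C ⥤ D ⥤ E} [∀ Y, (F.flip.obj Y).Additive] [∀ X, (F.obj X).Additive]
  {K : CochainComplex (MatClosure b C) ℤ} {L : CochainComplex (MatClosure b D) ℤ} {p q k : ℤ}

lemma tot_d_val (k l : ℤ) (r : ((tot F K L).X k).ι) (s : ((tot F K L).X l).ι) :
    ((tot F K L).d k l).1 r s =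
      biMap F ((flat K).d.1 r.1.1 s.1.1) (delta (flat L).obj.X r.1.2 s.1.2) +
        biMap F (r.1.1.1.negOnePow • delta (flat K).obj.X r.1.1 s.1.1)
          ((flat L).d.1 r.1.2 s.1.2) :=
  (part_val _ k l r s).trans (congrArg (fun t => biMap F ((flat K).d.1 r.1.1 s.1.1)
    (delta (flat L).obj.X r.1.2 s.1.2) + biMap F t ((flat L).d.1 r.1.2 s.1.2))
      (sign_val (flat K).deg r.1.1 s.1.1))

lemma flat_d_val_of_ne {p q : ℤ} (hpq : p + 1 ≠ q) (x : (K.X p).ι) (y : (K.X q).ι) :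
    (flat K).d.1 ⟨p, x⟩ ⟨q, y⟩ = 0 := by
  change (K.d p q).1 x y = 0
  rw [K.shape _ _ hpq]; rfl

/-- The defining formula of the product total complex, whose differential is specified by its
components at each target bidegree. -/
lemma tot_d_comp_toBideg (l : ℤ) (h : p + q = l) (hk : k + 1 = l) :
    (tot F K L).d k l ≫ toBideg F K L h =
      toBideg F K L (p := p - 1) (q := q) (by omega) ≫ tmap F (K.d (p - 1) p) (𝟙 _) +
        p.negOnePow • toBideg F K L (p := p) (q := q - 1) (by omega) ≫
          tmap F (𝟙 _) (L.d (q - 1) q) := by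
  refine MatClosure.hom_ext ?_
  rintro ⟨⟨⟨a, u⟩, ⟨c, v⟩⟩, hr⟩ ⟨x, y⟩
  refine (comp_toBideg_val h _ _ _).trans ((tot_d_val k l _ _).trans (congrArg₂ (· + ·) ?_ ?_))
  · by_cases ha : a = p - 1
    · subst ha
      obtain rfl : c = q := by change p - 1 + c = k at hr; omega
      refine Eq.trans ?_ (toBideg_comp_val (F := F) (K := K) (L := L) hr
        (tmap F (K.d (p - 1) p) (𝟙 (L.X c))) (x, y) u v).symm
      exact congrArg (biMap F _) (delta_sigma _ _ _ _)
    · refine Eq.trans ?_ (toBideg_comp_val_of_ne (F := F) (K := K) (L := L) (p := p - 1) (q := q)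
        (by omega) (tmap F (K.d (p - 1) p) (𝟙 (L.X q))) (x, y) (r := ⟨(⟨a, u⟩, ⟨c, v⟩), hr⟩)
          (Or.inl ha)).symm
      refine (congrArg (biMap F · _) (flat_d_val_of_ne ?_ u x)).trans (biMap_zero_left F _)
      omega
  -- The sign in the matrix is the parity of the source degree `a`, whereas the formula uses that of
  -- `p`; the entry vanishes unless they agree.
  · refine Eq.trans ?_ (congrArg (p.negOnePow • ·) ?_ : p.negOnePow • biMap F
      (delta (flat K).obj.X ⟨a, u⟩ ⟨p, x⟩) ((flat L).d.1 ⟨c, v⟩ ⟨q, y⟩) = _)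
    · refine (biMap_units_smul_left _ _ _).trans ?_
      by_cases ha : a = p
      · subst ha
        rfl
      · have : delta (flat K).obj.X ⟨a, u⟩ ⟨p, x⟩ = 0 :=
          delta_of_ne _ fun e => ha (congrArg Sigma.fst e)
        have hz : biMap F (delta (flat K).obj.X ⟨a, u⟩ ⟨p, x⟩) ((flat L).d.1 ⟨c, v⟩ ⟨q, y⟩) = 0 :=
          (congrArg (biMap F · _) this).trans (biMap_zero_left F _)
        exact (congrArg (a.negOnePow • ·) hz).trans ((smul_zero _).trans
          ((smul_zero _).symm.trans (congrArg (p.negOnePow • ·) hz.symm)))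
    · by_cases ha : a = p
      · subst ha
        obtain rfl : c = q - 1 := by change a + c = k at hr; omega
        refine Eq.trans ?_ (toBideg_comp_val (F := F) (K := K) (L := L) hr
          (tmap F (𝟙 (K.X a)) (L.d (q - 1) q)) (x, y) u v).symm
        exact congrArg (biMap F · _) (delta_sigma _ _ _ _)
      · refine Eq.trans ?_ (toBideg_comp_val_of_ne (F := F) (K := K) (L := L) (p := p) (q := q - 1)
          (by omega) (tmap F (𝟙 (K.X p)) (L.d (q - 1) q)) (x, y) (r := ⟨(⟨a, u⟩, ⟨c, v⟩), hr⟩)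
            (Or.inl ha)).symm
        exact (congrArg (biMap F · _) (delta_of_ne _ fun e => ha (congrArg Sigma.fst e))).trans
          (biMap_zero_left F _)

/-- The same formula read at the source bidegree, as needed for the sum total complex, whose
differential is specified on summands. -/
lemma ofBideg_comp_tot_d (l : ℤ) (h : p + q = k) (hk : k + 1 = l) :
    ofBideg F K L h ≫ (tot F K L).d k l =
      tmap F (K.d p (p + 1)) (𝟙 _) ≫ ofBideg F K L (p := p + 1) (q := q) (by omega) +
        p.negOnePow • tmap F (𝟙 _) (L.d q (q + 1)) ≫
          ofBideg F K L (p := p) (q := q + 1) (by omega) := by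
  refine MatClosure.hom_ext ?_
  rintro ⟨x, y⟩ ⟨⟨⟨a, u⟩, ⟨c, v⟩⟩, hr⟩
  refine (ofBideg_comp_val h _ _ _).trans ((tot_d_val k l _ _).trans (congrArg₂ (· + ·) ?_ ?_))
  · by_cases ha : a = p + 1
    · subst ha
      obtain rfl : c = q := by change p + 1 + c = l at hr; omega
      refine Eq.trans ?_ (comp_ofBideg_val (F := F) (K := K) (L := L) hr
        (tmap F (K.d p (p + 1)) (𝟙 (L.X c))) (x, y) u v).symm
      exact congrArg (biMap F _) (delta_sigma _ _ _ _)
    · refine Eq.trans ?_ (comp_ofBideg_val_of_ne (F := F) (K := K) (L := L) (p := p + 1) (q := q)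
        (by omega) (tmap F (K.d p (p + 1)) (𝟙 (L.X q))) (x, y) (r := ⟨(⟨a, u⟩, ⟨c, v⟩), hr⟩)
          (Or.inl ha)).symm
      exact (congrArg (biMap F · _) (flat_d_val_of_ne (fun e => ha e.symm) x u)).trans
        (biMap_zero_left F _)
  · refine (biMap_units_smul_left _ _ _).trans (congrArg (p.negOnePow • ·) ?_)
    by_cases ha : a = p
    · subst ha
      obtain rfl : c = q + 1 := by change a + c = l at hr; omega
      refine Eq.trans ?_ (comp_ofBideg_val (F := F) (K := K) (L := L) hr
        (tmap F (𝟙 (K.X a)) (L.d q (q + 1))) (x, y) u v).symm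
      exact congrArg (biMap F · _) (delta_sigma _ _ _ _)
    · refine Eq.trans ?_ (comp_ofBideg_val_of_ne (F := F) (K := K) (L := L) (p := p) (q := q + 1)
        (by omega) (tmap F (𝟙 (K.X p)) (L.d q (q + 1))) (x, y) (r := ⟨(⟨a, u⟩, ⟨c, v⟩), hr⟩)
          (Or.inl ha)).symm
      exact (congrArg (biMap F · _) (delta_of_ne _ fun e => ha (congrArg Sigma.fst e).symm)).trans
        (biMap_zero_left F _)

end Differential

end DG
end BarNatan

/-! ### Comparison with the product and sum total complexes -/

namespace BarNatan
open MatClosure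

namespace MatClosure

variable {C : Type} [SmallCategory C] [Preadditive C]

/-- Matrices with finite columns, as morphisms between formal products. -/
def toProd : MatClosure false C ⥤ ProdClosure C where
  obj M := M.prod
  map f := f

/-- Morphisms between formal products as matrices. -/
def ofProd : ProdClosure C ⥤ MatClosure false C where
  obj M := ⟨M.ι, M.X⟩
  map f := f

/-- Matrices with finite rows, as morphisms between formal sums. -/
def toSum : MatClosure true C ⥤ SumClosure C where
  obj M := M.sum
  map f := f

/-- Morphisms between formal sums as matrices. -/
def ofSum : SumClosure C ⥤ MatClosure true C where
  obj M := ⟨M.ι, M.X⟩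
  map f := f

instance : (toProd (C := C)).Additive where map_add := rfl
instance : (ofProd (C := C)).Additive where map_add := rfl
instance : (toSum (C := C)).Additive where map_add := rfl
instance : (ofSum (C := C)).Additive where map_add := rfl

end MatClosure

namespace DG

variable {C D E : Type} [SmallCategory C] [SmallCategory D] [SmallCategory E] [Preadditive C]
  [Preadditive D] [Preadditive E]
  {F : C ⥤ D ⥤ E} [∀ Y, (F.flip.obj Y).Additive] [∀ X, (F.obj X).Additive]

section Prod

variable {K : CochainComplex (MatClosure false C) ℤ} {L : CochainComplex (MatClosure false D) ℤ}
  {p q k : ℤ}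

/-- The universal property of the total complex as a product. -/
def totLift {Z : MatClosure false E} (m : ∀ p q, p + q = k → (Z ⟶ tobj F (K.X p) (L.X q))) :
    Z ⟶ (tot F K L).X k :=
  ⟨fun z r => (m r.1.1.1 r.1.2.1 r.2).1 z (r.1.1.2, r.1.2.2),
    -- Finiteness of columns is a condition at one target index, hence in one bidegree; infinitely
    -- many nonzero components therefore do no harm.
    fun r => (m r.1.1.1 r.1.2.1 r.2).2 (r.1.1.2, r.1.2.2)⟩

lemma totLift_toBideg {Z : MatClosure false E}
    (m : ∀ p q, p + q = k → (Z ⟶ tobj F (K.X p) (L.X q))) (h : p + q = k) :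
    totLift m ≫ toBideg F K L h = m p q h :=
  MatClosure.hom_ext fun z x => comp_toBideg_val h _ z x

variable (F) in
/-- The product total complex, as a complex of matrices. -/
def totProdIso (A : CochainComplex (ProdClosure C) ℤ) (B : CochainComplex (ProdClosure D) ℤ) :
    totProd (ProdClosure.extend F) A B ≅ (toProd.mapHomologicalComplex _).obj
      (tot F ((ofProd.mapHomologicalComplex _).obj A) ((ofProd.mapHomologicalComplex _).obj B)) :=
  let K := (ofProd.mapHomologicalComplex (ComplexShape.up ℤ)).obj A
  let L := (ofProd.mapHomologicalComplex (ComplexShape.up ℤ)).obj B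
  let π' (p q k : ℤ) (h : p + q = k) :
    ofProd.obj ((totProd (ProdClosure.extend F) A B).X k) ⟶ tobj F (K.X p) (L.X q) :=
      ofProd.map (totProdπ (ProdClosure.extend F) A B p q k h)
  let u (k : ℤ) : ofProd.obj ((totProd (ProdClosure.extend F) A B).X k) ⟶ (tot F K L).X k :=
    totLift fun p q h => π' p q k h
  let v (k : ℤ) : toProd.obj ((tot F K L).X k) ⟶ (totProd (ProdClosure.extend F) A B).X k :=
    Pi.lift fun s => toProd.map (toBideg F K L s.2)
  have hv (p q k : ℤ) (h : p + q = k) : ofProd.map (v k) ≫ π' p q k h = toBideg F K L h :=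
    Pi.lift_π (f := fun s : Bideg k => ((ProdClosure.extend F).obj (A.X s.1.1)).obj (B.X s.1.2))
      (fun s => toProd.map (toBideg F K L s.2)) ⟨(p, q), h⟩
  HomologicalComplex.Hom.isoOfComponents (fun k =>
    { hom := toProd.map (u k)
      inv := v k
      hom_inv_id := by
        refine Pi.hom_ext _ _ fun s => ?_
        refine (Category.assoc _ _ _).trans (Eq.trans ?_ (Category.id_comp _).symm)
        exact (congrArg (toProd.map (u k) ≫ ·) (Pi.lift_π _ s)).trans
          (totLift_toBideg (fun p q h => π' p q k h) s.2)
      inv_hom_id := tot_hom_ext (f := ofProd.map (v k) ≫ u k) (g := 𝟙 ((tot F K L).X k)) fun p q h => by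
        exact (Category.assoc _ _ _).trans
          ((congrArg (ofProd.map (v k) ≫ ·) (totLift_toBideg (fun p q h => π' p q k h) h)).trans
            ((hv p q k h).trans (Category.id_comp _).symm)) })
    -- Compatibility with the differentials is tested after projection to each bidegree, where both
    -- sides have the same two terms.
    fun k l hk => (tot_hom_ext (f := u k ≫ (tot F K L).d k l)
        (g := ofProd.map ((totProd (ProdClosure.extend F) A B).d k l) ≫ u l) fun p q h => by
      rw [Category.assoc, Category.assoc, totLift_toBideg, tot_d_comp_toBideg l h hk,
        Preadditive.comp_add, Linear.comp_units_smul, ← Category.assoc, ← Category.assoc,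
        totLift_toBideg, totLift_toBideg]
      exact (congrArg ofProd.map
        (totProdD_π (ProdClosure.extend F) A B k l p q hk h)).symm)

end Prod

section Sum

/-- Makes the signs of the general total complex explicit for cochain complexes: `1` for the first
differential and `(-1)^p` for the second. -/
lemma ι_totSum_d {C D E : Type*} [Category C] [Category D] [Category E] [HasZeroMorphisms C]
    [HasZeroMorphisms D] [Preadditive E] [HasCountableCoproducts E] (F : C ⥤ D ⥤ E)
    [F.PreservesZeroMorphisms] [∀ X, (F.obj X).PreservesZeroMorphisms]
    (K : CochainComplex C ℤ) (L : CochainComplex D ℤ) {p q k l : ℤ} (h : p + q = k)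
    (hk : k + 1 = l) :
    HomologicalComplex.ιMapBifunctor K L F (ComplexShape.up ℤ) p q k h ≫ (totSum K L F).d k l =
      (F.map (K.d p (p + 1))).app (L.X q) ≫ HomologicalComplex.ιMapBifunctor K L F
          (ComplexShape.up ℤ) (p + 1) q l (by change p + 1 + q = l; omega) +
        p.negOnePow • (F.obj (K.X p)).map (L.d q (q + 1)) ≫ HomologicalComplex.ιMapBifunctor K L F
          (ComplexShape.up ℤ) p (q + 1) l (by change p + (q + 1) = l; omega) := by
  rw [HomologicalComplex.mapBifunctor.d_eq, Preadditive.comp_add,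
    HomologicalComplex.mapBifunctor.ι_D₁, HomologicalComplex.mapBifunctor.ι_D₂,
    HomologicalComplex.mapBifunctor.d₁_eq K L F (ComplexShape.up ℤ) (i₁' := p + 1) rfl q l
      (by change p + 1 + q = l; omega),
    HomologicalComplex.mapBifunctor.d₂_eq K L F (ComplexShape.up ℤ) p (i₂' := q + 1) rfl l
      (by change p + (q + 1) = l; omega)]
  exact congrArg (· + _) (one_smul _ _)

variable {K : CochainComplex (MatClosure true C) ℤ} {L : CochainComplex (MatClosure true D) ℤ}
  {p q k : ℤ}

/-- The universal property of the total complex as a sum. -/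
def totDesc {Z : MatClosure true E} (m : ∀ p q, p + q = k → (tobj F (K.X p) (L.X q) ⟶ Z)) :
    (tot F K L).X k ⟶ Z :=
  ⟨fun r z => (m r.1.1.1 r.1.2.1 r.2).1 (r.1.1.2, r.1.2.2) z,
    -- Finiteness of rows is a condition at one source index, which lies in a single bidegree.
    fun r => (m r.1.1.1 r.1.2.1 r.2).2 (r.1.1.2, r.1.2.2)⟩

lemma ofBideg_totDesc {Z : MatClosure true E}
    (m : ∀ p q, p + q = k → (tobj F (K.X p) (L.X q) ⟶ Z)) (h : p + q = k) :
    ofBideg F K L h ≫ totDesc m = m p q h :=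
  MatClosure.hom_ext fun x z => ofBideg_comp_val h _ z x

variable (F) in
/-- The sum total complex, as a complex of matrices. -/
def totSumIso (A : CochainComplex (SumClosure C) ℤ) (B : CochainComplex (SumClosure D) ℤ) :
    totSum A B (SumClosure.extend F) ≅ (toSum.mapHomologicalComplex _).obj
      (tot F ((ofSum.mapHomologicalComplex _).obj A) ((ofSum.mapHomologicalComplex _).obj B)) :=
  let K := (ofSum.mapHomologicalComplex (ComplexShape.up ℤ)).obj A
  let L := (ofSum.mapHomologicalComplex (ComplexShape.up ℤ)).obj B
  let T := totSum A B (SumClosure.extend F)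
  let ι' (p q k : ℤ) (h : p + q = k) : tobj F (K.X p) (L.X q) ⟶ ofSum.obj (T.X k) :=
    ofSum.map (HomologicalComplex.ιMapBifunctor A B (SumClosure.extend F) (ComplexShape.up ℤ)
      p q k h)
  let u (k : ℤ) : (tot F K L).X k ⟶ ofSum.obj (T.X k) := totDesc fun p q h => ι' p q k h
  let v (k : ℤ) : T.X k ⟶ toSum.obj ((tot F K L).X k) :=
    HomologicalComplex.mapBifunctorDesc fun p q h => toSum.map (ofBideg F K L (p := p) (q := q) h)
  have hv (p q k : ℤ) (h : p + q = k) : ι' p q k h ≫ ofSum.map (v k) = ofBideg F K L h :=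
    HomologicalComplex.ι_mapBifunctorDesc (F := SumClosure.extend F) (c := ComplexShape.up ℤ)
      (fun p q h => toSum.map (ofBideg F K L (p := p) (q := q) h)) p q h
  have hd (p q k l : ℤ) (h : p + q = k) (hk : k + 1 = l) : ι' p q k h ≫ ofSum.map (T.d k l) =
      tmap F (K.d p (p + 1)) (𝟙 _) ≫ ι' (p + 1) q l (by omega) +
        p.negOnePow • tmap F (𝟙 _) (L.d q (q + 1)) ≫ ι' p (q + 1) l (by omega) := by
    have e := congrArg ofSum.map (ι_totSum_d (SumClosure.extend F) A B h hk)
    refine e.trans (congrArg₂ (· + ·) ?_ (congrArg (p.negOnePow • ·) ?_))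
    · rfl
    · rfl
  (HomologicalComplex.Hom.isoOfComponents (fun k =>
    { hom := toSum.map (u k)
      inv := v k
      hom_inv_id := tot_hom_ext' (f := u k ≫ ofSum.map (v k)) (g := 𝟙 ((tot F K L).X k)) fun p q h => by
        exact (Category.assoc _ _ _).symm.trans
          ((congrArg (· ≫ ofSum.map (v k)) (ofBideg_totDesc (fun p q h => ι' p q k h) h)).trans
            ((hv p q k h).trans (Category.comp_id _).symm))
      inv_hom_id := by
        refine HomologicalComplex.mapBifunctor.hom_ext fun p q h => ?_
        refine (Category.assoc _ _ _).symm.trans (Eq.trans ?_ (Category.comp_id _).symm)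
        exact (congrArg (· ≫ toSum.map (u k)) (HomologicalComplex.ι_mapBifunctorDesc _ _ _ _)).trans
          (ofBideg_totDesc (fun p q h => ι' p q k h) h) })
    fun k l hk => (tot_hom_ext' (f := u k ≫ ofSum.map (T.d k l))
        (g := (tot F K L).d k l ≫ u l) fun p q h => by
      rw [← Category.assoc, ← Category.assoc, ofBideg_totDesc, ofBideg_comp_tot_d l h hk,
        Preadditive.add_comp, Linear.units_smul_comp, Category.assoc, Category.assoc,
        ofBideg_totDesc, ofBideg_totDesc]
      exact hd p q k l h hk)).symm

end Sum

end DG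
end BarNatan

/-! ### Complexes over finite direct sums as collected complexes -/

namespace BarNatan
open MatClosure

namespace MatClosure

variable {C D : Type} [SmallCategory C] [SmallCategory D] [Preadditive C] [Preadditive D]

/-- The inclusion of finite direct sums. -/
def incl (b : Bool) (C : Type) [SmallCategory C] [Preadditive C] : Mat_ C ⥤ MatClosure b C where
  obj M := ⟨M.ι, M.X⟩
  map f := ⟨f, mem_matrices (fun _ => Set.toFinite _) fun _ => Set.toFinite _⟩
  map_id M := MatClosure.hom_ext fun i j => by
    by_cases h : i = j
    · subst h; exact (Mat_.id_apply_self M i).trans (delta_self _ i).symm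
    · exact (Mat_.id_apply_of_ne M i j h).trans (delta_of_ne _ h).symm
  map_comp f g := MatClosure.hom_ext fun i k =>
    ((comp_val _ _ _ _).trans (finsum_eq_sum_of_fintype fun j => f i j ≫ g j k)).symm

instance (b : Bool) : (incl b C).Additive where
  map_add := rfl

end MatClosure

namespace DG

variable {C D : Type} [SmallCategory C] [SmallCategory D] [Preadditive C] [Preadditive D]

/-- The collection of all chain objects of a complex over finite direct sums. -/
abbrev ofMat (b : Bool) (Q : CochainComplex (Mat_ C) ℤ) : DG b C :=
  flat (((incl b C).mapHomologicalComplex _).obj Q)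

variable {b : Bool} {Q : CochainComplex (Mat_ C) ℤ}

/-- Chain objects here are finite sums, so a degreewise homotopy has finite rows and columns after
collection and serves for sums and for products alike. -/
lemma Contr.of_family {G : C ⥤ D} [G.Additive]
    (h : ∀ k l, G.mapMat_.obj (Q.X k) ⟶ G.mapMat_.obj (Q.X l))
    (H : ∀ k l m, k + 1 = l → m + 1 = k →
      G.mapMat_.map (Q.d k l) ≫ h l k + h k m ≫ G.mapMat_.map (Q.d m k) = 𝟙 _) :
    Contr (ofMat b Q) G := by
  -- Components of the family in degrees other than `-1` are unconstrained, so they are discarded.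
  let h' : ∀ p q : Σ k, (Q.X k).ι, G.obj ((Q.X p.1).X p.2) ⟶ G.obj ((Q.X q.1).X q.2) :=
    fun p q => if q.1 + 1 = p.1 then h p.1 q.1 p.2 q.2 else 0
  have hh : ∀ p q, h' p q ≠ 0 → q.1 + 1 = p.1 := fun p q hpq => by
    by_contra h'
    exact hpq (if_neg h')
  have hm : h' ∈ matrices (fobj G (ofMat b Q).obj) (fobj G (ofMat b Q).obj) := by
    refine mem_matrices ?_ ?_
    · rintro ⟨k, x⟩
      refine ((Set.finite_univ (α := (Q.X (k - 1)).ι)).image (Sigma.mk (k - 1))).subset ?_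
      rintro ⟨l, y⟩ hpq
      obtain rfl : l = k - 1 := by have := hh _ _ hpq; simp only at this; omega
      exact ⟨y, trivial, rfl⟩
    · rintro ⟨l, y⟩
      refine ((Set.finite_univ (α := (Q.X (l + 1)).ι)).image (Sigma.mk (l + 1))).subset ?_
      rintro ⟨k, x⟩ hpq
      obtain rfl : l + 1 = k := hh _ _ hpq
      exact ⟨x, trivial, rfl⟩
  let η : fobj G (ofMat b Q).obj ⟶ fobj G (ofMat b Q).obj := ⟨h', hm⟩
  have hη : Homog (M := fobj G (ofMat b Q).obj) (N := fobj G (ofMat b Q).obj)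
      (ofMat b Q).deg (ofMat b Q).deg (-1) η := fun p q hpq => by
    have := hh p q hpq
    change q.1 = p.1 + -1
    omega
  refine ⟨η, hη, MatClosure.hom_ext ?_⟩
  rintro ⟨k, x⟩ ⟨l, y⟩
  refine Eq.trans ?_ (id_val (M := fobj G (ofMat b Q).obj) ⟨k, x⟩ ⟨l, y⟩).symm
  by_cases hkl : k = l
  · subst hkl
    have e₁ : (fmap G (ofMat b Q).d ≫ η).1 ⟨k, x⟩ ⟨k, y⟩ =
        (G.mapMat_.map (Q.d k (k + 1)) ≫ h (k + 1) k) x y := by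
      refine (comp_val_range (N := fobj G (ofMat b Q).obj) (e := Sigma.mk (k + 1))
        sigma_mk_injective ?_).trans ((finsum_congr fun z => ?_).trans
          (finsum_eq_sum_of_fintype fun z =>
            (G.mapMat_.map (Q.d k (k + 1))) x z ≫ h (k + 1) k z y))
      · rintro ⟨l, z⟩ _ hz
        obtain rfl : k + 1 = l := hh _ _ hz
        exact ⟨z, rfl⟩
      · exact congrArg (_ ≫ ·) (if_pos rfl)
    have e₂ : (η ≫ fmap G (ofMat b Q).d).1 ⟨k, x⟩ ⟨k, y⟩ =
        (h k (k - 1) ≫ G.mapMat_.map (Q.d (k - 1) k)) x y := by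
      refine (comp_val_range (N := fobj G (ofMat b Q).obj) (e := Sigma.mk (k - 1))
        sigma_mk_injective ?_).trans ((finsum_congr fun z => ?_).trans
          (finsum_eq_sum_of_fintype fun z =>
            h k (k - 1) x z ≫ (G.mapMat_.map (Q.d (k - 1) k)) z y))
      · rintro ⟨l, z⟩ hz _
        obtain rfl : l = k - 1 := by have := hh _ _ hz; simp only at this; omega
        exact ⟨z, rfl⟩
      · exact congrArg (· ≫ _) (if_pos (by simp))
    refine (congrArg₂ (· + ·) e₁ e₂).trans ?_
    refine (congrFun (congrFun (H k (k + 1) (k - 1) rfl (by omega)) x) y).trans ?_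
    by_cases hxy : x = y
    · subst hxy
      exact (Mat_.id_apply_self (G.mapMat_.obj (Q.X k)) x).trans
        (delta_self (fobj G (ofMat b Q).obj).X ⟨k, x⟩).symm
    · refine (Mat_.id_apply_of_ne (G.mapMat_.obj (Q.X k)) x y hxy).trans
        (delta_of_ne (fobj G (ofMat b Q).obj).X (i := ⟨k, x⟩) (j := ⟨k, y⟩) fun e =>
          hxy (sigma_mk_injective (β := fun k => (Q.X k).ι) e)).symm
  · refine Eq.trans ?_ (delta_of_ne (fobj G (ofMat b Q).obj).X
      fun e => hkl (congrArg Sigma.fst e)).symm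
    -- Both composites have degree `0`, so nothing is left between different degrees.
    by_contra hne
    refine hkl ?_
    have := (((ofMat b Q).homog.fmap (G := G)).comp' hη (t := 0) (by simp)).add
      (hη.comp' ((ofMat b Q).homog.fmap (G := G)) (by simp)) _ _ hne
    change l = k + 0 at this
    omega

lemma Contr.of_homotopy {G : C ⥤ D} [G.Additive]
    (e : Homotopy (𝟙 ((G.mapMat_.mapHomologicalComplex (ComplexShape.up ℤ)).obj Q)) 0) :
    Contr (ofMat b Q) G :=
  .of_family e.hom fun k l m hl hm => by
    have := e.comm k
    rw [dNext_eq _ hl, prevD_eq _ hm] at this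
    exact ((add_zero _).symm.trans this.symm)

variable {X : C}

/-- A finite direct sum is zero only if each of its entries is, since the diagonal entries of its
identity vanish. -/
lemma ofMat_bounded (h : cond b (∀ k < 0, IsZero (Q.X k)) (∀ k > 0, IsZero (Q.X k))) :
    Bounded (ofMat b Q).obj (ofMat b Q).deg := by
  have key : ∀ M : Mat_ C, IsZero M → ∀ i, IsZero (M.X i) := fun M hM i => by
    rw [IsZero.iff_id_eq_zero, ← Mat_.id_apply_self]
    exact congrFun (congrFun ((IsZero.iff_id_eq_zero _).1 hM) i) i
  cases b
  · exact fun p hp => key _ (h p.1 hp) p.2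
  · exact fun p hp => key _ (h p.1 hp) p.2

/-- Composes the inclusion and projection of the chain object of degree `0` with the given
isomorphism `u` to a single object. One composite is the identity, the other the indicator of degree
`0`. -/
lemma ofMat_retract (u : Q.X 0 ≅ (Mat_.embedding C).obj X) :
    ∃ (i : (single (b := b) X).obj ⟶ (ofMat b Q).obj) (p : (ofMat b Q).obj ⟶ (single X).obj),
      Homog (single (b := b) X).deg (ofMat b Q).deg 0 i ∧
      Homog (ofMat b Q).deg (single (b := b) X).deg 0 p ∧ i ≫ p = 𝟙 _ ∧
      p ≫ i = scal fun x => if (ofMat b Q).deg x = 0 then 1 else 0 := by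
  let v : (incl b C).obj (Q.X 0) ≅ (single (b := b) X).obj := (incl b C).mapIso u
  let e : (Q.X 0).ι → (ofMat b Q).obj.ι := fun x => ⟨0, x⟩
  have he : e.Injective := sigma_mk_injective (β := fun k => (Q.X k).ι)
  let s : (incl b C).obj (Q.X 0) ⟶ (ofMat b Q).obj := put e he fun x => 𝟙 ((Q.X 0).X x)
  let r : (ofMat b Q).obj ⟶ (incl b C).obj (Q.X 0) := pick e he fun x => 𝟙 ((Q.X 0).X x)
  have sr : s ≫ r = 𝟙 _ := MatClosure.hom_ext fun x y =>
    (put_comp_val (N := (incl b C).obj (Q.X 0)) r x y).trans ((Category.id_comp _).trans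
      ((Category.comp_id _).trans ((delta_sigma (ι := fun k => (Q.X k).ι) _ _ _ _).trans
        (id_val (M := (incl b C).obj (Q.X 0)) x y).symm)))
  have rs : r ≫ s = scal fun x => if (ofMat b Q).deg x = 0 then 1 else 0 := by
    refine MatClosure.hom_ext ?_
    rintro ⟨k, x⟩ y
    refine Eq.trans ?_ (scal_val (M := (ofMat b Q).obj) _ ⟨k, x⟩ y).symm
    by_cases hk : k = 0
    · subst hk
      refine Eq.trans ?_ ((one_smul _ _).symm.trans (congrArg (· • _) (if_pos rfl).symm))
      exact (pick_comp_val (e := e) (he := he) (M := (ofMat b Q).obj)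
        (N := (incl b C).obj (Q.X 0)) s x y).trans
          ((Category.id_comp _).trans (Category.id_comp _))
    · refine Eq.trans ?_ ((zero_smul _ _).symm.trans (congrArg (· • _) (if_neg hk).symm))
      refine pick_comp_val_of (e := e) (he := he) (M := (ofMat b Q).obj)
        (N := (incl b C).obj (Q.X 0)) s y ?_
      rintro ⟨z, hz⟩
      exact hk (congrArg Sigma.fst hz).symm
  have hs : Homog (M := (incl b C).obj (Q.X 0)) (fun _ => 0) (ofMat b Q).deg 0 s := by
    rintro x ⟨k, y⟩ h
    by_contra hk
    refine h ((Category.id_comp _).trans (delta_of_ne _ fun e => hk ?_))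
    exact (congrArg Sigma.fst e).symm
  have hr : Homog (N := (incl b C).obj (Q.X 0)) (ofMat b Q).deg (fun _ => 0) 0 r := by
    rintro ⟨k, y⟩ x h
    by_contra hk
    refine h ((Category.comp_id _).trans (delta_of_ne _ fun e => hk ?_))
    exact (congrArg Sigma.fst e).symm.trans (add_zero k).symm
  have hv : Homog (M := (incl b C).obj (Q.X 0)) (N := (single (b := b) X).obj) (fun _ => 0)
    (single (b := b) X).deg 0 v.hom := fun _ _ _ => rfl
  have hv' : Homog (N := (incl b C).obj (Q.X 0)) (M := (single (b := b) X).obj)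
    (single (b := b) X).deg (fun _ => 0) 0 v.inv := fun _ _ _ => rfl
  refine ⟨v.inv ≫ s, r ≫ v.hom, hv'.comp' hs (zero_add _), hr.comp' hv (zero_add _), ?_, ?_⟩
  · rw [Category.assoc, ← Category.assoc s, sr, Category.id_comp, v.inv_hom_id]
  · rw [Category.assoc, ← Category.assoc v.hom, v.hom_inv_id, Category.id_comp, rs]

end DG
end BarNatan

/-! ### Duality and contractions -/

namespace BarNatan
open Diag MatClosure

lemma Diag.flip_flip : {m n : ℕ} → (a : Diag m n) → a.flip.flip = a
  | _, _, one _ => rfl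
  | _, _, cup _ _ => rfl
  | _, _, cap _ _ => rfl
  | _, _, comp a b => congrArg₂ comp (flip_flip a) (flip_flip b)

variable {m k l n : ℕ}

lemma CobMod.dual_stack {a a' : Diag m k} {b b' : Diag k n} (x : CobMod a a') (y : CobMod b b') :
    dual (stack x y) = stack (dual y) (dual x) := by
  induction x using CobMod.induction with
  | add x x' hx hx' => simp only [map_add, LinearMap.add_apply, hx, hx']; rfl
  | zero => simp only [map_zero, LinearMap.zero_apply]; rfl
  | of c s =>
    induction y using CobMod.induction with
    | add y y' hy hy' => simp only [map_add, LinearMap.add_apply, hy, hy']; rfl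
    | zero => simp only [map_zero, LinearMap.zero_apply]; rfl
    | of c' t =>
      simp only [map_smul, LinearMap.smul_apply, stack_of, dual_of, Cobordism.flip]
      rw [smul_comm]; rfl

lemma biMap_id_right {C D E : Type*} [Category C] [Category D] [Category E] (F : C ⥤ D ⥤ E)
    {X X' : C} (f : X ⟶ X') (Y : D) : biMap F f (𝟙 Y) = (F.map f).app Y := by
  rw [biMap, CategoryTheory.Functor.map_id, Category.comp_id]

namespace Cob

/-- Duality reverses the order of stacking. -/
def dualTensorIso (X : Cob m k) (Y : Cob k n) :
    (dual m n).obj (.op (((tensor m k n).obj X).obj Y)) ≅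
      ((tensor n k m).obj ((dual k n).obj (.op Y))).obj ((dual m k).obj (.op X)) where
  hom := ⟨CobMod.id _, CobMod.id_mem _ (by
    change -(X.shift + Y.shift) - (-Y.shift + -X.shift) = 0; abel)⟩
  inv := ⟨CobMod.id _, CobMod.id_mem _ (by
    change (-Y.shift + -X.shift) - -(X.shift + Y.shift) = 0; abel)⟩
  hom_inv_id := Subtype.ext (CobMod.id_comp _)
  inv_hom_id := Subtype.ext (CobMod.id_comp _)

lemma dualTensorIso_natural {X X' : Cob m k} {Y Y' : Cob k n} (f : X ⟶ X') (g : Y ⟶ Y') :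
    (dual m n).map (biMap (tensor m k n) f g).op ≫ (dualTensorIso X Y).hom =
      (dualTensorIso X' Y').hom ≫
        biMap (tensor n k m) ((dual k n).map g.op) ((dual m k).map f.op) := by
  apply Subtype.ext
  rw [comp_val, comp_val, biMap_val]
  refine (CobMod.comp_id _).trans (Eq.trans ?_ (CobMod.id_comp _).symm)
  exact (congrArg CobMod.dual (biMap_val f g)).trans (CobMod.dual_stack f.1 g.1)

end Cob

section Dual

variable {m' n' : ℕ} {b : Bool} {P : CochainComplex (BN m n) ℤ}
  {G : Cob m n ⥤ Cob m' n'} {G' : Cob n m ⥤ Cob n' m'} [G'.Additive]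
  {φ : ∀ X, (Cob.dual m' n').obj (.op (G.obj X)) ≅ G'.obj ((Cob.dual m n).obj (.op X))}

lemma units_smul_comp_units_smul {C : Type*} [Category C] [Preadditive C] (u : ℤˣ) {X Y Z : C}
    (f : X ⟶ Y) (g : Y ⟶ Z) : (u • f) ≫ (u • g) = f ≫ g := by
  rw [Linear.comp_units_smul, Linear.units_smul_comp, smul_smul, Int.units_mul_self, one_smul]

lemma map_units_smul {C D : Type*} [Category C] [Preadditive C] [Category D] [Preadditive D]
    (F : C ⥤ D) [F.Additive] (u : ℤˣ) {X Y : C} (f : X ⟶ Y) : F.map (u • f) = u • F.map f :=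
  F.map_zsmul (r := (u : ℤ))

/-- One of the two terms of the dual homotopy identity. The dual differential and the dual homotopy
carry equal signs, which cancel, and naturality of `φ` exchanges duality with the functor.
`dual_sum_left` is the other term. -/
lemma dual_sum_right (hφ : ∀ {X X'} (f : X ⟶ X'), (Cob.dual m' n').map (G.map f).op ≫ (φ X).hom =
      (φ X').hom ≫ G'.map ((Cob.dual m n).map f.op)) {u v : ℤˣ} (huv : u = v) {ι : Type} [Fintype ι]
    {X Y : Cob m n} {Z : ι → Cob m n} (f : ∀ z, Y ⟶ Z z) (h : ∀ z, G.obj (Z z) ⟶ G.obj X) :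
    ∑ z, (u • ((φ X).inv ≫ (Cob.dual m' n').map (h z).op ≫ (φ (Z z)).hom)) ≫
        G'.map (v • (Cob.dual m n).map (f z).op) =
      (φ X).inv ≫ (Cob.dual m' n').map (∑ z, G.map (f z) ≫ h z).op ≫ (φ Y).hom := by
  subst huv
  rw [op_sum, Functor.map_sum, Preadditive.sum_comp, Preadditive.comp_sum]
  refine Finset.sum_congr rfl fun z _ => ?_
  rw [map_units_smul, units_smul_comp_units_smul, Category.assoc, Category.assoc, ← hφ, op_comp,
    Functor.map_comp, Category.assoc]

lemma dual_sum_left (hφ : ∀ {X X'} (f : X ⟶ X'), (Cob.dual m' n').map (G.map f).op ≫ (φ X).hom =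
      (φ X').hom ≫ G'.map ((Cob.dual m n).map f.op)) (u : ℤˣ) {ι : Type} [Fintype ι]
    {X Y : Cob m n} {Z : ι → Cob m n} (f : ∀ z, Z z ⟶ X) (h : ∀ z, G.obj Y ⟶ G.obj (Z z)) :
    ∑ z, G'.map (u • (Cob.dual m n).map (f z).op) ≫
        (u • ((φ (Z z)).inv ≫ (Cob.dual m' n').map (h z).op ≫ (φ Y).hom)) =
      (φ X).inv ≫ (Cob.dual m' n').map (∑ z, h z ≫ G.map (f z)).op ≫ (φ Y).hom := by
  have hφ' : ∀ {X X'} (f : X ⟶ X'), G'.map ((Cob.dual m n).map f.op) ≫ (φ X).inv =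
      (φ X').inv ≫ (Cob.dual m' n').map (G.map f).op := fun f => by
    rw [Iso.comp_inv_eq, Category.assoc, hφ, Iso.inv_hom_id_assoc]
  rw [op_sum, Functor.map_sum, Preadditive.sum_comp, Preadditive.comp_sum]
  refine Finset.sum_congr rfl fun z _ => ?_
  rw [map_units_smul, units_smul_comp_units_smul, ← Category.assoc, hφ', op_comp,
    Functor.map_comp, Category.assoc, Category.assoc]

/-- Dualizing a contraction of `G(P)` contracts its dual, which `φ` identifies naturally with `G'`
applied to the dual of `P`. Degrees and the order of composition are reversed. -/
lemma DG.Contr.dual [G.Additive]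
    (hφ : ∀ {X X'} (f : X ⟶ X'), (Cob.dual m' n').map (G.map f).op ≫ (φ X).hom =
      (φ X').hom ≫ G'.map ((Cob.dual m n).map f.op))
    (e : Homotopy (𝟙 ((G.mapMat_.mapHomologicalComplex (ComplexShape.up ℤ)).obj P)) 0) :
    Contr (ofMat b (BN.dualCh P)) G' := by
  let H (k l : ℤ) (x : (P.X (-k)).ι) (y : (P.X (-l)).ι) : G.obj ((P.X (-l)).X y) ⟶
    G.obj ((P.X (-k)).X x) := e.hom (-l) (-k) y x
  -- The sign `(-1)^k` is chosen to match `(-1)^(k+1)` in the dual differential: in each of the two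
  -- terms of the homotopy identity the homotopy and the differential then have the same sign.
  refine .of_family (fun k l x y => k.negOnePow • ((φ ((P.X (-k)).X x)).inv ≫
    (Cob.dual m' n').map (H k l x y).op ≫ (φ ((P.X (-l)).X y)).hom)) fun k l r hl hr => ?_
  subst hl
  obtain rfl : r = k - 1 := by omega
  let E (k l : ℤ) : G.mapMat_.obj (P.X k) ⟶ G.mapMat_.obj (P.X l) := e.hom k l
  -- The homotopy identity for `P` in degree `-k`, with its terms in the order in which their duals
  -- appear in degree `k`.
  have he : E (-k) (-(k + 1)) ≫ G.mapMat_.map (P.d (-(k + 1)) (-k)) +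
      G.mapMat_.map (P.d (-k) (-(k - 1))) ≫ E (-(k - 1)) (-k) = 𝟙 _ := by
    have := e.comm (-k)
    rw [dNext_eq _ (show (ComplexShape.up ℤ).Rel (-k) (-(k - 1)) by change -k + 1 = _; omega),
      prevD_eq _ (show (ComplexShape.up ℤ).Rel (-(k + 1)) (-k) by change _ + 1 = -k; omega)]
      at this
    exact (add_comm _ _).trans ((add_zero _).symm.trans this.symm)
  have key (x y : (P.X (-k)).ι) := (congrArg₂ (· + ·)
    (dual_sum_left hφ (k + 1).negOnePow (fun z => P.d (-(k + 1)) (-k) z x)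
      fun z => H (k + 1) k z y)
    (dual_sum_right hφ (u := k.negOnePow) (v := (k - 1 + 1).negOnePow) (by rw [sub_add_cancel]) (fun z => P.d (-k) (-(k - 1)) y z)
      fun z => H k (k - 1) x z)).trans (show _ = (φ ((P.X (-k)).X x)).inv ≫
        (Cob.dual m' n').map ((𝟙 (G.mapMat_.obj (P.X (-k)))) y x).op ≫
          (φ ((P.X (-k)).X y)).hom by
      rw [← Preadditive.comp_add, ← Preadditive.add_comp, ← Functor.map_add, ← op_add]
      exact congrArg (fun t => (φ ((P.X (-k)).X x)).inv ≫ (Cob.dual m' n').map (Quiver.Hom.op t) ≫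
        (φ ((P.X (-k)).X y)).hom) (show _ = (𝟙 (G.mapMat_.obj (P.X (-k))) : _ ⟶ _) y x from congrFun (congrFun he y) x))
  have hz (X Y : Cob m n) : (φ X).inv ≫ (Cob.dual m' n').map (0 : G.obj Y ⟶ G.obj X).op ≫
      (φ Y).hom = 0 := by
    rw [op_zero, Functor.map_zero, zero_comp, comp_zero]
  refine funext₂ fun x y => Eq.trans ?_ ((key x y).trans ?_)
  · rfl
  · by_cases hxy : x = y
    · subst hxy
      refine (congrArg (fun t => (φ ((P.X (-k)).X x)).inv ≫ (Cob.dual m' n').map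
        (Quiver.Hom.op t) ≫ (φ ((P.X (-k)).X x)).hom)
          (Mat_.id_apply_self (G.mapMat_.obj (P.X (-k))) x)).trans (Eq.trans ?_
            (Mat_.id_apply_self (G'.mapMat_.obj ((BN.dualCh P).X k)) x).symm)
      refine Eq.trans ?_ (φ ((P.X (-k)).X x)).inv_hom_id
      exact congrArg (_ ≫ ·) ((congrArg (· ≫ _) (CategoryTheory.Functor.map_id _ _)).trans
        (Category.id_comp _))
    · refine (congrArg (fun t => (φ ((P.X (-k)).X x)).inv ≫ (Cob.dual m' n').map
        (Quiver.Hom.op t) ≫ (φ ((P.X (-k)).X y)).hom) (Mat_.id_apply_of_ne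
          (G.mapMat_.obj (P.X (-k))) y x fun e => hxy e.symm)).trans (Eq.trans ?_
            (Mat_.id_apply_of_ne (G'.mapMat_.obj ((BN.dualCh P).X k)) x y hxy).symm)
      exact hz _ _

end Dual

/-! ### Turnbacks and diagrams through fewer points -/

namespace Cob

instance (m k n : ℕ) (X : Cob m k) : ((tensor m k n).flip.flip.obj X).Additive :=
  inferInstanceAs ((tensor m k n).obj X).Additive

/-- Stacking on top with `X ⊗ Y`. -/
def tensorObjIso (X : Cob m k) (Y : Cob k l) (n : ℕ) :
    (tensor m l n).obj (((tensor m k l).obj X).obj Y) ≅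
      (tensor k l n).obj Y ⋙ (tensor m k n).obj X :=
  NatIso.ofComponents (fun A => assocIso X Y A) fun f => by
    have := assocIso_natural (𝟙 X) (𝟙 Y) f
    rw [biMap_id, biMap_id_left, biMap_id_left, biMap_id_left] at this
    exact this

/-- Stacking below with `Y ⊗ Z`. -/
def tensorFlipObjIso (m : ℕ) (Y : Cob k l) (Z : Cob l n) :
    (tensor m k n).flip.obj (((tensor k l n).obj Y).obj Z) ≅
      (tensor m k l).flip.obj Y ⋙ (tensor m l n).flip.obj Z :=
  NatIso.ofComponents (fun A => (assocIso A Y Z).symm) fun {A B} f => by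
    have := assocIso_natural f (𝟙 Y) (𝟙 Z)
    rw [biMap_id, biMap_id_right, biMap_id_right, biMap_id_right] at this
    exact (Iso.comp_inv_eq _).2 (((Iso.eq_inv_comp _).2 this.symm).trans (Category.assoc _ _ _).symm)

variable {b : Bool} {P : DG b (Cob n n)}

/-- Having fewer top than bottom points, `Z` splits into diagrams that end in a cap; on each of them
the contraction for that cap is carried along by the diagram stacked above. -/
lemma contr_tensor_of_lt
    (hP : ∀ k (h : n = k + 2) i, DG.Contr P ((tensor k n n).obj ⟨0, h ▸ cap k i⟩))
    (h : m < n) (Z : Cob m n) : DG.Contr P ((tensor m n n).obj Z) := by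
  refine DG.Contr.of_splits (splits_endsInCap h Z) ?_
  rintro ⟨s, d⟩ ⟨k, e, x, i, hd⟩
  obtain rfl : d = _ := hd
  have : (⟨s, comp x (e ▸ cap k i)⟩ : Cob m n) =
      ((tensor m k n).obj ⟨s, x⟩).obj ⟨0, e ▸ cap k i⟩ := by
    change _ = (⟨s + 0, _⟩ : Cob m n)
    rw [add_zero]
  rw [this]
  exact .of_iso (tensorObjIso _ _ _) ((hP k e i).comp _)

lemma contr_tensor_flip_of_lt
    (hP : ∀ k (h : n = k + 2) i, DG.Contr P ((tensor n n k).flip.obj ⟨0, h ▸ cup k i⟩))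
    (h : m < n) (Z : Cob n m) : DG.Contr P ((tensor n n m).flip.obj Z) := by
  have hZ : Splits (fun Z : Cob n m => ∃ (k : ℕ) (e : n = k + 2) (i : Fin (k + 1))
      (x : Diag k m), Z.diag = comp (e ▸ cup k i) x) Z := by
    -- The decomposition into diagrams that begin with a cup is the reflection of the one into
    -- diagrams that end in a cap.
    have := (splits_endsInCap h ((dual n m).obj (.op Z))).map_op (dual m n)
      (T := fun Z : Cob n m => ∃ (k : ℕ) (e : n = k + 2) (i : Fin (k + 1)) (x : Diag k m),
        Z.diag = comp (e ▸ cup k i) x) (by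
      rintro ⟨s, d⟩ ⟨k, e, x, i, hd⟩
      refine .of ⟨k, e, i, x.flip, (congrArg Diag.flip hd).trans ?_⟩
      subst e; rfl)
    have hZ : (dual m n).obj (.op ((dual n m).obj (.op Z))) = Z := by
      obtain ⟨s, d⟩ := Z
      exact congrArg₂ Cob.mk (neg_neg s) d.flip_flip
    rwa [hZ] at this
  refine DG.Contr.of_splits hZ ?_
  rintro ⟨s, d⟩ ⟨k, e, i, x, hd⟩
  obtain rfl : d = _ := hd
  have : (⟨s, comp (e ▸ cup k i) x⟩ : Cob n m) =
      ((tensor n k m).obj ⟨0, e ▸ cup k i⟩).obj ⟨s, x⟩ := by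
    change _ = (⟨0 + s, _⟩ : Cob n m)
    rw [zero_add]
  rw [this]
  exact .of_iso (tensorFlipObjIso _ _ _) ((hP k e i).comp _)

lemma IsLow.exists_eq {X : Cob n n} (hX : IsLow X) : ∃ (k : ℕ) (_ : k < n) (x : Cob n k)
    (y : Cob k n), X = ((tensor n k n).obj x).obj y := by
  obtain ⟨s, d⟩ := X
  obtain ⟨k, hk, x, y, hd⟩ := hX
  refine ⟨k, hk, ⟨s, x⟩, ⟨0, y⟩, congrArg₂ Cob.mk (add_zero s).symm hd⟩

/-- For a low diagram `x ⊗ y` the object `y ⊗ Y` has fewer than `n` top points, so stacking it on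
`P` is already contractible; `x` is then put on top. -/
lemma contr_of_splits_isLow
    (hP : ∀ k (h : n = k + 2) i, DG.Contr P ((tensor k n n).obj ⟨0, h ▸ cap k i⟩))
    {X : Cob n n} (hX : Splits IsLow X) (Y : Cob n n) :
    DG.Contr P ((tensor n n n).obj (((tensor n n n).obj X).obj Y)) := by
  -- The dependence on `X` is expressed as a functor so that a decomposition of `X` induces one of
  -- the functor applied to `P`.
  let T : Cob n n ⥤ Cob n n ⥤ Cob n n := (tensor n n n).flip.obj Y ⋙ tensor n n n
  have h₁ (X : Cob n n) : (T.obj X).Additive := inferInstanceAs ((tensor n n n).obj _).Additive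
  have h₂ (Z : Cob n n) : (T.flip.obj Z).Additive :=
    inferInstanceAs ((tensor n n n).flip.obj Y ⋙ (tensor n n n).flip.obj Z).Additive
  refine DG.Contr.of_splits (T := T) hX fun X hX => ?_
  obtain ⟨k, hk, x, y, rfl⟩ := hX.exists_eq
  exact DG.Contr.of_iso ((tensor n n n).mapIso (assocIso x y Y) ≪≫ tensorObjIso _ _ _)
    ((contr_tensor_of_lt hP hk _).comp _)

lemma contr_flip_of_splits_isLow
    (hP : ∀ k (h : n = k + 2) i, DG.Contr P ((tensor n n k).flip.obj ⟨0, h ▸ cup k i⟩))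
    {X : Cob n n} (hX : Splits IsLow X) (Y : Cob n n) :
    DG.Contr P ((tensor n n n).flip.obj (((tensor n n n).flip.obj X).obj Y)) := by
  let T : Cob n n ⥤ Cob n n ⥤ Cob n n := (tensor n n n).obj Y ⋙ (tensor n n n).flip
  have h₁ (X : Cob n n) : (T.obj X).Additive := inferInstanceAs ((tensor n n n).flip.obj _).Additive
  have h₂ (Z : Cob n n) : (T.flip.obj Z).Additive :=
    inferInstanceAs ((tensor n n n).obj Y ⋙ (tensor n n n).obj Z).Additive
  refine DG.Contr.of_splits (T := T) hX fun X hX => ?_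
  obtain ⟨k, hk, x, y, rfl⟩ := hX.exists_eq
  exact DG.Contr.of_iso ((tensor n n n).flip.mapIso (assocIso Y x y).symm ≪≫
    tensorFlipObjIso _ _ _) ((contr_tensor_flip_of_lt hP hk _).comp _)

end Cob
end BarNatan

/-! ### Universal projectors and their duals are absorbing -/

namespace BarNatan
open Diag MatClosure

/-- Each entry is a direct summand of a finite direct sum. -/
def retractEntry {C : Type} [SmallCategory C] [Preadditive C] (M : Mat_ C) (x : M.ι) :
    Retract ((Mat_.embedding C).obj (M.X x)) M where
  i _ y := (𝟙 M : M ⟶ M) x y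
  r y _ := (𝟙 M : M ⟶ M) y x
  retract := funext₂ fun _ _ => (congrFun (congrFun (Category.comp_id (𝟙 M)) x) x).trans
    ((Mat_.id_apply_self M x).trans
      (Mat_.id_apply_self ((Mat_.embedding C).obj (M.X x)) PUnit.unit).symm)

variable {k n : ℕ}

lemma flip_cast_cup (h : n = k + 2) (i : Fin (k + 1)) :
    (h ▸ cup k i : Diag n k).flip = h ▸ cap k i := by
  subst h; rfl

lemma flip_cast_cap (h : n = k + 2) (i : Fin (k + 1)) :
    (h ▸ cap k i : Diag k n).flip = h ▸ cup k i := by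
  subst h; rfl

namespace BN

variable {m : ℕ} {P : CochainComplex (BN m n) ℤ} {b : Bool}

lemma Contractible.contr_dual_left {c : Diag n k} (h : Contractible (stackRight P c)) :
    DG.Contr (DG.ofMat b (dualCh P)) ((Cob.tensor k n m).obj ⟨0, c.flip⟩) := by
  obtain ⟨e⟩ := h
  refine DG.Contr.dual (G := (Cob.tensor m n k).flip.obj ⟨0, c⟩)
    (φ := fun X => Cob.dualTensorIso X ⟨0, c⟩) (fun {X X'} f => ?_) e
  have := Cob.dualTensorIso_natural f (𝟙 (⟨0, c⟩ : Cob n k))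
  rw [biMap_id_right, op_id, CategoryTheory.Functor.map_id, biMap_id_left] at this
  exact this

lemma Contractible.contr_dual_right {c : Diag k m} (h : Contractible (stackLeft c P)) :
    DG.Contr (DG.ofMat b (dualCh P)) ((Cob.tensor n m k).flip.obj ⟨0, c.flip⟩) := by
  obtain ⟨e⟩ := h
  refine DG.Contr.dual (G := (Cob.tensor k m n).obj ⟨0, c⟩)
    (φ := fun X => Cob.dualTensorIso ⟨0, c⟩ X) (fun {X X'} f => ?_) e
  have := Cob.dualTensorIso_natural (𝟙 (⟨0, c⟩ : Cob k m)) f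
  rw [biMap_id_left, op_id, CategoryTheory.Functor.map_id, biMap_id_right] at this
  exact this

namespace IsUniversalProjector

variable {P : CochainComplex (BN n n) ℤ}

/-- Every entry of `P.X k` is a retract of it. An identity summand of an entry would thus be one of
the chain object, which is excluded for `k ≠ 0`. -/
lemma splits_isLow (hP : IsUniversalProjector P) {k : ℤ} (hk : k ≠ 0) (x : (P.X k).ι) :
    Splits Cob.IsLow ((P.X k).X x) := by
  refine (Cob.retract_one_or_splits_isLow _).resolve_left ?_
  rintro ⟨r, ⟨h⟩⟩
  exact (hP.no_summand k hk r).false ((h.map (Mat_.embedding _)).trans (retractEntry _ x))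

lemma splits_isLow_dual (hP : IsUniversalProjector P) {k : ℤ} (hk : k ≠ 0)
    (x : ((dualCh P).X k).ι) : Splits Cob.IsLow (((dualCh P).X k).X x) := by
  refine (hP.splits_isLow (neg_ne_zero.2 hk) x).map_op (Cob.dual n n) ?_
  rintro ⟨s, d⟩ ⟨k, hk, x, y, hd⟩
  exact .of ⟨k, hk, y.flip, x.flip, congrArg Diag.flip hd⟩

/-- The nonpositive degrees of `P` are what `Bounded` demands for `b = false`, that is, for
products. -/
lemma absorbing (hP : IsUniversalProjector P) :
    DG.Absorbing (Cob.tensor n n n) ⟨0, one n⟩ (DG.ofMat false P) where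
  bounded := DG.ofMat_bounded hP.nonpos
  retract := hP.zero.elim DG.ofMat_retract
  contr p hp := Cob.contr_of_splits_isLow
    (fun k h i => (hP.kills_left k h i).elim DG.Contr.of_homotopy) (hP.splits_isLow hp p.2)

lemma absorbing_flip (hP : IsUniversalProjector P) :
    DG.Absorbing (Cob.tensor n n n).flip ⟨0, one n⟩ (DG.ofMat false P) where
  bounded := DG.ofMat_bounded hP.nonpos
  retract := hP.zero.elim DG.ofMat_retract
  contr p hp := Cob.contr_flip_of_splits_isLow
    (fun k h i => (hP.kills_right k h i).elim DG.Contr.of_homotopy) (hP.splits_isLow hp p.2)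

lemma isZero_dual (hP : IsUniversalProjector P) (k : ℤ) (hk : k < 0) : IsZero ((dualCh P).X k) :=
  (dual n n).map_isZero (hP.nonpos (-k) (by omega)).op

lemma nonempty_dual_zero (hP : IsUniversalProjector P) :
    Nonempty ((dualCh P).X 0 ≅ (Mat_.embedding _).obj ⟨0, one n⟩) :=
  hP.zero.map fun e =>
    show (dual n n).obj (.op (P.X 0)) ≅ (dual n n).obj (.op (unit n 0)) from
      (dual n n).mapIso e.symm.op

/-- Duality moves the degrees to the nonnegative side, which is what `Bounded` demands for sums. It
also reverses stacking, so killing turnbacks on the right for `P` becomes killing them on the left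
for its dual. -/
lemma absorbing_dual (hP : IsUniversalProjector P) :
    DG.Absorbing (Cob.tensor n n n) ⟨0, one n⟩ (DG.ofMat true (dualCh P)) where
  bounded := DG.ofMat_bounded hP.isZero_dual
  retract := hP.nonempty_dual_zero.elim DG.ofMat_retract
  contr p hp := Cob.contr_of_splits_isLow
    (fun k h i => flip_cast_cup h i ▸ (hP.kills_right k h i).contr_dual_left)
    (hP.splits_isLow_dual hp p.2)

lemma absorbing_dual_flip (hP : IsUniversalProjector P) :
    DG.Absorbing (Cob.tensor n n n).flip ⟨0, one n⟩ (DG.ofMat true (dualCh P)) where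
  bounded := DG.ofMat_bounded hP.isZero_dual
  retract := hP.nonempty_dual_zero.elim DG.ofMat_retract
  contr p hp := Cob.contr_flip_of_splits_isLow
    (fun k h i => flip_cast_cap h i ▸ (hP.kills_left k h i).contr_dual_right)
    (hP.splits_isLow_dual hp p.2)

end IsUniversalProjector

end BN

/-- The left unitality of stacking. -/
def Cob.tensorOneLeft (n : ℕ) : (tensor n n n).obj ⟨0, one n⟩ ≅ 𝟭 (Cob n n) :=
  NatIso.ofComponents oneLeftIso fun f => by
    have := oneLeftIso_natural f
    rw [biMap_id_left] at this
    exact this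

/-- The right unitality of stacking. -/
def Cob.tensorOneRight (n : ℕ) : (tensor n n n).flip.obj ⟨0, one n⟩ ≅ 𝟭 (Cob n n) :=
  NatIso.ofComponents oneRightIso fun f => by
    have := oneRightIso_natural f
    rw [biMap_id_right] at this
    exact this

lemma DG.Absorbing.commute_tensor {n : ℕ} {b : Bool} {P : DG b (Cob n n)}
    (h : Absorbing (Cob.tensor n n n) ⟨0, one n⟩ P)
    (h' : Absorbing (Cob.tensor n n n).flip ⟨0, one n⟩ P) (A : DG b (Cob n n)) :
    Nonempty (HomotopyEquiv (real.obj (tensor (Cob.tensor n n n) P A))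
      (real.obj (tensor (Cob.tensor n n n) A P))) :=
  h.commute h' (Cob.tensorOneLeft n) (Cob.tensorOneRight n) Cob.assocIso Cob.assocIso_natural A

/-! ### Transfer to the tensor products of the theorem -/

namespace DG.Absorbing

lemma commute_tensorSum {Q A : CochainComplex (BNSum n n) ℤ}
    (h : Absorbing (Cob.tensor n n n) ⟨0, one n⟩ (flat ((ofSum.mapHomologicalComplex _).obj Q)))
    (h' : Absorbing (Cob.tensor n n n).flip ⟨0, one n⟩
      (flat ((ofSum.mapHomologicalComplex _).obj Q))) :
    Nonempty (HomotopyEquiv (tensorSum Q A) (tensorSum A Q)) := by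
  obtain ⟨e⟩ := h.commute_tensor h' (flat ((ofSum.mapHomologicalComplex _).obj A))
  exact ⟨(HomotopyEquiv.ofIso (totSumIso (Cob.tensor n n n) Q A)).trans
    ((toSum.mapHomotopyEquiv e).trans
      (HomotopyEquiv.ofIso (totSumIso (Cob.tensor n n n) A Q)).symm)⟩

lemma commute_tensorProd {Q A : CochainComplex (BNProd n n) ℤ}
    (h : Absorbing (Cob.tensor n n n) ⟨0, one n⟩ (flat ((ofProd.mapHomologicalComplex _).obj Q)))
    (h' : Absorbing (Cob.tensor n n n).flip ⟨0, one n⟩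
      (flat ((ofProd.mapHomologicalComplex _).obj Q))) :
    Nonempty (HomotopyEquiv (tensorProd Q A) (tensorProd A Q)) := by
  obtain ⟨e⟩ := h.commute_tensor h' (flat ((ofProd.mapHomologicalComplex _).obj A))
  exact ⟨(HomotopyEquiv.ofIso (totProdIso (Cob.tensor n n n) Q A)).trans
    ((toProd.mapHomotopyEquiv e).trans
      (HomotopyEquiv.ofIso (totProdIso (Cob.tensor n n n) A Q)).symm)⟩

end DG.Absorbing

/-- The two descriptions of formal sums differ only in packaging, so the collected complex of
`BN.toSum Q` is the one for which absorption was shown. -/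
lemma ofSum_toSum (Q : CochainComplex (BN n n) ℤ) :
    (ofSum.mapHomologicalComplex _).obj (BN.toSum Q) =
      ((incl true _).mapHomologicalComplex _).obj Q := rfl

lemma ofProd_toProd (Q : CochainComplex (BN n n) ℤ) :
    (ofProd.mapHomologicalComplex _).obj (BN.toProd Q) =
      ((incl false _).mapHomologicalComplex _).obj Q := rfl

end BarNatan

end

theorem mainTheorem3 (n : ℕ) (P : CochainComplex (BarNatan.BN n n) ℤ)
    (hP : BarNatan.BN.IsUniversalProjector P) :
    (∀ A : CochainComplex (BarNatan.BNSum n n) ℤ,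
      Nonempty (HomotopyEquiv
        (BarNatan.tensorSum (BarNatan.BN.toSum (BarNatan.BN.dualCh P)) A)
        (BarNatan.tensorSum A (BarNatan.BN.toSum (BarNatan.BN.dualCh P))))) ∧
    (∀ A : CochainComplex (BarNatan.BNProd n n) ℤ,
      Nonempty (HomotopyEquiv
        (BarNatan.tensorProd (BarNatan.BN.toProd P) A)
        (BarNatan.tensorProd A (BarNatan.BN.toProd P)))) := by
  refine ⟨fun A => BarNatan.DG.Absorbing.commute_tensorSum ?_ ?_, fun A => BarNatan.DG.Absorbing.commute_tensorProd ?_ ?_⟩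
  · exact BarNatan.ofSum_toSum _ ▸ hP.absorbing_dual
  · exact BarNatan.ofSum_toSum _ ▸ hP.absorbing_dual_flip
  · exact BarNatan.ofProd_toProd _ ▸ hP.absorbing
  · exact BarNatan.ofProd_toProd _ ▸ hP.absorbing_flip
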